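/- **Setting.** Let $n\ge 1$, $d=n+1$, let $Y\subset\mathbb R^{n}$ be a bounded open set, $0<h\ll1$, $\mathcal D_t=-ih\partial_t$, $\mathcal D_{y_j}=-ih\partial_{y_j}$, and $$(\mathrm{Op}_h(a)f)(y)=(2\pi h)^{-n}\int\!\!\int_{Y} e^{\frac ih\langle y-w,\eta\rangle}a(y,\eta)f(w)\,dw\,d\eta ,$$ where for $f\in L^2(Y)$ the $\eta$-integral is the limit in mean, as $R\to\infty$, of the integrals over $|\eta|<R$. Functions on $T^*Y=Y\times\mathbb R^n$ with $\mathrm{supp}_y\subset Y$ are extended by zero; $S^{0,0}_{0,0}(Y)$ is the set of smooth $a(y,\eta)$ with $\mathrm{supp}_y\,a\subset Y$ and $|\partial_y^\alpha\partial_\eta^\beta a|\le C_{\alpha,\beta}\langle\eta\rangle^{-|\beta|}$ for all $\alpha,\beta$. Let $\epsilon>0$ and let $\mu\in\mathbb R$ satisfy $h^{2/3-\epsilon}\le|\mu|\le1$. Consider on $(0,1)\times Y$ the operator $$P_0(h,\mu)=\mathcal D_t^2+\mathcal D_{y_1}-i\mu+\mathrm{Op}_h(m(t,\cdot,\cdot;h,\mu)).$$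 Assume that there are $m_j(t,y,\eta;\mu)$, $j\ge 0$, independent of $h$, in $C^\infty([0,1]\times T^*Y)$ for each $0<|\mu|\le1$, such that: (i) for every $\nu\ge0$, $m=\sum_{j=0}^\nu h^jm_j+h^{\nu+1}m^\sharp_{\nu+1}$ with $m^\sharp_{\nu+1}\in S^{0,0}_{0,0}(Y)$ uniformly in $t,h,\mu$; (ii) $\partial_t^km_j\in S^{0,0}_{0,0}(Y)$ uniformly in $t,\mu$, for all $k,j\ge 0$; (iii) $\mathrm{Im}\,\partial_t^k\partial_y^\beta m_0=\mathcal O(|\mu|)$ for all $k,\beta$, uniformly in $t,y,\eta,\mu$; (iv) $m_0|_{t=0}\equiv0$. Put $m_{k,j}=\frac1{k!}\partial_t^km_j|_{t=0}$. **Construction.** Let $\phi\in C_0^\infty(\mathbb R)$ be independent of $h,\mu$, with $\phi(\sigma)=1$ for $|\sigma|\le1$ and $\phi(\sigma)=0$ for $|\sigma|\ge2$, and let $\varrho(\eta_1;\mu)=\sqrt{-\eta_1+i\mu}$, $\mathrm{Im}\,\varrho>0$. Given an integer $M\ge1$, let $$\varphi=\sum_{k=1}^Mt^k\varphi_k,\quad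 \varphi_1=\varrho,\qquad a=\sum_{j=0}^M\sum_{k=0}^Mh^jt^ka_{k,j},\quad a_{0,0}=\phi(\eta_1),\quad a_{0,j}=0\ (j\ge1),$$ where the coefficients $\varphi_k,a_{k,j}$, functions of $(y,\eta;\mu)$, are uniquely determined recursively as follows. In the expressions below $m_j$ is replaced by its formal Taylor series $\sum_kt^km_{k,j}$ and $m$ by $\sum_{j,k} h^jt^km_{k,j}$. The coefficients of $t^K$, $0\le K\le M-1$, vanish in $$(\partial_t\varphi)^2+\partial_{y_1}\varphi-\varrho^2+\sum_{|\alpha|\le M}\frac1{\alpha!}\,\partial_\eta^\alpha m_0\,(\partial_y\varphi)^\alpha ,$$ and the coefficients of $h^{j+1}t^k$, $0\le j\le M$, $0\le k\le M-1$, vanish in $$\big((\partial_t\varphi)^2+\partial_{y_1}\varphi-\varrho^2-ih\partial_t^2\varphi\big)a-2ih\,\partial_t\varphi\,\partial_ta-ih\,\partial_{y_1}a-h^2\partial_t^2a+e^{-i\varphi/h}\sum_{|\alpha|\le M}\frac{(-ih)^{|\alpha|}}{\alpha!}\,\partial_\eta^\alpha m\;\partial_y^\alpha\big(e^{i\varphi/h}a\big).$$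 For $\delta>0$ independent of $h,\mu$ and $f\in L^2(Y)$ set $$\widetilde u(t,\cdot)=\mathrm{Op}_h\big(e^{i\varphi/h}\,\Phi_{\epsilon,\delta}\,a\big)f,\qquad \Phi_{\epsilon,\delta}=\phi\big(t/h^{\epsilon}\big)\,\phi\big(t/(|\varrho|^2\delta)\big).$$ **Proposition.** There is $M_0$, depending only on $\epsilon$ and the dimension, such that for every integer $M\ge M_0$ and every sufficiently small $\delta>0$ (depending on $M$, but not on $h,\mu$) there are $C,h_0>0$ such that for all $0<h\le h_0$, all $\mu$ with $h^{2/3-\epsilon}\le|\mu|\le1$, and all $f\in L^2(Y)$, one has $\widetilde u,\ P_0(h,\mu)\widetilde u\in L^2((0,1)\times Y)$ (derivatives in the sense of distributions) and $$\|\widetilde u\|_{L^2((0,1)\times Y)}\le C\,h^{-d}\,\|f\|_{L^2(Y)},\qquad \|P_0(h,\mu)\widetilde u\|_{L^2((0,1)\times Y)}\le C\,h^{\epsilon M/2}\,\|f\|_{L^2(Y)} .$$ -/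

import Mathlib

open scoped ContDiff

noncomputable section

namespace ModelParametrix

/-- The space of the variables `y` and `η`; its dimension is `n = d - 1`. -/
abbrev E (n : ℕ) := EuclideanSpace ℝ (Fin n)

/-- Functions `a(y, η)` on `ℝⁿ × ℝⁿ`, a commutative ring under pointwise operations. -/
abbrev Sym (n : ℕ) := E n → E n → ℂ

/-! ### Partial derivatives -/

/-- `∂a/∂y_i`. -/
def dy {n : ℕ} (i : Fin n) (a : Sym n) : Sym n :=
  fun y η => fderiv ℝ (fun y' => a y' η) y (EuclideanSpace.single i 1)

/-- `∂a/∂η_i`. -/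
def deta {n : ℕ} (i : Fin n) (a : Sym n) : Sym n :=
  fun y η => fderiv ℝ (fun η' => a y η') η (EuclideanSpace.single i 1)

/-- The power `D^α = D_1^{α_1} ⋯ D_n^{α_n}` of a family of maps, for a multi-index `α`. -/
def mpow {n : ℕ} {A : Type*} (D : Fin n → A → A) (α : Fin n → ℕ) (x : A) : A :=
  (List.finRange n).foldr (fun i g => (D i)^[α i] g) x

/-- The length `|α|` of a multi-index. -/
def len {n : ℕ} (α : Fin n → ℕ) : ℕ := ∑ i, α i

/-! ### The symbol class `S^{0,0}_{0,0}(Y)` and the hypotheses on `m` -/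

/-- The functions `a i`, `i ∈ S`, belong to `S^{0,0}_{0,0}(Y)` uniformly: each is smooth, with
`supp_y (a i) ⊂ Y` (functions on `T^*Y` are extended by zero), and
`|∂_y^α ∂_η^β (a i)| ≤ C_{α,β} ⟨η⟩^{-|β|}` with constants that do not depend on `i`. -/
def IsUniformSymbol {n : ℕ} (Y : Set (E n)) {ι : Type*} (S : Set ι) (a : ι → Sym n) : Prop :=
  (∀ i ∈ S, ContDiff ℝ ∞ (fun p : E n × E n => a i p.1 p.2) ∧
    closure {y | ∃ η, a i y η ≠ 0} ⊆ Y) ∧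
  ∀ α β : Fin n → ℕ, ∃ C : ℝ, ∀ i ∈ S, ∀ y η,
    ‖mpow dy α (mpow deta β (a i)) y η‖ ≤ C / Real.sqrt (1 + ‖η‖ ^ 2) ^ len β

/-- `∂_t^k b` for a function `b(t, y, η)` with `t ∈ [0,1]` (one-sided at the end points). -/
def dtWithin {n : ℕ} (k : ℕ) (b : ℝ → Sym n) (t : ℝ) : Sym n :=
  fun y η => iteratedDerivWithin k (fun s => b s y η) (Set.Icc 0 1) t

/-- The hypotheses on the perturbation `m = m(t,y,η;h,μ)`, written `m h μ t y η`, and on the terms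
`m_j = m_j(t,y,η;μ)` of its expansion `m ~ ∑ h^j m_j`, written `mj j μ t y η`. -/
structure IsModelPerturbation {n : ℕ} (Y : Set (E n)) (ε : ℝ)
    (m : ℝ → ℝ → ℝ → Sym n) (mj : ℕ → ℝ → ℝ → Sym n) : Prop where
  /-- `m_j ∈ C^∞([0,1] × T^*Y)`. -/
  smooth : ∀ j μ, 0 < |μ| → |μ| ≤ 1 →
    ContDiffOn ℝ ∞ (fun p : ℝ × E n × E n => mj j μ p.1 p.2.1 p.2.2) (Set.Icc 0 1 ×ˢ Set.univ)
  /-- `∂_t^k m_j ∈ S^{0,0}_{0,0}(Y)` uniformly in `t` and `μ`. -/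
  symbol : ∀ j k, IsUniformSymbol Y
    {p : ℝ × ℝ | 0 < |p.1| ∧ |p.1| ≤ 1 ∧ p.2 ∈ Set.Icc (0 : ℝ) 1}
    (fun p => dtWithin k (mj j p.1) p.2)
  /-- `Im ∂_t^k ∂_y^β m_0 = O(|μ|)`. -/
  im_bound : ∀ (k : ℕ) (β : Fin n → ℕ), ∃ C : ℝ, ∀ μ t, 0 < |μ| → |μ| ≤ 1 →
    t ∈ Set.Icc (0 : ℝ) 1 → ∀ y η, |(mpow dy β (dtWithin k (mj 0 μ) t) y η).im| ≤ C * |μ|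
  /-- `m_{0,0} = 0`. -/
  zero : ∀ μ, 0 < |μ| → |μ| ≤ 1 → ∀ y η, mj 0 μ 0 y η = 0
  /-- For every `ν` one has `m = ∑_{j ≤ ν} h^j m_j + h^{ν+1} m^♯_{ν+1}`, where `m^♯_{ν+1}` is in
  `S^{0,0}_{0,0}(Y)` uniformly in `t`, `h`, `μ`, for all small `h`. -/
  expansion : ∃ h₁ : ℝ, 0 < h₁ ∧ ∀ ν : ℕ, IsUniformSymbol Y
    {p : ℝ × ℝ × ℝ | 0 < p.1 ∧ p.1 ≤ h₁ ∧ p.1 ^ (2 / 3 - ε) ≤ |p.2.1| ∧ |p.2.1| ≤ 1 ∧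
      p.2.2 ∈ Set.Ioo (0 : ℝ) 1}
    (fun p y η => ((p.1 : ℂ) ^ (ν + 1))⁻¹ *
      (m p.1 p.2.1 p.2.2 y η - ∑ j ∈ Finset.range (ν + 1), (p.1 : ℂ) ^ j * mj j p.2.1 p.2.2 y η))
  /-- `m` is measurable in `t`. -/
  measurable : ∀ h μ, 0 < h → h ^ (2 / 3 - ε) ≤ |μ| → |μ| ≤ 1 → ∀ y η,
    AEMeasurable (fun t => m h μ t y η) (MeasureTheory.volume.restrict (Set.Ioo (0 : ℝ) 1))

/-! ### The function `ϱ` -/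

/-- `ϱ = √(-η₁ + iμ)`, the branch with `Im ϱ > 0`. -/
def rho (n : ℕ) [NeZero n] (μ : ℝ) : Sym n :=
  fun _ η => Complex.I * ((η 0 : ℂ) - Complex.I * μ) ^ (1 / 2 : ℂ)

theorem rho_sq (n : ℕ) [NeZero n] (μ : ℝ) (y η : E n) :
    rho n μ y η ^ 2 = -(η 0 : ℂ) + Complex.I * μ := by
  have h : (((η 0 : ℂ) - Complex.I * μ) ^ (1 / 2 : ℂ)) ^ 2 = (η 0 : ℂ) - Complex.I * μ := by
    simp
  rw [rho, mul_pow, h, Complex.I_sq]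
  ring

theorem rho_im_pos (n : ℕ) [NeZero n] (μ : ℝ) (hμ : μ ≠ 0) (y η : E n) :
    0 < (rho n μ y η).im := by
  set w : ℂ := (η 0 : ℂ) - Complex.I * μ with hw
  have him : w.im = -μ := by simp [hw]
  have hne : w ≠ 0 := fun h0 => hμ (by simpa [h0] using him)
  have harg : w.arg ≠ Real.pi := fun h0 => hμ (by
    have := (Complex.arg_eq_pi_iff.1 h0).2
    rw [him] at this
    linarith)
  have hre : 0 < (w ^ (1 / 2 : ℂ)).re := by
    rw [Complex.cpow_def_of_ne_zero hne, Complex.exp_re]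
    have h2 : (Complex.log w * (1 / 2)).im = w.arg / 2 := by
      have : Complex.log w * (1 / 2) = Complex.log w / 2 := by ring
      rw [this]
      simp [Complex.log_im]
    rw [h2]
    refine mul_pos (Real.exp_pos _) (Real.cos_pos_of_mem_Ioo ⟨?_, ?_⟩)
    · linarith [Complex.neg_pi_lt_arg w]
    · have := lt_of_le_of_ne (Complex.arg_le_pi w) harg
      linarith
  simpa [rho, hw] using hre

/-! ### Formal series in `t` and `h`

The coefficients of the phase and of the amplitude are found by comparing powers of `t` and `h`.
A formal series `∑ t^k s_k(y,η)` is an element of `PowerSeries (Sym n)`, and a formal series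
`∑ h^j t^k s_{k,j}(y,η)` an element of `PowerSeries (PowerSeries (Sym n))`, the outer variable
being `h`. -/

/-- Apply a map to every coefficient of a formal series. -/
def mapCoeff {R : Type*} [Semiring R] (F : R → R) (s : PowerSeries R) : PowerSeries R :=
  PowerSeries.mk fun k => F (PowerSeries.coeff k s)

/-- `∂_t` of a formal series in `t`. -/
def dt {n : ℕ} (s : PowerSeries (Sym n)) : PowerSeries (Sym n) :=
  PowerSeries.mk fun k => ((k : ℂ) + 1) • PowerSeries.coeff (k + 1) s

/-- `m_{k,j} = (1/k!) ∂_t^k m_j |_{t=0}`. -/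
def taylorCoeff {n : ℕ} (mj : ℕ → ℝ → ℝ → Sym n) (μ : ℝ) (k j : ℕ) : Sym n :=
  fun y η => dtWithin k (mj j μ) 0 y η / (k.factorial : ℂ)

/-- The formal series `∑_k t^k m_{k,j}`. -/
def mSeries {n : ℕ} (mj : ℕ → ℝ → ℝ → Sym n) (μ : ℝ) (j : ℕ) : PowerSeries (Sym n) :=
  PowerSeries.mk fun k => taylorCoeff mj μ k j

/-- `1/α! = 1/(α_1! ⋯ α_n!)`. -/
def invFact {n : ℕ} (α : Fin n → ℕ) : ℂ := (∏ i, ((α i).factorial : ℂ))⁻¹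

/-- The sum over all multi-indices of length at most `M`. -/
def multiSum {n : ℕ} {A : Type*} [AddCommMonoid A] (M : ℕ) (F : (Fin n → ℕ) → A) : A :=
  ∑ k ∈ Finset.range (M + 1), ∑ α ∈ Finset.piAntidiag Finset.univ k, F α

/-- The formal series of
`(∂_t φ)² + ∂_{y₁} φ - ϱ² + ∑_{|α| ≤ M} (1/α!) ∂_η^α m_0 (∂_y φ)^α`. -/
def eikonal {n : ℕ} [NeZero n] (M : ℕ) (mj : ℕ → ℝ → ℝ → Sym n) (μ : ℝ)
    (φ : PowerSeries (Sym n)) : PowerSeries (Sym n) :=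
  dt φ ^ 2 + mapCoeff (dy 0) φ - PowerSeries.C (rho n μ ^ 2) +
    multiSum M fun α => invFact α •
      (mapCoeff (mpow deta α) (mSeries mj μ 0) * ∏ i, mapCoeff (dy i) φ ^ α i)

/-- The sum `∑_{k=1}^{K+1} t^k φ_k`, where `φ_1 = ϱ` and `φ_{k+1}`, `k ≥ 1`, is the solution of the
equation that the coefficient of `t^k` in `eikonal` vanishes. In that coefficient `φ_{k+1}` occurs
only in the term `2 (k+1) ϱ φ_{k+1}`. -/
def phaseAux {n : ℕ} [NeZero n] (M : ℕ) (mj : ℕ → ℝ → ℝ → Sym n) (μ : ℝ) :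
    ℕ → PowerSeries (Sym n)
  | 0 => PowerSeries.X * PowerSeries.C (rho n μ)
  | K + 1 =>
    phaseAux M mj μ K + PowerSeries.X ^ (K + 2) * PowerSeries.C (fun y η =>
      -PowerSeries.coeff (K + 1) (eikonal M mj μ (phaseAux M mj μ K)) y η /
        (2 * ((K : ℂ) + 2) * rho n μ y η))

/-- The phase `φ = ∑_{k=1}^M t^k φ_k`, as a formal series. -/
def phase {n : ℕ} [NeZero n] (M : ℕ) (mj : ℕ → ℝ → ℝ → Sym n) (μ : ℝ) : PowerSeries (Sym n) :=
  phaseAux M mj μ (M - 1)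

/-- `e^{-iφ/h} ∘ (-ih ∂_{y_i}) ∘ e^{iφ/h} = ∂_{y_i} φ - ih ∂_{y_i}` on formal series. -/
def conjD {n : ℕ} (φ : PowerSeries (Sym n)) (i : Fin n)
    (b : PowerSeries (PowerSeries (Sym n))) : PowerSeries (PowerSeries (Sym n)) :=
  PowerSeries.C (mapCoeff (dy i) φ) * b -
    Complex.I • (PowerSeries.X * mapCoeff (mapCoeff (dy i)) b)

/-- The formal series in `(t, h)` of
`A_M = ((∂_t φ)² + ∂_{y₁} φ - ϱ² - ih ∂_t² φ) a - 2ih ∂_t φ ∂_t a - ih ∂_{y₁} a - h² ∂_t² a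
  + e^{-iφ/h} E_M(m, e^{iφ/h} a)`,
with `E_M(m, b) = ∑_{|α| ≤ M} ((-ih)^{|α|}/α!) ∂_η^α m ∂_y^α b`. -/
def transport {n : ℕ} [NeZero n] (M : ℕ) (mj : ℕ → ℝ → ℝ → Sym n) (μ : ℝ)
    (a : PowerSeries (PowerSeries (Sym n))) : PowerSeries (PowerSeries (Sym n)) :=
  let φ := phase M mj μ
  PowerSeries.C (dt φ ^ 2 + mapCoeff (dy 0) φ - PowerSeries.C (rho n μ ^ 2)) * a
    - Complex.I • (PowerSeries.X * (PowerSeries.C (dt (dt φ)) * a))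
    - (2 * Complex.I) • (PowerSeries.X * (PowerSeries.C (dt φ) * mapCoeff dt a))
    - Complex.I • (PowerSeries.X * mapCoeff (mapCoeff (dy 0)) a)
    - PowerSeries.X ^ 2 * mapCoeff (fun s => dt (dt s)) a
    + multiSum M fun α => invFact α •
        (mapCoeff (mapCoeff (mpow deta α)) (PowerSeries.mk fun j => mSeries mj μ j) *
          mpow (conjD φ) α a)

/-- Given `a = ∑_{i < j} h^i a_i`, add the terms `h^j t^l a_{l,j}` with `l ≤ k`. Here
`a_{0,0} = χ(η₁)`, `a_{0,j} = 0` for `j ≥ 1`, and `a_{l+1,j}` is the solution of the equation that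
the coefficient of `h^{j+1} t^l` in `transport` vanishes. In that coefficient `a_{l+1,j}` occurs
only in the term `-2i (l+1) ϱ a_{l+1,j}`. -/
def ampRow {n : ℕ} [NeZero n] (χ : ℝ → ℂ) (M : ℕ) (mj : ℕ → ℝ → ℝ → Sym n) (μ : ℝ)
    (a : PowerSeries (PowerSeries (Sym n))) (j : ℕ) : ℕ → PowerSeries (PowerSeries (Sym n))
  | 0 => a + PowerSeries.X ^ j *
      PowerSeries.C (PowerSeries.C (fun _ η => if j = 0 then χ (η 0) else 0))
  | l + 1 =>
    ampRow χ M mj μ a j l + PowerSeries.X ^ j * PowerSeries.C (PowerSeries.X ^ (l + 1) *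
      PowerSeries.C (fun y η =>
        PowerSeries.coeff l (PowerSeries.coeff (j + 1)
          (transport M mj μ (ampRow χ M mj μ a j l))) y η /
            (2 * Complex.I * ((l : ℂ) + 1) * rho n μ y η)))

/-- `∑_{i < j} h^i a_i`, with `a_i = ∑_{k=0}^M t^k a_{k,i}`. -/
def ampAux {n : ℕ} [NeZero n] (χ : ℝ → ℂ) (M : ℕ) (mj : ℕ → ℝ → ℝ → Sym n) (μ : ℝ) :
    ℕ → PowerSeries (PowerSeries (Sym n))
  | 0 => 0
  | j + 1 => ampRow χ M mj μ (ampAux χ M mj μ j) j M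

/-- The amplitude `a = ∑_{j=0}^M h^j a_j`, as a formal series. -/
def amp {n : ℕ} [NeZero n] (χ : ℝ → ℂ) (M : ℕ) (mj : ℕ → ℝ → ℝ → Sym n) (μ : ℝ) :
    PowerSeries (PowerSeries (Sym n)) :=
  ampAux χ M mj μ (M + 1)

/-! ### The parametrix -/

/-- The phase function `φ(t,y,η;μ)`. -/
def phaseFun {n : ℕ} [NeZero n] (M : ℕ) (mj : ℕ → ℝ → ℝ → Sym n) (μ t : ℝ) : Sym n :=
  fun y η => ∑ k ∈ Finset.Icc 1 M, (t : ℂ) ^ k * PowerSeries.coeff k (phase M mj μ) y η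

/-- The amplitude function `a(t,y,η;h,μ)`. -/
def ampFun {n : ℕ} [NeZero n] (χ : ℝ → ℂ) (M : ℕ) (mj : ℕ → ℝ → ℝ → Sym n) (h μ t : ℝ) : Sym n :=
  fun y η => ∑ j ∈ Finset.range (M + 1), ∑ k ∈ Finset.range (M + 1),
    (h : ℂ) ^ j * (t : ℂ) ^ k *
      PowerSeries.coeff k (PowerSeries.coeff j (amp χ M mj μ)) y η

/-- The symbol `e^{iφ/h} Φ_{ε,δ} a` of the parametrix, where
`Φ_{ε,δ} = χ(t/h^ε) χ(t/(|ϱ|²δ))`. -/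
def parametrixSymbol {n : ℕ} [NeZero n] (χ : ℝ → ℂ) (M : ℕ) (mj : ℕ → ℝ → ℝ → Sym n)
    (ε δ h μ t : ℝ) : Sym n :=
  fun y η => Complex.exp (Complex.I * phaseFun M mj μ t y η / h) *
    (χ (t / h ^ ε) * χ (t / (‖rho n μ y η‖ ^ 2 * δ))) * ampFun χ M mj h μ t y η

/-- Lebesgue measure on `(0,1) × Y`. -/
def slab {n : ℕ} (Y : Set (E n)) : MeasureTheory.Measure (ℝ × E n) :=
  MeasureTheory.volume.restrict (Set.Ioo (0 : ℝ) 1 ×ˢ Y)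

/-- `(2πh)^{-n} ∫_{|η| < R} ∫_Y e^{i⟨y-w,η⟩/h} a(y,η) f(w) dw dη`. -/
def opTrunc {n : ℕ} (Y : Set (E n)) (h R : ℝ) (a : Sym n) (f : E n → ℂ) (y : E n) : ℂ :=
  ((2 * Real.pi * h : ℝ) : ℂ)⁻¹ ^ n * ∫ η in Metric.ball (0 : E n) R, ∫ w in Y,
    Complex.exp (Complex.I * (inner ℝ (y - w) η : ℝ) / h) * a y η * f w

/-- `v(t,·) = Op_h(a(t)) g(t)` on `(0,1) × Y`. For functions `g(t) ∈ L²(Y)` and bounded symbols the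
integral over `η` need not converge absolutely, and is understood as a limit in mean: `v` is the
limit in `L²((0,1) × Y)`, as `R → ∞`, of the integrals over `|η| < R`. -/
def IsOp {n : ℕ} (Y : Set (E n)) (h : ℝ) (a : ℝ → Sym n) (g : ℝ → E n → ℂ)
    (v : ℝ × E n → ℂ) : Prop :=
  MeasureTheory.MemLp v 2 (slab Y) ∧
  Filter.Tendsto (fun R : ℝ => MeasureTheory.eLpNorm
      (fun p : ℝ × E n => opTrunc Y h R (a p.1) (g p.1) p.2 - v p) 2 (slab Y))
    Filter.atTop (nhds 0)

/-- `P_0 u = g` on `(0,1) × Y`, for `u, g ∈ L²((0,1) × Y)`, where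
`P_0 = D_t² + D_{y₁} - iμ + Op_h(m)`, `D = -ih∂`, and the derivatives are taken in the sense of
distributions. -/
def IsP0 {n : ℕ} [NeZero n] (Y : Set (E n)) (h μ : ℝ) (m : ℝ → Sym n)
    (u g : ℝ × E n → ℂ) : Prop :=
  ∃ v : ℝ × E n → ℂ, IsOp Y h m (fun t w => u (t, w)) v ∧
    ∀ ψ : ℝ × E n → ℂ, ContDiff ℝ ∞ ψ → HasCompactSupport ψ →
      tsupport ψ ⊆ Set.Ioo (0 : ℝ) 1 ×ˢ Y →
      ∫ p, (u p * (-(h : ℂ) ^ 2 * fderiv ℝ (fun q => fderiv ℝ ψ q (1, 0)) p (1, 0) +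
          Complex.I * h * fderiv ℝ ψ p (0, EuclideanSpace.single 0 1) -
          Complex.I * μ * ψ p) + v p * ψ p) ∂(slab Y) =
        ∫ p, g p * ψ p ∂(slab Y)

end ModelParametrix

end

open scoped ContDiff Pointwise

noncomputable section

set_option linter.unusedSectionVars false

open scoped FourierTransform Real
open Finset (Icc induction_on mem_Icc mem_range mul_sum piAntidiag range sum_add_distrib sum_congr
  sum_eq_single sum_eq_zero sum_le_sum sum_mul sum_nonneg sum_range_succ sum_range_succ'
  sum_sub_distrib)
open ContinuousMultilinearMap (norm_compContinuousLinearMap_le)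
open PowerSeries (C X coeff coeff_C coeff_X_pow_mul' coeff_mk coeff_mul coeff_smul
  coeff_zero_eq_constantCoeff_apply constantCoeff)
open Real (fourier_eq norm_eq_abs rpow_add rpow_le_one rpow_le_rpow_of_exponent_ge rpow_mul
  rpow_natCast rpow_one rpow_pos_of_pos)
open ContinuousLinearMap (inl inr lsmul norm_toSpanSingleton opNorm_comp_le opNorm_le_bound
  smulRightL toSpanSingleton)
open EuclideanSpace (basisFun proj single)
open List (finRange)
open Function (iterate_succ_apply' uncurry uncurry_def)
open Finset.HasAntidiagonal (antidiagonal mem_antidiagonal)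
open Complex (I I_sq norm_I norm_real real_smul)
open Set (Ioo indicator_of_mem indicator_of_notMem)
open Metric (closedBall infDist)
open ENNReal (ofReal ofReal_mul ofReal_ne_top)
open Filter.Eventually (of_forall)
open Bornology (IsBounded)

namespace ModelParametrix

/-! ### Families with uniform derivative bounds -/

theorem one_nonneg {ι : Type*} {S : Set ι} : ∀ i ∈ S, (0 : ℝ) ≤ 1 := fun _ _ => zero_le_one

/-- Uniform bounds `‖D^k (f i)‖ ≤ C_k w_i σ_i^k`, `i ∈ S`, for a family of smooth functions. -/
def Bd {ι V F : Type*} [NormedAddCommGroup V] [NormedSpace ℝ V] [NormedAddCommGroup F]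
    [NormedSpace ℝ F] (S : Set ι) (σ w : ι → ℝ) (f : ι → V → F) : Prop :=
  (∀ i ∈ S, ContDiff ℝ ∞ (f i)) ∧
    ∀ k : ℕ, ∃ C : ℝ, 0 ≤ C ∧ ∀ i ∈ S, ∀ y, ‖iteratedFDeriv ℝ k (f i) y‖ ≤ C * w i * σ i ^ k

namespace Bd

variable {ι V F G : Type*} [NormedAddCommGroup V] [NormedSpace ℝ V] [NormedAddCommGroup F]
    [NormedSpace ℝ F] [NormedAddCommGroup G] [NormedSpace ℝ G] {S T : Set ι}
    {σ σ' w w' : ι → ℝ} {f g : ι → V → F}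

theorem mono_set (h : Bd S σ w f) (hT : T ⊆ S) : Bd T σ w f :=
  ⟨fun i hi => h.1 i (hT hi), fun k => by
    obtain ⟨C, hC, H⟩ := h.2 k
    exact ⟨C, hC, fun i hi => H i (hT hi)⟩⟩

theorem congr (h : Bd S σ w f) (hfg : ∀ i ∈ S, f i = g i) : Bd S σ w g :=
  ⟨fun i hi => hfg i hi ▸ h.1 i hi, fun k => by
    obtain ⟨C, hC, H⟩ := h.2 k
    exact ⟨C, hC, fun i hi => hfg i hi ▸ H i hi⟩⟩

theorem mono (h : Bd S σ w f) (hσ : ∀ i ∈ S, 0 ≤ σ i) (K : ℝ)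
    (hw : ∀ i ∈ S, w i ≤ K * w' i) (hw' : ∀ i ∈ S, 0 ≤ w' i) : Bd S σ w' f :=
  ⟨h.1, fun k => by
    obtain ⟨C, hC, H⟩ := h.2 k
    refine ⟨C * |K|, by positivity, fun i hi y => (H i hi y).trans ?_⟩
    have h1 := hw i hi
    have h2 := hw' i hi
    have h3 : w i ≤ |K| * w' i := h1.trans (by gcongr; exact le_abs_self K)
    have := hσ i hi
    calc C * w i * σ i ^ k ≤ C * (|K| * w' i) * σ i ^ k := by gcongr
      _ = _ := by ring⟩

theorem scale (h : Bd S σ w f) (hσ : ∀ i ∈ S, 0 ≤ σ i) (hσ' : ∀ i ∈ S, σ i ≤ σ' i)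
    (hw : ∀ i ∈ S, 0 ≤ w i) : Bd S σ' w f :=
  ⟨h.1, fun k => by
    obtain ⟨C, hC, H⟩ := h.2 k
    refine ⟨C, hC, fun i hi y => (H i hi y).trans ?_⟩
    have := hσ i hi
    have := hσ' i hi
    have := hw i hi
    gcongr⟩

theorem le (h : Bd S σ w f) : ∃ C : ℝ, 0 ≤ C ∧ ∀ i ∈ S, ∀ y, ‖f i y‖ ≤ C * w i := by
  obtain ⟨C, hC, H⟩ := h.2 0
  exact ⟨C, hC, fun i hi y => by simpa using H i hi y⟩

/-- One constant for the derivatives up to a given order. -/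
theorem le_upTo (h : Bd S σ w f) (hσ : ∀ i ∈ S, 0 ≤ σ i) (hw : ∀ i ∈ S, 0 ≤ w i) (N : ℕ) :
    ∃ C : ℝ, 0 ≤ C ∧ ∀ k ≤ N, ∀ i ∈ S, ∀ y,
      ‖iteratedFDeriv ℝ k (f i) y‖ ≤ C * w i * σ i ^ k := by
  choose C hC H using h.2
  refine ⟨∑ k ∈ range (N + 1), C k, sum_nonneg fun k _ => hC k,
    fun k hk i hi y => (H k i hi y).trans ?_⟩
  have h1 : C k ≤ ∑ k ∈ range (N + 1), C k :=
    Finset.single_le_sum (f := C) (fun k _ => hC k) (mem_range.2 (by omega))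
  have := hσ i hi
  have := hw i hi
  gcongr

theorem const (hσ : ∀ i ∈ S, 0 ≤ σ i) (hw : ∀ i ∈ S, 0 ≤ w i) (c : ι → F) (K : ℝ)
    (hc : ∀ i ∈ S, ‖c i‖ ≤ K * w i) :
    Bd S σ w (fun i (_ : V) => c i) :=
  ⟨fun i _ => contDiff_const, fun k => by
    refine ⟨|K|, abs_nonneg K, fun i hi y => ?_⟩
    have h1 := hσ i hi
    have h2 := hw i hi
    rcases k with _ | k
    · simpa using (hc i hi).trans (by gcongr; exact le_abs_self K)
    · rw [iteratedFDeriv_succ_const]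
      simp only [Pi.zero_apply, norm_zero]
      positivity⟩

theorem zero (hσ : ∀ i ∈ S, 0 ≤ σ i) (hw : ∀ i ∈ S, 0 ≤ w i) :
    Bd S σ w (fun _ (_ : V) => (0 : F)) :=
  const hσ hw _ 0 (by simp)

theorem add (hf : Bd S σ w f) (hg : Bd S σ w g) : Bd S σ w (fun i y => f i y + g i y) :=
  ⟨fun i hi => (hf.1 i hi).add (hg.1 i hi), fun k => by
    obtain ⟨C, hC, H⟩ := hf.2 k
    obtain ⟨C', hC', H'⟩ := hg.2 k
    refine ⟨C + C', by positivity, fun i hi y => ?_⟩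
    have := iteratedFDeriv_add_apply (x := y) ((hf.1 i hi).of_le (m := k)
      (mod_cast le_top)).contDiffAt
      ((hg.1 i hi).of_le (m := k) (mod_cast le_top)).contDiffAt
    change ‖iteratedFDeriv ℝ k (f i + g i) y‖ ≤ _
    rw [this]
    refine (norm_add_le _ _).trans ((add_le_add (H i hi y) (H' i hi y)).trans (le_of_eq ?_))
    ring⟩

theorem clm (L : F →L[ℝ] G) (hf : Bd S σ w f) : Bd S σ w (fun i y => L (f i y)) :=
  ⟨fun i hi => L.contDiff.comp (hf.1 i hi), fun k => by
    obtain ⟨C, hC, H⟩ := hf.2 k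
    refine ⟨‖L‖ * C, by positivity, fun i hi y => ?_⟩
    have := L.norm_iteratedFDeriv_comp_left (x := y) (n := k) (hf.1 i hi).contDiffAt
      (mod_cast le_top)
    refine this.trans ?_
    calc ‖L‖ * ‖iteratedFDeriv ℝ k (f i) y‖ ≤ ‖L‖ * (C * w i * σ i ^ k) := by
          gcongr; exact H i hi y
      _ = _ := by ring⟩

theorem neg (hf : Bd S σ w f) : Bd S σ w (fun i y => -f i y) := by
  simpa using hf.clm (-ContinuousLinearMap.id ℝ F)

theorem sub (hf : Bd S σ w f) (hg : Bd S σ w g) : Bd S σ w (fun i y => f i y - g i y) := by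
  simpa [sub_eq_add_neg] using hf.add hg.neg

theorem sum {κ : Type*} (s : Finset κ) {f : κ → ι → V → F} (hσ : ∀ i ∈ S, 0 ≤ σ i)
    (hw : ∀ i ∈ S, 0 ≤ w i) (hf : ∀ j ∈ s, Bd S σ w (f j)) :
    Bd S σ w (fun i y => ∑ j ∈ s, f j i y) := by
  classical
  induction s using induction_on with
  | empty => simpa using zero hσ hw
  | insert j s hj ih =>
    simp only [Finset.sum_insert hj]
    exact (hf j (by simp)).add (ih fun k hk => hf k (by simp [hk]))

theorem mul {f g : ι → V → ℂ} (hf : Bd S σ w f) (hg : Bd S σ w' g) :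
    Bd S σ (fun i => w i * w' i) (fun i y => f i y * g i y) :=
  ⟨fun i hi => (hf.1 i hi).mul (hg.1 i hi), fun k => by
    choose C hC H using hf.2
    choose C' hC' H' using hg.2
    refine ⟨∑ j ∈ range (k + 1), (k.choose j : ℝ) * C j * C' (k - j),
      sum_nonneg fun j _ => by have := hC j; have := hC' (k - j); positivity,
      fun i hi y => ?_⟩
    refine (norm_iteratedFDeriv_mul_le (hf.1 i hi) (hg.1 i hi) y
      (mod_cast le_top)).trans ?_
    rw [sum_mul, sum_mul]
    refine sum_le_sum fun j hj => ?_
    have hjk : j + (k - j) = k := by have := mem_range.1 hj; omega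
    have h1 := H j i hi y
    have h2 := H' (k - j) i hi y
    calc (k.choose j : ℝ) * ‖iteratedFDeriv ℝ j (f i) y‖ * ‖iteratedFDeriv ℝ (k - j) (g i) y‖
        ≤ (k.choose j : ℝ) * (C j * w i * σ i ^ j) * (C' (k - j) * w' i * σ i ^ (k - j)) :=
          mul_le_mul (mul_le_mul_of_nonneg_left h1 (by positivity)) h2 (norm_nonneg _)
            (mul_nonneg (by positivity) ((norm_nonneg _).trans h1))
      _ = (k.choose j : ℝ) * C j * C' (k - j) * (w i * w' i) * (σ i ^ j * σ i ^ (k - j)) := by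
          ring
      _ = _ := by rw [← pow_add, hjk]⟩

theorem const_mul {f : ι → V → ℂ} (hf : Bd S σ w f) (hσ : ∀ i ∈ S, 0 ≤ σ i) (c : ι → ℂ) (K : ℝ)
    (hw' : ∀ i ∈ S, 0 ≤ w' i) (hc : ∀ i ∈ S, ‖c i‖ ≤ K * w' i) :
    Bd S σ (fun i => w' i * w i) (fun i y => c i * f i y) :=
  (const hσ hw' c K hc).mul hf

theorem smul_const {f : ι → V → ℂ} (hf : Bd S σ w f) (c : ℂ) :
    Bd S σ w (fun i y => c * f i y) := by
  simpa using hf.clm ((ContinuousLinearMap.mul ℝ ℂ) c)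

theorem fderiv (hf : Bd S σ w f) :
    Bd S σ (fun i => w i * σ i) (fun i y => fderiv ℝ (f i) y) :=
  ⟨fun i hi => (hf.1 i hi).fderiv_right (mod_cast le_top), fun k => by
    obtain ⟨C, hC, H⟩ := hf.2 (k + 1)
    refine ⟨C, hC, fun i hi y => ?_⟩
    change ‖iteratedFDeriv ℝ k (_root_.fderiv ℝ (f i)) y‖ ≤ _
    rw [norm_iteratedFDeriv_fderiv]
    exact (H i hi y).trans (le_of_eq (by ring))⟩

theorem fderiv_apply (hf : Bd S σ w f) (v : V) :
    Bd S σ (fun i => w i * σ i) (fun i y => _root_.fderiv ℝ (f i) y v) :=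
  hf.fderiv.clm (ContinuousLinearMap.apply ℝ F v)

/-- Precomposition with an affine isometric-type map `y ↦ L y + c i`. -/
theorem comp_affine {U : Type*} [NormedAddCommGroup U] [NormedSpace ℝ U] (hf : Bd S σ w f)
    (L : U →L[ℝ] V) (c : ι → V) :
    Bd S σ w (fun i y => f i (L y + c i)) :=
  ⟨fun i hi => (hf.1 i hi).comp (L.contDiff.add contDiff_const), fun k => by
    obtain ⟨C, hC, H⟩ := hf.2 k
    refine ⟨C * ‖L‖ ^ k, by positivity, fun i hi y => ?_⟩
    have h2 : ContDiff ℝ ∞ (fun z => f i (z + c i)) :=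
      (hf.1 i hi).comp (contDiff_id.add contDiff_const)
    change ‖iteratedFDeriv ℝ k ((fun z => f i (z + c i)) ∘ L) y‖ ≤ _
    rw [L.iteratedFDeriv_comp_right h2 y (i := k) (mod_cast le_top),
      iteratedFDeriv_comp_add_right]
    refine (norm_compContinuousLinearMap_le _ _).trans ?_
    simp only [Finset.prod_const, Finset.card_univ, Fintype.card_fin]
    calc _ ≤ C * w i * σ i ^ k * ‖L‖ ^ k := by gcongr; exact H i hi _
      _ = _ := by ring⟩

theorem exp {ψ : ι → V → ℂ} {v : ι → ℝ} (hψ : ∀ i ∈ S, ContDiff ℝ ∞ (ψ i))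
    (hσ : ∀ i ∈ S, 0 ≤ σ i)
    (hd : ∀ k, 1 ≤ k → ∃ C : ℝ, 0 ≤ C ∧ ∀ i ∈ S, ∀ y,
      ‖iteratedFDeriv ℝ k (ψ i) y‖ ≤ C * σ i ^ k)
    (hre : ∀ i ∈ S, ∀ y, Real.exp (ψ i y).re ≤ v i) :
    Bd S σ v (fun i y => Complex.exp (ψ i y)) :=
  ⟨fun i hi => Complex.contDiff_exp.comp (hψ i hi), fun k => by
    choose! C hC H using hd
    set D : ℝ := 1 + ∑ j ∈ Icc 1 k, C j with hD
    have hCD : ∀ j, 1 ≤ j → j ≤ k → C j ≤ D := fun j h1 h2 =>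
      (Finset.single_le_sum (f := C) (fun i hi => hC i (mem_Icc.1 hi).1)
        (mem_Icc.2 ⟨h1, h2⟩)).trans (by linarith)
    have hD1 : 1 ≤ D := by
      have : 0 ≤ ∑ j ∈ Icc 1 k, C j :=
        sum_nonneg fun i hi => hC i (mem_Icc.1 hi).1
      linarith
    refine ⟨k.factorial * D ^ k, by positivity, fun i hi y => ?_⟩
    have := norm_iteratedFDeriv_comp_le (𝕜 := ℝ) (g := Complex.exp) (f := ψ i) (n := k)
      (N := ∞) Complex.contDiff_exp (hψ i hi) (mod_cast le_top) y (C := v i)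
      (D := D * σ i) (fun j _ => ?_) (fun j h1 h2 => ?_)
    · refine this.trans (le_of_eq ?_)
      rw [mul_pow]; ring
    · have e := (Complex.contDiff_exp (𝕜 := ℂ) (n := j)).contDiffAt.restrictScalars_iteratedFDeriv
        (𝕜 := ℝ) (x := ψ i y)
      rw [← e, Function.comp_apply,
        ContinuousMultilinearMap.norm_restrictScalars,
        norm_iteratedFDeriv_eq_norm_iteratedDeriv, iteratedDeriv_eq_iterate, Complex.iter_deriv_exp,
        Complex.norm_exp]
      exact hre i hi y
    · refine (H j h1 i hi y).trans ?_
      rw [mul_pow]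
      have := hσ i hi
      have h3 : C j ≤ D ^ j := (hCD j h1 h2).trans (le_self_pow₀ hD1 (by omega))
      gcongr⟩

end Bd

universe u

/-! ### Interpolation of derivative bounds -/

theorem exists_extraction_weights (N : ℕ) : ∃ c : ℕ → ℝ, ∀ i < N,
    ∑ j ∈ range N, c j * (j : ℝ) ^ i = if i = 1 then 1 else 0 := by
  classical
  refine ⟨fun j => (Lagrange.basis (range N) (fun j : ℕ => (j : ℝ)) j).coeff 1,
    fun i hi => ?_⟩
  have h := Lagrange.eq_interpolate (s := range N) (v := fun j : ℕ => (j : ℝ))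
    (f := (Polynomial.X : Polynomial ℝ) ^ i) (fun a _ b _ hab => by simpa using hab)
    (by rw [Polynomial.degree_X_pow]; simpa using hi)
  have h1 := congrArg (fun p => Polynomial.coeff p 1) h
  simp only [Lagrange.interpolate_apply, Polynomial.finsetSum_coeff, Polynomial.coeff_C_mul,
    Polynomial.eval_pow, Polynomial.eval_X, Polynomial.coeff_X_pow] at h1
  rw [sum_congr rfl fun j _ => mul_comm _ _, ← h1]
  simp [eq_comm]

theorem norm_taylor_sub_le {F : Type*} [NormedAddCommGroup F] [NormedSpace ℝ F] {g : ℝ → F}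
    (hg : ContDiff ℝ ∞ g) {N : ℕ} {B x : ℝ} (hx : 0 ≤ x)
    (hB : ∀ y, ‖iteratedDeriv (N + 1) g y‖ ≤ B) :
    ‖g x - ∑ i ∈ range (N + 1), ((i.factorial : ℝ)⁻¹ * x ^ i) • iteratedDeriv i g 0‖
      ≤ B * x ^ (N + 1) := by
  have hB0 : 0 ≤ B := (norm_nonneg _).trans (hB 0)
  rcases hx.eq_or_lt with rfl | hx
  · rw [sum_eq_single 0 (fun i _ hi => by simp [hi]) (by simp)]
    simp
  have hu := uniqueDiffOn_Icc hx
  have e : ∀ i, ∀ y ∈ Set.Icc 0 x,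
      iteratedDerivWithin i g (Set.Icc 0 x) y = iteratedDeriv i g y := fun i y hy =>
    iteratedDerivWithin_eq_iteratedDeriv hu ((hg.of_le (mod_cast le_top)).contDiffAt) hy
  have h := taylor_mean_remainder_bound (f := g) (n := N) (C := B) hx.le
    ((hg.of_le (mod_cast le_top)).contDiffOn) (Set.right_mem_Icc.2 hx.le)
    (fun y hy => by rw [e _ y hy]; exact hB y)
  rw [taylor_within_apply] at h
  simp only [sub_zero] at h
  rw [sum_congr rfl fun i _ => by rw [e i 0 (Set.left_mem_Icc.2 hx.le)]] at h
  refine h.trans (div_le_self (by positivity) ?_)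
  exact_mod_cast Nat.one_le_iff_ne_zero.2 (Nat.factorial_ne_zero N)

theorem exists_norm_deriv_le (N : ℕ) (hN : 1 ≤ N) : ∃ C : ℝ, 0 ≤ C ∧
    ∀ {F : Type*} [NormedAddCommGroup F] [NormedSpace ℝ F] (g : ℝ → F) (A B : ℝ),
      ContDiff ℝ ∞ g → (∀ x, ‖g x‖ ≤ A) → (∀ x, ‖iteratedDeriv (N + 1) g x‖ ≤ B) →
      ∀ s, 0 < s → ‖deriv g 0‖ ≤ C * (A / s + B * s ^ N) := by
  obtain ⟨c, hc⟩ := exists_extraction_weights (N + 1)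
  refine ⟨∑ j ∈ range (N + 1), |c j| * (1 + (j : ℝ) ^ (N + 1)),
    sum_nonneg fun j _ => by positivity, ?_⟩
  intro F _ _ g A B hg hA hB s hs
  have hA0 : 0 ≤ A := (norm_nonneg _).trans (hA 0)
  have hB0 : 0 ≤ B := (norm_nonneg _).trans (hB 0)
  set R : ℕ → F := fun j => g (j * s) - ∑ i ∈ range (N + 1),
    ((i.factorial : ℝ)⁻¹ * (j * s) ^ i) • iteratedDeriv i g 0 with hR
  have hRb : ∀ j : ℕ, ‖R j‖ ≤ B * (j * s) ^ (N + 1) := fun j =>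
    norm_taylor_sub_le hg (by positivity) hB
  have key : s • deriv g 0 =
      ∑ j ∈ range (N + 1), c j • g (j * s) - ∑ j ∈ range (N + 1), c j • R j := by
    rw [← sum_sub_distrib]
    have : ∀ j ∈ range (N + 1), c j • g (j * s) - c j • R j =
        ∑ i ∈ range (N + 1),
          ((i.factorial : ℝ)⁻¹ * s ^ i * (c j * (j : ℝ) ^ i)) • iteratedDeriv i g 0 := by
      intro j _
      rw [hR, ← smul_sub, sub_sub_cancel, Finset.smul_sum]
      refine sum_congr rfl fun i _ => ?_
      rw [smul_smul, mul_pow]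
      congr 1
      ring
    rw [sum_congr rfl this, Finset.sum_comm]
    have h2 : ∀ i ∈ range (N + 1), ∑ j ∈ range (N + 1),
        ((i.factorial : ℝ)⁻¹ * s ^ i * (c j * (j : ℝ) ^ i)) • iteratedDeriv i g 0 =
        if i = 1 then s • deriv g 0 else 0 := by
      intro i hi
      rw [← Finset.sum_smul, ← mul_sum, hc i (mem_range.1 hi)]
      split_ifs with h
      · subst h; simp
      · simp
    rw [sum_congr rfl h2, Finset.sum_ite_eq' , if_pos (mem_range.2 (by omega))]
  have hn : ‖s • deriv g 0‖ ≤ ∑ j ∈ range (N + 1),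
      |c j| * (1 + (j : ℝ) ^ (N + 1)) * (A + B * s ^ (N + 1)) := by
    rw [key, ← sum_sub_distrib]
    refine (norm_sum_le _ _).trans (sum_le_sum fun j _ => ?_)
    rw [← smul_sub, norm_smul, norm_eq_abs, mul_assoc]
    refine mul_le_mul_of_nonneg_left ?_ (abs_nonneg _)
    refine (norm_sub_le _ _).trans ((add_le_add (hA _) (hRb j)).trans ?_)
    have h3 : 0 ≤ (j : ℝ) ^ (N + 1) := by positivity
    have h4 : 0 ≤ B * s ^ (N + 1) := by positivity
    rw [mul_pow]
    nlinarith [mul_nonneg h3 hA0]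
  rw [norm_smul, norm_eq_abs, abs_of_pos hs, ← sum_mul] at hn
  rw [← mul_le_mul_iff_right₀ hs]
  refine hn.trans (le_of_eq ?_)
  field_simp
  ring

theorem norm_fderiv_le_of_line {V F : Type*} [NormedAddCommGroup V] [NormedSpace ℝ V]
    [NormedAddCommGroup F] [NormedSpace ℝ F] {N : ℕ} {C A B s : ℝ} (hC : 0 ≤ C) (hA : 0 ≤ A)
    (hs : 0 < s)
    (H : ∀ g : ℝ → F, ContDiff ℝ ∞ g → (∀ x, ‖g x‖ ≤ A) →
      (∀ x, ‖iteratedDeriv (N + 1) g x‖ ≤ B) → ‖deriv g 0‖ ≤ C * (A / s + B * s ^ N))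
    {G : V → F} (hG : ContDiff ℝ ∞ G) (h0 : ∀ y, ‖G y‖ ≤ A)
    (hN : ∀ y, ‖iteratedFDeriv ℝ (N + 1) G y‖ ≤ B) (y : V) :
    ‖fderiv ℝ G y‖ ≤ C * (A / s + B * s ^ N) := by
  have hB0 : 0 ≤ B := (norm_nonneg _).trans (hN 0)
  refine ContinuousLinearMap.opNorm_le_of_unit_norm (by positivity) fun v hv => ?_
  set L : ℝ →L[ℝ] V := toSpanSingleton ℝ v with hL
  have hL1 : ‖L‖ = 1 := by rw [hL, norm_toSpanSingleton, hv]
  have hc : ContDiff ℝ ∞ (fun z => G (z + y)) := hG.comp (contDiff_id.add contDiff_const)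
  have h1 := H ((fun z => G (z + y)) ∘ L) (hc.comp L.contDiff) (fun x => h0 _) (fun x => ?_)
  · have h2 : HasDerivAt ((fun z => G (z + y)) ∘ L) (fderiv ℝ G y v) 0 := by
      have h3 : HasFDerivAt G (fderiv ℝ G y) (L 0 + y) := by
        simpa using ((hG.differentiable (by simp)) y).hasFDerivAt
      have h4 : HasDerivAt (fun x => L x + y) v 0 := by
        have := (L.hasDerivAt (x := 0)).add_const y
        simpa [hL] using this
      exact HasFDerivAt.comp_hasDerivAt (f := fun x => L x + y) (0 : ℝ) h3 h4
    rwa [h2.deriv] at h1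
  · rw [← norm_iteratedFDeriv_eq_norm_iteratedDeriv,
      L.iteratedFDeriv_comp_right hc x (i := N + 1) (mod_cast le_top),
      iteratedFDeriv_comp_add_right]
    refine (norm_compContinuousLinearMap_le _ _).trans ?_
    simpa [hL1] using hN _

theorem Bd.norm_fderiv_le {ι V F : Type*} [NormedAddCommGroup V] [NormedSpace ℝ V]
    [NormedAddCommGroup F] [NormedSpace ℝ F] {S : Set ι} {f : ι → V → F} {A : ι → ℝ}
    (hf : Bd S (fun _ => 1) (fun _ => 1) f) (hA : ∀ i ∈ S, 0 < A i) (hA1 : ∀ i ∈ S, A i ≤ 1)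
    (K : ℝ) (hv : ∀ i ∈ S, ∀ y, ‖f i y‖ ≤ K * A i) (τ : ℝ) (hτ : τ < 1) :
    ∃ C : ℝ, ∀ i ∈ S, ∀ y, ‖_root_.fderiv ℝ (f i) y‖ ≤ C * A i ^ τ := by
  obtain ⟨N, hN⟩ := exists_nat_gt (1 / (1 - τ))
  have hτ' : 0 < 1 - τ := by linarith
  have hN0 : (0 : ℝ) < N := (by positivity : (0 : ℝ) < 1 / (1 - τ)).trans hN
  have hN1 : 1 ≤ N := by exact_mod_cast hN0
  obtain ⟨D, hD, HD⟩ := hf.2 (N + 1)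
  obtain ⟨c, hc, Hc⟩ := exists_norm_deriv_le N hN1
  refine ⟨c * (|K| + D), fun i hi y => ?_⟩
  have hAi := hA i hi
  set s : ℝ := A i ^ (1 / ((N : ℝ) + 1)) with hs
  have hs0 : 0 < s := rpow_pos_of_pos hAi _
  have hb := norm_fderiv_le_of_line (G := f i) (A := |K| * A i) (B := D)
    (N := N) hc (by positivity) hs0 (fun g h1 h2 h3 => Hc g _ _ h1 h2 h3 s hs0)
    (hf.1 i hi) (fun z => (hv i hi z).trans (by gcongr; exact le_abs_self K))
    (fun z => by simpa using HD i hi z) y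
  refine hb.trans ?_
  rw [div_lt_iff₀ hτ'] at hN
  have e0 : 1 / ((N : ℝ) + 1) ≤ 1 - τ := by
    rw [div_le_iff₀ (by positivity)]; nlinarith
  have e1 : |K| * A i / s ≤ |K| * A i ^ τ := by
    rw [hs, mul_div_assoc]
    nth_rewrite 1 [← rpow_one (A i)]
    rw [← Real.rpow_sub hAi]
    refine mul_le_mul_of_nonneg_left
      (rpow_le_rpow_of_exponent_ge hAi (hA1 i hi) ?_) (abs_nonneg _)
    linarith
  have e2 : D * s ^ N ≤ D * A i ^ τ := by
    rw [hs, ← rpow_natCast, ← rpow_mul hAi.le]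
    refine mul_le_mul_of_nonneg_left (rpow_le_rpow_of_exponent_ge hAi (hA1 i hi) ?_) hD
    have : 1 / ((N : ℝ) + 1) * N = 1 - 1 / ((N : ℝ) + 1) := by field_simp; ring
    rw [this]; linarith
  calc c * (|K| * A i / s + D * s ^ N) ≤ c * (|K| * A i ^ τ + D * A i ^ τ) := by gcongr
    _ = _ := by ring

/-- Bounds on the values and on all derivatives of a family give almost the same bound on the
derivatives as on the values. -/
theorem Bd.interpolate {ι : Type*} {V F : Type u} [NormedAddCommGroup V] [NormedSpace ℝ V]
    [NormedAddCommGroup F] [NormedSpace ℝ F] {S : Set ι} {f : ι → V → F} {A : ι → ℝ}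
    (hf : Bd S (fun _ => 1) (fun _ => 1) f) (hA : ∀ i ∈ S, 0 < A i) (hA1 : ∀ i ∈ S, A i ≤ 1)
    (K : ℝ) (hv : ∀ i ∈ S, ∀ y, ‖f i y‖ ≤ K * A i) (θ : ℝ) (hθ : θ < 1) :
    Bd S (fun _ => 1) (fun i => A i ^ θ) f := by
  refine ⟨hf.1, fun k => ?_⟩
  simp only [one_pow, mul_one]
  induction k generalizing θ F K A with
  | zero =>
    refine ⟨|K|, abs_nonneg K, fun i hi y => ?_⟩
    rw [norm_iteratedFDeriv_zero]
    have h1 := hA i hi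
    calc ‖f i y‖ ≤ K * A i := hv i hi y
      _ ≤ |K| * A i ^ (1 : ℝ) := by rw [rpow_one]; gcongr; exact le_abs_self K
      _ ≤ |K| * A i ^ θ := mul_le_mul_of_nonneg_left
          (rpow_le_rpow_of_exponent_ge h1 (hA1 i hi) hθ.le) (abs_nonneg _)
  | succ k ih =>
    rcases le_or_gt θ 0 with h0 | h0
    · obtain ⟨C, hC, H⟩ := hf.2 (k + 1)
      refine ⟨C, hC, fun i hi y => (H i hi y).trans ?_⟩
      have := Real.one_le_rpow_of_pos_of_le_one_of_nonpos (hA i hi) (hA1 i hi) h0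
      simp only [one_pow, mul_one]
      nlinarith
    have hτ : √θ < 1 := by rw [Real.sqrt_lt' one_pos]; simpa using hθ
    obtain ⟨C, HC⟩ := hf.norm_fderiv_le hA hA1 K hv √θ hτ
    obtain ⟨D, hD, HD⟩ := ih (f := fun i y => _root_.fderiv ℝ (f i) y) (A := fun i => A i ^ √θ)
      (by simpa using hf.fderiv) (fun i hi => rpow_pos_of_pos (hA i hi) _)
      (fun i hi => rpow_le_one (hA i hi).le (hA1 i hi) (Real.sqrt_nonneg _)) C HC √θ hτ
    refine ⟨D, hD, fun i hi y => ?_⟩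
    have := HD i hi y
    rwa [← rpow_mul (hA i hi).le, Real.mul_self_sqrt h0.le, norm_iteratedFDeriv_fderiv]
      at this

/-- Formal series in `t`. -/
abbrev FS (n : ℕ) := PowerSeries (Sym n)

/-- Formal series in `h` and `t`. -/
abbrev FS₂ (n : ℕ) := PowerSeries (FS n)

/-- The series of the derivatives `∂_η^α m`. -/
local notation:max "∂ηm(" mj "," α "," μ ")" => mapCoeff (mapCoeff (mpow deta α)) (PowerSeries.mk fun j => mSeries mj μ j)

variable {n : ℕ}

/-! ### Smooth symbols and their partial derivatives -/

/-- The symbol as a function on `ℝⁿ × ℝⁿ`. -/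
def unc (a : Sym n) : E n × E n → ℂ := fun p => a p.1 p.2

/-- Joint smoothness in `(y, η)`. -/
def SmoothSym (a : Sym n) : Prop := ContDiff ℝ ∞ (unc a)

/-- The standard basis vectors. -/
abbrev bas (i : Fin n) : E n := single i (1 : ℝ)

theorem SmoothSym.left {a : Sym n} (ha : SmoothSym a) (η : E n) :
    ContDiff ℝ ∞ (fun y => a y η) :=
  ContDiff.comp ha (contDiff_id.prodMk contDiff_const)

theorem SmoothSym.right {a : Sym n} (ha : SmoothSym a) (y : E n) :
    ContDiff ℝ ∞ (fun η => a y η) :=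
  ContDiff.comp (f := fun η => (y, η)) ha (contDiff_const.prodMk contDiff_id)

theorem SmoothSym.differentiable {a : Sym n} (ha : SmoothSym a) : Differentiable ℝ (unc a) :=
  ContDiff.differentiable ha (by simp)

theorem SmoothSym.dy_eq {a : Sym n} (ha : SmoothSym a) (i : Fin n) :
    unc (dy i a) = fun p => fderiv ℝ (unc a) p (bas i, 0) := by
  funext ⟨y, η⟩
  have h1 := (ha.differentiable (y, η)).hasFDerivAt
  have h2 : HasFDerivAt (fun y' : E n => (y', η)) (inl ℝ (E n) (E n)) y :=
    hasFDerivAt_prodMk_left y η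
  have h3 := h1.comp y h2
  change fderiv ℝ (unc a ∘ fun y' => (y', η)) y (bas i) = _
  rw [h3.fderiv]
  rfl

theorem SmoothSym.deta_eq {a : Sym n} (ha : SmoothSym a) (i : Fin n) :
    unc (deta i a) = fun p => fderiv ℝ (unc a) p (0, bas i) := by
  funext ⟨y, η⟩
  have h1 := (ha.differentiable (y, η)).hasFDerivAt
  have h2 : HasFDerivAt (fun η' : E n => (y, η')) (inr ℝ (E n) (E n)) η :=
    hasFDerivAt_prodMk_right y η
  have h3 := h1.comp η h2
  change fderiv ℝ (unc a ∘ fun η' => (y, η')) η (bas i) = _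
  rw [h3.fderiv]
  rfl

theorem SmoothSym.dirDeriv {a : Sym n} (ha : SmoothSym a) (v : E n × E n) :
    ContDiff ℝ ∞ (fun p => fderiv ℝ (unc a) p v) :=
  (ContDiff.fderiv_right ha (by simp)).clm_apply contDiff_const

protected theorem SmoothSym.dy {a : Sym n} (ha : SmoothSym a) (i : Fin n) : SmoothSym (dy i a) := by
  rw [SmoothSym, ha.dy_eq]; exact ha.dirDeriv _

protected theorem SmoothSym.deta {a : Sym n} (ha : SmoothSym a) (i : Fin n) : SmoothSym (deta i a) := by
  rw [SmoothSym, ha.deta_eq]; exact ha.dirDeriv _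

theorem SmoothSym.add {a b : Sym n} (ha : SmoothSym a) (hb : SmoothSym b) : SmoothSym (a + b) :=
  ContDiff.add ha hb

theorem SmoothSym.mul {a b : Sym n} (ha : SmoothSym a) (hb : SmoothSym b) : SmoothSym (a * b) :=
  ContDiff.mul ha hb

theorem SmoothSym.smul {a : Sym n} (c : ℂ) (ha : SmoothSym a) : SmoothSym (c • a) :=
  ContDiff.const_smul c ha

theorem SmoothSym.zero : SmoothSym (0 : Sym n) := contDiff_const

variable (n) in
/-- The space of smooth symbols. -/
def smoothSyms : Submodule ℂ (Sym n) where
  carrier := {a | SmoothSym a}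
  add_mem' ha hb := ha.add hb
  zero_mem' := SmoothSym.zero
  smul_mem' c _ ha := ha.smul c

theorem dy_add {a b : Sym n} (ha : SmoothSym a) (hb : SmoothSym b) (i : Fin n) :
    dy i (a + b) = dy i a + dy i b := by
  funext y η
  have := fderiv_fun_add (((ha.left η).differentiable (by simp)) y)
    (((hb.left η).differentiable (by simp)) y)
  exact congrArg (fun L => L (bas i)) this

theorem deta_add {a b : Sym n} (ha : SmoothSym a) (hb : SmoothSym b) (i : Fin n) :
    deta i (a + b) = deta i a + deta i b := by
  funext y η
  have := fderiv_fun_add (((ha.right y).differentiable (by simp)) η)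
    (((hb.right y).differentiable (by simp)) η)
  exact congrArg (fun L => L (bas i)) this

theorem dy_smul (c : ℂ) (a : Sym n) (ha : SmoothSym a) (i : Fin n) : dy i (c • a) = c • dy i a := by
  funext y η
  have := fderiv_fun_const_smul (((ha.left η).differentiable (by simp)) y) c
  exact congrArg (fun L => L (bas i)) this

theorem deta_smul (c : ℂ) (a : Sym n) (ha : SmoothSym a) (i : Fin n) :
    deta i (c • a) = c • deta i a := by
  funext y η
  have := fderiv_fun_const_smul (((ha.right y).differentiable (by simp)) η) c
  exact congrArg (fun L => L (bas i)) this

/-- `∂_{y_i}` on smooth symbols. -/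
def dyEnd (i : Fin n) : Module.End ℂ (smoothSyms n) where
  toFun a := ⟨dy i a.1, a.2.dy i⟩
  map_add' a b := Subtype.ext (dy_add a.2 b.2 i)
  map_smul' c a := Subtype.ext (dy_smul c a.1 a.2 i)

/-- `∂_{η_i}` on smooth symbols. -/
def detaEnd (i : Fin n) : Module.End ℂ (smoothSyms n) where
  toFun a := ⟨deta i a.1, a.2.deta i⟩
  map_add' a b := Subtype.ext (deta_add a.2 b.2 i)
  map_smul' c a := Subtype.ext (deta_smul c a.1 a.2 i)

theorem SmoothSym.fderiv_comm {a : Sym n} (ha : SmoothSym a) (v w : E n × E n)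
    (p : E n × E n) :
    fderiv ℝ (fun q => fderiv ℝ (unc a) q v) p w = fderiv ℝ (fun q => fderiv ℝ (unc a) q w) p v := by
  have hs : IsSymmSndFDerivAt ℝ (unc a) p :=
    (ContDiff.contDiffAt ha).isSymmSndFDerivAt (by simp; exact ENat.LEInfty.out)
  have hd :=
    ((ContDiff.fderiv_right (m := ∞) ha (by simp)).differentiable (by simp)) p
  have e : ∀ v w, fderiv ℝ (fun q => fderiv ℝ (unc a) q v) p w =
      fderiv ℝ (fderiv ℝ (unc a)) p w v := by
    intro v w
    have := (hd.hasFDerivAt.clm_apply (hasFDerivAt_const v p)).fderiv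
    rw [this]; simp
  rw [e, e, hs.eq]

theorem dy_dy_comm {a : Sym n} (ha : SmoothSym a) (i j : Fin n) :
    dy i (dy j a) = dy j (dy i a) := by
  have : unc (dy i (dy j a)) = unc (dy j (dy i a)) := by
    rw [(ha.dy j).dy_eq, (ha.dy i).dy_eq, ha.dy_eq, ha.dy_eq]
    exact funext fun p => ha.fderiv_comm _ _ p
  exact funext fun y => funext fun η => congrFun this (y, η)

theorem dy_deta_comm {a : Sym n} (ha : SmoothSym a) (i j : Fin n) :
    dy i (deta j a) = deta j (dy i a) := by
  have : unc (dy i (deta j a)) = unc (deta j (dy i a)) := by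
    rw [(ha.deta j).dy_eq, (ha.dy i).deta_eq, ha.deta_eq, ha.dy_eq]
    exact funext fun p => ha.fderiv_comm _ _ p
  exact funext fun y => funext fun η => congrFun this (y, η)

theorem deta_deta_comm {a : Sym n} (ha : SmoothSym a) (i j : Fin n) :
    deta i (deta j a) = deta j (deta i a) := by
  have : unc (deta i (deta j a)) = unc (deta j (deta i a)) := by
    rw [(ha.deta j).deta_eq, (ha.deta i).deta_eq, ha.deta_eq, ha.deta_eq]
    exact funext fun p => ha.fderiv_comm _ _ p
  exact funext fun y => funext fun η => congrFun this (y, η)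

theorem commute_dyEnd (i j : Fin n) : Commute (dyEnd (n := n) i) (dyEnd j) :=
  LinearMap.ext fun a => Subtype.ext (dy_dy_comm a.2 i j)

theorem commute_detaEnd (i j : Fin n) : Commute (detaEnd (n := n) i) (detaEnd j) :=
  LinearMap.ext fun a => Subtype.ext (deta_deta_comm a.2 i j)

theorem commute_dyEnd_detaEnd (i j : Fin n) : Commute (dyEnd (n := n) i) (detaEnd j) :=
  LinearMap.ext fun a => Subtype.ext (dy_deta_comm a.2 i j)

/-! ### Multi-indices -/

/-- `P^α` for a commuting family of endomorphisms. -/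
def endPow {A : Type*} [AddCommGroup A] [Module ℂ A] (P : Fin n → Module.End ℂ A)
    (α : Fin n → ℕ) : Module.End ℂ A :=
  ((finRange n).map fun i => P i ^ α i).prod

theorem mpow_coe {B : Type*} [AddCommGroup B] [Module ℂ B] {A : Submodule ℂ B}
    (P : Fin n → Module.End ℂ A) (D : Fin n → B → B) (hP : ∀ i a, (P i a : B) = D i a)
    (α : Fin n → ℕ) (a : A) : mpow D α (a : B) = (endPow P α a : B) := by
  unfold mpow endPow
  induction finRange n with
  | nil => simp
  | cons i l ih =>
    simp only [List.foldr_cons, List.map_cons, List.prod_cons, Module.End.mul_apply, ih]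
    induction α i with
    | zero => simp
    | succ k ihk => rw [iterate_succ_apply', pow_succ', Module.End.mul_apply, hP, ← ihk]

section endPow
variable {A : Type*} [AddCommGroup A] [Module ℂ A] {P : Fin n → Module.End ℂ A}
  (hP : ∀ i j, Commute (P i) (P j))
include hP

theorem endPow_eq_noncommProd (α : Fin n → ℕ) :
    endPow P α = Finset.univ.noncommProd (fun i => P i ^ α i)
      (fun i _ j _ _ => (hP i j).pow_pow _ _) := by
  unfold endPow
  rw [← Finset.noncommProd_toFinset (finRange n) (fun i => P i ^ α i)
    (fun i _ j _ _ => (hP i j).pow_pow _ _) (List.nodup_finRange n)]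
  congr 1
  exact List.toFinset_finRange n

theorem endPow_add_single (α : Fin n → ℕ) (i : Fin n) :
    endPow P (α + Pi.single i 1) = P i * endPow P α := by
  have h1 := fun β : Fin n → ℕ => Finset.mul_noncommProd_erase Finset.univ (Finset.mem_univ i)
    (fun j => P j ^ β j) (fun i _ j _ _ => (hP i j).pow_pow _ _)
  rw [endPow_eq_noncommProd hP, endPow_eq_noncommProd hP]
  refine (h1 _).symm.trans (Eq.trans ?_ (congrArg (P i * ·) (h1 α)))
  rw [← mul_assoc]
  congr 1
  · simp [pow_succ']
  · refine Finset.noncommProd_congr rfl (fun j hj => ?_) _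
    have := Finset.ne_of_mem_erase hj
    simp [this]

end endPow

theorem mpow_dy_coe (α : Fin n → ℕ) (a : smoothSyms n) :
    mpow dy α (a : Sym n) = (endPow dyEnd α a : Sym n) :=
  mpow_coe dyEnd dy (fun _ _ => rfl) α a

theorem mpow_deta_coe (α : Fin n → ℕ) (a : smoothSyms n) :
    mpow deta α (a : Sym n) = (endPow detaEnd α a : Sym n) :=
  mpow_coe detaEnd deta (fun _ _ => rfl) α a

theorem SmoothSym.mpow_dy {a : Sym n} (ha : SmoothSym a) (α : Fin n → ℕ) :
    SmoothSym (mpow dy α a) := by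
  rw [mpow_dy_coe α ⟨a, ha⟩]; exact (endPow dyEnd α ⟨a, ha⟩).2

theorem SmoothSym.mpow_deta {a : Sym n} (ha : SmoothSym a) (α : Fin n → ℕ) :
    SmoothSym (mpow deta α a) := by
  rw [mpow_deta_coe α ⟨a, ha⟩]; exact (endPow detaEnd α ⟨a, ha⟩).2

theorem dy_mpow_dy {a : Sym n} (ha : SmoothSym a) (α : Fin n → ℕ) (i : Fin n) :
    dy i (mpow dy α a) = mpow dy (α + Pi.single i 1) a := by
  rw [mpow_dy_coe _ ⟨a, ha⟩, mpow_dy_coe _ ⟨a, ha⟩, endPow_add_single commute_dyEnd]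
  rfl

theorem deta_mpow_deta {a : Sym n} (ha : SmoothSym a) (α : Fin n → ℕ) (i : Fin n) :
    deta i (mpow deta α a) = mpow deta (α + Pi.single i 1) a := by
  rw [mpow_deta_coe _ ⟨a, ha⟩, mpow_deta_coe _ ⟨a, ha⟩, endPow_add_single commute_detaEnd]
  rfl

theorem deta_mpow_dy {a : Sym n} (ha : SmoothSym a) (α : Fin n → ℕ) (i : Fin n) :
    deta i (mpow dy α a) = mpow dy α (deta i a) := by
  rw [mpow_dy_coe _ ⟨a, ha⟩, mpow_dy_coe _ ⟨deta i a, ha.deta i⟩]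
  have h : Commute (endPow dyEnd α) (detaEnd i) := by
    refine Commute.list_prod_left _ _ fun x hx => ?_
    obtain ⟨j, -, rfl⟩ := List.mem_map.1 hx
    exact (commute_dyEnd_detaEnd j i).pow_left _
  exact congrArg Subtype.val (LinearMap.congr_fun h.symm ⟨a, ha⟩)

/-- The derivative of order `k + 1` is controlled by those of order `k` of the partial
derivatives. -/
theorem SmoothSym.norm_iteratedFDeriv_succ_le {a : Sym n} (ha : SmoothSym a) (k : ℕ)
    (p : E n × E n) :
    ‖iteratedFDeriv ℝ (k + 1) (unc a) p‖ ≤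
      ∑ i, (‖iteratedFDeriv ℝ k (unc (dy i a)) p‖ +
        ‖iteratedFDeriv ℝ k (unc (deta i a)) p‖) := by
  set ℓ : Fin n → (E n × E n →L[ℝ] ℝ) := fun i =>
    (proj i : E n →L[ℝ] ℝ).comp (ContinuousLinearMap.fst ℝ (E n) (E n)) with hℓ
  set ℓ' : Fin n → (E n × E n →L[ℝ] ℝ) := fun i =>
    (proj i : E n →L[ℝ] ℝ).comp (ContinuousLinearMap.snd ℝ (E n) (E n)) with hℓ'
  have hproj : ∀ i, ‖(proj i : E n →L[ℝ] ℝ)‖ ≤ 1 := fun i =>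
    opNorm_le_bound _ zero_le_one fun x => by
      simpa using PiLp.norm_apply_le x i
  have h1 : ∀ i, ‖ℓ i‖ ≤ 1 := fun i => (opNorm_comp_le _ _).trans
    (mul_le_one₀ (hproj i) (norm_nonneg _) (ContinuousLinearMap.norm_fst_le _ _ _))
  have h1' : ∀ i, ‖ℓ' i‖ ≤ 1 := fun i => (opNorm_comp_le _ _).trans
    (mul_le_one₀ (hproj i) (norm_nonneg _) (ContinuousLinearMap.norm_snd_le _ _ _))
  have hsum := fun v => by
    have := (basisFun (Fin n) ℝ).sum_repr v
    simpa using this.symm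
  have key : fderiv ℝ (unc a) = fun q => ∑ i,
      (smulRightL ℝ (E n × E n) ℂ (ℓ i) (unc (dy i a) q) +
        smulRightL ℝ (E n × E n) ℂ (ℓ' i)
          (unc (deta i a) q)) := by
    funext q
    refine ContinuousLinearMap.ext fun v => ?_
    have hv : v = ∑ i, (v.1 i • ((bas i, 0) : E n × E n) + v.2 i • ((0, bas i) : E n × E n)) := by
      refine Prod.ext ?_ ?_
      · simpa [Prod.fst_sum] using hsum v.1
      · simpa [Prod.snd_sum] using hsum v.2
    conv_lhs => rw [hv]
    simp only [map_sum, map_add, map_smul, ha.dy_eq, ha.deta_eq,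
      sum_apply]
    rfl
  have hcd : ∀ (i : Fin n) (L : E n × E n →L[ℝ] ℝ) (b : Sym n), SmoothSym b →
      ContDiff ℝ ∞ (fun q => smulRightL ℝ (E n × E n) ℂ L (unc b q)) :=
    fun i L b hb => (ContinuousLinearMap.contDiff _).comp hb
  have hb : ∀ (L : E n × E n →L[ℝ] ℝ) (b : Sym n), ‖L‖ ≤ 1 → SmoothSym b →
      ‖iteratedFDeriv ℝ k (fun q => smulRightL ℝ (E n × E n) ℂ L (unc b q)) p‖
        ≤ ‖iteratedFDeriv ℝ k (unc b) p‖ := by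
    intro L b hL hb
    refine ((smulRightL ℝ (E n × E n) ℂ L).norm_iteratedFDeriv_comp_left
      (ContDiff.contDiffAt hb) (mod_cast le_top)).trans ?_
    refine mul_le_of_le_one_left (norm_nonneg _) ?_
    refine opNorm_le_bound _ zero_le_one fun c => ?_
    change ‖ContinuousLinearMap.smulRight L c‖ ≤ _
    rw [ContinuousLinearMap.norm_smulRight_apply]
    gcongr
  rw [← norm_iteratedFDeriv_fderiv, key, iteratedFDeriv_sum (fun i _ =>
    (((hcd i (ℓ i) _ (ha.dy i)).add (hcd i (ℓ' i) _ (ha.deta i))).of_le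
      (mod_cast le_top)))]
  rw [Finset.sum_apply]
  refine (norm_sum_le _ _).trans (sum_le_sum fun i _ => ?_)
  have := iteratedFDeriv_add_apply (x := p) (i := k)
    ((hcd i (ℓ i) _ (ha.dy i)).of_le (mod_cast le_top)).contDiffAt
    ((hcd i (ℓ' i) _ (ha.deta i)).of_le (mod_cast le_top)).contDiffAt
  refine le_trans (le_of_eq (congrArg norm this)) ?_
  exact (norm_add_le _ _).trans (add_le_add (hb _ _ (h1 i) (ha.dy i)) (hb _ _ (h1' i) (ha.deta i)))

/-- Uniform symbols have uniformly bounded derivatives of all orders. -/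
theorem IsUniformSymbol.bd {Y : Set (E n)} {ι : Type*} {S : Set ι} {a : ι → Sym n}
    (h : IsUniformSymbol Y S a) : Bd S (fun _ => 1) (fun _ => 1) (fun i => unc (a i)) := by
  refine ⟨fun i hi => (h.1 i hi).1, fun k => ?_⟩
  have hs : ∀ i ∈ S, SmoothSym (a i) := fun i hi => (h.1 i hi).1
  suffices H : ∀ α β : Fin n → ℕ, ∃ C : ℝ, 0 ≤ C ∧ ∀ i ∈ S, ∀ p,
      ‖iteratedFDeriv ℝ k (unc (mpow dy α (mpow deta β (a i)))) p‖ ≤ C by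
    obtain ⟨C, hC, H⟩ := H 0 0
    refine ⟨C, hC, fun i hi p => ?_⟩
    have e : ∀ (D : Fin n → Sym n → Sym n) (b : Sym n), mpow D 0 b = b := by
      intro D b
      unfold mpow
      induction finRange n with
      | nil => rfl
      | cons j l ih => simp
    have := H i hi p
    rw [e, e] at this
    simpa using this
  induction k with
  | zero =>
    intro α β
    obtain ⟨C, H⟩ := h.2 α β
    refine ⟨|C|, abs_nonneg C, fun i hi p => ?_⟩
    rw [norm_iteratedFDeriv_zero]
    refine (H i hi p.1 p.2).trans (le_trans (by gcongr; exact le_abs_self C)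
      (div_le_self (abs_nonneg C) (one_le_pow₀ ?_)))
    rw [Real.one_le_sqrt]
    nlinarith
  | succ k ih =>
    intro α β
    choose C hC H using ih
    refine ⟨∑ i, (C (α + Pi.single i 1) β + C α (β + Pi.single i 1)),
      sum_nonneg fun i _ => add_nonneg (hC _ _) (hC _ _), fun j hj p => ?_⟩
    refine (((hs j hj).mpow_deta β).mpow_dy α |>.norm_iteratedFDeriv_succ_le k p).trans
      (sum_le_sum fun i _ => ?_)
    rw [dy_mpow_dy ((hs j hj).mpow_deta β), deta_mpow_dy ((hs j hj).mpow_deta β),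
      deta_mpow_deta (hs j hj)]
    exact add_le_add (H _ _ j hj p) (H _ _ j hj p)

theorem mpow_family_induction {ι A : Type*} {D : Fin n → A → A} (Q : (ι → A) → Prop)
    (hD : ∀ j b, Q b → Q (fun i => D j (b i))) (α : Fin n → ℕ) {a : ι → A} (ha : Q a) :
    Q (fun i => mpow D α (a i)) := by
  unfold mpow
  induction finRange n with
  | nil => exact ha
  | cons j l ih =>
    simp
    induction α j with
    | zero => exact ih
    | succ k ihk => simp only [iterate_succ_apply']; exact hD _ _ ihk

theorem mpow_induction {A : Type*} {D : Fin n → A → A} (Q : A → Prop)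
    (hD : ∀ j b, Q b → Q (D j b)) (α : Fin n → ℕ) {a : A} (ha : Q a) : Q (mpow D α a) :=
  mpow_family_induction (fun b => Q (b ())) (fun j b => hD j (b ())) α
    (a := fun _ => a) ha

theorem Bd.union {ι V F : Type*} [NormedAddCommGroup V] [NormedSpace ℝ V] [NormedAddCommGroup F]
    [NormedSpace ℝ F] {S T : Set ι} {σ w : ι → ℝ} {f : ι → V → F} (hS : Bd S σ w f)
    (hT : Bd T σ w f) (hσ : ∀ i ∈ S ∪ T, 0 ≤ σ i) (hw : ∀ i ∈ S ∪ T, 0 ≤ w i) :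
    Bd (S ∪ T) σ w f := by
  refine ⟨fun i hi => hi.elim (hS.1 i) (hT.1 i), fun k => ?_⟩
  obtain ⟨C, hC, H⟩ := hS.2 k
  obtain ⟨C', hC', H'⟩ := hT.2 k
  refine ⟨C + C', by positivity, fun i hi y => ?_⟩
  have h1 := hσ i hi
  have h2 := hw i hi
  have h3 : 0 ≤ C' * w i * σ i ^ k := by positivity
  have h4 : 0 ≤ C * w i * σ i ^ k := by positivity
  rcases hi with hi | hi
  · linarith [H i hi y]
  · linarith [H' i hi y]

theorem Bd.comp_index {ι κ V F : Type*} [NormedAddCommGroup V] [NormedSpace ℝ V]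
    [NormedAddCommGroup F] [NormedSpace ℝ F] {S : Set ι} {σ w : ι → ℝ} {f : ι → V → F}
    (h : Bd S σ w f) (e : κ → ι) {T : Set κ} (hT : ∀ j ∈ T, e j ∈ S) :
    Bd T (fun j => σ (e j)) (fun j => w (e j)) (fun j => f (e j)) :=
  ⟨fun j hj => h.1 _ (hT j hj), fun k => by
    obtain ⟨C, hC, H⟩ := h.2 k
    exact ⟨C, hC, fun j hj => H _ (hT j hj)⟩⟩

section
variable {ι : Type*} {S : Set ι} {a : ι → Sym n}

/-- All derivatives in `(y, η)` are bounded uniformly in `i ∈ S`. -/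
abbrev JointBd (S : Set ι) (a : ι → Sym n) : Prop :=
  Bd S (fun _ => 1) (fun _ => 1) (fun i => unc (a i))

protected theorem Bd.deta {σ w : ι → ℝ} (h : Bd S σ w (fun i => unc (a i))) (j : Fin n) :
    Bd S σ (fun i => w i * σ i) (fun i => unc (deta j (a i))) :=
  (h.fderiv_apply (0, bas j)).congr fun i hi => (SmoothSym.deta_eq (h.1 i hi) j).symm

theorem JointBd.mpow_deta (h : JointBd S a) (α : Fin n → ℕ) :
    JointBd S (fun i => mpow deta α (a i)) :=
  mpow_family_induction (fun b => JointBd S b) (fun j b hb => by simpa using Bd.deta hb j) α h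

end

/-! ### Taylor's formula in `η` -/

/-- `ζ^α`. -/
def monom (ζ : E n) (α : Fin n → ℕ) : ℂ := ∏ i, (ζ i : ℂ) ^ α i

/-- `ζ · ∂_η` on smooth symbols. -/
def lineEnd (ζ : E n) : Module.End ℂ (smoothSyms n) := ∑ i, (ζ i : ℂ) • detaEnd i

theorem lineEnd_apply (ζ : E n) (a : smoothSyms n) (y η : E n) :
    (lineEnd ζ a : Sym n) y η = fderiv ℝ (unc (a : Sym n)) (y, η) (0, ζ) := by
  have h1 : (lineEnd ζ a : Sym n) = ∑ i, (ζ i : ℂ) • deta i (a : Sym n) := by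
    simp [lineEnd, detaEnd]
  have h2 : ((0, ζ) : E n × E n) = ∑ i, ζ i • ((0, bas i) : E n × E n) := by
    refine Prod.ext ?_ ?_
    · simp [Prod.fst_sum]
    · have := (basisFun (Fin n) ℝ).sum_repr ζ
      simpa [Prod.snd_sum] using this.symm
  rw [h1, h2, map_sum, Finset.sum_apply, Finset.sum_apply]
  refine sum_congr rfl fun i _ => ?_
  rw [map_smul]
  exact congrArg (ζ i • ·) (congrFun (SmoothSym.deta_eq a.2 i) (y, η))

theorem lineEnd_pow (ζ : E n) (j : ℕ) (a : smoothSyms n) :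
    ((lineEnd ζ ^ j) a : Sym n) = (j.factorial : ℂ) • ∑ α ∈ piAntidiag Finset.univ j,
      (invFact α * monom ζ α) • mpow deta α (a : Sym n) := by
  have hc : ∀ i k : Fin n, Commute ((ζ i : ℂ) • detaEnd i) ((ζ k : ℂ) • detaEnd k) :=
    fun i k => ((commute_detaEnd i k).smul_left _).smul_right _
  have h := Finset.sum_pow_eq_sum_piAntidiag_of_commute Finset.univ
    (fun i => (ζ i : ℂ) • detaEnd i) (fun i _ k _ _ => hc i k) j
  have h1 : ∀ α : Fin n → ℕ, Finset.univ.noncommProd (fun i => ((ζ i : ℂ) • detaEnd i) ^ α i)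
      (fun i _ k _ _ => (hc i k).pow_pow _ _) = monom ζ α • endPow detaEnd α := by
    intro α
    rw [← endPow_eq_noncommProd hc α]
    unfold endPow monom
    rw [← List.prod_ofFn, List.ofFn_eq_map]
    induction finRange n with
    | nil => simp
    | cons i l ih =>
      simp only [smul_pow, List.map_cons, List.prod_cons] at ih ⊢
      rw [ih, smul_mul_assoc, mul_smul_comm, smul_smul]
  rw [lineEnd, h, LinearMap.sum_apply, Finset.smul_sum, Submodule.coe_sum]
  refine sum_congr rfl fun α hα => ?_
  have h2 := h1 α
  have h3 : (Nat.multinomial Finset.univ α : ℂ) = j.factorial * invFact α := by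
    have h4 := Nat.multinomial_spec Finset.univ α
    rw [(Finset.mem_piAntidiag.1 hα).1] at h4
    rw [invFact, eq_mul_inv_iff_mul_eq₀
      (Finset.prod_ne_zero_iff.2 fun i _ => mod_cast Nat.factorial_ne_zero _), mul_comm]
    exact_mod_cast h4
  rw [h2, mpow_deta_coe, smul_smul, ← mul_assoc, ← h3]
  rw [Module.End.mul_apply, Module.End.natCast_apply, LinearMap.smul_apply,
    ← Nat.cast_smul_eq_nsmul ℂ, mul_smul]
  rfl

/-- The remainder of order `M` in Taylor's formula in `η`. -/
def etaRem (M : ℕ) (a : Sym n) (ζ : E n) : Sym n := fun y η =>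
  a y (η + ζ) - multiSum M fun α => invFact α * monom ζ α * mpow deta α a y η

theorem iteratedDeriv_line (a : smoothSyms n) (y η ζ : E n) (j : ℕ) :
    iteratedDeriv j (fun s : ℝ => (a : Sym n) y (η + s • ζ)) =
      fun s => ((lineEnd ζ ^ j) a : Sym n) y (η + s • ζ) := by
  induction j with
  | zero => simp
  | succ j ih =>
    rw [iteratedDeriv_succ, ih]
    funext s
    set b := (lineEnd ζ ^ j) a with hb
    have h1 : HasDerivAt (fun s : ℝ => (y, η + s • ζ)) ((0, ζ) : E n × E n) s := by
      refine (hasDerivAt_const s y).prodMk ?_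
      simpa using ((hasDerivAt_id s).smul_const ζ).const_add η
    have h2 := ((SmoothSym.differentiable b.2) (y, η + s • ζ)).hasFDerivAt.comp_hasDerivAt s h1
    rw [pow_succ', Module.End.mul_apply, lineEnd_apply]
    exact h2.deriv

theorem norm_etaRem_le {a : Sym n} (ha : SmoothSym a) {M : ℕ} {B : ℝ}
    (hB : ∀ p, ‖iteratedFDeriv ℝ (M + 1) (unc a) p‖ ≤ B) (ζ y η : E n) :
    ‖etaRem M a ζ y η‖ ≤ B * ‖ζ‖ ^ (M + 1) := by
  set g : ℝ → ℂ := fun s => a y (η + s • ζ) with hg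
  set L : ℝ →L[ℝ] E n × E n :=
    (toSpanSingleton ℝ ((0, ζ) : E n × E n)) with hL
  have hgL : g = (fun z => unc a (z + (y, η))) ∘ L := by
    funext s; simp [hg, hL, unc, add_comm]
  have hc : ContDiff ℝ ∞ (fun z => unc a (z + (y, η))) :=
    ContDiff.comp ha (contDiff_id.add contDiff_const)
  have hgs : ContDiff ℝ ∞ g := by rw [hgL]; exact hc.comp L.contDiff
  have h := norm_taylor_sub_le hgs (N := M) (B := B * ‖ζ‖ ^ (M + 1)) (zero_le_one' ℝ) (fun x => ?_)
  · rw [one_pow, mul_one] at h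
    refine le_trans (le_of_eq (congrArg norm ?_)) h
    change a y (η + ζ) - multiSum M _ = _
    congr 1
    · simp [hg]
    · refine sum_congr rfl fun j _ => ?_
      rw [hg, iteratedDeriv_line ⟨a, ha⟩, lineEnd_pow]
      have : (j.factorial : ℂ) ≠ 0 := mod_cast Nat.factorial_ne_zero _
      simp [this]
  · rw [← norm_iteratedFDeriv_eq_norm_iteratedDeriv, hgL,
      L.iteratedFDeriv_comp_right hc x (mod_cast le_top),
      iteratedFDeriv_comp_add_right]
    refine (norm_compContinuousLinearMap_le _ _).trans ?_
    simp
    have : ‖L‖ = ‖ζ‖ := by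
      rw [hL, norm_toSpanSingleton, Prod.norm_mk]; simp
    rw [this]
    gcongr
    exact hB _

theorem norm_monom_le (ζ : E n) (α : Fin n → ℕ) : ‖monom ζ α‖ ≤ ‖ζ‖ ^ len α := by
  rw [monom, norm_prod, len, ← Finset.prod_pow_eq_pow_sum]
  refine Finset.prod_le_prod (fun i _ => norm_nonneg _) fun i _ => ?_
  rw [norm_pow]
  gcongr
  simpa using PiLp.norm_apply_le ζ i

theorem len_of_mem {k : ℕ} {α : Fin n → ℕ} (h : α ∈ piAntidiag Finset.univ k) :
    len α = k := (Finset.mem_piAntidiag.1 h).1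

/-- The Taylor remainder in `η`, with all its derivatives, is `O(|ζ|^{M+1})`. -/
protected theorem JointBd.etaRem {ι : Type*} {S : Set ι} {a : ι → Sym n} (h : JointBd S a) (M : ℕ) :
    Bd (S ×ˢ (Set.univ : Set (E n))) (fun _ => 1) (fun q => ‖q.2‖ ^ (M + 1))
      (fun q => unc (etaRem M (a q.1) q.2)) := by
  have h' : ∀ T : Set (ι × E n), T ⊆ S ×ˢ Set.univ → ∀ α : Fin n → ℕ,
      JointBd T (fun q => mpow deta α (a q.1)) := fun T hT α =>
    (h.mpow_deta α).comp_index Prod.fst fun q hq => (hT hq).1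
  have hterm : ∀ (T : Set (ι × E n)) (w : ι × E n → ℝ), T ⊆ S ×ˢ Set.univ → ∀ α : Fin n → ℕ,
      (∀ q ∈ T, 0 ≤ w q) → (∀ q ∈ T, ‖q.2‖ ^ len α ≤ w q) →
      Bd T (fun _ => 1) w (fun q (p : E n × E n) => invFact α * monom q.2 α * mpow deta α (a q.1) p.1 p.2) := by
    intro T w hT α h0 hw
    have := (h' T hT α).const_mul (by simp) (fun q => invFact α * monom q.2 α) ‖invFact α‖
      (w' := w) h0 (fun q hq => by
        rw [norm_mul]; gcongr; exact (norm_monom_le _ _).trans (hw q hq))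
    simpa [unc] using this
  have htrans : ∀ T : Set (ι × E n), T ⊆ S ×ˢ Set.univ →
      Bd T (fun _ => 1) (fun _ => 1) (fun q (p : E n × E n) => a q.1 p.1 (p.2 + q.2)) := by
    intro T hT
    have h1 : Bd T (fun _ => 1) (fun _ => 1) (fun q => unc (a q.1)) :=
      h.comp_index Prod.fst fun q hq => (hT hq).1
    have := h1.comp_affine (ContinuousLinearMap.id ℝ (E n × E n)) (fun q => (0, q.2))
    simpa [unc] using this
  set T₁ : Set (ι × E n) := {q | q.1 ∈ S ∧ q.2 = 0}
  set T₂ : Set (ι × E n) := {q | q.1 ∈ S ∧ q.2 ≠ 0 ∧ ‖q.2‖ ≤ 1}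
  set T₃ : Set (ι × E n) := {q | q.1 ∈ S ∧ 1 ≤ ‖q.2‖}
  have hT₂ : T₂ ⊆ S ×ˢ Set.univ := fun q hq => ⟨hq.1, trivial⟩
  have hT₃ : T₃ ⊆ S ×ˢ Set.univ := fun q hq => ⟨hq.1, trivial⟩
  have h1 : Bd T₁ (fun _ => 1) (fun q => ‖q.2‖ ^ (M + 1))
      (fun q => unc (etaRem M (a q.1) q.2)) := by
    refine (Bd.zero (by simp) fun q _ => by positivity).congr fun q hq => ?_
    funext p
    have h0 := norm_etaRem_le (h.1 q.1 hq.1) (M := M) (B := ‖(0 : ℝ)‖ + (h.2 (M + 1)).choose)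
      (fun p => by simpa using (h.2 (M + 1)).choose_spec.2 q.1 hq.1 p) q.2 p.1 p.2
    rw [hq.2] at h0 ⊢
    simpa [unc, eq_comm] using h0
  have h2 : Bd T₂ (fun _ => 1) (fun q => ‖q.2‖ ^ (M + 1))
      (fun q => unc (etaRem M (a q.1) q.2)) := by
    have hsmall : ∀ k l : ℕ, k ≤ l → ∀ q ∈ T₂, ‖q.2‖ ^ l ≤ ‖q.2‖ ^ k := fun k l hkl q hq =>
      pow_le_pow_of_le_one (norm_nonneg _) hq.2.2 hkl
    obtain ⟨B, hB, HB⟩ := h.2 (2 * M + 1 + 1)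
    have hbig : Bd T₂ (fun _ => 1) (fun _ => 1)
        (fun q => unc (etaRem (2 * M + 1) (a q.1) q.2)) := by
      refine (htrans T₂ hT₂).sub (Bd.sum _ (by simp) (by simp) fun k _ =>
        Bd.sum _ (by simp) (by simp) fun α _ => hterm T₂ _ hT₂ α (by simp) fun q hq => ?_)
      simpa using hsmall 0 (len α) (Nat.zero_le _) q hq
    have hint := hbig.interpolate (A := fun q => ‖q.2‖ ^ (2 * M + 1 + 1))
      (fun q hq => pow_pos (norm_pos_iff.2 hq.2.1) _)
      (fun q hq => by simpa using hsmall 0 (2 * M + 1 + 1) (Nat.zero_le _) q hq) B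
      (fun q hq p => norm_etaRem_le (h.1 q.1 hq.1)
        (fun p => by simpa using HB q.1 hq.1 p) q.2 p.1 p.2) (1 / 2) (by norm_num)
    have hint' : Bd T₂ (fun _ => 1) (fun q => ‖q.2‖ ^ (M + 1))
        (fun q => unc (etaRem (2 * M + 1) (a q.1) q.2)) := by
      refine hint.mono (by simp) 1 (fun q hq => ?_) fun q _ => by positivity
      rw [← rpow_natCast, ← rpow_mul (norm_nonneg _), one_mul, ← rpow_natCast]
      refine le_of_eq ?_
      congr 1
      push_cast
      ring
    refine (hint'.add (Bd.sum (Finset.Ico (M + 1) (2 * M + 1 + 1)) (by simp)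
      (fun q _ => by positivity) fun k hk => Bd.sum (piAntidiag Finset.univ k) (by simp)
        (fun q _ => by positivity) fun α hα => hterm T₂ _ hT₂ α (fun q _ => by positivity)
          fun q hq => ?_)).congr fun q hq => ?_
    · rw [len_of_mem hα]
      exact hsmall _ _ (Finset.mem_Ico.1 hk).1 q hq
    · funext p
      have := Finset.sum_range_add_sum_Ico (fun k => ∑ α ∈ piAntidiag Finset.univ k,
        invFact α * monom q.2 α * mpow deta α (a q.1) p.1 p.2) (show M + 1 ≤ 2 * M + 1 + 1 by omega)
      simp only [unc, etaRem, multiSum]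
      rw [← this]
      ring
  have h3 : Bd T₃ (fun _ => 1) (fun q => ‖q.2‖ ^ (M + 1))
      (fun q => unc (etaRem M (a q.1) q.2)) := by
    refine ((htrans T₃ hT₃).mono (by simp) 1 (fun q hq => ?_) fun q _ => by positivity).sub
      (Bd.sum _ (by simp) (fun q _ => by positivity) fun k hk =>
        Bd.sum _ (by simp) (fun q _ => by positivity) fun α hα =>
          hterm T₃ _ hT₃ α (fun q _ => by positivity) fun q hq => ?_)
    · simpa using one_le_pow₀ hq.2
    · rw [len_of_mem hα]
      exact pow_le_pow_right₀ hq.2 (by have := mem_range.1 hk; omega)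
  refine ((h1.union h2 (by simp) fun q _ => by positivity).union h3 (by simp)
    fun q _ => by positivity).mono_set fun q hq => ?_
  rcases eq_or_ne q.2 0 with h0 | h0
  · exact Or.inl (Or.inl ⟨hq.1, h0⟩)
  · rcases le_total ‖q.2‖ 1 with h4 | h4
    · exact Or.inl (Or.inr ⟨hq.1, h0, h4⟩)
    · exact Or.inr ⟨hq.1, h4⟩

/-! ### Graded classes of coefficients -/

/-- A graded module over a graded family of classes of symbols depending on `μ`; the grading counts
powers of `|ϱ|`. The scalars in `K` act. -/
structure GradedMod [NeZero n] (K : Set ℂ) (A B : ℤ → (ℝ → Sym n) → Prop) : Prop where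
  real_mem : ∀ c : ℝ, (c : ℂ) ∈ K
  zero : ∀ p, B p 0
  add : ∀ {p a b}, B p a → B p b → B p (a + b)
  mul : ∀ {p q a b}, A p a → B q b → B (p + q) (a * b)
  succ : ∀ {p a}, B (p + 1) a → B p a
  dy : ∀ {p a} (i : Fin n), B p a → B p (fun μ => dy i (a μ))
  smul : ∀ {p a} (c : ℂ), c ∈ K → B p a → B p (fun μ => c • a μ)
  div : ∀ {p a}, B p a → B (p - 1) (fun μ y η => a μ y η / rho n μ y η)

/-- A graded family of classes of symbols. -/
structure Graded [NeZero n] (K : Set ℂ) (A : ℤ → (ℝ → Sym n) → Prop) : Prop where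
  mod : GradedMod K A A
  one : A 0 1
  rho : A 1 (fun μ => rho n μ)

/-- A formal series `∑ t^k s_k` with `s_k` of degree `p - 2k`. -/
def Ser (A : ℤ → (ℝ → Sym n) → Prop) (p : ℤ) (s : ℝ → FS n) : Prop :=
  ∀ k : ℕ, A (p - 2 * k) (fun μ => coeff k (s μ))

/-- A formal series `∑ h^j t^k s_{k,j}` with `s_{k,j}` of degree `p - 3j - 2k`. -/
def Ser₂ (B : ℤ → (ℝ → Sym n) → Prop) (p : ℤ) (s : ℝ → FS₂ n) :
    Prop :=
  ∀ j : ℕ, Ser B (p - 3 * j) (fun μ => coeff j (s μ))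

section ser
variable [NeZero n] {K : Set ℂ} {A B : ℤ → (ℝ → Sym n) → Prop} {p q : ℤ}

theorem mono_of_succ {T : Type*} {A : ℤ → T → Prop} (h : ∀ {p a}, A (p + 1) a → A p a) {p q : ℤ}
    (hpq : q ≤ p) {a : T} (ha : A p a) : A q a := by
  obtain ⟨k, rfl⟩ := Int.le.dest hpq
  clear hpq
  induction k with
  | zero => simpa using ha
  | succ k ih => exact ih (h (by push_cast at ha; rwa [← add_assoc] at ha))

theorem sum_of_add {T κ : Type*} [AddCommMonoid T] {P : T → Prop} (h0 : P 0)
    (h : ∀ a b, P a → P b → P (a + b)) (s : Finset κ) (f : κ → T) (hf : ∀ i ∈ s, P (f i)) :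
    P (∑ i ∈ s, f i) :=
  Finset.sum_induction _ P h h0 hf

/-- The operations of a module class that series inherit. -/
theorem GradedMod.fam_sum (hB : GradedMod K A B) {κ : Type*} (s : Finset κ) (f : κ → ℝ → Sym n)
    (hf : ∀ i ∈ s, B p (f i)) : B p (fun μ => ∑ i ∈ s, f i μ) := by
  have := sum_of_add (hB.zero p) (fun _ _ => hB.add) s f hf
  convert this using 1
  funext μ; simp

theorem Ser.zero (hB : GradedMod K A B) : Ser B p (fun _ => 0) := fun k => by
  simp; exact hB.zero _

theorem Ser.add (hB : GradedMod K A B) {s t : ℝ → FS n} (hs : Ser B p s)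
    (ht : Ser B p t) : Ser B p (fun μ => s μ + t μ) := fun k => by
  simp; exact hB.add (hs k) (ht k)

theorem Ser.smul (hB : GradedMod K A B) {s : ℝ → FS n} {c : ℂ} (hc : c ∈ K)
    (hs : Ser B p s) : Ser B p (fun μ => c • s μ) := fun k => by
  simpa using hB.smul c hc (hs k)

theorem Ser.mono (hB : GradedMod K A B) {s : ℝ → FS n} (hs : Ser B p s)
    (hpq : q ≤ p) : Ser B q s := fun k => mono_of_succ hB.succ (by omega) (hs k)

theorem Ser.mul (hB : GradedMod K A B) {s t : ℝ → FS n} (hs : Ser A p s)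
    (ht : Ser B q t) : Ser B (p + q) (fun μ => s μ * t μ) := fun k => by
  simp only [coeff_mul]
  refine hB.fam_sum _ (fun (x : ℕ × ℕ) μ => coeff x.1 (s μ) * coeff x.2 (t μ))
    fun x hx => ?_
  have := hB.mul (hs x.1) (ht x.2)
  have hk := mem_antidiagonal.1 hx
  rw [show p + q - 2 * (k : ℤ) = p - 2 * (x.1 : ℤ) + (q - 2 * (x.2 : ℤ)) by
    rw [← hk]; push_cast; ring]
  exact this

theorem Ser.mapCoeff_dy (hB : GradedMod K A B) {s : ℝ → FS n} (hs : Ser B p s)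
    (i : Fin n) : Ser B p (fun μ => mapCoeff (dy i) (s μ)) := fun k => by
  simpa [mapCoeff] using hB.dy i (hs k)

protected theorem Ser.dt (hB : GradedMod K A B) {s : ℝ → FS n} (hs : Ser B p s) :
    Ser B (p - 2) (fun μ => dt (s μ)) := fun k => by
  have := hB.smul ((k : ℂ) + 1) (by exact_mod_cast hB.real_mem (k + 1)) (hs (k + 1))
  rw [show p - 2 * ((k + 1 : ℕ) : ℤ) = p - 2 - 2 * (k : ℤ) by push_cast; ring] at this
  simpa [dt] using this

theorem Ser.X_pow_mul_C (hB : GradedMod K A B) {c : ℝ → Sym n} (m : ℕ) (hc : B (p - 2 * m) c) :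
    Ser B p (fun μ => X ^ m * C (c μ)) := fun k => by
  simp only [coeff_X_pow_mul', coeff_C]
  by_cases h : k = m
  · subst h; simpa using hc
  · have : ∀ μ, (if m ≤ k then if k - m = 0 then c μ else 0 else 0) = (0 : Sym n) := by
      intro μ
      split_ifs with h1 h2
      · omega
      · rfl
      · rfl
    simp only [this]
    exact hB.zero _

theorem Ser.C (hB : GradedMod K A B) {c : ℝ → Sym n} (hc : B p c) :
    Ser B p (fun μ => C (c μ)) := by
  simpa using Ser.X_pow_mul_C hB 0 (by simpa using hc)

theorem Ser.sum (hB : GradedMod K A B) {κ : Type*} (S : Finset κ)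
    (f : κ → ℝ → FS n) (hf : ∀ i ∈ S, Ser B p (f i)) :
    Ser B p (fun μ => ∑ i ∈ S, f i μ) := by
  have := sum_of_add (Ser.zero hB) (fun _ _ => Ser.add hB) S f hf
  convert this using 1
  funext μ; simp

theorem Ser₂.zero (hB : GradedMod K A B) : Ser₂ B p (fun _ => 0) := fun j => by
  simpa using Ser.zero hB

theorem Ser₂.add (hB : GradedMod K A B) {s t : ℝ → FS₂ n}
    (hs : Ser₂ B p s) (ht : Ser₂ B p t) : Ser₂ B p (fun μ => s μ + t μ) := fun j => by
  simpa using Ser.add hB (hs j) (ht j)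

theorem Ser₂.smul (hB : GradedMod K A B) {s : ℝ → FS₂ n} {c : ℂ} (hc : c ∈ K)
    (hs : Ser₂ B p s) : Ser₂ B p (fun μ => c • s μ) := fun j => by
  simpa using Ser.smul hB hc (hs j)

theorem Ser₂.sub (hB : GradedMod K A B) {s t : ℝ → FS₂ n}
    (hs : Ser₂ B p s) (ht : Ser₂ B p t) : Ser₂ B p (fun μ => s μ - t μ) := by
  have h1 : ∀ μ, s μ - t μ = s μ + (-1 : ℂ) • t μ := fun μ => by
    rw [neg_one_smul ℂ, sub_eq_add_neg]
  simp only [h1]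
  exact Ser₂.add hB hs (Ser₂.smul hB (mod_cast hB.real_mem (-1)) ht)

theorem Ser₂.mono (hB : GradedMod K A B) {s : ℝ → FS₂ n}
    (hs : Ser₂ B p s) (hpq : q ≤ p) : Ser₂ B q s := fun j => Ser.mono hB (hs j) (by omega)

theorem Ser₂.mul (hB : GradedMod K A B) {s t : ℝ → FS₂ n}
    (hs : Ser₂ A p s) (ht : Ser₂ B q t) : Ser₂ B (p + q) (fun μ => s μ * t μ) := fun j => by
  simp only [coeff_mul]
  refine Ser.sum hB _ (fun (x : ℕ × ℕ) μ => coeff x.1 (s μ) * coeff x.2 (t μ))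
    fun x hx => ?_
  have := Ser.mul hB (hs x.1) (ht x.2)
  have hk := mem_antidiagonal.1 hx
  rw [show p + q - 3 * (j : ℤ) = p - 3 * (x.1 : ℤ) + (q - 3 * (x.2 : ℤ)) by
    rw [← hk]; push_cast; ring]
  exact this

theorem Ser₂.mapCoeff_dy (hB : GradedMod K A B) {s : ℝ → FS₂ n}
    (hs : Ser₂ B p s) (i : Fin n) : Ser₂ B p (fun μ => mapCoeff (mapCoeff (dy i)) (s μ)) :=
  fun j => by
    have := Ser.mapCoeff_dy hB (hs j) i
    simpa [mapCoeff] using this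

protected theorem Ser₂.dt (hB : GradedMod K A B) {s : ℝ → FS₂ n}
    (hs : Ser₂ B p s) : Ser₂ B (p - 2) (fun μ => mapCoeff dt (s μ)) := fun j => by
  have := Ser.dt hB (hs j)
  rw [show p - 3 * (j : ℤ) - 2 = p - 2 - 3 * (j : ℤ) by ring] at this
  simpa [mapCoeff] using this

theorem Ser₂.X_pow_mul_C (hB : GradedMod K A B) {c : ℝ → FS n} (m : ℕ)
    (hc : Ser B (p - 3 * m) c) :
    Ser₂ B p (fun μ => X ^ m * C (c μ)) := fun k => by
  simp only [coeff_X_pow_mul', coeff_C]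
  by_cases h : k = m
  · subst h; simpa using hc
  · have : ∀ μ, (if m ≤ k then if k - m = 0 then c μ else 0 else 0) =
        (0 : FS n) := by
      intro μ
      split_ifs with h1 h2
      · omega
      · rfl
      · rfl
    simp only [this]
    exact Ser.zero hB

theorem Ser₂.C (hB : GradedMod K A B) {c : ℝ → FS n} (hc : Ser B p c) :
    Ser₂ B p (fun μ => C (c μ)) := by
  simpa using Ser₂.X_pow_mul_C hB 0 (by simpa using hc)

theorem Ser₂.X_mul (hB : GradedMod K A B) {s : ℝ → FS₂ n}
    (hs : Ser₂ B p s) : Ser₂ B (p + 3) (fun μ => X * s μ) := fun j => by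
  rcases j with _ | j
  · simpa using Ser.zero hB
  · simp
    have := hs j
    rwa [show p - 3 * (j : ℤ) = p + 3 - 3 * ((j + 1 : ℕ) : ℤ) by push_cast; ring] at this

theorem Ser₂.sum (hB : GradedMod K A B) {κ : Type*} (S : Finset κ)
    (f : κ → ℝ → FS₂ n) (hf : ∀ i ∈ S, Ser₂ B p (f i)) :
    Ser₂ B p (fun μ => ∑ i ∈ S, f i μ) := by
  have := sum_of_add (Ser₂.zero hB) (fun _ _ => Ser₂.add hB) S f hf
  convert this using 1
  funext μ; simp

theorem Ser.one (hA : Graded K A) : Ser A 0 (fun _ => 1) := by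
  have := Ser.C hA.mod hA.one
  simpa using this

theorem Ser.pow (hA : Graded K A) {s : ℝ → FS n} (hs : Ser A 0 s) (m : ℕ) :
    Ser A 0 (fun μ => s μ ^ m) := by
  induction m with
  | zero => simpa using Ser.one hA
  | succ m ih => simpa [pow_succ] using Ser.mul hA.mod ih hs

theorem Ser.prod (hA : Graded K A) {κ : Type*} (S : Finset κ) {f : κ → ℝ → FS n}
    (hf : ∀ i ∈ S, Ser A 0 (f i)) : Ser A 0 (fun μ => ∏ i ∈ S, f i μ) := by
  classical
  induction S using induction_on with
  | empty => simpa using Ser.one hA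
  | insert i S hi ih =>
    simp only [Finset.prod_insert hi]
    simpa using Ser.mul hA.mod (hf i (by simp)) (ih fun j hj => hf j (by simp [hj]))

theorem invFact_mem (hB : GradedMod K A B) (α : Fin n → ℕ) : invFact α ∈ K := by
  have := hB.real_mem (∏ i, ((α i).factorial : ℝ))⁻¹
  simpa [invFact] using this

theorem Ser₂.multiSum (hB : GradedMod K A B) (M : ℕ)
    (f : (Fin n → ℕ) → ℝ → FS₂ n) (hf : ∀ α, Ser₂ B p (f α)) :
    Ser₂ B p (fun μ => multiSum M fun α => f α μ) :=
  Ser₂.sum hB _ _ fun _ _ => Ser₂.sum hB _ _ fun α _ => hf α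

theorem Ser.multiSum (hB : GradedMod K A B) (M : ℕ)
    (f : (Fin n → ℕ) → ℝ → FS n) (hf : ∀ α, Ser B p (f α)) :
    Ser B p (fun μ => multiSum M fun α => f α μ) :=
  Ser.sum hB _ _ fun _ _ => Ser.sum hB _ _ fun α _ => hf α

/-! ### The coefficients of the phase -/

variable {M : ℕ} {mj : ℕ → ℝ → ℝ → Sym n}

theorem Ser.sub (hB : GradedMod K A B) {s t : ℝ → FS n}
    (hs : Ser B p s) (ht : Ser B p t) : Ser B p (fun μ => s μ - t μ) := by
  have h1 : ∀ μ, s μ - t μ = s μ + (-1 : ℂ) • t μ := fun μ => by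
    rw [neg_one_smul ℂ, sub_eq_add_neg]
  simp only [h1]
  exact Ser.add hB hs (Ser.smul hB (mod_cast hB.real_mem (-1)) ht)

theorem Ser.eikonal_symbol (hA : Graded K A) {φ : ℝ → FS n} (hφ : Ser A 3 φ) :
    Ser A 2 (fun μ => dt (φ μ) ^ 2 + mapCoeff (dy 0) (φ μ) -
      PowerSeries.C (rho n μ ^ 2)) := by
  have h1 := Ser.dt hA.mod hφ
  have h2 := Ser.mul hA.mod h1 h1
  have h3 := Ser.mono hA.mod (Ser.mapCoeff_dy hA.mod hφ 0) (show (2 : ℤ) ≤ 3 by norm_num)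
  have h4 := Ser.C hA.mod (hA.mod.mul hA.rho hA.rho)
  simp only [sq]
  exact Ser.sub hA.mod (Ser.add hA.mod h2 h3) h4

protected theorem Ser.eikonal (hA : Graded K A)
    (hm : ∀ α, Ser A 2 (fun μ => mapCoeff (mpow deta α) (mSeries mj μ 0)))
    {φ : ℝ → FS n} (hφ : Ser A 3 φ) :
    Ser A 2 (fun μ => eikonal M mj μ (φ μ)) := by
  refine Ser.add hA.mod (Ser.eikonal_symbol hA hφ) (Ser.multiSum hA.mod M _ fun α =>
    Ser.smul hA.mod (invFact_mem hA.mod α) ?_)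
  have h5 := Ser.prod hA Finset.univ fun i _ =>
    Ser.pow hA (Ser.mono hA.mod (Ser.mapCoeff_dy hA.mod hφ i) (show (0 : ℤ) ≤ 3 by norm_num)) (α i)
  simpa using Ser.mul hA.mod (hm α) h5

protected theorem Ser.phaseAux (hA : Graded K A)
    (hm : ∀ α, Ser A 2 (fun μ => mapCoeff (mpow deta α) (mSeries mj μ 0))) (k : ℕ) :
    Ser A 3 (fun μ => phaseAux M mj μ k) := by
  induction k with
  | zero =>
    have := Ser.X_pow_mul_C (p := 3) hA.mod 1 (by simpa using hA.rho)
    simpa [phaseAux] using this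
  | succ k ih =>
    refine Ser.add hA.mod ih (Ser.X_pow_mul_C hA.mod (k + 2) ?_)
    have h1 := hA.mod.smul (((-(1 / (2 * ((k : ℝ) + 2))) : ℝ) : ℂ)) (hA.mod.real_mem _)
      (hA.mod.div (Ser.eikonal (M := M) hA hm ih (k + 1)))
    rw [show (2 : ℤ) - 2 * ((k + 1 : ℕ) : ℤ) - 1 = 3 - 2 * ((k + 2 : ℕ) : ℤ) by
      push_cast; ring] at h1
    convert h1 using 1
    funext μ y η
    simp
    rcases eq_or_ne (rho n μ y η) 0 with h0 | h0
    · simp [h0]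
    · field_simp

/-! ### The coefficients of the amplitude -/

protected theorem Ser₂.conjD (hA : Graded K A) (hB : GradedMod Set.univ A B) {φ : ℝ → FS n}
    (hφ : Ser A 3 φ) {a : ℝ → FS₂ n} (ha : Ser₂ B p a) (i : Fin n) :
    Ser₂ B p (fun μ => conjD (φ μ) i (a μ)) := by
  refine Ser₂.sub hB ?_ (Ser₂.smul hB trivial ?_)
  · refine Ser₂.mono hB (Ser₂.mul hB (Ser₂.C hA.mod (Ser.mapCoeff_dy hA.mod hφ i)) ha)
      (by omega)
  · exact Ser₂.mono hB (Ser₂.X_mul hB (Ser₂.mapCoeff_dy hB ha i)) (by omega)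

protected theorem Ser₂.transport (hA : Graded K A) (hB : GradedMod Set.univ A B)
    (hm : ∀ α, Ser₂ A 2 (fun μ => ∂ηm(mj, α, μ)))
    (hφ : Ser A 3 (fun μ => phase M mj μ))
    {a : ℝ → FS₂ n} (ha : Ser₂ B 0 a) :
    Ser₂ B 2 (fun μ => transport M mj μ (a μ)) := by
  have hdt := Ser.dt hA.mod hφ
  have hdt2 :=
    Ser.dt hA.mod hdt
  refine Ser₂.add hB (Ser₂.sub hB (Ser₂.sub hB (Ser₂.sub hB (Ser₂.sub hB ?_ ?_) ?_) ?_) ?_) ?_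
  · simpa using Ser₂.mul hB (Ser₂.C hA.mod (Ser.eikonal_symbol hA hφ)) ha
  · exact Ser₂.smul hB trivial (Ser₂.X_mul hB (Ser₂.mul hB (Ser₂.C hA.mod hdt2) ha))
  · exact Ser₂.smul hB trivial (Ser₂.X_mul hB (Ser₂.mul hB (Ser₂.C hA.mod hdt) (Ser₂.dt hB ha)))
  · exact Ser₂.smul hB trivial (Ser₂.mono hB (Ser₂.X_mul hB (Ser₂.mapCoeff_dy hB ha 0))
      (by norm_num))
  · have h := Ser₂.X_mul hB (Ser₂.X_mul hB (Ser₂.dt hB (Ser₂.dt hB ha)))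
    simp only [← mul_assoc, ← sq] at h
    simpa [mapCoeff] using h
  · refine Ser₂.multiSum hB M _ fun α => Ser₂.smul hB trivial ?_
    have : Ser₂ B 0 (fun μ => mpow (conjD (phase M mj μ)) α (a μ)) := by
      unfold mpow
      induction finRange n with
      | nil => simpa using ha
      | cons j l ih =>
        simp
        induction α j with
        | zero => exact ih
        | succ k ihk =>
          simp only [iterate_succ_apply']
          exact Ser₂.conjD hA hB hφ ihk j
    simpa using Ser₂.mul hB (hm α) this

protected theorem Ser₂.ampRow (hA : Graded K A) (hB : GradedMod Set.univ A B) {χ : ℝ → ℂ}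
    (hχ : B 0 (fun _ _ η => χ (η 0)))
    (hm : ∀ α, Ser₂ A 2 (fun μ => ∂ηm(mj, α, μ)))
    (hφ : Ser A 3 (fun μ => phase M mj μ))
    {a : ℝ → FS₂ n} (ha : Ser₂ B 0 a) (j l : ℕ) :
    Ser₂ B 0 (fun μ => ampRow χ M mj μ (a μ) j l) := by
  induction l with
  | zero =>
    refine Ser₂.add hB ha (Ser₂.X_pow_mul_C hB j (Ser.C hB ?_))
    by_cases hj : j = 0
    · subst hj; simpa using hχ
    · simp only [hj]; exact hB.zero _
  | succ l ih =>
    refine Ser₂.add hB ih (Ser₂.X_pow_mul_C hB j (Ser.X_pow_mul_C hB (l + 1) ?_))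
    have h1 := hB.smul (1 / (2 * I * ((l : ℂ) + 1))) trivial
      (hB.div (Ser₂.transport hA hB hm hφ ih (j + 1) l))
    rw [show (2 : ℤ) - 3 * ((j + 1 : ℕ) : ℤ) - 2 * (l : ℤ) - 1 =
      0 - 3 * (j : ℤ) - 2 * ((l + 1 : ℕ) : ℤ) by push_cast; ring] at h1
    convert h1 using 1
    funext μ y η
    simp only [Pi.smul_apply, smul_eq_mul]
    rcases eq_or_ne (rho n μ y η) 0 with h0 | h0
    · simp [h0]
    · field_simp

protected theorem Ser₂.ampAux (hA : Graded K A) (hB : GradedMod Set.univ A B) {χ : ℝ → ℂ}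
    (hχ : B 0 (fun _ _ η => χ (η 0)))
    (hm : ∀ α, Ser₂ A 2 (fun μ => ∂ηm(mj, α, μ)))
    (hφ : Ser A 3 (fun μ => phase M mj μ)) (j : ℕ) :
    Ser₂ B 0 (fun μ => ampAux χ M mj μ j) := by
  induction j with
  | zero => exact Ser₂.zero hB
  | succ j ih => exact Ser₂.ampRow hA hB hχ hm hφ ih j M

end ser

/-! ### The coefficients of the eikonal equation vanish -/

/-- Two series agree below the power `t^N`. -/
def Agree {R : Type*} [Semiring R] (N : ℕ) (s t : PowerSeries R) : Prop :=
  ∀ k < N, coeff k s = coeff k t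

section Agree
variable {R : Type*} [CommRing R] [Module ℂ R] {N : ℕ} {s t s' t' : PowerSeries R}

theorem Agree.refl (s : PowerSeries R) : Agree N s s := fun _ _ => rfl

theorem Agree.add (h : Agree N s t) (h' : Agree N s' t') : Agree N (s + s') (t + t') :=
  fun k hk => by simp [h k hk, h' k hk]

theorem Agree.sub (h : Agree N s t) (h' : Agree N s' t') : Agree N (s - s') (t - t') :=
  fun k hk => by simp [h k hk, h' k hk]

theorem Agree.smul (c : ℂ) (h : Agree N s t) : Agree N (c • s) (c • t) :=
  fun k hk => by simp [h k hk]

theorem Agree.mul (h : Agree N s t) (h' : Agree N s' t') : Agree N (s * s') (t * t') :=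
  fun k hk => by
    rw [coeff_mul, coeff_mul]
    refine sum_congr rfl fun x hx => ?_
    have := mem_antidiagonal.1 hx
    rw [h _ (by omega), h' _ (by omega)]

theorem Agree.pow (h : Agree N s t) (m : ℕ) : Agree N (s ^ m) (t ^ m) := by
  induction m with
  | zero => simpa using Agree.refl 1
  | succ m ih => simpa [pow_succ] using ih.mul h

theorem Agree.prod {κ : Type*} (S : Finset κ) {f g : κ → PowerSeries R}
    (h : ∀ i ∈ S, Agree N (f i) (g i)) : Agree N (∏ i ∈ S, f i) (∏ i ∈ S, g i) := by
  classical
  induction S using induction_on with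
  | empty => simpa using Agree.refl 1
  | insert i S hi ih =>
    simp only [Finset.prod_insert hi]
    exact (h i (by simp)).mul (ih fun j hj => h j (by simp [hj]))

theorem Agree.sum {κ : Type*} (S : Finset κ) {f g : κ → PowerSeries R}
    (h : ∀ i ∈ S, Agree N (f i) (g i)) : Agree N (∑ i ∈ S, f i) (∑ i ∈ S, g i) := fun k hk => by
  simp
  exact sum_congr rfl fun i hi => h i hi k hk

protected theorem Agree.mapCoeff (F : R → R) (h : Agree N s t) : Agree N (mapCoeff F s) (mapCoeff F t) :=
  fun k hk => by simp [mapCoeff, h k hk]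

end Agree

theorem dy_zero (i : Fin n) : dy i (0 : Sym n) = 0 := by
  funext y η
  change fderiv ℝ (fun _ => (0 : ℂ)) y _ = 0
  simp

theorem deta_zero (i : Fin n) : deta i (0 : Sym n) = 0 := by
  funext y η
  change fderiv ℝ (fun _ => (0 : ℂ)) η _ = 0
  simp

theorem mpow_deta_zero (α : Fin n → ℕ) : mpow deta α (0 : Sym n) = 0 :=
  mpow_induction (fun b => b = 0) (fun j b hb => by rw [hb, deta_zero]) α rfl

theorem rho_ne_zero [NeZero n] {μ : ℝ} (hμ : μ ≠ 0) (y η : E n) : rho n μ y η ≠ 0 := fun h => by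
  have := rho_im_pos n μ hμ y η
  rw [h] at this
  simp at this

section phase
variable [NeZero n] {M : ℕ} {mj : ℕ → ℝ → ℝ → Sym n} {μ : ℝ}

theorem coeff_zero_phaseAux (K : ℕ) : coeff 0 (phaseAux M mj μ K) = 0 := by
  induction K with
  | zero => simp [phaseAux]
  | succ K ih => rw [phaseAux, map_add, ih, coeff_X_pow_mul', if_neg (by omega), add_zero]

theorem coeff_one_phaseAux (K : ℕ) : coeff 1 (phaseAux M mj μ K) = rho n μ := by
  induction K with
  | zero => simp [phaseAux]
  | succ K ih => simp [phaseAux, ih]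

theorem coeff_phaseAux_of_gt (K k : ℕ) (hk : K + 1 < k) :
    coeff k (phaseAux M mj μ K) = 0 := by
  induction K with
  | zero =>
    obtain ⟨k, rfl⟩ : ∃ m, k = m + 1 := ⟨k - 1, by omega⟩
    rw [phaseAux, PowerSeries.coeff_succ_X_mul, coeff_C, if_neg (by omega)]
  | succ K ih =>
    rw [phaseAux, map_add, ih (by omega), coeff_X_pow_mul', coeff_C,
      if_pos (by omega), if_neg (by omega), add_zero]

theorem coeff_eikonal_phaseAux (hμ : μ ≠ 0) (h0 : taylorCoeff mj μ 0 0 = 0) (K k : ℕ)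
    (hk : k ≤ K) : coeff k (eikonal M mj μ (phaseAux M mj μ K)) = 0 := by
  induction K generalizing k with
  | zero =>
    obtain rfl : k = 0 := by omega
    have h1 : ∀ α : Fin n → ℕ, constantCoeff
        (mapCoeff (mpow deta α) (mSeries mj μ 0)) = 0 := by
      intro α
      simp [mapCoeff, mSeries, h0, mpow_deta_zero]
    have h2 : constantCoeff (dt (phaseAux M mj μ 0)) = rho n μ := by
      simp [dt, coeff_one_phaseAux]
    have h3 : constantCoeff (mapCoeff (dy 0) (phaseAux M mj μ 0)) = 0 := by
      rw [← coeff_zero_eq_constantCoeff_apply]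
      simp only [mapCoeff, coeff_mk, coeff_zero_phaseAux, dy_zero]
    rw [eikonal, multiSum]
    simp only [PowerSeries.coeff_zero_eq_constantCoeff, map_add, map_sub, map_pow, map_sum, h2, h3,
      PowerSeries.constantCoeff_C, add_zero, sub_self, zero_add]
    refine sum_eq_zero fun j _ => sum_eq_zero fun α _ => ?_
    rw [← coeff_zero_eq_constantCoeff_apply, coeff_smul,
      coeff_zero_eq_constantCoeff_apply, map_mul, h1]
    simp
  | succ K ih =>
    set φ := phaseAux M mj μ K with hφ
    set c : Sym n := fun y η => -coeff (K + 1) (eikonal M mj μ φ) y η /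
        (2 * ((K : ℂ) + 2) * rho n μ y η) with hc
    have e : phaseAux M mj μ (K + 1) = φ + X ^ (K + 2) * C c := rfl
    set φ' := phaseAux M mj μ (K + 1) with hφ'
    set d : Sym n := ((K : ℂ) + 2) • c with hd
    have hagree : Agree (K + 2) φ' φ := fun m hm => by
      rw [e, map_add, coeff_X_pow_mul', if_neg (by omega), add_zero]
    have hdt : dt φ' = dt φ + X ^ (K + 1) * C d := by
      ext m : 1
      rw [e]
      simp only [dt, coeff_mk, map_add, coeff_X_pow_mul',
        coeff_C]
      by_cases h : m = K + 1
      · subst h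
        simp [hd]
        ring
      · split_ifs <;> first | omega | simp
    have h1 : Agree (K + 2) (eikonal M mj μ φ')
        (eikonal M mj μ φ + 2 * dt φ * (X ^ (K + 1) * C d)) := by
      have h2 : Agree (K + 2) (dt φ' ^ 2)
          (dt φ ^ 2 + 2 * dt φ * (X ^ (K + 1) * C d)) := fun m hm => by
        rw [hdt, add_sq, map_add, mul_pow, ← pow_mul,
          coeff_X_pow_mul' _ ((K + 1) * 2), if_neg (by omega), add_zero]
      have h3 : eikonal M mj μ φ + 2 * dt φ * (X ^ (K + 1) * C d) =
          (dt φ ^ 2 + 2 * dt φ * (X ^ (K + 1) * C d)) + mapCoeff (dy 0) φ -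
          C (rho n μ ^ 2) + multiSum M fun α => invFact α •
      (mapCoeff (mpow deta α) (mSeries mj μ 0) * ∏ i, mapCoeff (dy i) φ ^ α i) := by
        rw [eikonal]; ring
      rw [h3, eikonal]
      refine Agree.add ((h2.add (hagree.mapCoeff _)).sub (Agree.refl _)) (Agree.sum _ fun j _ =>
        Agree.sum _ fun α _ => ((Agree.refl _).mul (Agree.prod _ fun i _ =>
          (hagree.mapCoeff _).pow _)).smul _)
    rw [h1 k (by omega), map_add,
      show 2 * dt φ * (X ^ (K + 1) * C d) =
        X ^ (K + 1) * (2 * dt φ * C d) by ring,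
      coeff_X_pow_mul']
    split_ifs with hkK
    · obtain rfl : k = K + 1 := by omega
      have h4 : constantCoeff (dt φ) = rho n μ := by
        simp [dt, hφ, coeff_one_phaseAux]
      rw [Nat.sub_self, coeff_zero_eq_constantCoeff_apply, map_mul, map_mul, h4,
        map_ofNat, PowerSeries.constantCoeff_C]
      funext y η
      have hρ := rho_ne_zero hμ y η
      have hK : ((K : ℂ) + 2) ≠ 0 := by exact_mod_cast (by simp)
      have h2 : (2 : Sym n) y η = 2 := rfl
      simp only [Pi.add_apply, Pi.mul_apply, hd, hc, Pi.smul_apply, smul_eq_mul, Pi.zero_apply, h2]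
      field_simp
      ring
    · rw [ih k (by omega), add_zero]

theorem coeff_eikonal_phase (hμ : μ ≠ 0) (h0 : taylorCoeff mj μ 0 0 = 0) (hM : 1 ≤ M) (k : ℕ)
    (hk : k < M) : coeff k (eikonal M mj μ (phase M mj μ)) = 0 :=
  coeff_eikonal_phaseAux hμ h0 _ _ (by omega)

/-! ### The coefficients of the transport equations vanish -/

/-- All coefficients are smooth symbols. -/
def SmoothSer (s : FS n) : Prop := ∀ k, SmoothSym (coeff k s)

/-- All coefficients are smooth symbols. -/
def SmoothSer₂ (s : FS₂ n) : Prop :=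
  ∀ j, SmoothSer (coeff j s)

theorem SmoothSym.sum {κ : Type*} (S : Finset κ) {f : κ → Sym n}
    (hf : ∀ i ∈ S, SmoothSym (f i)) : SmoothSym (∑ i ∈ S, f i) :=
  (smoothSyms n).sum_mem hf

theorem SmoothSer.add {s t : FS n} (hs : SmoothSer s) (ht : SmoothSer t) :
    SmoothSer (s + t) := fun k => by rw [map_add]; exact (hs k).add (ht k)

theorem SmoothSer.mul {s t : FS n} (hs : SmoothSer s) (ht : SmoothSer t) :
    SmoothSer (s * t) := fun k => by
  rw [coeff_mul]
  exact SmoothSym.sum _ fun x _ => (hs _).mul (ht _)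

theorem SmoothSer.zero : SmoothSer (0 : FS n) := fun k => by
  rw [map_zero]; exact SmoothSym.zero

theorem SmoothSer.sum {κ : Type*} (S : Finset κ) {f : κ → FS n}
    (hf : ∀ i ∈ S, SmoothSer (f i)) : SmoothSer (∑ i ∈ S, f i) :=
  Finset.sum_induction _ SmoothSer (fun _ _ => SmoothSer.add) SmoothSer.zero hf

theorem SmoothSer.mapCoeff_dy {s : FS n} (hs : SmoothSer s) (i : Fin n) :
    SmoothSer (mapCoeff (dy i) s) := fun k => by
  simp only [mapCoeff, coeff_mk]; exact (hs k).dy i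

theorem SmoothSer₂.add {s t : FS₂ n} (hs : SmoothSer₂ s)
    (ht : SmoothSer₂ t) : SmoothSer₂ (s + t) := fun k => by rw [map_add]; exact (hs k).add (ht k)

theorem SmoothSer₂.smul {s : FS₂ n} (c : ℂ) (hs : SmoothSer₂ s) :
    SmoothSer₂ (c • s) := fun j k => by
  rw [coeff_smul, coeff_smul]; exact (hs j k).smul c

theorem SmoothSer₂.mul {s t : FS₂ n} (hs : SmoothSer₂ s)
    (ht : SmoothSer₂ t) : SmoothSer₂ (s * t) := fun k => by
  rw [coeff_mul]
  exact SmoothSer.sum _ fun x _ => (hs _).mul (ht _)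

theorem SmoothSer₂.C {s : FS n} (hs : SmoothSer s) :
    SmoothSer₂ (C s) := fun k => by
  rw [coeff_C]
  split_ifs
  · exact hs
  · exact SmoothSer.zero

theorem SmoothSer₂.X_mul {s : FS₂ n} (hs : SmoothSer₂ s) :
    SmoothSer₂ (X * s) := fun k => by
  rcases k with _ | k
  · simpa using SmoothSer.zero
  · simpa using hs k

theorem SmoothSer₂.mapCoeff_dy {s : FS₂ n} (hs : SmoothSer₂ s)
    (i : Fin n) : SmoothSer₂ (mapCoeff (mapCoeff (dy i)) s) := fun k => by
  simp only [mapCoeff, coeff_mk]; exact SmoothSer.mapCoeff_dy (hs k) i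

protected theorem SmoothSer₂.conjD {φ : FS n} (hφ : SmoothSer φ)
    {s : FS₂ n} (hs : SmoothSer₂ s) (i : Fin n) :
    SmoothSer₂ (conjD φ i s) := by
  rw [conjD, sub_eq_add_neg, ← neg_smul]
  exact ((SmoothSer₂.C (hφ.mapCoeff_dy i)).mul hs).add ((hs.mapCoeff_dy i).X_mul.smul _)

theorem mapCoeff_dy_add {s t : FS₂ n} (hs : SmoothSer₂ s)
    (ht : SmoothSer₂ t) (i : Fin n) : mapCoeff (mapCoeff (dy i)) (s + t) =
      mapCoeff (mapCoeff (dy i)) s + mapCoeff (mapCoeff (dy i)) t := by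
  ext j : 1
  ext k : 1
  simp only [mapCoeff, coeff_mk, map_add, dy_add (hs j k) (ht j k)]

theorem conjD_add {φ : FS n} {s t : FS₂ n}
    (hs : SmoothSer₂ s) (ht : SmoothSer₂ t) (i : Fin n) :
    conjD φ i (s + t) = conjD φ i s + conjD φ i t := by
  rw [conjD, mapCoeff_dy_add hs ht, conjD, conjD, mul_add, mul_add, smul_add]
  ring

theorem mpow_conjD_add {φ : FS n} (hφ : SmoothSer φ)
    {s t : FS₂ n}
    (hs : SmoothSer₂ s) (ht : SmoothSer₂ t) (α : Fin n → ℕ) :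
    mpow (conjD φ) α (s + t) = mpow (conjD φ) α s + mpow (conjD φ) α t := by
  refine (mpow_family_induction
    (fun b => SmoothSer₂ (b 0) ∧ SmoothSer₂ (b 1) ∧ b 2 = b 0 + b 1) ?_ α
    (a := ![s, t, s + t]) ⟨hs, ht, rfl⟩).2.2
  rintro j b ⟨h0, h1, h2⟩
  exact ⟨h0.conjD hφ j, h1.conjD hφ j, by
    change conjD φ j (b 2) = conjD φ j (b 0) + conjD φ j (b 1)
    rw [h2, conjD_add h0 h1]⟩

theorem mapCoeff_dt_add (s t : FS₂ n) :
    mapCoeff dt (s + t) = mapCoeff dt s + mapCoeff dt t := by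
  ext j : 1
  ext k : 1
  simp [mapCoeff, dt]

theorem mapCoeff_dt_dt (s : FS₂ n) :
    mapCoeff (fun s => dt (dt s)) s = mapCoeff dt (mapCoeff dt s) := by
  simp [mapCoeff]

theorem transport_add (hφ : SmoothSer (phase M mj μ)) {s t : FS₂ n}
    (hs : SmoothSer₂ s) (ht : SmoothSer₂ t) :
    transport M mj μ (s + t) = transport M mj μ s + transport M mj μ t := by
  have h : (multiSum M fun α => invFact α •
        (∂ηm(mj, α, μ) *
          mpow (conjD (phase M mj μ)) α (s + t))) = (multiSum M fun α => invFact α •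
        (∂ηm(mj, α, μ) *
          mpow (conjD (phase M mj μ)) α s)) + multiSum M fun α => invFact α •
        (∂ηm(mj, α, μ) *
          mpow (conjD (phase M mj μ)) α t) := by
    simp only [multiSum, mpow_conjD_add hφ hs ht, mul_add, smul_add, sum_add_distrib]
  simp only [transport, h, mapCoeff_dt_dt, mapCoeff_dt_add, mapCoeff_dy_add hs ht, mul_add,
    smul_add]
  ring

end phase

/-- The coefficients of `h^{j'} t^k` vanish for `j' < j` and for `k < l`. -/
def VanishBelow (j l : ℕ) (s : FS₂ n) : Prop :=
  ∀ j' k, (j' < j ∨ k < l) → coeff k (coeff j' s) = 0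

namespace VanishBelow
variable {j l : ℕ} {s t : FS₂ n}

theorem add (hs : VanishBelow j l s) (ht : VanishBelow j l t) : VanishBelow j l (s + t) :=
  fun j' k h => by rw [map_add, map_add, hs _ _ h, ht _ _ h, add_zero]

theorem smul (c : ℂ) (hs : VanishBelow j l s) : VanishBelow j l (c • s) := fun j' k h => by
  rw [coeff_smul, coeff_smul, hs _ _ h, smul_zero]

theorem sub (hs : VanishBelow j l s) (ht : VanishBelow j l t) : VanishBelow j l (s - t) :=
  fun j' k h => by rw [map_sub, map_sub, hs _ _ h, ht _ _ h, sub_zero]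

theorem mul (m : FS₂ n) (hs : VanishBelow j l s) :
    VanishBelow j l (m * s) := fun j' k h => by
  rw [coeff_mul, map_sum]
  refine sum_eq_zero fun x hx => ?_
  rw [coeff_mul]
  refine sum_eq_zero fun y hy => ?_
  have h1 := mem_antidiagonal.1 hx
  have h2 := mem_antidiagonal.1 hy
  rw [hs x.2 y.2 (by omega), mul_zero]

theorem mapCoeff_dy (i : Fin n) (hs : VanishBelow j l s) :
    VanishBelow j l (mapCoeff (mapCoeff (dy i)) s) := fun j' k h => by
  simp only [mapCoeff, coeff_mk, hs _ _ h, dy_zero]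

protected theorem conjD (φ : FS n) (i : Fin n) (hs : VanishBelow j l s) :
    VanishBelow j l (conjD φ i s) :=
  (hs.mul _).sub (((hs.mapCoeff_dy i).mul _).smul _)

theorem sum {κ : Type*} (S : Finset κ) {f : κ → FS₂ n}
    (hf : ∀ i ∈ S, VanishBelow j l (f i)) : VanishBelow j l (∑ i ∈ S, f i) :=
  Finset.sum_induction _ (VanishBelow j l) (fun _ _ => VanishBelow.add)
    (fun _ _ _ => by simp) hf

end VanishBelow

/-- The lowest power of `h` in `t` is `h^j`, with coefficient `s`. -/
def Lead (j : ℕ) (t : FS₂ n) (s : FS n) : Prop :=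
  (∀ j' < j, coeff j' t = 0) ∧ coeff j t = s

namespace Lead
variable {j : ℕ} {t t' : FS₂ n} {s s' : FS n}

theorem add (h : Lead j t s) (h' : Lead j t' s') : Lead j (t + t') (s + s') :=
  ⟨fun k hk => by rw [map_add, h.1 k hk, h'.1 k hk, add_zero], by rw [map_add, h.2, h'.2]⟩

theorem sub (h : Lead j t s) (h' : Lead j t' s') : Lead j (t - t') (s - s') :=
  ⟨fun k hk => by rw [map_sub, h.1 k hk, h'.1 k hk, sub_zero], by rw [map_sub, h.2, h'.2]⟩

theorem smul (c : ℂ) (h : Lead j t s) : Lead j (c • t) (c • s) :=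
  ⟨fun k hk => by rw [coeff_smul, h.1 k hk, smul_zero],
    by rw [coeff_smul, h.2]⟩

theorem mul (m : FS₂ n) (h : Lead j t s) :
    Lead j (m * t) (coeff 0 m * s) := by
  refine ⟨fun k hk => ?_, ?_⟩
  · rw [coeff_mul]
    refine sum_eq_zero fun x hx => ?_
    have h1 := mem_antidiagonal.1 hx
    rw [h.1 x.2 (by omega), mul_zero]
  · rw [coeff_mul, sum_eq_single (0, j), h.2]
    · rintro ⟨a, b⟩ hx hne
      have h1 := mem_antidiagonal.1 hx
      have : b < j := by
        by_contra hb
        exact hne (Prod.ext (by simp at h1 ⊢; omega) (by simp at h1 ⊢; omega))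
      simp only [h.1 b this, mul_zero]
    · intro hx
      exact absurd (mem_antidiagonal.2 (by simp)) hx

theorem X_mul (h : Lead j t s) : Lead j (X * t) 0 := by
  have := h.mul X
  simpa using this

protected theorem mapCoeff {F : FS n → FS n} (hF : F 0 = 0) (h : Lead j t s) :
    Lead j (mapCoeff F t) (F s) :=
  ⟨fun k hk => by simp [mapCoeff, h.1 k hk, hF],
    by simp [mapCoeff, h.2]⟩

theorem mapCoeff_dy_zero (i : Fin n) : mapCoeff (dy i) 0 = 0 := by
  ext k : 1
  simp [mapCoeff, dy_zero]

protected theorem conjD (φ : FS n) (i : Fin n) (h : Lead j t s) :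
    Lead j (conjD φ i t) (mapCoeff (dy i) φ * s) := by
  have h1 := (h.mul (C (mapCoeff (dy i) φ))).sub
    (((h.mapCoeff (mapCoeff_dy_zero i)).X_mul).smul I)
  simpa [conjD] using h1

theorem sum {κ : Type*} (S : Finset κ) {f : κ → FS₂ n}
    {g : κ → FS n} (hf : ∀ i ∈ S, Lead j (f i) (g i)) :
    Lead j (∑ i ∈ S, f i) (∑ i ∈ S, g i) :=
  ⟨fun k hk => by rw [map_sum]; exact sum_eq_zero fun i hi => (hf i hi).1 k hk,
    by rw [map_sum]; exact sum_congr rfl fun i hi => (hf i hi).2⟩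

end Lead

theorem mpow_mul_left {R : Type*} [CommRing R] (g : Fin n → R) (α : Fin n → ℕ) (s : R) :
    mpow (fun i s => g i * s) α s = (∏ i, g i ^ α i) * s := by
  rw [← List.prod_ofFn, List.ofFn_eq_map]
  unfold mpow
  induction finRange n with
  | nil => simp
  | cons i l ih =>
    simp only [List.foldr_cons, ih, List.map_cons, List.prod_cons]
    induction α i with
    | zero => simp
    | succ k ihk => rw [iterate_succ_apply', ihk, pow_succ']; ring

theorem Lead.mpow_conjD {j : ℕ} {t : FS₂ n} {s : FS n}
    (φ : FS n) (h : Lead j t s) (α : Fin n → ℕ) :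
    Lead j (mpow (conjD φ) α t) ((∏ i, mapCoeff (dy i) φ ^ α i) * s) := by
  rw [← mpow_mul_left]
  unfold mpow
  induction finRange n with
  | nil => exact h
  | cons i l ih =>
    simp only [List.foldr_cons]
    induction α i with
    | zero => exact ih
    | succ k ihk => simp only [iterate_succ_apply']; exact ihk.conjD φ i

section transport
variable [NeZero n] {M : ℕ} {mj : ℕ → ℝ → ℝ → Sym n} {μ : ℝ}

protected theorem Lead.transport {j : ℕ} {t : FS₂ n} {s : FS n}
    (h : Lead j t s) :
    Lead j (transport M mj μ t) (eikonal M mj μ (phase M mj μ) * s) := by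
  have hdt : dt (0 : FS n) = 0 := by
    ext k : 1; simp [dt]
  have h1 := h.mul (C (dt (phase M mj μ) ^ 2 +
    mapCoeff (dy 0) (phase M mj μ) - C (rho n μ ^ 2)))
  have h2 := (h.mul (C (dt (dt
    (phase M mj μ))))).X_mul.smul I
  have h3 := ((h.mapCoeff hdt).mul (C (dt
    (phase M mj μ)))).X_mul.smul (2 * I)
  have h4 := (h.mapCoeff (Lead.mapCoeff_dy_zero 0)).X_mul.smul I
  have h5 := (h.mapCoeff (F := fun s => dt (dt s))
    (by simp [hdt])).mul (X ^ 2)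
  have h6 := Lead.sum (j := j) (range (M + 1)) fun k _ =>
    Lead.sum (piAntidiag Finset.univ k) fun α _ => ((h.mpow_conjD (phase M mj μ) α).mul
      ∂ηm(mj, α, μ)).smul (invFact α)
  have h7 := ((((h1.sub h2).sub h3).sub h4).sub h5).add h6
  convert h7 using 1
  · rfl
  have e0 : ∀ α : Fin n → ℕ, coeff 0 ∂ηm(mj, α, μ) =
      mapCoeff (mpow deta α) (mSeries mj μ 0) := fun α => by
    simp [mapCoeff]
  have e5 : coeff 0 (X ^ 2 : FS₂ n) = 0 := by
    rw [PowerSeries.coeff_X_pow, if_neg (by norm_num)]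
  rw [e5, eikonal, multiSum]
  simp only [e0, smul_zero, sub_zero, zero_mul, PowerSeries.coeff_zero_C, add_mul, sum_mul]
  simp only [smul_mul_assoc, mul_assoc]

/-- The transport operator on one monomial `h^j t^l c`: below the power `h^{j+1} t^{l-1}`. -/
theorem coeff_transport_monomial (j l : ℕ) (c : Sym n) (k : ℕ) (hk : k ≤ l) :
    coeff k (coeff (j + 1) (transport M mj μ
      (X ^ j * C (X ^ (l + 1) * C c)))) =
      if k = l then -(2 * I * ((l : ℂ) + 1)) • (rho n μ * c) else 0 := by
  set b : FS₂ n :=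
    X ^ j * C (X ^ (l + 1) * C c) with hb
  have hbv : VanishBelow j (l + 1) b := fun j' k h => by
    rw [hb, coeff_X_pow_mul', coeff_C]
    split_ifs with h1 h2
    · rw [coeff_X_pow_mul', if_neg (by omega)]
    · simp
    · simp
  have hdt : coeff (j + 1) (X * (C (dt (phase M mj μ)) *
      mapCoeff dt b)) = dt (phase M mj μ) * (X ^ l * C (((l : ℂ) + 1) • c)) := by
    rw [PowerSeries.coeff_succ_X_mul, PowerSeries.coeff_C_mul]
    congr 1
    ext m : 1
    simp only [mapCoeff, dt, coeff_mk, hb, coeff_X_pow_mul',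
      coeff_C, le_refl, Nat.sub_self, if_true]
    by_cases h : m = l
    · subst h; simp
    · split_ifs <;> first | omega | simp
  have v1 := hbv.mul (C (dt (phase M mj μ) ^ 2 + mapCoeff (dy 0) (phase M mj μ) -
    C (rho n μ ^ 2)))
  have v2 := ((hbv.mul (C (dt (dt (phase M mj μ))))).mul X).smul I
  have v4 := ((hbv.mapCoeff_dy 0).mul X).smul I
  have v6 := VanishBelow.sum (range (M + 1)) fun k _ =>
    VanishBelow.sum (piAntidiag Finset.univ k) fun α _ =>
      ((mpow_induction (D := conjD (phase M mj μ)) (VanishBelow j (l + 1))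
        (fun i b hb => hb.conjD _ i) α hbv).mul ∂ηm(mj, α, μ)).smul (invFact α)
  have h5 : coeff (j + 1) (X ^ 2 * mapCoeff (fun s => dt (dt s)) b) = 0 := by
    rw [coeff_X_pow_mul']
    split_ifs with h
    · have hbj : coeff (j + 1 - 2) b = 0 := by
        ext m : 1
        exact hbv _ _ (Or.inl (by omega))
      simp only [mapCoeff, coeff_mk, hbj]
      ext m : 1
      simp [dt]
    · rfl
  rw [transport]
  simp only [map_add, map_sub, h5, coeff_smul, hdt, multiSum] at v1 v2 v4 v6 ⊢
  have w1 := v1 (j + 1) k (by omega)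
  have w2 := v2 (j + 1) k (by omega)
  have w4 := v4 (j + 1) k (by omega)
  have w6 := v6 (j + 1) k (by omega)
  simp only [coeff_smul] at w2 w4
  rw [w1, w2, w4, w6]
  rw [show dt (phase M mj μ) * (X ^ l * C (((l : ℂ) + 1) • c)) =
    X ^ l * (dt (phase M mj μ) * C (((l : ℂ) + 1) • c)) by ring,
    coeff_X_pow_mul']
  by_cases h : k = l
  · subst h
    have h8 : coeff 0 (dt (phase M mj μ)) = rho n μ := by
      simp [dt, phase, coeff_one_phaseAux]
    rw [if_pos le_rfl, if_pos rfl, Nat.sub_self, PowerSeries.coeff_mul_C, h8]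
    simp only [map_zero, sub_zero, add_zero, zero_sub]
    rw [mul_smul_comm, smul_smul, neg_smul]
  · rw [if_neg (by omega), if_neg h]
    simp

theorem ampRow_vanish (hμ : μ ≠ 0) (h0 : taylorCoeff mj μ 0 0 = 0) (hM : 1 ≤ M) (χ : ℝ → ℂ)
    (hχ : SmoothSym (fun (_ : E n) η => χ (η 0)))
    (hφ : SmoothSer (phase M mj μ))
    (hsm : ∀ j l, SmoothSer₂ (ampRow χ M mj μ (ampAux χ M mj μ j) j l))
    (hsa : ∀ j, SmoothSer₂ (ampAux χ M mj μ j)) (j : ℕ)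
    (hj : ∀ r ≤ j, ∀ k < M, coeff k (coeff r
      (transport M mj μ (ampAux χ M mj μ j))) = 0) (l : ℕ) (hl : l ≤ M) :
    (∀ r ≤ j, ∀ k < M, coeff k (coeff r
      (transport M mj μ (ampRow χ M mj μ (ampAux χ M mj μ j) j l))) = 0) ∧
    ∀ k < l, coeff k (coeff (j + 1)
      (transport M mj μ (ampRow χ M mj μ (ampAux χ M mj μ j) j l))) = 0 := by
  have hlead : ∀ s : FS n, ∀ r ≤ j, ∀ k < M, coeff k
      (coeff r (transport M mj μ (X ^ j * C s))) = 0 := by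
    intro s r hr k hk
    have h1 : Lead j (X ^ j * C s) s :=
      ⟨fun j' hj' => by rw [coeff_X_pow_mul', if_neg (by omega)],
        by simp⟩
    have h2 := h1.transport (M := M) (mj := mj) (μ := μ)
    rcases hr.eq_or_lt with rfl | hr
    · rw [h2.2, coeff_mul]
      refine sum_eq_zero fun x hx => ?_
      have h3 := mem_antidiagonal.1 hx
      rw [coeff_eikonal_phase hμ h0 hM _ (by omega), zero_mul]
    · rw [h2.1 r hr, map_zero]
  have hmono : ∀ (m : ℕ) (s : FS n), SmoothSer s →
      SmoothSer₂ (X ^ m * C s) := fun m s hs => by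
    induction m with
    | zero => simpa using SmoothSer₂.C hs
    | succ m ih => rw [pow_succ', mul_assoc]; exact ih.X_mul
  induction l with
  | zero =>
    refine ⟨fun r hr k hk => ?_, fun k hk => by omega⟩
    rw [ampRow, transport_add hφ (hsa j) (hmono _ _ fun k => ?_), map_add, map_add, hj r hr k hk,
      hlead _ r hr k hk, add_zero]
    rw [coeff_C]
    split_ifs
    · exact hχ
    · exact SmoothSym.zero
    · exact SmoothSym.zero
  | succ l ih =>
    obtain ⟨ih1, ih2⟩ := ih (by omega)
    set A := ampRow χ M mj μ (ampAux χ M mj μ j) j l with hA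
    set c : Sym n := fun y η => coeff l (coeff (j + 1)
      (transport M mj μ A)) y η / (2 * I * ((l : ℂ) + 1) * rho n μ y η) with hc
    have e : ampRow χ M mj μ (ampAux χ M mj μ j) j (l + 1) = A + X ^ j *
      C (X ^ (l + 1) * C c) := rfl
    have hcs : SmoothSym c := by
      have h1 := hsm j (l + 1) j (l + 1)
      have h2 := (hsm j l j (l + 1)).smul (-1)
      have h3 := h1.add h2
      rw [e] at h3
      convert h3 using 1
      simp [coeff_X_pow_mul', hA]
    have hs : SmoothSer (X ^ (l + 1) * C c) := fun k => by
      rw [coeff_X_pow_mul', coeff_C]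
      split_ifs
      · exact hcs
      · exact SmoothSym.zero
      · exact SmoothSym.zero
    rw [e, transport_add hφ (hsm j l) (hmono _ _ hs)]
    refine ⟨fun r hr k hk => ?_, fun k hk => ?_⟩
    · rw [map_add, map_add, ih1 r hr k hk, hlead _ r hr k hk, add_zero]
    · rw [map_add, map_add, coeff_transport_monomial j l c k (by omega)]
      by_cases h : k = l
      · subst h
        rw [if_pos rfl]
        funext y η
        have hρ := rho_ne_zero hμ y η
        simp only [Pi.add_apply, Pi.smul_apply, Pi.mul_apply, smul_eq_mul, hc, Pi.zero_apply]
        field_simp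
        ring
      · rw [if_neg h, ih2 k (by omega), add_zero]

theorem coeff_transport_amp (hμ : μ ≠ 0) (h0 : taylorCoeff mj μ 0 0 = 0) (hM : 1 ≤ M) (χ : ℝ → ℂ)
    (hχ : SmoothSym (fun (_ : E n) η => χ (η 0)))
    (hφ : SmoothSer (phase M mj μ))
    (hsm : ∀ j l, SmoothSer₂ (ampRow χ M mj μ (ampAux χ M mj μ j) j l))
    (hsa : ∀ j, SmoothSer₂ (ampAux χ M mj μ j)) (r k : ℕ) (hr : r ≤ M + 1) (hk : k < M) :
    coeff k (coeff r (transport M mj μ (amp χ M mj μ))) = 0 := by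
  suffices H : ∀ j, ∀ r ≤ j, ∀ k < M, coeff k (coeff r
      (transport M mj μ (ampAux χ M mj μ j))) = 0 from H (M + 1) r hr k hk
  intro j
  induction j with
  | zero =>
    intro r hr k hk
    obtain rfl : r = 0 := by omega
    have h1 : Lead 0 (0 : FS₂ n) 0 := ⟨fun _ h => by omega, by simp⟩
    have h2 := h1.transport (M := M) (mj := mj) (μ := μ)
    rw [ampAux, h2.2, mul_zero, map_zero]
  | succ j ih =>
    obtain ⟨h1, h2⟩ := ampRow_vanish hμ h0 hM χ hχ hφ hsm hsa j ih M le_rfl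
    intro r hr k hk
    rcases Nat.lt_or_ge j r with h | h
    · obtain rfl : r = j + 1 := by omega
      exact h2 k hk
    · exact h1 r h k hk

theorem coeff_ampRow_eq_zero (χ : ℝ → ℂ) (a : FS₂ n) (j l : ℕ) {J : ℕ}
    (hj : j ≤ J) (hl : l ≤ M) (ha : ∀ r k, (J < r ∨ M < k) →
      coeff k (coeff r a) = 0) (r k : ℕ) (h : J < r ∨ M < k) :
    coeff k (coeff r (ampRow χ M mj μ a j l)) = 0 := by
  induction l with
  | zero =>
    rw [ampRow, map_add, map_add, ha r k h, coeff_X_pow_mul', coeff_C]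
    split_ifs with h1 h2 <;> first | rw [coeff_C, if_neg (by omega), add_zero] | simp
  | succ l ih =>
    rw [ampRow, map_add, map_add, ih (by omega), coeff_X_pow_mul', coeff_C]
    split_ifs with h1 h2
    · rw [coeff_X_pow_mul', coeff_C]
      split_ifs with h3 h4
      · omega
      · simp
      · simp
    · simp
    · simp

theorem coeff_amp_eq_zero (χ : ℝ → ℂ) (r k : ℕ) (h : M < r ∨ M < k) :
    coeff k (coeff r (amp χ M mj μ)) = 0 := by
  suffices H : ∀ j ≤ M + 1, ∀ r k, (M < r ∨ M < k) →
      coeff k (coeff r (ampAux χ M mj μ j)) = 0 from H _ le_rfl r k h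
  intro j
  induction j with
  | zero => intro _ r k _; simp [ampAux]
  | succ j ih =>
    intro hj r k h
    exact coeff_ampRow_eq_zero χ _ j M (by omega) le_rfl (ih (by omega)) r k h

end transport

/-! ### The size of `ϱ` -/

section
variable [NeZero n]

/-- `|ϱ|` as a function of `(μ, η)`. -/
def rhoN (q : ℝ × E n) : ℝ := ‖rho n q.1 0 q.2‖

/-- The parameters on which the amplitude lives. -/
def S₀ (n : ℕ) [NeZero n] : Set (ℝ × E n) := {q | 0 < |q.1| ∧ |q.1| ≤ 1 ∧ |q.2 0| ≤ 2}

variable {q : ℝ × E n}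

theorem rhoN_pos (hq : 0 < |q.1|) : 0 < rhoN q :=
  norm_pos_iff.2 (rho_ne_zero (abs_pos.1 hq) _ _)

theorem rhoN_sq (q : ℝ × E n) : rhoN q ^ 2 = ‖-(q.2 0 : ℂ) + I * q.1‖ := by
  rw [rhoN, ← norm_pow, rho_sq]

theorem abs_le_rhoN_sq (q : ℝ × E n) : |q.1| ≤ rhoN q ^ 2 := by
  rw [rhoN_sq]
  simpa using Complex.abs_im_le_norm (-(q.2 0 : ℂ) + I * q.1)

theorem rhoN_le (hq : q ∈ S₀ n) : rhoN q ≤ 2 := by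
  have h : rhoN q ^ 2 ≤ 3 := by
    rw [rhoN_sq]
    refine (norm_add_le _ _).trans ?_
    simp only [norm_neg, norm_mul, norm_I, one_mul, norm_real, norm_eq_abs]
    linarith [hq.2.1, hq.2.2]
  nlinarith [norm_nonneg (rho n q.1 0 q.2), show rhoN q = ‖rho n q.1 0 q.2‖ from rfl]

theorem abs_le_two_mul_im_rho (hq : 0 < |q.1|) :
    |q.1| ≤ 2 * rhoN q * (rho n q.1 0 q.2).im := by
  have h := congrArg Complex.im (rho_sq n q.1 0 q.2)
  simp only [sq, Complex.mul_im, Complex.add_im, Complex.neg_im, Complex.ofReal_im, neg_zero,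
    Complex.I_re, Complex.I_im, Complex.ofReal_re, zero_mul, one_mul, zero_add] at h
  have h1 := rho_im_pos n q.1 (abs_pos.1 hq) 0 q.2
  have h2 : |(rho n q.1 0 q.2).re| ≤ rhoN q := Complex.abs_re_le_norm _
  have h3 : |q.1| = 2 * |(rho n q.1 0 q.2).re| * (rho n q.1 0 q.2).im := by
    conv_lhs => rw [← h]
    rw [show ∀ x y : ℝ, x * y + y * x = 2 * x * y by intros; ring, abs_mul, abs_mul, abs_two,
      abs_of_pos h1]
  rw [h3]
  gcongr

theorem smoothSym_rho {μ : ℝ} (hμ : μ ≠ 0) : SmoothSym (rho n μ) := by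
  have h0 : ∀ η : E n, (η 0 : ℂ) - I * μ ∈ Complex.slitPlane := fun η =>
    Or.inr (by simpa using hμ)
  have h1 : ContDiff ℝ ∞ (fun p : E n × E n => (p.2 0 : ℂ) - I * μ) := by
    refine ContDiff.sub ?_ contDiff_const
    exact Complex.ofRealCLM.contDiff.comp
      ((proj (𝕜 := ℝ) (0 : Fin n)).contDiff.comp contDiff_snd)
  have h2 : unc (rho n μ) = fun p : E n × E n =>
      I * Complex.exp (Complex.log ((p.2 0 : ℂ) - I * μ) * (1 / 2)) := by
    funext p
    simp only [unc, rho, Complex.cpow_def_of_ne_zero (Complex.slitPlane_ne_zero (h0 p.2))]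
  rw [SmoothSym, h2, contDiff_iff_contDiffAt]
  intro p
  refine contDiffAt_const.mul (ContDiffAt.cexp (ContDiffAt.mul ?_ contDiffAt_const))
  exact ((Complex.contDiffAt_log (h0 p.2)).restrict_scalars ℝ).comp p h1.contDiffAt

end

theorem Bd.congr_weight {ι V F : Type*} [NormedAddCommGroup V] [NormedSpace ℝ V]
    [NormedAddCommGroup F] [NormedSpace ℝ F] {S : Set ι} {σ w w' : ι → ℝ} {f : ι → V → F}
    (h : Bd S σ w f) (hw : ∀ i ∈ S, w i = w' i) : Bd S σ w' f :=
  ⟨h.1, fun k => by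
    obtain ⟨C, hC, H⟩ := h.2 k
    exact ⟨C, hC, fun i hi => hw i hi ▸ H i hi⟩⟩

section
variable [NeZero n]

/-! ### The graded class defined by powers of `|ϱ|` -/

/-- `D_y^k c = O(|ϱ|^p)`. -/
def WtCls (p : ℤ) (c : ℝ → Sym n) : Prop :=
  Bd (S₀ n) (fun _ => 1) (fun q => rhoN q ^ p) (fun q y => c q.1 y q.2)

theorem WtCls.of_const {p : ℤ} (c : ℝ → E n → ℂ) (K : ℝ)
    (hc : ∀ q ∈ S₀ n, ‖c q.1 q.2‖ ≤ K * rhoN q ^ p) : WtCls p (fun μ _ η => c μ η) :=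
  Bd.const (S := S₀ n) (V := E n) one_nonneg
    (fun _ hq => (zpow_pos (rhoN_pos hq.1) _).le) (fun q : ℝ × E n => c q.1 q.2) K hc

theorem WtCls.rho_inv : WtCls (-1) (fun μ (_ : E n) η => (rho n μ 0 η)⁻¹) :=
  WtCls.of_const _ 1 fun q _ => by rw [norm_inv, zpow_neg_one, one_mul]; rfl

theorem WtCls.mul {p r : ℤ} {a b : ℝ → Sym n} (ha : WtCls p a) (hb : WtCls r b) :
    WtCls (p + r) (a * b) :=
  (Bd.mul ha hb).congr_weight fun _ hq => (zpow_add₀ (rhoN_pos hq.1).ne' _ _).symm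

theorem graded_wtCls : Graded Set.univ (WtCls (n := n)) where
  mod :=
    { real_mem := fun _ => trivial
      zero := fun p => Bd.zero one_nonneg fun q hq =>
        (zpow_pos (rhoN_pos hq.1) _).le
      add := fun ha hb => Bd.add ha hb
      mul := WtCls.mul
      succ := fun {p a} ha => Bd.mono ha one_nonneg 2 (fun q hq => by
          rw [zpow_add_one₀ (rhoN_pos hq.1).ne', mul_comm]
          have := (zpow_pos (rhoN_pos hq.1) p).le
          have := rhoN_le hq
          gcongr) fun q hq => (zpow_pos (rhoN_pos hq.1) _).le
      dy := fun i ha => by simpa using! Bd.fderiv_apply ha (bas i)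
      smul := fun c _ ha => Bd.smul_const ha c
      div := fun {p a} ha => by
        have := WtCls.mul ha WtCls.rho_inv
        rw [sub_eq_add_neg]
        exact this }
  one := WtCls.of_const (fun _ _ => 1) 1 fun q _ => by simp
  rho := WtCls.of_const (fun μ η => rho n μ 0 η) 1 fun q _ => by simp [rhoN]

/-! ### The class of symbols with small imaginary part -/

/-- `(Im ϱ / |ϱ|) (1 + |μ|^{-ε} |ϱ|²)`. -/
def imW (ε : ℝ) (q : ℝ × E n) : ℝ :=
  (rho n q.1 0 q.2).im / rhoN q * (1 + |q.1| ^ (-ε) * rhoN q ^ 2)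

/-- `c = O(|ϱ|^p)` and `Im c = O(|ϱ|^p imW)`, with the derivatives in `y`. -/
def ImCls (ε : ℝ) (p : ℤ) (c : ℝ → Sym n) : Prop :=
  WtCls p c ∧ Bd (S₀ n) (fun _ => 1) (fun q => imW ε q * rhoN q ^ p)
    (fun q y => ((c q.1 y q.2).im : ℂ))

variable {ε : ℝ}

theorem imW_nonneg {q : ℝ × E n} (hq : 0 < |q.1|) : 0 ≤ imW ε q := by
  have := rho_im_pos n q.1 (abs_pos.1 hq) 0 q.2
  have := rhoN_pos hq
  unfold imW; positivity

theorem im_div_rhoN_le_imW {q : ℝ × E n} (hq : 0 < |q.1|) :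
    (rho n q.1 0 q.2).im / rhoN q ≤ imW ε q := by
  have := rho_im_pos n q.1 (abs_pos.1 hq) 0 q.2
  have := rhoN_pos hq
  refine le_mul_of_one_le_right (by positivity) ?_
  have : 0 ≤ |q.1| ^ (-ε) * rhoN q ^ 2 := by positivity
  linarith

theorem rpow_le_imW {q : ℝ × E n} (hq : 0 < |q.1|) : |q.1| ^ (1 - ε) ≤ 2 * imW ε q := by
  have h1 := rho_im_pos n q.1 (abs_pos.1 hq) 0 q.2
  have h2 := rhoN_pos hq
  have h3 := abs_le_two_mul_im_rho hq
  have h4 : |q.1| ^ (1 - ε) = |q.1| ^ (-ε) * |q.1| := by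
    rw [sub_eq_neg_add, rpow_add hq, rpow_one]
  have h5 : 0 < |q.1| ^ (-ε) := rpow_pos_of_pos hq _
  rw [h4, imW]
  calc |q.1| ^ (-ε) * |q.1| ≤ |q.1| ^ (-ε) * (2 * rhoN q * (rho n q.1 0 q.2).im) := by gcongr
    _ = 2 * ((rho n q.1 0 q.2).im / rhoN q * (|q.1| ^ (-ε) * rhoN q ^ 2)) := by field_simp
    _ ≤ _ := by gcongr; linarith

/-- `Im` as a linear map with values in `ℂ`. -/
def imL : ℂ →L[ℝ] ℂ := Complex.ofRealCLM.comp Complex.imCLM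

/-- `Re` as a linear map with values in `ℂ`. -/
def reL : ℂ →L[ℝ] ℂ := Complex.ofRealCLM.comp Complex.reCLM

theorem imL_apply (z : ℂ) : imL z = (z.im : ℂ) := rfl

theorem ImCls.mul {p r : ℤ} {a b : ℝ → Sym n} (ha : ImCls ε p a) (hb : ImCls ε r b) :
    ImCls ε (p + r) (a * b) := by
  refine ⟨ha.1.mul hb.1, ?_⟩
  have h1 := (Bd.mul (Bd.clm reL ha.1) hb.2).congr_weight
    (w' := fun q => imW ε q * rhoN q ^ (p + r)) fun q hq => by
      rw [zpow_add₀ (rhoN_pos hq.1).ne']; ring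
  have h2 := (Bd.mul ha.2 (Bd.clm reL hb.1)).congr_weight
    (w' := fun q => imW ε q * rhoN q ^ (p + r)) fun q hq => by
      rw [zpow_add₀ (rhoN_pos hq.1).ne']; ring
  refine (h1.add h2).congr fun q _ => ?_
  funext y
  simp [reL, Complex.mul_im]

theorem ImCls.of_const {p : ℤ} (c : ℝ → E n → ℂ) (K : ℝ)
    (hc : ∀ q ∈ S₀ n, ‖c q.1 q.2‖ ≤ K * rhoN q ^ p)
    (hi : ∀ q ∈ S₀ n, |(c q.1 q.2).im| ≤ K * (imW ε q * rhoN q ^ p)) :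
    ImCls ε p (fun μ _ η => c μ η) :=
  ⟨WtCls.of_const c K hc, Bd.const (S := S₀ n) (V := E n) one_nonneg
    (fun _ hq => mul_nonneg (imW_nonneg hq.1) (zpow_pos (rhoN_pos hq.1) _).le)
    (fun q : ℝ × E n => ((c q.1 q.2).im : ℂ)) K fun q hq => by simpa using! hi q hq⟩

theorem ImCls.rho_inv : ImCls ε (-1) (fun μ (_ : E n) η => (rho n μ 0 η)⁻¹) :=
  ImCls.of_const _ 1 (fun q _ => by rw [norm_inv, zpow_neg_one, one_mul]; rfl) fun q hq => by
    have h1 := rho_im_pos n q.1 (abs_pos.1 hq.1) 0 q.2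
    have h2 := rhoN_pos hq.1
    rw [Complex.inv_im, zpow_neg_one, one_mul, abs_div, abs_neg, abs_of_pos h1,
      Complex.normSq_eq_norm_sq, abs_of_nonneg (by positivity), ← div_eq_mul_inv]
    change _ / rhoN q ^ 2 ≤ _
    rw [sq, ← div_div]
    have := im_div_rhoN_le_imW (ε := ε) hq.1
    gcongr

theorem graded_imCls : Graded (Set.range ((↑) : ℝ → ℂ)) (ImCls (n := n) ε) where
  mod :=
    { real_mem := fun c => ⟨c, rfl⟩
      zero := fun p => ⟨graded_wtCls.mod.zero p, by
        simpa using! Bd.zero (S := S₀ n) (V := E n) (F := ℂ) one_nonneg fun q hq =>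
          mul_nonneg (imW_nonneg (ε := ε) hq.1) (zpow_pos (rhoN_pos hq.1) p).le⟩
      add := fun ha hb => ⟨graded_wtCls.mod.add ha.1 hb.1, by
        simpa using! Bd.add ha.2 hb.2⟩
      mul := ImCls.mul
      succ := fun {p a} ha => ⟨graded_wtCls.mod.succ ha.1,
        Bd.mono ha.2 one_nonneg 2 (fun q hq => by
          rw [zpow_add_one₀ (rhoN_pos hq.1).ne', mul_comm (rhoN q ^ p), mul_left_comm]
          have := mul_nonneg (imW_nonneg (ε := ε) hq.1) (zpow_pos (rhoN_pos hq.1) p).le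
          have := rhoN_le hq
          gcongr) fun q hq => mul_nonneg (imW_nonneg hq.1) (zpow_pos (rhoN_pos hq.1) _).le⟩
      dy := fun {p a} i ha => ⟨graded_wtCls.mod.dy i ha.1, by
        have h := Bd.fderiv_apply ha.2 (bas i)
        simp only [mul_one] at h
        refine h.congr fun q hq => ?_
        funext y
        have h1 : DifferentiableAt ℝ (fun y => a q.1 y q.2) y :=
          ((ha.1.1 q hq).differentiable (by simp)) y
        have h2 := (imL.hasFDerivAt.comp y h1.hasFDerivAt).fderiv
        change fderiv ℝ (imL ∘ fun y => a q.1 y q.2) y (bas i) = _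
        rw [h2]
        rfl⟩
      smul := by
        rintro p a _ ⟨c, rfl⟩ ha
        refine ⟨graded_wtCls.mod.smul _ trivial ha.1, ?_⟩
        simpa using! Bd.smul_const ha.2 (c : ℂ)
      div := fun {p a} ha => by
        have := ImCls.mul ha ImCls.rho_inv
        rw [sub_eq_add_neg]
        exact this }
  one := ImCls.of_const (fun _ _ => 1) 1 (fun q _ => by simp) fun q hq => by
    simpa using imW_nonneg hq.1
  rho := ImCls.of_const (fun μ η => rho n μ 0 η) 1 (fun q _ => by simp [rhoN]) fun q hq => by
    have h1 := rho_im_pos n q.1 (abs_pos.1 hq.1) 0 q.2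
    rw [abs_of_pos h1, zpow_one, one_mul, ← div_le_iff₀ (rhoN_pos hq.1)]
    exact im_div_rhoN_le_imW hq.1

/-! ### Smoothness and vanishing -/

/-- Smooth for every `0 < |μ| ≤ 1`. -/
def SmoothCls (_ : ℤ) (c : ℝ → Sym n) : Prop := ∀ μ, 0 < |μ| → |μ| ≤ 1 → SmoothSym (c μ)

theorem graded_smoothCls : Graded Set.univ (SmoothCls (n := n)) where
  mod :=
    { real_mem := fun _ => trivial
      zero := fun _ _ _ _ => SmoothSym.zero
      add := fun ha hb μ h h' => (ha μ h h').add (hb μ h h')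
      mul := fun ha hb μ h h' => (ha μ h h').mul (hb μ h h')
      succ := fun ha => ha
      dy := fun i ha μ h h' => (ha μ h h').dy i
      smul := fun c _ ha μ h h' => (ha μ h h').smul c
      div := fun {p a} ha μ h h' => by
        have h1 : SmoothSym (fun y η => (rho n μ y η)⁻¹) :=
          ContDiff.inv (smoothSym_rho (abs_pos.1 h)) fun p => rho_ne_zero (abs_pos.1 h) _ _
        exact (ha μ h h').mul h1 }
  one := fun _ _ _ => contDiff_const
  rho := fun μ h _ => smoothSym_rho (abs_pos.1 h)

/-- Vanishing for `|η₁| ≥ 2`. -/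
def VanCls (_ : ℤ) (c : ℝ → Sym n) : Prop := ∀ μ y η, 2 ≤ |η 0| → c μ y η = 0

theorem gradedMod_vanCls :
    GradedMod Set.univ (fun _ (_ : ℝ → Sym n) => True) (VanCls (n := n)) where
  real_mem := fun _ => trivial
  zero := fun _ _ _ _ _ => rfl
  add := fun ha hb μ y η h => by simp [ha μ y η h, hb μ y η h]
  mul := fun _ hb μ y η h => by simp [hb μ y η h]
  succ := fun ha => ha
  dy := fun {p a} i ha μ y η h => by
    have : (fun y' => a μ y' η) = fun _ => 0 := funext fun y' => ha μ y' η h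
    simp [dy, this]
  smul := fun c _ ha μ y η h => by simp [ha μ y η h]
  div := fun {p a} ha μ y η h => by simp [ha μ y η h]

theorem graded_true : Graded Set.univ (fun _ (_ : ℝ → Sym n) => True) where
  mod := ⟨fun _ => trivial, fun _ => trivial, fun _ _ => trivial, fun _ _ => trivial,
    fun _ => trivial, fun _ _ => trivial, fun _ _ _ => trivial, fun _ => trivial⟩
  one := trivial
  rho := trivial

end

/-! ### The Taylor coefficients of the perturbation -/

theorem mpow_zero {A : Type*} (D : Fin n → A → A) (b : A) : mpow D 0 b = b := by
  unfold mpow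
  induction finRange n with
  | nil => rfl
  | cons j l ih => simp

/-- The imaginary part of a symbol. -/
def imSym (a : Sym n) : Sym n := fun y η => ((a y η).im : ℂ)

theorem SmoothSym.deta_imSym {a : Sym n} (ha : SmoothSym a) (i : Fin n) :
    deta i (imSym a) = imSym (deta i a) := by
  funext y η
  have h1 : DifferentiableAt ℝ (fun η => a y η) η := (ha.right y).differentiable (by simp) η
  have h2 := (imL.hasFDerivAt.comp η h1.hasFDerivAt).fderiv
  change fderiv ℝ (imL ∘ fun η => a y η) η (bas i) = _
  rw [h2]
  rfl

theorem mpow_deta_imSym {ι : Type*} {S : Set ι} {w : ι → ℝ} {a : ι → Sym n}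
    (ha : ∀ i ∈ S, SmoothSym (a i))
    (h : Bd S (fun _ => 1) w (fun i => unc (imSym (a i)))) (α : Fin n → ℕ) :
    Bd S (fun _ => 1) w (fun i => unc (imSym (mpow deta α (a i)))) := by
  refine (mpow_family_induction (fun b : ι → Sym n => (∀ i ∈ S, SmoothSym (b i)) ∧
    Bd S (fun _ => 1) w (fun i => unc (imSym (b i)))) (fun j b hb =>
      ⟨fun i hi => (hb.1 i hi).deta j, ?_⟩) α ⟨ha, h⟩).2
  refine (by simpa using Bd.deta hb.2 j : Bd S (fun _ => 1) w _).congr fun i hi => ?_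
  rw [(hb.1 i hi).deta_imSym j]

/-- Restriction of a joint bound to the slices `η = const`. -/
theorem Bd.slice {ι : Type*} {S : Set ι} {σ w : ι → ℝ} {a : ι → Sym n}
    (h : Bd S σ w (fun i => unc (a i))) :
    Bd {q : ι × E n | q.1 ∈ S} (fun q => σ q.1) (fun q => w q.1)
      (fun q y => a q.1 y q.2) := by
  have h1 := (h.comp_index (Prod.fst : ι × E n → ι) (T := {q | q.1 ∈ S}) fun q hq => hq).comp_affine
    (inl ℝ (E n) (E n)) (fun q => (0, q.2))
  simpa [unc] using h1

section
variable [NeZero n] {Y : Set (E n)} {ε : ℝ} {m : ℝ → ℝ → ℝ → Sym n} {mj : ℕ → ℝ → ℝ → Sym n}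

namespace IsModelPerturbation
variable (H : IsModelPerturbation Y ε m mj)
include H

theorem jointBd (j k : ℕ) : JointBd {p : ℝ × ℝ | 0 < |p.1| ∧ |p.1| ≤ 1 ∧ p.2 ∈ Set.Icc (0 : ℝ) 1}
    (fun p => dtWithin k (mj j p.1) p.2) :=
  (H.symbol j k).bd

theorem jointBd_taylorCoeff (k j : ℕ) :
    JointBd {μ : ℝ | 0 < |μ| ∧ |μ| ≤ 1} (fun μ => taylorCoeff mj μ k j) := by
  have h := ((H.jointBd j k).comp_index (fun μ : ℝ => (μ, (0 : ℝ)))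
    (T := {μ : ℝ | 0 < |μ| ∧ |μ| ≤ 1}) fun μ hμ => ⟨hμ.1, hμ.2, by simp⟩).smul_const
    ((k.factorial : ℂ)⁻¹)
  refine h.congr fun μ _ => ?_
  funext p
  simp [unc, taylorCoeff, div_eq_inv_mul]

theorem taylorCoeff_zero {μ : ℝ} (h : 0 < |μ|) (h' : |μ| ≤ 1) : taylorCoeff mj μ 0 0 = 0 := by
  funext y η
  simp [taylorCoeff, dtWithin, H.zero μ h h' y η]

theorem jointBd_im_taylorCoeff (hε : 0 < ε) (k : ℕ) : Bd {μ : ℝ | 0 < |μ| ∧ |μ| ≤ 1}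
    (fun _ => 1) (fun μ => |μ| ^ (1 - ε)) (fun μ => unc (imSym (taylorCoeff mj μ k 0))) := by
  obtain ⟨C, hC⟩ := H.im_bound k 0
  refine Bd.interpolate ((H.jointBd_taylorCoeff k 0).clm imL) (fun μ hμ => hμ.1)
    (fun μ hμ => hμ.2) (|C|) (fun μ hμ p => ?_) (1 - ε) (by linarith)
  have h1 := hC μ 0 hμ.1 hμ.2 (by simp) p.1 p.2
  rw [mpow_zero] at h1
  have h2 : (unc (taylorCoeff mj μ k 0) p).im =
      (dtWithin k (mj 0 μ) 0 p.1 p.2).im / k.factorial := by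
    rw [show unc (taylorCoeff mj μ k 0) p = dtWithin k (mj 0 μ) 0 p.1 p.2 /
      ((k.factorial : ℝ) : ℂ) by simp [unc, taylorCoeff], Complex.div_ofReal_im]
  rw [imL_apply, norm_real, norm_eq_abs, h2, abs_div, Nat.abs_cast]
  have h3 : (1 : ℝ) ≤ k.factorial := by exact_mod_cast k.factorial_pos
  refine (div_le_self (abs_nonneg _) h3).trans (h1.trans ?_)
  gcongr
  exact le_abs_self C

theorem wtCls_of_nonpos {p : ℤ} (hp : p ≤ 0) (k j : ℕ) (α : Fin n → ℕ) :
    WtCls p (fun μ => mpow deta α (taylorCoeff mj μ k j)) := by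
  have h := (Bd.slice ((H.jointBd_taylorCoeff k j).mpow_deta α)).mono_set
    (T := S₀ n) fun q hq => ⟨hq.1, hq.2.1⟩
  have h0 : WtCls 0 (fun μ => mpow deta α (taylorCoeff mj μ k j)) := by
    simpa [WtCls] using h
  exact mono_of_succ graded_wtCls.mod.succ hp h0

theorem ser₂_wtCls (α : Fin n → ℕ) : Ser₂ WtCls 2 (fun μ => ∂ηm(mj, α, μ)) := fun j k => by
  have e : (fun μ => coeff k (coeff j ∂ηm(mj, α, μ))) =
      fun μ => mpow deta α (taylorCoeff mj μ k j) := by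
    funext μ; simp [mapCoeff, mSeries]
  rw [e]
  by_cases h : k = 0 ∧ j = 0
  · obtain ⟨rfl, rfl⟩ := h
    refine (graded_wtCls.mod.zero _ : WtCls _ (0 : ℝ → Sym n)).congr fun q hq => ?_
    beta_reduce
    rw [H.taylorCoeff_zero hq.1 hq.2.1, mpow_deta_zero]
    rfl
  · exact H.wtCls_of_nonpos (by omega) k j α

theorem ser_imCls (hε : 0 < ε) (α : Fin n → ℕ) :
    Ser (ImCls ε) 2 (fun μ => mapCoeff (mpow deta α) (mSeries mj μ 0)) := fun k => by
  have e : (fun μ => coeff k (mapCoeff (mpow deta α) (mSeries mj μ 0))) =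
      fun μ => mpow deta α (taylorCoeff mj μ k 0) := by
    funext μ; simp [mapCoeff, mSeries]
  rw [e]
  rcases k with _ | k
  · have h := (graded_imCls (n := n) (ε := ε)).mod.zero (2 - 2 * ((0 : ℕ) : ℤ))
    refine ⟨h.1.congr fun q hq => ?_, h.2.congr fun q hq => ?_⟩ <;>
    · beta_reduce
      rw [H.taylorCoeff_zero hq.1 hq.2.1, mpow_deta_zero]
      rfl
  · refine mono_of_succ graded_imCls.mod.succ (p := 0) (by push_cast; omega) ?_
    refine ⟨H.wtCls_of_nonpos le_rfl _ _ _, ?_⟩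
    have h := (Bd.slice (mpow_deta_imSym (fun μ hμ => (H.jointBd_taylorCoeff (k + 1) 0).1 μ hμ)
      (H.jointBd_im_taylorCoeff hε (k + 1)) α)).mono_set
      (T := S₀ n) fun q hq => ⟨hq.1, hq.2.1⟩
    exact h.mono one_nonneg 2 (fun q hq => by simpa using rpow_le_imW hq.1)
      fun q hq => by simpa using imW_nonneg hq.1

theorem ser₂_smoothCls (α : Fin n → ℕ) : Ser₂ SmoothCls 2 (fun μ => ∂ηm(mj, α, μ)) := fun j k μ h h' => by
  have e : coeff k (coeff j ∂ηm(mj, α, μ)) =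
      mpow deta α (taylorCoeff mj μ k j) := by
    simp [mapCoeff, mSeries]
  beta_reduce
  rw [e]
  exact ((H.jointBd_taylorCoeff k j).mpow_deta α).1 μ ⟨h, h'⟩

omit H in
theorem ser_of_ser₂ {A : ℤ → (ℝ → Sym n) → Prop} {α : Fin n → ℕ}
    (h : Ser₂ A 2 (fun μ => ∂ηm(mj, α, μ))) :
    Ser A 2 (fun μ => mapCoeff (mpow deta α) (mSeries mj μ 0)) := by
  have := h 0
  simpa [mapCoeff] using this

/-! ### The coefficients of the phase and of the amplitude -/

theorem ser_phase_imCls (hε : 0 < ε) (M : ℕ) : Ser (ImCls ε) 3 (fun μ => phase M mj μ) :=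
  Ser.phaseAux graded_imCls (H.ser_imCls hε) _

theorem ser_phase_wtCls (M : ℕ) : Ser WtCls 3 (fun μ => phase M mj μ) :=
  Ser.phaseAux graded_wtCls (fun α => ser_of_ser₂ (H.ser₂_wtCls α)) _

theorem ser_phase_smoothCls (M : ℕ) : Ser SmoothCls 3 (fun μ => phase M mj μ) :=
  Ser.phaseAux graded_smoothCls (fun α => ser_of_ser₂ (H.ser₂_smoothCls α)) _

omit H in
theorem exists_norm_le_of_cutoff {χ : ℝ → ℂ} (hχ : ContDiff ℝ ∞ χ)
    (h2 : ∀ σ, 2 ≤ |σ| → χ σ = 0) : ∃ K, ∀ σ, ‖χ σ‖ ≤ K := by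
  obtain ⟨K, hK⟩ := (isCompact_Icc (a := (-2 : ℝ)) (b := 2)).exists_bound_of_continuousOn
    hχ.continuous.continuousOn
  refine ⟨max K 0, fun σ => ?_⟩
  by_cases h : |σ| ≤ 2
  · exact (hK σ (abs_le.1 h)).trans (le_max_left _ _)
  · rw [h2 σ (not_le.1 h).le, norm_zero]; exact le_max_right _ _

theorem ser₂_amp_wtCls {χ : ℝ → ℂ} (hχ : ContDiff ℝ ∞ χ) (h2 : ∀ σ, 2 ≤ |σ| → χ σ = 0)
    (M : ℕ) : Ser₂ WtCls 0 (fun μ => amp χ M mj μ) := by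
  obtain ⟨K, hK⟩ := exists_norm_le_of_cutoff hχ h2
  exact Ser₂.ampAux graded_wtCls graded_wtCls.mod
    (WtCls.of_const (fun _ η => χ (η 0)) K fun q _ => by simpa using hK _)
    H.ser₂_wtCls (H.ser_phase_wtCls M) _

omit H in
theorem smoothSym_cutoff {χ : ℝ → ℂ} (hχ : ContDiff ℝ ∞ χ) :
    SmoothSym (fun (_ : E n) η => χ (η 0)) :=
  hχ.comp ((proj (𝕜 := ℝ) (0 : Fin n)).contDiff.comp contDiff_snd)

theorem ser₂_ampAux_smoothCls {χ : ℝ → ℂ} (hχ : ContDiff ℝ ∞ χ) (M j : ℕ) :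
    Ser₂ SmoothCls 0 (fun μ => ampAux χ M mj μ j) :=
  Ser₂.ampAux graded_smoothCls graded_smoothCls.mod (fun _ _ _ => smoothSym_cutoff hχ)
    H.ser₂_smoothCls (H.ser_phase_smoothCls M) _

omit H in
theorem ser₂_amp_vanCls {χ : ℝ → ℂ} (h2 : ∀ σ, 2 ≤ |σ| → χ σ = 0) (M : ℕ) :
    Ser₂ VanCls 0 (fun μ => amp χ M mj μ) :=
  Ser₂.ampAux graded_true gradedMod_vanCls (fun _ _ _ h => h2 _ h)
    (fun _ _ _ => trivial) (fun _ => trivial) _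

/-- The transport equations hold. -/
theorem coeff_transport {χ : ℝ → ℂ} (hχ : ContDiff ℝ ∞ χ) {M : ℕ} (hM : 1 ≤ M) {μ : ℝ}
    (h : 0 < |μ|) (h' : |μ| ≤ 1) (r k : ℕ) (hr : r ≤ M + 1) (hk : k < M) :
    coeff k (coeff r (transport M mj μ (amp χ M mj μ))) = 0 :=
  coeff_transport_amp (abs_pos.1 h) (H.taylorCoeff_zero h h') hM χ (smoothSym_cutoff hχ)
    (fun k => H.ser_phase_smoothCls M k μ h h')
    (fun j l r k => Ser₂.ampRow graded_smoothCls graded_smoothCls.mod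
      (fun _ _ _ => smoothSym_cutoff hχ) H.ser₂_smoothCls (H.ser_phase_smoothCls M)
      (H.ser₂_ampAux_smoothCls hχ M j) j l r k μ h h')
    (fun j r k => H.ser₂_ampAux_smoothCls hχ M j r k μ h h') r k hr hk

end IsModelPerturbation
end

/-! ### Expansions of functions of `(h, μ, t, y, η)` -/

/-- The parameters `(h, μ, t, η)`. -/
abbrev Par (n : ℕ) := ℝ × ℝ × ℝ × E n

namespace Par

/-- `|ϱ|` at a parameter. -/
def r [NeZero n] (q : Par n) : ℝ := rhoN (q.2.1, q.2.2.2)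

/-- `t / |ϱ|²`. -/
def x [NeZero n] (q : Par n) : ℝ := q.2.2.1 / q.r ^ 2

/-- `h / |ϱ|³`. -/
def z [NeZero n] (q : Par n) : ℝ := q.1 / q.r ^ 3

end Par

/-- The parameters at which the phase is used. -/
def S₁ (n : ℕ) [NeZero n] (ε h₁ : ℝ) : Set (Par n) :=
  {q | 0 < q.1 ∧ q.1 ≤ h₁ ∧ q.1 ^ (2 / 3 - ε) ≤ |q.2.1| ∧ |q.2.1| ≤ 1 ∧
    q.2.2.1 ∈ Ioo (0 : ℝ) 1 ∧ |q.2.2.2 0| ≤ 2 ∧ q.2.2.1 ≤ q.r ^ 2}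

section
variable [NeZero n] {ε h₁ : ℝ} {q : Par n}

theorem S₁.mu_pos (hq : q ∈ S₁ n ε h₁) : 0 < |q.2.1| :=
  (rpow_pos_of_pos hq.1 _).trans_le hq.2.2.1

theorem S₁.mem (hq : q ∈ S₁ n ε h₁) : (q.2.1, q.2.2.2) ∈ S₀ n :=
  ⟨S₁.mu_pos hq, hq.2.2.2.1, hq.2.2.2.2.2.1⟩

theorem S₁.r_pos (hq : q ∈ S₁ n ε h₁) : 0 < q.r := rhoN_pos (S₁.mem hq).1

theorem S₁.r_le (hq : q ∈ S₁ n ε h₁) : q.r ≤ 2 := rhoN_le (S₁.mem hq)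

theorem S₁.x_pos (hq : q ∈ S₁ n ε h₁) : 0 < q.x := div_pos hq.2.2.2.2.1.1 (pow_pos (S₁.r_pos hq) 2)

theorem S₁.z_pos (hq : q ∈ S₁ n ε h₁) : 0 < q.z := div_pos hq.1 (pow_pos (S₁.r_pos hq) 3)

theorem S₁.x_le (hq : q ∈ S₁ n ε h₁) : q.x ≤ 1 :=
  (div_le_one (pow_pos (S₁.r_pos hq) 2)).2 hq.2.2.2.2.2.2

/-- `|ϱ|³ ≥ h^{1 - 3ε/2}`. -/
theorem rpow_le_rhoN_pow_three {h μ : ℝ} {η : E n} (hh : 0 < h) (hμ : h ^ (2 / 3 - ε) ≤ |μ|) :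
    h ^ (1 - 3 * ε / 2) ≤ rhoN (μ, η) ^ 3 := by
  have h1 := hμ.trans (abs_le_rhoN_sq (μ, η))
  have h2 : 0 ≤ rhoN (μ, η) := norm_nonneg _
  have h3 : (h ^ (2 / 3 - ε)) ^ (3 / 2 : ℝ) ≤ (rhoN (μ, η) ^ 2) ^ (3 / 2 : ℝ) := by gcongr
  rw [← rpow_mul hh.le, ← rpow_natCast, ← rpow_mul h2] at h3
  rw [show 1 - 3 * ε / 2 = (2 / 3 - ε) * (3 / 2) by ring]
  refine h3.trans (le_of_eq ?_)
  norm_num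

theorem S₁.z_le_rpow (hq : q ∈ S₁ n ε h₁) : q.z ≤ q.1 ^ (3 * ε / 2) := by
  have h1 := rpow_le_rhoN_pow_three (η := q.2.2.2) hq.1 hq.2.2.1
  rw [Par.z, div_le_iff₀ (pow_pos (S₁.r_pos hq) 3)]
  calc q.1 = q.1 ^ (3 * ε / 2) * q.1 ^ (1 - 3 * ε / 2) := by
        rw [← rpow_add hq.1]; simp
    _ ≤ _ := by have := rpow_pos_of_pos hq.1 (3 * ε / 2); gcongr; exact h1

theorem S₁.z_le (hε : 0 < ε) (hh : h₁ ≤ 1) (hq : q ∈ S₁ n ε h₁) : q.z ≤ 1 :=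
  (S₁.z_le_rpow hq).trans (rpow_le_one hq.1.le (hq.2.1.trans hh) (by positivity))

theorem S₁.t_eq (hq : q ∈ S₁ n ε h₁) : q.2.2.1 = q.r ^ 2 * q.x := by
  have := S₁.r_pos hq
  rw [Par.x]; field_simp

theorem S₁.h_eq (hq : q ∈ S₁ n ε h₁) : q.1 = q.r ^ 3 * q.z := by
  have := S₁.r_pos hq
  rw [Par.z]; field_simp

/-- A family of symbols as a family of functions of `y`. -/
def slices (F : ℝ → ℝ → ℝ → Sym n) (q : Par n) (y : E n) : ℂ := F q.1 q.2.1 q.2.2.1 y q.2.2.2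

/-- `∑_{j,k<N} h^j t^k s_{k,j}`. -/
def evS (N : ℕ) (s : ℝ → FS₂ n) (h μ t : ℝ) : Sym n := fun y η =>
  ∑ j ∈ range N, ∑ k ∈ range N,
    (h : ℂ) ^ j * (t : ℂ) ^ k * coeff k (coeff j (s μ)) y η

theorem slices_evS (N : ℕ) (s : ℝ → FS₂ n) : slices (evS N s) =
    fun q y => ∑ j ∈ range N, ∑ k ∈ range N, (q.1 : ℂ) ^ j * (q.2.2.1 : ℂ) ^ k *
      coeff k (coeff j (s q.2.1)) y q.2.2.2 := rfl

variable (S : Set (Par n))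

/-- `F = O(|ϱ|^p)`, `F = ∑_{j,k<M} h^j t^k s_{k,j} + O(|ϱ|^p (x^M + z^M))`, where `s_{k,j}` has the
degree `p - 2k - 3j`. -/
def Expn (M : ℕ) (p : ℤ) (F : ℝ → ℝ → ℝ → Sym n)
    (s : ℝ → FS₂ n) : Prop :=
  Ser₂ WtCls p s ∧ Bd S (fun _ => 1) (fun q => q.r ^ p) (slices F) ∧
    Bd S (fun _ => 1) (fun q => q.r ^ p * (q.x ^ M + q.z ^ M))
      (fun q y => slices F q y - slices (evS M s) q y)

variable {S} {M : ℕ} {p p' : ℤ} (hS : S ⊆ S₁ n ε h₁) (hε : 0 < ε) (hh : h₁ ≤ 1)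
include hS

theorem rpow_nonneg_of_mem (p : ℤ) : ∀ q ∈ S, 0 ≤ q.r ^ p := fun _ hq =>
  (zpow_pos (S₁.r_pos (hS hq)) p).le

theorem errW_nonneg (M : ℕ) (p : ℤ) : ∀ q ∈ S, 0 ≤ q.r ^ p * (q.x ^ M + q.z ^ M) := fun q hq =>
  mul_nonneg (rpow_nonneg_of_mem hS p q hq)
    (add_nonneg (pow_pos (S₁.x_pos (hS hq)) _).le (pow_pos (S₁.z_pos (hS hq)) _).le)

theorem WtCls.slices {c : ℝ → Sym n} (hc : WtCls p c) :
    Bd S (fun _ => 1) (fun q => q.r ^ p) (slices fun _ μ _ => c μ) :=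
  Bd.comp_index hc (fun q : Par n => (q.2.1, q.2.2.2)) fun _ hq => S₁.mem (hS hq)

theorem Bd.monomial_mul {w : Par n → ℝ} {f : Par n → E n → ℂ} (hf : Bd S (fun _ => 1) w f)
    (j k : ℕ) : Bd S (fun _ => 1) (fun q => q.1 ^ j * q.2.2.1 ^ k * w q)
      (fun q y => (q.1 : ℂ) ^ j * (q.2.2.1 : ℂ) ^ k * f q y) :=
  hf.const_mul one_nonneg (fun q => (q.1 : ℂ) ^ j * (q.2.2.1 : ℂ) ^ k) 1
    (fun q hq => mul_nonneg (pow_nonneg (hS hq).1.le _)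
      (pow_nonneg (hS hq).2.2.2.2.1.1.le _)) fun q hq => by
    rw [norm_mul, norm_pow, norm_pow, norm_real, norm_real, norm_eq_abs,
      norm_eq_abs, abs_of_pos (hS hq).1, abs_of_pos (hS hq).2.2.2.2.1.1, one_mul]

theorem monomial_weight (j k : ℕ) : ∀ q ∈ S,
    q.1 ^ j * q.2.2.1 ^ k * q.r ^ (p - 3 * j - 2 * k) = q.r ^ p * (q.x ^ k * q.z ^ j) := by
  intro q hq
  have h1 := S₁.r_pos (hS hq)
  have h2 : q.r ^ (p - 3 * j - 2 * k) * (q.r ^ (3 * j) * q.r ^ (2 * k)) = q.r ^ p := by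
    rw [← zpow_natCast, ← zpow_natCast, ← zpow_add₀ h1.ne', ← zpow_add₀ h1.ne']
    congr 1; push_cast; ring
  rw [← h2]
  conv_lhs => rw [S₁.h_eq (hS hq), S₁.t_eq (hS hq)]
  ring

/-- A monomial `h^j t^k c`. -/
theorem WtCls.monomial {c : ℝ → Sym n} (j k : ℕ) (hc : WtCls (p - 3 * j - 2 * k) c) :
    Bd S (fun _ => 1) (fun q => q.r ^ p * (q.x ^ k * q.z ^ j))
      (fun q y => (q.1 : ℂ) ^ j * (q.2.2.1 : ℂ) ^ k * c q.2.1 y q.2.2.2) :=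
  (Bd.monomial_mul hS (WtCls.slices hS hc) j k).congr_weight (monomial_weight hS j k)

include hε hh

theorem mono_monomial {f : Par n → E n → ℂ} {j k : ℕ}
    (hf : Bd S (fun _ => 1) (fun q => q.r ^ p * (q.x ^ k * q.z ^ j)) f) :
    Bd S (fun _ => 1) (fun q => q.r ^ p) f :=
  hf.mono one_nonneg 1 (fun q hq => by
    rw [one_mul]
    refine mul_le_of_le_one_right (rpow_nonneg_of_mem hS p q hq) (mul_le_one₀
      (pow_le_one₀ (S₁.x_pos (hS hq)).le (S₁.x_le (hS hq)))
      (pow_pos (S₁.z_pos (hS hq)) _).le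
      (pow_le_one₀ (S₁.z_pos (hS hq)).le (S₁.z_le hε hh (hS hq))))) (rpow_nonneg_of_mem hS p)

theorem small_monomial {f : Par n → E n → ℂ} {j k : ℕ} (h : M ≤ j ∨ M ≤ k)
    (hf : Bd S (fun _ => 1) (fun q => q.r ^ p * (q.x ^ k * q.z ^ j)) f) :
    Bd S (fun _ => 1) (fun q => q.r ^ p * (q.x ^ M + q.z ^ M)) f :=
  hf.mono one_nonneg 1 (fun q hq => by
    rw [one_mul]
    refine mul_le_mul_of_nonneg_left ?_ (rpow_nonneg_of_mem hS p q hq)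
    have hx := S₁.x_pos (hS hq)
    have hz := S₁.z_pos (hS hq)
    have hx1 := S₁.x_le (hS hq)
    have hz1 := S₁.z_le hε hh (hS hq)
    rcases h with h | h
    · calc q.x ^ k * q.z ^ j ≤ 1 * q.z ^ M := by
            gcongr ?_ * ?_
            · exact pow_le_one₀ hx.le hx1
            · exact pow_le_pow_of_le_one hz.le hz1 h
        _ ≤ _ := by have := pow_pos hx M; linarith
    · calc q.x ^ k * q.z ^ j ≤ q.x ^ M * 1 := by
            gcongr ?_ * ?_
            · exact pow_le_pow_of_le_one hx.le hx1 h
            · exact pow_le_one₀ hz.le hz1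
        _ ≤ _ := by have := pow_pos hz M; linarith) (errW_nonneg hS M p)

protected theorem Ser₂.evS {s : ℝ → FS₂ n} (hs : Ser₂ WtCls p s) (N : ℕ) :
    Bd S (fun _ => 1) (fun q => q.r ^ p) (slices (evS N s)) := by
  rw [slices_evS]
  exact Bd.sum _ one_nonneg (rpow_nonneg_of_mem hS p) fun j _ =>
    Bd.sum _ one_nonneg (rpow_nonneg_of_mem hS p) fun k _ =>
      mono_monomial hS hε hh (WtCls.monomial hS j k (hs j k))

omit hε hh hS in
theorem sum_range_extend {R : Type*} [AddCommMonoid R] {M N : ℕ} (h : M ≤ N) (g : ℕ → ℕ → R) :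
    ∑ j ∈ range N, ∑ k ∈ range N, g j k =
      ∑ j ∈ range M, ∑ k ∈ range M, g j k +
      ∑ j ∈ range N, ∑ k ∈ range N, if M ≤ j ∨ M ≤ k then g j k else 0 := by
  have h1 : ∀ g : ℕ → R, ∑ j ∈ range M, g j =
      ∑ j ∈ range N, if j < M then g j else 0 := fun g => by
    rw [← Finset.sum_filter]
    congr 1
    ext j; simp; omega
  rw [h1, ← sum_add_distrib]
  refine sum_congr rfl fun j _ => ?_
  split_ifs with hj
  · rw [h1, ← sum_add_distrib]
    refine sum_congr rfl fun k _ => ?_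
    by_cases hk : k < M
    · rw [if_pos hk, if_neg (by omega), add_zero]
    · simp [hk]
  · simp [not_lt.1 hj]

/-- Polynomials. -/
protected theorem Expn.evS {s : ℝ → FS₂ n} (hs : Ser₂ WtCls p s) {N : ℕ}
    (hN : M ≤ N) : Expn S M p (evS N s) s := by
  refine ⟨hs, hs.evS hS hε hh N, ?_⟩
  have h : Bd S (fun _ => 1) (fun q => q.r ^ p * (q.x ^ M + q.z ^ M)) (fun q y =>
      ∑ j ∈ range N, ∑ k ∈ range N, if M ≤ j ∨ M ≤ k then
        (q.1 : ℂ) ^ j * (q.2.2.1 : ℂ) ^ k * coeff k (coeff j (s q.2.1)) y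
          q.2.2.2 else 0) :=
    Bd.sum _ one_nonneg (errW_nonneg hS M p) fun j _ =>
      Bd.sum _ one_nonneg (errW_nonneg hS M p) fun k _ => by
        split_ifs with h
        · exact small_monomial hS hε hh h (WtCls.monomial hS j k (hs j k))
        · exact Bd.zero one_nonneg (errW_nonneg hS M p)
  refine h.congr fun q _ => ?_
  funext y
  simp only [slices, evS]
  rw [sum_range_extend hN fun j k => (q.1 : ℂ) ^ j * (q.2.2.1 : ℂ) ^ k *
    coeff k (coeff j (s q.2.1)) y q.2.2.2]
  ring

omit hε hh in
theorem Expn.add {F G : ℝ → ℝ → ℝ → Sym n} {s u : ℝ → FS₂ n}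
    (hF : Expn S M p F s) (hG : Expn S M p G u) :
    Expn S M p (fun h μ t => F h μ t + G h μ t) (fun μ => s μ + u μ) := by
  refine ⟨Ser₂.add graded_wtCls.mod hF.1 hG.1, hF.2.1.add hG.2.1,
    (hF.2.2.add hG.2.2).congr fun q _ => ?_⟩
  funext y
  simp only [slices, evS, map_add, Pi.add_apply, mul_add, sum_add_distrib]
  ring

omit hε hh in
theorem Expn.smul {F : ℝ → ℝ → ℝ → Sym n} {s : ℝ → FS₂ n}
    (c : ℂ) (hF : Expn S M p F s) :
    Expn S M p (fun h μ t => c • F h μ t) (fun μ => c • s μ) := by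
  refine ⟨Ser₂.smul graded_wtCls.mod trivial hF.1, hF.2.1.smul_const c,
    (hF.2.2.smul_const c).congr fun q _ => ?_⟩
  funext y
  simp only [slices, evS, coeff_smul, Pi.smul_apply,
    mul_sub, mul_sum]
  congr 1
  refine sum_congr rfl fun j _ => sum_congr rfl fun k _ => by ring

omit hε hh in
theorem Expn.sub {F G : ℝ → ℝ → ℝ → Sym n} {s u : ℝ → FS₂ n}
    (hF : Expn S M p F s) (hG : Expn S M p G u) :
    Expn S M p (fun h μ t => F h μ t - G h μ t) (fun μ => s μ - u μ) := by
  have h := Expn.add hS hF (Expn.smul hS (-1) hG)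
  have h1 : (fun μ => s μ + (-1 : ℂ) • u μ) = fun μ => s μ - u μ := by
    funext μ; rw [neg_one_smul ℂ, sub_eq_add_neg]
  have h2 : (fun h μ t => F h μ t + (-1 : ℂ) • G h μ t) = fun h μ t => F h μ t - G h μ t := by
    funext h μ t; rw [neg_one_smul ℂ, sub_eq_add_neg]
  rwa [h1, h2] at h

omit hε hh in
theorem Expn.mono (hF : p' ≤ p) {F : ℝ → ℝ → ℝ → Sym n}
    {s : ℝ → FS₂ n} (h : Expn S M p F s) : Expn S M p' F s := by
  obtain ⟨k, rfl⟩ := Int.le.dest hF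
  have h1 : ∀ q ∈ S, q.r ^ (p' + k) ≤ 2 ^ k * q.r ^ p' := fun q hq => by
    have h2 := S₁.r_pos (hS hq)
    rw [zpow_add₀ h2.ne', mul_comm, zpow_natCast]
    have := S₁.r_le (hS hq)
    gcongr
  refine ⟨Ser₂.mono graded_wtCls.mod h.1 hF, h.2.1.mono one_nonneg _ h1
    (rpow_nonneg_of_mem hS p'), h.2.2.mono one_nonneg (2 ^ k) (fun q hq => ?_)
    (errW_nonneg hS M p')⟩
  rw [← mul_assoc]
  have h3 := S₁.x_pos (hS hq)
  have h4 := S₁.z_pos (hS hq)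
  have := h1 q hq
  gcongr

omit hε hh in
protected theorem Expn.dy (i : Fin n) {F : ℝ → ℝ → ℝ → Sym n}
    {s : ℝ → FS₂ n} (h : Expn S M p F s) :
    Expn S M p (fun h μ t => dy i (F h μ t)) (fun μ => mapCoeff (mapCoeff (dy i)) (s μ)) := by
  have h2 := h.2.1.fderiv_apply (bas i)
  have h3 := h.2.2.fderiv_apply (bas i)
  simp only [mul_one] at h2 h3
  refine ⟨Ser₂.mapCoeff_dy graded_wtCls.mod h.1 i, h2, h3.congr fun q hq => ?_⟩
  funext y
  have hd : ∀ j k, DifferentiableAt ℝ (fun y => coeff k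
      (coeff j (s q.2.1)) y q.2.2.2) y := fun j k =>
    (((h.1 j k).1 _ (S₁.mem (hS hq))).differentiable (by simp)) y
  have hd₁ : ∀ j k, DifferentiableAt ℝ (fun y => (q.1 : ℂ) ^ j * (q.2.2.1 : ℂ) ^ k *
      coeff k (coeff j (s q.2.1)) y q.2.2.2) y := fun j k =>
    (hd j k).const_mul _
  have hd₂ : ∀ j, DifferentiableAt ℝ (fun y => ∑ k ∈ range M, (q.1 : ℂ) ^ j *
      (q.2.2.1 : ℂ) ^ k * coeff k (coeff j (s q.2.1)) y q.2.2.2) y :=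
    fun j => DifferentiableAt.fun_sum fun k _ => hd₁ j k
  have hd' : DifferentiableAt ℝ (slices (evS M s) q) y := by
    rw [slices_evS]
    exact DifferentiableAt.fun_sum fun j _ => hd₂ j
  have h4 : DifferentiableAt ℝ (slices F q) y := (h.2.1.1 q hq).differentiable (by simp) y
  rw [fderiv_fun_sub h4 hd', sub_apply]
  congr 1
  simp only [slices_evS, mapCoeff, coeff_mk]
  rw [fderiv_fun_sum fun j _ => hd₂ j, sum_apply]
  refine sum_congr rfl fun j _ => ?_
  rw [fderiv_fun_sum fun k _ => hd₁ j k, sum_apply]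
  refine sum_congr rfl fun k _ => ?_
  rw [fderiv_const_mul (hd j k)]
  rfl

omit hε hh hS in
theorem sum_range_antidiagonal {R : Type*} [AddCommMonoid R] (M : ℕ) (g : ℕ → ℕ → R) :
    ∑ J ∈ range M, ∑ x ∈ antidiagonal J, g x.1 x.2 =
      ∑ j ∈ range M, ∑ j' ∈ range M, if j + j' < M then g j j' else 0 := by
  simp only [Finset.Nat.sum_antidiagonal_eq_sum_range_succ g]
  rw [Finset.sum_range_diag_flip]
  refine sum_congr rfl fun j _ => ?_
  rw [← Finset.sum_filter]
  congr 1
  ext j'; simp; omega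

/-- The product of two truncations. -/
theorem evS_mul_sub {s u : ℝ → FS₂ n} (hs : Ser₂ WtCls p s)
    (hu : Ser₂ WtCls p' u) :
    Bd S (fun _ => 1) (fun q => q.r ^ (p + p') * (q.x ^ M + q.z ^ M)) (fun q y =>
      slices (evS M s) q y * slices (evS M u) q y -
        slices (evS M fun μ => s μ * u μ) q y) := by
  have hw := errW_nonneg hS M (p + p')
  have h0 : ∀ q ∈ S, (0 : ℝ) ≤ 1 := fun _ _ => zero_le_one
  have h : Bd S (fun _ => 1) (fun q => q.r ^ (p + p') * (q.x ^ M + q.z ^ M)) (fun q y =>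
      ∑ j ∈ range M, ∑ j' ∈ range M, ∑ k ∈ range M, ∑ k' ∈ range M,
        if j + j' < M ∧ k + k' < M then (0 : ℂ) else
        (q.1 : ℂ) ^ (j + j') * (q.2.2.1 : ℂ) ^ (k + k') *
          (coeff k (coeff j (s q.2.1)) y q.2.2.2 *
          coeff k' (coeff j' (u q.2.1)) y q.2.2.2)) := by
    refine Bd.sum _ h0 hw fun j _ => Bd.sum _ h0 hw fun j' _ => Bd.sum _ h0 hw fun k _ =>
      Bd.sum _ h0 hw fun k' _ => ?_
    split_ifs with hc
    · exact Bd.zero h0 hw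
    · refine small_monomial hS hε hh (by omega)
        (WtCls.monomial (c := (fun μ => coeff k (coeff j (s μ))) *
          (fun μ => coeff k' (coeff j' (u μ)))) hS (j + j') (k + k') ?_)
      have := WtCls.mul (hs j k) (hu j' k')
      rw [show p + p' - 3 * ((j + j' : ℕ) : ℤ) - 2 * ((k + k' : ℕ) : ℤ) =
        p - 3 * j - 2 * k + (p' - 3 * j' - 2 * k') by push_cast; ring]
      exact this
  refine h.congr fun q _ => ?_
  funext y
  simp only [slices, evS]
  have e1 : ∀ (J K : ℕ), coeff K (coeff J (s q.2.1 * u q.2.1)) y q.2.2.2 =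
      ∑ a ∈ antidiagonal J, ∑ b ∈ antidiagonal K,
        coeff b.1 (coeff a.1 (s q.2.1)) y q.2.2.2 *
          coeff b.2 (coeff a.2 (u q.2.1)) y q.2.2.2 := fun J K => by
    simp only [coeff_mul, map_sum, Finset.sum_apply, Pi.mul_apply]
  set c := fun j k => coeff k (coeff j (s q.2.1)) y q.2.2.2 with hc
  set d := fun j k => coeff k (coeff j (u q.2.1)) y q.2.2.2 with hd
  have e2 : ∑ J ∈ range M, ∑ K ∈ range M, (q.1 : ℂ) ^ J * (q.2.2.1 : ℂ) ^ K *
      coeff K (coeff J (s q.2.1 * u q.2.1)) y q.2.2.2 =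
      ∑ j ∈ range M, ∑ j' ∈ range M, ∑ k ∈ range M, ∑ k' ∈ range M,
        if j + j' < M ∧ k + k' < M then (q.1 : ℂ) ^ (j + j') * (q.2.2.1 : ℂ) ^ (k + k') *
          (c j k * d j' k') else 0 := by
    have e3 : ∀ J, ∑ K ∈ range M, (q.1 : ℂ) ^ J * (q.2.2.1 : ℂ) ^ K *
        coeff K (coeff J (s q.2.1 * u q.2.1)) y q.2.2.2 =
        ∑ a ∈ antidiagonal J, ∑ k ∈ range M, ∑ k' ∈ range M,
          if k + k' < M then (q.1 : ℂ) ^ (a.1 + a.2) * (q.2.2.1 : ℂ) ^ (k + k') *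
          (c a.1 k * d a.2 k') else 0 := fun J => by
      have e4 : ∀ K, (q.1 : ℂ) ^ J * (q.2.2.1 : ℂ) ^ K *
          coeff K (coeff J (s q.2.1 * u q.2.1)) y q.2.2.2 =
          ∑ a ∈ antidiagonal J, ∑ b ∈ antidiagonal K,
            (q.1 : ℂ) ^ (a.1 + a.2) * (q.2.2.1 : ℂ) ^ (b.1 + b.2) *
              (c a.1 b.1 * d a.2 b.2) := fun K => by
        rw [e1, mul_sum]
        refine sum_congr rfl fun a ha => ?_
        rw [mul_sum]
        refine sum_congr rfl fun b hb => ?_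
        rw [mem_antidiagonal.1 ha,
          mem_antidiagonal.1 hb]
      rw [sum_congr rfl fun K _ => e4 K, Finset.sum_comm]
      refine sum_congr rfl fun a _ => ?_
      exact sum_range_antidiagonal M fun k k' => (q.1 : ℂ) ^ (a.1 + a.2) *
        (q.2.2.1 : ℂ) ^ (k + k') * (c a.1 k * d a.2 k')
    rw [sum_congr rfl fun J _ => e3 J, sum_range_antidiagonal M fun j j' =>
      ∑ k ∈ range M, ∑ k' ∈ range M, if k + k' < M then
        (q.1 : ℂ) ^ (j + j') * (q.2.2.1 : ℂ) ^ (k + k') * (c j k * d j' k') else 0]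
    refine sum_congr rfl fun j _ => sum_congr rfl fun j' _ => ?_
    by_cases hj : j + j' < M <;> simp [hj]
  rw [e2, Finset.sum_mul_sum, ← sum_sub_distrib]
  refine sum_congr rfl fun j _ => ?_
  rw [← sum_sub_distrib]
  refine sum_congr rfl fun j' _ => ?_
  rw [Finset.sum_mul_sum, ← sum_sub_distrib]
  refine sum_congr rfl fun k _ => ?_
  rw [← sum_sub_distrib]
  refine sum_congr rfl fun k' _ => ?_
  split_ifs
  · simp only [hc, hd]; ring
  · ring

theorem Expn.mul {F G : ℝ → ℝ → ℝ → Sym n} {s u : ℝ → FS₂ n}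
    (hF : Expn S M p F s) (hG : Expn S M p' G u) :
    Expn S M (p + p') (fun h μ t => F h μ t * G h μ t) (fun μ => s μ * u μ) := by
  have hr : ∀ q ∈ S, q.r ^ p * q.r ^ p' = q.r ^ (p + p') := fun q hq =>
    (zpow_add₀ (S₁.r_pos (hS hq)).ne' _ _).symm
  refine ⟨Ser₂.mul graded_wtCls.mod hF.1 hG.1, (hF.2.1.mul hG.2.1).congr_weight hr, ?_⟩
  have h1 := (hF.2.2.mul hG.2.1).congr_weight (w' := fun q => q.r ^ (p + p') *
    (q.x ^ M + q.z ^ M)) fun q hq => by rw [← hr q hq]; ring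
  have h2 := ((hF.1.evS hS hε hh M).mul hG.2.2).congr_weight (w' := fun q => q.r ^ (p + p') *
    (q.x ^ M + q.z ^ M)) fun q hq => by rw [← hr q hq]; ring
  refine ((h1.add h2).add (evS_mul_sub hS hε hh hF.1 hG.1)).congr fun q _ => ?_
  simp only [slices, Pi.mul_apply]
  ring

theorem Expn.h_mul (hM : 1 ≤ M) {F : ℝ → ℝ → ℝ → Sym n}
    {s : ℝ → FS₂ n} (hF : Expn S M p F s) :
    Expn S M (p + 3) (fun h μ t => (h : ℂ) • F h μ t) (fun μ => X * s μ) := by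
  have hr : ∀ q ∈ S, q.1 * q.r ^ p ≤ q.r ^ (p + 3) := fun q hq => by
    have h1 := S₁.r_pos (hS hq)
    conv_lhs => rw [S₁.h_eq (hS hq)]
    rw [zpow_add₀ h1.ne']
    have := S₁.z_le hε hh (hS hq)
    calc q.r ^ 3 * q.z * q.r ^ p = q.r ^ p * q.r ^ 3 * q.z := by ring
      _ ≤ q.r ^ p * q.r ^ 3 * 1 := by gcongr
      _ = _ := by simp
  refine ⟨Ser₂.X_mul graded_wtCls.mod hF.1, ?_, ?_⟩
  · have h1 := Bd.monomial_mul hS hF.2.1 1 0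
    refine (h1.mono one_nonneg 1 (fun q hq => by simpa using hr q hq)
      (rpow_nonneg_of_mem hS _)).congr fun q _ => ?_
    funext y; simp [slices]
  · have h1 := (Bd.monomial_mul hS hF.2.2 1 0).mono one_nonneg
      1 (fun q hq => by
        have h2 := S₁.x_pos (hS hq)
        have h3 := S₁.z_pos (hS hq)
        simp
        rw [← mul_assoc]
        have := hr q hq
        gcongr) (errW_nonneg hS _ _)
    obtain ⟨N, rfl⟩ : ∃ N, M = N + 1 := ⟨M - 1, by omega⟩
    have h2 : Bd S (fun _ => 1) (fun q => q.r ^ (p + 3) * (q.x ^ (N + 1) + q.z ^ (N + 1)))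
        (fun q y => ∑ k ∈ range (N + 1), (q.1 : ℂ) ^ (N + 1) * (q.2.2.1 : ℂ) ^ k *
          coeff k (coeff N (s q.2.1)) y q.2.2.2) :=
      Bd.sum _ one_nonneg (errW_nonneg hS _ _) fun k _ =>
        small_monomial hS hε hh (Or.inl le_rfl) (WtCls.monomial hS (N + 1) k (by
            have := hF.1 N k
            rwa [show p + 3 - 3 * ((N + 1 : ℕ) : ℤ) - 2 * (k : ℤ) = p - 3 * N - 2 * k by
              push_cast; ring]))
    refine (h1.add h2).congr fun q _ => ?_
    funext y
    simp only [slices, evS, Pi.smul_apply]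
    rw [sum_range_succ' (fun j => ∑ k ∈ range (N + 1), (q.1 : ℂ) ^ j *
      (q.2.2.1 : ℂ) ^ k * coeff k (coeff j
        ((X : FS₂ n) * s q.2.1)) y
        q.2.2.2) N]
    simp
    rw [sum_range_succ (fun j => ∑ k ∈ range (N + 1), (q.1 : ℂ) ^ j *
      (q.2.2.1 : ℂ) ^ k * coeff k (coeff j (s q.2.1)) y q.2.2.2) N]
    simp only [mul_add, mul_sub, mul_sum]
    ring

end

/-! ### The expansion of the perturbation -/

theorem mpow_deta_sub {a b : Sym n} (ha : SmoothSym a) (hb : SmoothSym b) (α : Fin n → ℕ) :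
    mpow deta α (a - b) = mpow deta α a - mpow deta α b := by
  rw [mpow_deta_coe α ⟨a, ha⟩, mpow_deta_coe α ⟨b, hb⟩]
  have h := mpow_deta_coe α (⟨a, ha⟩ - ⟨b, hb⟩ : smoothSyms n)
  rw [map_sub] at h
  exact h

theorem mpow_deta_smul {a : Sym n} (ha : SmoothSym a) (c : ℂ) (α : Fin n → ℕ) :
    mpow deta α (c • a) = c • mpow deta α a := by
  rw [mpow_deta_coe α ⟨a, ha⟩]
  have h := mpow_deta_coe α (c • ⟨a, ha⟩ : smoothSyms n)
  rw [map_smul] at h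
  exact h

theorem mpow_deta_sum {κ : Type*} (s : Finset κ) {a : κ → Sym n} (ha : ∀ i ∈ s, SmoothSym (a i))
    (α : Fin n → ℕ) : mpow deta α (∑ i ∈ s, a i) = ∑ i ∈ s, mpow deta α (a i) := by
  have h := mpow_deta_coe α (∑ i ∈ s.attach, ⟨a i, ha i i.2⟩ : smoothSyms n)
  rw [map_sum] at h
  simp only [Submodule.coe_sum, ← mpow_deta_coe] at h
  rwa [Finset.sum_attach s a, Finset.sum_attach s fun i => mpow deta α (a i)] at h

theorem Bd.mpow_deta {ι : Type*} {S : Set ι} {w : ι → ℝ} {a : ι → Sym n}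
    (h : Bd S (fun _ => 1) w (fun i => unc (a i))) (α : Fin n → ℕ) :
    Bd S (fun _ => 1) w (fun i => unc (mpow deta α (a i))) :=
  mpow_family_induction (fun b : ι → Sym n => Bd S (fun _ => 1) w (fun i => unc (b i)))
    (fun j b hb => by simpa using Bd.deta hb j) α h

/-- The parameters `(h, μ, t)`. -/
def T₁ (ε h₁ : ℝ) : Set (ℝ × ℝ × ℝ) :=
  {p | 0 < p.1 ∧ p.1 ≤ h₁ ∧ p.1 ^ (2 / 3 - ε) ≤ |p.2.1| ∧ |p.2.1| ≤ 1 ∧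
    p.2.2 ∈ Ioo (0 : ℝ) 1}

section
variable [NeZero n] {Y : Set (E n)} {ε h₁ : ℝ} {m : ℝ → ℝ → ℝ → Sym n} {mj : ℕ → ℝ → ℝ → Sym n}

namespace IsModelPerturbation

/-- `(μ, t)` with `0 < t < 1`. -/
def T₀ : Set (ℝ × ℝ) := {p | 0 < |p.1| ∧ |p.1| ≤ 1 ∧ p.2 ∈ Ioo (0 : ℝ) 1}

theorem mem_T₀ {p : ℝ × ℝ × ℝ} (hp : p ∈ T₁ ε h₁) : (p.2.1, p.2.2) ∈ T₀ :=
  ⟨(rpow_pos_of_pos hp.1 _).trans_le hp.2.2.1, hp.2.2.2.1, hp.2.2.2.2⟩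

variable (H : IsModelPerturbation Y ε m mj)
include H

theorem jointBd_mj (j : ℕ) : JointBd T₀ (fun p => mj j p.1 p.2) := by
  refine ((H.jointBd j 0).mono_set fun p hp =>
    ⟨hp.1, hp.2.1, Set.Ioo_subset_Icc_self hp.2.2⟩).congr fun p _ => ?_
  funext x
  simp [unc, dtWithin]

theorem norm_taylor_le (j K : ℕ) : ∃ C : ℝ, 0 ≤ C ∧ ∀ p ∈ T₀, ∀ y η : E n,
    ‖mj j p.1 p.2 y η - ∑ k ∈ range (K + 1), (p.2 : ℂ) ^ k * taylorCoeff mj p.1 k j y η‖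
      ≤ C * p.2 ^ (K + 1) := by
  obtain ⟨C, hC, hb⟩ := (H.jointBd j (K + 1)).le
  refine ⟨C, hC, fun p hp y η => ?_⟩
  have hs : ContDiffOn ℝ (K + 1) (fun s => mj j p.1 s y η) (Set.Icc 0 1) := by
    have h1 := H.smooth j p.1 hp.1 hp.2.1
    have h2 : ContDiffOn ℝ ∞ (fun s : ℝ => (s, y, η)) (Set.Icc 0 1) :=
      (contDiff_id.prodMk contDiff_const).contDiffOn
    exact (h1.comp h2 fun s hs => ⟨hs, trivial⟩).of_le (mod_cast le_top)
  have h3 := taylor_mean_remainder_bound zero_le_one hs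
    (Set.Ioo_subset_Icc_self hp.2.2) fun s hs => by
      have := hb (p.1, s) ⟨hp.1, hp.2.1, hs⟩ (y, η)
      simpa [unc, dtWithin] using this
  rw [taylor_within_apply, sub_zero] at h3
  refine le_trans (le_of_eq ?_) (h3.trans (div_le_self ?_ ?_))
  · congr 2
    refine sum_congr rfl fun k _ => ?_
    rw [real_smul, taylorCoeff, dtWithin]
    push_cast
    ring
  · have := hp.2.2.1; positivity
  · exact_mod_cast K.factorial_pos

theorem bd_rem (j : ℕ) {M : ℕ} (hM : 1 ≤ M) : Bd T₀ (fun _ => 1) (fun p => p.2 ^ M)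
    (fun p => unc (mj j p.1 p.2 - ∑ k ∈ range (2 * M),
      ((p.2 : ℂ) ^ k) • taylorCoeff mj p.1 k j)) := by
  have h1 : JointBd T₀ (fun p => mj j p.1 p.2 - ∑ k ∈ range (2 * M),
      ((p.2 : ℂ) ^ k) • taylorCoeff mj p.1 k j) := by
    have h2 : Bd T₀ (fun _ => 1) (fun _ => 1) (fun p x => ∑ k ∈ range (2 * M),
        (p.2 : ℂ) ^ k * unc (taylorCoeff mj p.1 k j) x) := by
      refine Bd.sum _ one_nonneg one_nonneg fun k _ => ?_
      have h3 := ((H.jointBd_taylorCoeff k j).comp_index (fun p : ℝ × ℝ => p.1) (T := T₀)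
        fun p hp => ⟨hp.1, hp.2.1⟩).const_mul one_nonneg (fun p => (p.2 : ℂ) ^ k)
        1 one_nonneg fun p hp => by
          rw [norm_pow, norm_real, norm_eq_abs, abs_of_pos hp.2.2.1, one_mul]
          exact pow_le_one₀ hp.2.2.1.le hp.2.2.2.le
      simpa using h3
    refine ((H.jointBd_mj j).sub h2).congr fun p _ => ?_
    funext x
    simp [unc]
  obtain ⟨C, hC, hb⟩ := H.norm_taylor_le j (2 * M - 1)
  rw [show 2 * M - 1 + 1 = 2 * M by omega] at hb
  refine (h1.interpolate (A := fun p => p.2 ^ (2 * M)) (fun p hp => pow_pos hp.2.2.1 _)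
    (fun p hp => pow_le_one₀ hp.2.2.1.le hp.2.2.2.le) C (fun p hp x => ?_) (1 / 2)
    (by norm_num)).congr_weight fun p hp => ?_
  · have := hb p hp x.1 x.2
    simpa [unc] using this
  · rw [pow_mul', sq, Real.mul_rpow (pow_nonneg hp.2.2.1.le _) (pow_nonneg hp.2.2.1.le _),
      ← rpow_add (pow_pos hp.2.2.1 _)]
    norm_num

/-- The remainder of the double expansion of `m`. -/
def remM (m : ℝ → ℝ → ℝ → Sym n) (mj : ℕ → ℝ → ℝ → Sym n) (M : ℕ) (p : ℝ × ℝ × ℝ) : Sym n :=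
  m p.1 p.2.1 p.2.2 - ∑ j ∈ range M, ∑ k ∈ range M,
    ((p.1 : ℂ) ^ j * (p.2.2 : ℂ) ^ k) • taylorCoeff mj p.2.1 k j

/-- The bound for the remainder. -/
abbrev RemBd (m : ℝ → ℝ → ℝ → Sym n) (mj : ℕ → ℝ → ℝ → Sym n) (M : ℕ) (ε h₁ : ℝ) : Prop :=
  Bd (T₁ ε h₁) (fun _ => 1) (fun p => p.2.2 ^ M + p.1 ^ M) (fun p => unc (remM m mj M p))

theorem exists_bd : ∃ h₁ : ℝ, 0 < h₁ ∧ h₁ ≤ 1 ∧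
    JointBd (T₁ ε h₁) (fun p => m p.1 p.2.1 p.2.2) ∧
    ∀ M, 1 ≤ M → RemBd m mj M ε h₁ := by
  obtain ⟨h₁, hh₁, hexp⟩ := H.expansion
  refine ⟨min h₁ 1, lt_min hh₁ one_pos, min_le_right _ _, ?_⟩
  set T := T₁ ε (min h₁ 1) with hT
  have hc1 : ∀ p ∈ T, p.1 ≤ 1 := fun p hp => hp.2.1.trans (min_le_right _ _)
  have h01 : ∀ p ∈ T, (0 : ℝ) ≤ 1 := fun _ _ => zero_le_one
  have hmono : ∀ (j k : ℕ), ∀ p ∈ T, ‖(p.1 : ℂ) ^ j * (p.2.2 : ℂ) ^ k‖ = p.1 ^ j * p.2.2 ^ k := by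
    intro j k p hp
    rw [norm_mul, norm_pow, norm_pow, norm_real, norm_real, norm_eq_abs,
      norm_eq_abs, abs_of_pos hp.1, abs_of_pos hp.2.2.2.2.1]
  have hsharp : ∀ M, 1 ≤ M → JointBd T (fun p y η => ((p.1 : ℂ) ^ M)⁻¹ *
      (m p.1 p.2.1 p.2.2 y η - ∑ j ∈ range M, (p.1 : ℂ) ^ j * mj j p.2.1 p.2.2 y η)) := by
    intro M hM
    have := (hexp (M - 1)).bd
    rw [show M - 1 + 1 = M by omega] at this
    exact this.mono_set fun p hp => ⟨hp.1, hp.2.1.trans (min_le_left _ _), hp.2.2⟩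
  have hmj : ∀ j, JointBd T (fun p => mj j p.2.1 p.2.2) := fun j =>
    (H.jointBd_mj j).comp_index (fun p : ℝ × ℝ × ℝ => (p.2.1, p.2.2)) fun p hp => mem_T₀ hp
  constructor
  · have h1 := (hsharp 1 le_rfl).const_mul h01 (fun p => (p.1 : ℂ)) 1
      h01 fun p hp => by
        rw [norm_real, norm_eq_abs, abs_of_pos hp.1]; simpa using hc1 p hp
    simp at h1
    refine (h1.add (hmj 0)).congr fun p hp => ?_
    funext x
    have : (p.1 : ℂ) ≠ 0 := mod_cast hp.1.ne'
    simp [unc, this]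
  · intro M hM
    have hw : ∀ p ∈ T, 0 ≤ p.2.2 ^ M + p.1 ^ M := fun p hp =>
      add_nonneg (pow_nonneg hp.2.2.2.2.1.le _) (pow_nonneg hp.1.le _)
    have h1 : Bd T (fun _ => 1) (fun p => p.2.2 ^ M + p.1 ^ M) (fun p x =>
        ∑ j ∈ range M, (p.1 : ℂ) ^ j * unc (mj j p.2.1 p.2.2 -
          ∑ k ∈ range (2 * M), ((p.2.2 : ℂ) ^ k) • taylorCoeff mj p.2.1 k j) x) := by
      refine Bd.sum _ h01 hw fun j _ => ?_
      have h2 := ((H.bd_rem j hM).comp_index (fun p : ℝ × ℝ × ℝ => (p.2.1, p.2.2))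
        fun p hp => mem_T₀ hp).const_mul h01 (fun p => (p.1 : ℂ) ^ j) 1
        h01 fun p hp => by
          have := hmono j 0 p hp
          simp only [pow_zero, mul_one] at this
          rw [this, mul_one]; exact pow_le_one₀ hp.1.le (hc1 p hp)
      exact h2.mono h01 1 (fun p hp => by
        have := pow_nonneg hp.1.le M
        simp; linarith) hw
    have h3 : Bd T (fun _ => 1) (fun p => p.2.2 ^ M + p.1 ^ M) (fun p x =>
        ∑ j ∈ range M, ∑ k ∈ range (2 * M), if M ≤ k then
          (p.1 : ℂ) ^ j * (p.2.2 : ℂ) ^ k * unc (taylorCoeff mj p.2.1 k j) x else 0) := by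
      refine Bd.sum _ h01 hw fun j _ => Bd.sum _ h01 hw fun k _ => ?_
      split_ifs with hk
      · refine (((H.jointBd_taylorCoeff k j).comp_index (fun p : ℝ × ℝ × ℝ => p.2.1)
          fun p hp => ⟨(mem_T₀ hp).1, (mem_T₀ hp).2.1⟩).const_mul h01
          (fun p => (p.1 : ℂ) ^ j * (p.2.2 : ℂ) ^ k) 1 hw fun p hp => ?_).congr_weight
          fun p _ => mul_one _
        rw [hmono j k p hp, one_mul]
        have h4 := hp.2.2.2.2.1
        have h5 := pow_le_one₀ (n := j) hp.1.le (hc1 p hp)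
        have h6 := pow_le_pow_of_le_one h4.le hp.2.2.2.2.2.le hk
        have h7 := pow_nonneg hp.1.le M
        have h8 := pow_nonneg h4.le k
        nlinarith
      · exact Bd.zero h01 hw
    have h4 : Bd T (fun _ => 1) (fun p => p.2.2 ^ M + p.1 ^ M) (fun p x => (p.1 : ℂ) ^ M *
        unc (fun y η => ((p.1 : ℂ) ^ M)⁻¹ * (m p.1 p.2.1 p.2.2 y η -
          ∑ j ∈ range M, (p.1 : ℂ) ^ j * mj j p.2.1 p.2.2 y η)) x) := by
      refine ((hsharp M hM).const_mul h01 (fun p => (p.1 : ℂ) ^ M) 1 hw fun p hp => ?_).congr_weight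
        fun p _ => mul_one _
      have := hmono M 0 p hp
      simp only [pow_zero, mul_one] at this
      have h5 := pow_nonneg hp.2.2.2.2.1.le M
      rw [this, one_mul]; linarith
    refine ((h1.add h3).add h4).congr fun p hp => ?_
    funext x
    have hne : (p.1 : ℂ) ^ M ≠ 0 := pow_ne_zero _ (mod_cast hp.1.ne')
    have h5 : ∀ j, ∑ k ∈ range (2 * M), (p.2.2 : ℂ) ^ k * taylorCoeff mj p.2.1 k j x.1 x.2 =
        ∑ k ∈ range M, (p.2.2 : ℂ) ^ k * taylorCoeff mj p.2.1 k j x.1 x.2 +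
        ∑ k ∈ range (2 * M), if M ≤ k then
          (p.2.2 : ℂ) ^ k * taylorCoeff mj p.2.1 k j x.1 x.2 else 0 := fun j => by
      rw [← Finset.sum_filter_add_sum_filter_not (range (2 * M)) (· < M)]
      congr 1
      · congr 1; ext k; simp; omega
      · rw [← Finset.sum_filter]; simp
    simp only [unc, Pi.sub_apply, Finset.sum_apply, Pi.smul_apply, smul_eq_mul, remM,
      mul_inv_cancel_left₀ hne, h5]
    have h6 : ∀ j, (∑ k ∈ range (2 * M), if M ≤ k then
        (p.1 : ℂ) ^ j * (p.2.2 : ℂ) ^ k * taylorCoeff mj p.2.1 k j x.1 x.2 else 0) =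
        (p.1 : ℂ) ^ j * ∑ k ∈ range (2 * M), if M ≤ k then
          (p.2.2 : ℂ) ^ k * taylorCoeff mj p.2.1 k j x.1 x.2 else 0 := fun j => by
      rw [mul_sum]
      refine sum_congr rfl fun k _ => ?_
      split_ifs <;> ring
    simp only [h6]
    simp only [mul_assoc, ← mul_sum, mul_sub, mul_add, sum_sub_distrib,
      sum_add_distrib]
    ring

end IsModelPerturbation

/-- The derivatives `∂_η^α m` have the expected expansions. -/
theorem Expn.perturbation (H : IsModelPerturbation Y ε m mj)
    {M : ℕ} (hb : JointBd (T₁ ε h₁) (fun p => m p.1 p.2.1 p.2.2))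
    (hrem : IsModelPerturbation.RemBd m mj M ε h₁) (α : Fin n → ℕ) :
    Expn (S₁ n ε h₁) M 0 (fun h μ t => mpow deta α (m h μ t))
      (fun μ => ∂ηm(mj, α, μ)) := by
  have hmem : ∀ q ∈ S₁ n ε h₁, (q.1, q.2.1, q.2.2.1) ∈ T₁ ε h₁ := fun q hq =>
    ⟨hq.1, hq.2.1, hq.2.2.1, hq.2.2.2.1, hq.2.2.2.2.1⟩
  refine ⟨Ser₂.mono graded_wtCls.mod (H.ser₂_wtCls α) (by norm_num), ?_, ?_⟩
  · have h1 := (Bd.slice (hb.mpow_deta α)).comp_index (fun q : Par n =>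
      ((q.1, q.2.1, q.2.2.1), q.2.2.2)) hmem
    exact h1
  · have h1 := (Bd.slice (hrem.mpow_deta α)).comp_index (fun q : Par n =>
      ((q.1, q.2.1, q.2.2.1), q.2.2.2)) hmem
    refine (h1.mono one_nonneg (8 ^ M) (fun q hq => ?_)
      (errW_nonneg subset_rfl M 0)).congr fun q hq => ?_
    · simp
      conv_lhs => rw [S₁.t_eq hq, S₁.h_eq hq]
      have h2 := S₁.r_pos hq
      have h3 := S₁.r_le hq
      have h4 := S₁.x_pos hq
      have h5 := S₁.z_pos hq
      rw [mul_add, ← mul_pow, ← mul_pow]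
      have h6 : q.r ^ 2 ≤ 8 := by nlinarith
      have h7 : q.r ^ 3 ≤ 8 := by
        calc q.r ^ 3 ≤ 2 ^ 3 := by gcongr
          _ = 8 := by norm_num
      gcongr
    · have hp := IsModelPerturbation.mem_T₀ (hmem q hq)
      have hs : ∀ k j, SmoothSym (taylorCoeff mj q.2.1 k j) := fun k j =>
        (H.jointBd_taylorCoeff k j).1 _ ⟨hp.1, hp.2.1⟩
      have hs' := fun k j c =>
        (hs k j).smul c
      simp only [IsModelPerturbation.remM]
      rw [mpow_deta_sub (hb.1 _ (hmem q hq)) (SmoothSym.sum _ fun j _ => SmoothSym.sum _ fun k _ =>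
        hs' k j _), mpow_deta_sum _ fun j _ => SmoothSym.sum _ fun k _ => hs' k j _]
      simp only [mpow_deta_sum _ fun k _ => hs' k _ _, mpow_deta_smul (hs _ _)]
      simp [slices, evS, mapCoeff, mSeries]

end

section
variable [NeZero n] {Y : Set (E n)} {ε h₁ : ℝ} {m : ℝ → ℝ → ℝ → Sym n} {mj : ℕ → ℝ → ℝ → Sym n}
  {p p' : ℤ} {S : Set (Par n)} {M : ℕ}

/-! ### The phase and the amplitude as functions of `t` -/

theorem hasDerivAt_evS {N : ℕ} {s : ℝ → FS₂ n} {μ : ℝ}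
    (hs : ∀ j, coeff N (coeff j (s μ)) = 0) (h t : ℝ) (y η : E n) :
    HasDerivAt (fun t => evS N s h μ t y η) (evS N (fun μ => mapCoeff dt (s μ)) h μ t y η) t := by
  refine HasDerivAt.fun_sum fun j _ => ?_
  have h1 : HasDerivAt (fun t : ℝ => ∑ k ∈ range N, (h : ℂ) ^ j * (t : ℂ) ^ k *
      coeff k (coeff j (s μ)) y η)
      (∑ k ∈ range N, (h : ℂ) ^ j * ((k : ℂ) * (t : ℂ) ^ (k - 1)) *
        coeff k (coeff j (s μ)) y η) t := by
    refine HasDerivAt.fun_sum fun k _ => HasDerivAt.mul_const (HasDerivAt.const_mul _ ?_) _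
    simpa using ((hasDerivAt_id t).ofReal_comp).fun_pow k
  refine h1.congr_deriv ?_
  have h2 := sum_range_succ (fun k => (h : ℂ) ^ j * ((k : ℂ) * (t : ℂ) ^ (k - 1)) *
        coeff k (coeff j (s μ)) y η) N
  rw [hs j] at h2
  simp at h2
  rw [← h2, sum_range_succ']
  simp
  refine sum_congr rfl fun k _ => ?_
  simp only [mapCoeff, dt, coeff_mk, Pi.smul_apply]
  ring

theorem mapCoeff_dt_C (s : FS n) :
    mapCoeff dt (C s) = C (dt s) := by
  have h0 : dt (0 : FS n) = 0 := by
    ext k : 1; simp [dt]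
  ext j : 1
  simp only [mapCoeff, coeff_mk, coeff_C]
  split_ifs <;> simp [h0]

theorem mapCoeff_dy_C (i : Fin n) (s : FS n) :
    mapCoeff (mapCoeff (dy i)) (C s) = C (mapCoeff (dy i) s) := by
  have h0 : mapCoeff (dy i) (0 : FS n) = 0 := by
    ext k : 1; simp [mapCoeff, dy_zero]
  ext j : 1
  simp only [mapCoeff, coeff_mk, coeff_C]
  split_ifs
  · rfl
  · exact h0

/-- The phase as a series in `(h, t)`. -/
def phase₂ (M : ℕ) (mj : ℕ → ℝ → ℝ → Sym n) (μ : ℝ) : FS₂ n :=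
  C (phase M mj μ)

theorem phaseFun_eq_evS (h μ t : ℝ) : phaseFun M mj μ t = evS (M + 1) (phase₂ M mj) h μ t := by
  funext y η
  simp only [phaseFun, evS, phase₂, coeff_C]
  symm
  rw [sum_eq_single 0 (fun j _ hj => by simp [hj]) (by simp), sum_range_succ',
    show Icc 1 M = Finset.Ico 1 (M + 1) by ext k; simp, Finset.sum_Ico_eq_sum_range]
  simp only [if_true, phase, coeff_zero_phaseAux, Pi.zero_apply, add_zero, pow_zero,
    one_mul]
  exact sum_congr rfl fun k _ => by rw [add_comm]

theorem coeff_phase₂ (hM : 1 ≤ M) (μ : ℝ) (k j : ℕ) (hk : M < k) :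
    coeff k (coeff j (phase₂ M mj μ)) = 0 := by
  rw [phase₂, coeff_C]
  split_ifs
  · exact coeff_phaseAux_of_gt (M - 1) k (by omega)
  · simp

theorem coeff_mapCoeff_dt {s : FS₂ n}
    (hs : ∀ k j, M < k → coeff k (coeff j s) = 0) (k j : ℕ) (hk : M < k) :
    coeff k (coeff j (mapCoeff dt s)) = 0 := by
  simp only [mapCoeff, dt, coeff_mk]
  rw [hs _ _ (by omega), smul_zero]

/-- `∂_t^i φ`. -/
def phaseD (M : ℕ) (mj : ℕ → ℝ → ℝ → Sym n) (i : ℕ) (h μ t : ℝ) : Sym n :=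
  evS (M + 1) (fun μ => (mapCoeff dt)^[i] (phase₂ M mj μ)) h μ t

/-- `∂_t^i a`. -/
def ampD (χ : ℝ → ℂ) (M : ℕ) (mj : ℕ → ℝ → ℝ → Sym n) (i : ℕ) (h μ t : ℝ) : Sym n :=
  evS (M + 1) (fun μ => (mapCoeff dt)^[i] (amp χ M mj μ)) h μ t

theorem hasDerivAt_iterate {s : ℝ → FS₂ n} {μ : ℝ}
    (hs : ∀ k j, M < k → coeff k (coeff j (s μ)) = 0) (i : ℕ)
    (h t : ℝ) (y η : E n) :
    HasDerivAt (fun t => evS (M + 1) (fun μ => (mapCoeff dt)^[i] (s μ)) h μ t y η)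
      (evS (M + 1) (fun μ => (mapCoeff dt)^[i + 1] (s μ)) h μ t y η) t := by
  have h1 : ∀ i k j, M < k →
      coeff k (coeff j ((mapCoeff dt)^[i] (s μ))) = 0 := by
    intro i
    induction i with
    | zero => exact hs
    | succ i ih =>
      rw [iterate_succ_apply']
      exact coeff_mapCoeff_dt ih
  simp only [iterate_succ_apply']
  exact hasDerivAt_evS (fun j => h1 i (M + 1) j (by omega)) h t y η

theorem hasDerivAt_phaseD (hM : 1 ≤ M) (i : ℕ) (h μ t : ℝ) (y η : E n) :
    HasDerivAt (fun t => phaseD M mj i h μ t y η) (phaseD M mj (i + 1) h μ t y η) t :=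
  hasDerivAt_iterate (fun k j hk => coeff_phase₂ hM μ k j hk) i h t y η

theorem hasDerivAt_ampD (χ : ℝ → ℂ) (i : ℕ) (h μ t : ℝ) (y η : E n) :
    HasDerivAt (fun t => ampD χ M mj i h μ t y η) (ampD χ M mj (i + 1) h μ t y η) t :=
  hasDerivAt_iterate (fun k j hk => coeff_amp_eq_zero χ j k (Or.inr hk)) i h t y η

/-! ### The transport operator on functions -/

/-- `e^{-iφ/h} (-ih ∂_{y_i}) e^{iφ/h}`. -/
def conjS (φ : Sym n) (h : ℝ) (i : Fin n) (b : Sym n) : Sym n :=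
  dy i φ * b - I • ((h : ℂ) • dy i b)

/-- The transport operator applied to the true amplitude, with the true perturbation. -/
def transportFun (χ : ℝ → ℂ) (M : ℕ) (m : ℝ → ℝ → ℝ → Sym n) (mj : ℕ → ℝ → ℝ → Sym n)
    (h μ t : ℝ) : Sym n :=
  (phaseD M mj 1 h μ t * phaseD M mj 1 h μ t + dy 0 (phaseD M mj 0 h μ t) - rho n μ ^ 2) *
      ampD χ M mj 0 h μ t
    - I • ((h : ℂ) • (phaseD M mj 2 h μ t * ampD χ M mj 0 h μ t))
    - (2 * I) • ((h : ℂ) • (phaseD M mj 1 h μ t * ampD χ M mj 1 h μ t))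
    - I • ((h : ℂ) • dy 0 (ampD χ M mj 0 h μ t))
    - (h : ℂ) • ((h : ℂ) • ampD χ M mj 2 h μ t)
    + multiSum M fun α => invFact α •
        (mpow deta α (m h μ t) * mpow (conjS (phaseD M mj 0 h μ t) h) α (ampD χ M mj 0 h μ t))

theorem Expn.zero' (hS : S ⊆ S₁ n ε h₁) : Expn S M p (fun _ _ _ => 0) (fun _ => 0) := by
  refine ⟨Ser₂.zero graded_wtCls.mod, Bd.zero one_nonneg (rpow_nonneg_of_mem hS p),
    (Bd.zero one_nonneg (errW_nonneg hS M p)).congr fun q _ => ?_⟩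
  simp [slices, evS]

theorem Expn.sum (hS : S ⊆ S₁ n ε h₁) {κ : Type*} (A : Finset κ) {F : κ → ℝ → ℝ → ℝ → Sym n}
    {s : κ → ℝ → FS₂ n} (h : ∀ i ∈ A, Expn S M p (F i) (s i)) :
    Expn S M p (fun h μ t => ∑ i ∈ A, F i h μ t) (fun μ => ∑ i ∈ A, s i μ) := by
  classical
  induction A using induction_on with
  | empty => simpa using Expn.zero' hS
  | insert i A hi ih =>
    simp only [Finset.sum_insert hi]
    exact Expn.add hS (h i (by simp)) (ih fun j hj => h j (by simp [hj]))

theorem Expn.const (hS : S ⊆ S₁ n ε h₁) (hε : 0 < ε) (hh : h₁ ≤ 1) (hM : 1 ≤ M) {c : ℝ → Sym n}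
    (hc : WtCls p c) :
    Expn S M p (fun _ μ _ => c μ) (fun μ => C (C (c μ))) := by
  have h := Expn.evS hS hε hh (Ser₂.C graded_wtCls.mod (Ser.C graded_wtCls.mod hc)) (le_refl M)
  have e : evS M (fun μ => C (C (c μ))) =
      fun _ μ _ => c μ := by
    funext h μ t y η
    obtain ⟨N, rfl⟩ : ∃ N, M = N + 1 := ⟨M - 1, by omega⟩
    simp only [evS, coeff_C]
    rw [sum_eq_single 0 (fun j _ hj => by simp [hj]) (by simp),
      sum_eq_single 0 (fun j _ hj => by simp [coeff_C, hj]) (by simp)]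
    simp
  rwa [e] at h

theorem Ser₂.iterate_dt {s : ℝ → FS₂ n} (hs : Ser₂ WtCls p s) (i : ℕ) :
    Ser₂ WtCls (p - 2 * i) (fun μ => (mapCoeff dt)^[i] (s μ)) := by
  induction i with
  | zero => simpa using hs
  | succ i ih =>
    simp only [iterate_succ_apply']
    rw [show p - 2 * ((i + 1 : ℕ) : ℤ) = p - 2 * i - 2 by push_cast; ring]
    exact Ser₂.dt graded_wtCls.mod ih

namespace IsModelPerturbation
variable (H : IsModelPerturbation Y ε m mj)
include H

theorem expn_phaseD (hS : S ⊆ S₁ n ε h₁) (hε : 0 < ε) (hh : h₁ ≤ 1) (i : ℕ) :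
    Expn S M (3 - 2 * i) (phaseD M mj i) (fun μ => (mapCoeff dt)^[i] (phase₂ M mj μ)) :=
  Expn.evS hS hε hh (Ser₂.iterate_dt (Ser₂.C graded_wtCls.mod (H.ser_phase_wtCls M)) i)
    (Nat.le_succ M)

theorem expn_ampD (hS : S ⊆ S₁ n ε h₁) (hε : 0 < ε) (hh : h₁ ≤ 1) {χ : ℝ → ℂ}
    (hχ : ContDiff ℝ ∞ χ) (h2 : ∀ σ, 2 ≤ |σ| → χ σ = 0) (i : ℕ) :
    Expn S M (0 - 2 * i) (ampD χ M mj i) (fun μ => (mapCoeff dt)^[i] (amp χ M mj μ)) :=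
  Expn.evS hS hε hh (Ser₂.iterate_dt (H.ser₂_amp_wtCls hχ h2 M) i) (Nat.le_succ M)

theorem bd_transportFun (hε : 0 < ε) (hh : h₁ ≤ 1) (hM : 1 ≤ M)
    (hb : JointBd (T₁ ε h₁) (fun p => m p.1 p.2.1 p.2.2))
    (hrem : RemBd m mj M ε h₁)
    {χ : ℝ → ℂ} (hχ : ContDiff ℝ ∞ χ) (h2 : ∀ σ, 2 ≤ |σ| → χ σ = 0) :
    Bd (S₁ n ε h₁) (fun _ => 1) (fun q => q.x ^ M + q.z ^ M)
      (slices (transportFun χ M m mj)) := by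
  have hS : S₁ n ε h₁ ⊆ S₁ n ε h₁ := subset_rfl
  have hφ := H.expn_phaseD (M := M) hS hε hh
  have ha := H.expn_ampD (M := M) hS hε hh hχ h2
  have hρ : Expn (S₁ n ε h₁) M 2 (fun _ μ _ => rho n μ * rho n μ)
      (fun μ => C (C (rho n μ * rho n μ))) :=
    Expn.const hS hε hh hM (WtCls.mul graded_wtCls.rho graded_wtCls.rho)
  have e1 := Expn.mul hS hε hh (Expn.sub hS (Expn.add hS (Expn.mul hS hε hh (hφ 1) (hφ 1))
    (Expn.mono hS (by norm_num) (Expn.dy hS 0 (hφ 0)))) hρ) (ha 0)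
  have e2 := Expn.smul hS I (Expn.h_mul hS hε hh hM (Expn.mul hS hε hh (hφ 2) (ha 0)))
  have e3 := Expn.smul hS (2 * I)
    (Expn.h_mul hS hε hh hM (Expn.mul hS hε hh (hφ 1) (ha 1)))
  have e4 := Expn.smul hS I (Expn.h_mul hS hε hh hM (Expn.dy hS 0 (ha 0)))
  have e5 := Expn.h_mul hS hε hh hM (Expn.h_mul hS hε hh hM (ha 2))
  have hc : ∀ α : Fin n → ℕ, Expn (S₁ n ε h₁) M 0
      (fun h μ t => mpow (conjS (phaseD M mj 0 h μ t) h) α (ampD χ M mj 0 h μ t))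
      (fun μ => mpow (conjD (phase M mj μ)) α (amp χ M mj μ)) := by
    intro α
    unfold mpow
    induction finRange n with
    | nil => simpa using! ha 0
    | cons j l ih =>
      simp
      induction α j with
      | zero => exact ih
      | succ k ihk =>
        simp only [iterate_succ_apply']
        have h3 := Expn.mono hS (p' := 0) (by norm_num) (Expn.mul hS hε hh (Expn.dy hS j (hφ 0)) ihk)
        have h4 := Expn.mono hS (p' := 0) (by norm_num)
          (Expn.smul hS I (Expn.h_mul hS hε hh hM (Expn.dy hS j ihk)))
        have h5 := Expn.sub hS h3 h4
        simp only [Function.iterate_zero, id, phase₂, mapCoeff_dy_C] at h5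
        exact h5
  have e6 := Expn.sum hS (range (M + 1)) fun k _ =>
    Expn.sum hS (piAntidiag Finset.univ k) fun α _ =>
      Expn.smul hS (invFact α) (Expn.mul hS hε hh (Expn.perturbation H hb hrem α) (hc α))
  have e := Expn.add hS (Expn.sub hS (Expn.sub hS (Expn.sub hS (Expn.sub hS
    (Expn.mono hS (by norm_num) e1) (Expn.mono hS (by norm_num) e2))
    (Expn.mono hS (by norm_num) e3)) (Expn.mono hS (by norm_num) e4))
    (Expn.mono hS (by norm_num) e5)) (Expn.mono hS (p' := 0) (by norm_num) e6)
  have h3 := e.2.2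
  simp only [zpow_zero, one_mul] at h3
  refine h3.congr fun q hq => ?_
  funext y
  have h4 : ∀ s : ℝ → FS₂ n,
      (∀ μ, s μ = transport M mj μ (amp χ M mj μ)) → slices (evS M s) q y = 0 := by
    intro s hs
    have hp := S₁.mem hq
    simp only [slices, evS, hs]
    refine sum_eq_zero fun j hj => sum_eq_zero fun k hk => ?_
    rw [H.coeff_transport hχ hM hp.1 hp.2.1 j k (by have := mem_range.1 hj; omega)
      (mem_range.1 hk)]
    simp
  rw [h4, sub_zero]
  · simp only [slices, transportFun, multiSum, sq]
  · intro μ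
    rw [transport, multiSum]
    simp only [iterate_succ_apply', Function.iterate_zero, id, phase₂, mapCoeff_dt_C,
      mapCoeff_dy_C, mapCoeff_dt_dt, sq, map_add, map_sub, map_mul, mul_assoc]

end IsModelPerturbation
end

section
variable [NeZero n] {Y : Set (E n)} {ε h₁ : ℝ} {m : ℝ → ℝ → ℝ → Sym n} {mj : ℕ → ℝ → ℝ → Sym n}
  {M : ℕ} {q : Par n}

/-! ### The imaginary part of the phase -/

/-- The imaginary part of `ϱ`. -/
def Par.im (q : Par n) : ℝ := (rho n q.2.1 0 q.2.2.2).im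

/-- The decay rate `t Im ϱ / h`. -/
def Par.s (q : Par n) : ℝ := q.2.2.1 * q.im / q.1

theorem S₁.im_pos (hq : q ∈ S₁ n ε h₁) : 0 < q.im := rho_im_pos n q.2.1 (abs_pos.1 (S₁.mu_pos hq)) _ _

theorem S₁.s_pos (hq : q ∈ S₁ n ε h₁) : 0 < q.s :=
  div_pos (mul_pos hq.2.2.2.2.1.1 (S₁.im_pos hq)) hq.1

/-- `x ≤ 2 h^{3ε/2} s`. -/
theorem S₁.x_le_s (hq : q ∈ S₁ n ε h₁) : q.x ≤ 2 * q.1 ^ (3 * ε / 2) * q.s := by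
  have hr := S₁.r_pos hq
  have hh := hq.1
  have hμ := S₁.mu_pos hq
  have h1 : |q.2.1| ^ (1 / 2 : ℝ) ≤ q.r := by
    have h2 : |q.2.1| ^ (1 / 2 : ℝ) ≤ (q.r ^ 2) ^ (1 / 2 : ℝ) :=
      Real.rpow_le_rpow hμ.le (abs_le_rhoN_sq (q.2.1, q.2.2.2)) (by norm_num)
    refine h2.trans (le_of_eq ?_)
    rw [← rpow_natCast, ← rpow_mul hr.le]
    norm_num
  have h3 : q.1 ^ (1 - 3 * ε / 2) ≤ q.r * |q.2.1| := by
    calc q.1 ^ (1 - 3 * ε / 2) = (q.1 ^ (2 / 3 - ε)) ^ (1 / 2 + 1 : ℝ) := by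
          rw [← rpow_mul hh.le]; ring_nf
      _ ≤ |q.2.1| ^ (1 / 2 + 1 : ℝ) :=
          Real.rpow_le_rpow (rpow_pos_of_pos hh _).le hq.2.2.1 (by norm_num)
      _ = |q.2.1| ^ (1 / 2 : ℝ) * |q.2.1| := by rw [rpow_add hμ, rpow_one]
      _ ≤ _ := by gcongr
  have h4 : |q.2.1| ≤ 2 * q.r * q.im := abs_le_two_mul_im_rho (q := (q.2.1, q.2.2.2)) hμ
  have h5 : q.1 ≤ 2 * q.1 ^ (3 * ε / 2) * (q.r ^ 2 * q.im) := by
    have h6 : 0 < q.1 ^ (3 * ε / 2) := rpow_pos_of_pos hh _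
    calc q.1 = q.1 ^ (3 * ε / 2) * q.1 ^ (1 - 3 * ε / 2) := by rw [← rpow_add hh]; simp
      _ ≤ q.1 ^ (3 * ε / 2) * (q.r * |q.2.1|) := by gcongr
      _ ≤ q.1 ^ (3 * ε / 2) * (q.r * (2 * q.r * q.im)) := by gcongr
      _ = _ := by ring
  rw [Par.x, Par.s, div_le_iff₀ (pow_pos hr 2), mul_assoc, div_mul_eq_mul_div, mul_div_assoc',
    le_div_iff₀ hh]
  have ht := hq.2.2.2.2.1.1
  calc q.2.2.1 * q.1 ≤ q.2.2.1 * (2 * q.1 ^ (3 * ε / 2) * (q.r ^ 2 * q.im)) := by gcongr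
    _ = _ := by ring

theorem pow_mul_exp_le (N : ℕ) {s : ℝ} (hs : 0 ≤ s) :
    s ^ N * Real.exp (-(s / 2)) ≤ N.factorial * 2 ^ N := by
  have h1 := Real.pow_div_factorial_le_exp (s / 2) (by positivity) N
  rw [div_le_iff₀ (by positivity), div_pow, div_le_iff₀ (by positivity)] at h1
  rw [Real.exp_neg, ← div_eq_mul_inv, div_le_iff₀ (Real.exp_pos _)]
  linarith

/-- `x^N e^{-s/2} = O(h^{3εN/2})`. -/
theorem S₁.x_pow_mul_exp_le (hq : q ∈ S₁ n ε h₁) (N : ℕ) :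
    q.x ^ N * Real.exp (-(q.s / 2)) ≤ (N.factorial * 4 ^ N) * q.1 ^ (3 * ε * N / 2) := by
  have h1 := S₁.x_le_s hq
  have h2 := pow_mul_exp_le N (S₁.s_pos hq).le
  have h3 := (rpow_pos_of_pos hq.1 (3 * ε / 2))
  have h4 : q.1 ^ (3 * ε * N / 2) = (q.1 ^ (3 * ε / 2)) ^ N := by
    rw [← rpow_natCast, ← rpow_mul hq.1.le]; ring_nf
  calc q.x ^ N * Real.exp (-(q.s / 2))
      ≤ (2 * q.1 ^ (3 * ε / 2) * q.s) ^ N * Real.exp (-(q.s / 2)) := by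
        have := S₁.x_pos hq; gcongr
    _ = 2 ^ N * (q.1 ^ (3 * ε / 2)) ^ N * (q.s ^ N * Real.exp (-(q.s / 2))) := by
        rw [mul_pow, mul_pow]; ring
    _ ≤ 2 ^ N * (q.1 ^ (3 * ε / 2)) ^ N * (N.factorial * 2 ^ N) := by gcongr
    _ = _ := by rw [h4, show (4 : ℝ) = 2 * 2 by norm_num, mul_pow]; ring

theorem S₁.z_pow_le (hq : q ∈ S₁ n ε h₁) (N : ℕ) : q.z ^ N ≤ q.1 ^ (3 * ε * N / 2) := by
  have h4 : q.1 ^ (3 * ε * N / 2) = (q.1 ^ (3 * ε / 2)) ^ N := by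
    rw [← rpow_natCast, ← rpow_mul hq.1.le]; ring_nf
  rw [h4]
  have := S₁.z_pos hq
  have := S₁.z_le_rpow hq
  gcongr

/-- `φ - t ϱ`. -/
def phaseTail (M : ℕ) (mj : ℕ → ℝ → ℝ → Sym n) (_h μ t : ℝ) : Sym n := fun y η =>
  ∑ k ∈ Icc 2 M, (t : ℂ) ^ k * coeff k (phase M mj μ) y η

theorem phaseFun_eq (hM : 1 ≤ M) (h μ t : ℝ) (y η : E n) :
    phaseFun M mj μ t y η = t * rho n μ 0 η + phaseTail M mj h μ t y η := by
  rw [phaseFun, phaseTail, ← Finset.add_sum_Ioc_eq_sum_Icc (by omega)]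
  congr 1
  · rw [phase, coeff_one_phaseAux, pow_one]; rfl

namespace IsModelPerturbation
variable (H : IsModelPerturbation Y ε m mj)
include H

theorem bd_phaseTail : Bd (S₁ n ε h₁) (fun _ => 1) (fun q => q.2.2.1)
    (slices (phaseTail M mj)) := by
  have h0 : ∀ q ∈ S₁ n ε h₁, 0 ≤ q.2.2.1 := fun q hq => hq.2.2.2.2.1.1.le
  refine Bd.sum (Icc 2 M) (f := fun k (q : Par n) y => (q.2.2.1 : ℂ) ^ k *
    coeff k (phase M mj q.2.1) y q.2.2.2) one_nonneg h0 fun k hk => ?_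
  have h1 := WtCls.monomial (p := 3) (c := fun μ => coeff k (phase M mj μ))
    (S := S₁ n ε h₁) subset_rfl 0 k (by simpa using H.ser_phase_wtCls M k)
  simp only [pow_zero, one_mul, mul_one] at h1
  refine h1.mono one_nonneg 2 (fun q hq => ?_) h0
  have h2 := S₁.x_pos hq
  have h3 := S₁.r_pos hq
  have h4 : q.x ^ k ≤ q.x := pow_le_of_le_one h2.le (S₁.x_le hq) (by
    have := (mem_Icc.1 hk).1; omega)
  calc q.r ^ (3 : ℤ) * q.x ^ k ≤ q.r ^ (3 : ℤ) * q.x := by gcongr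
    _ = q.r * q.2.2.1 := by rw [S₁.t_eq hq]; norm_cast; ring
    _ ≤ 2 * q.2.2.1 := by have := S₁.r_le hq; have := h0 q hq; gcongr

theorem exists_abs_im_phaseTail_le (hε : 0 < ε) : ∃ C : ℝ, 0 ≤ C ∧ ∀ h₁, ∀ q ∈ S₁ n ε h₁, ∀ y,
    |(slices (phaseTail M mj) q y).im| ≤
      C * (q.2.2.1 * q.im * (q.x + q.2.2.1 * |q.2.1| ^ (-ε))) := by
  have hk := fun k => (H.ser_phase_imCls hε M k).2.le
  choose C hC hb using hk
  refine ⟨∑ k ∈ Icc 2 M, C k, sum_nonneg fun k _ => hC k, fun h₁ q hq y => ?_⟩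
  simp only [slices, phaseTail, Complex.im_sum]
  refine (Finset.abs_sum_le_sum_abs _ _).trans ?_
  rw [sum_mul]
  refine sum_le_sum fun k hk => ?_
  have h1 := hb k _ (S₁.mem hq) y
  rw [norm_real, norm_eq_abs] at h1
  have ht := hq.2.2.2.2.1.1
  have hr := S₁.r_pos hq
  have hx := S₁.x_pos hq
  have hi := S₁.im_pos hq
  have h2 := monomial_weight (p := 3) (S := S₁ n ε h₁) subset_rfl 0 k q hq
  simp only [pow_zero, one_mul, mul_one, Nat.cast_zero, mul_zero, sub_zero] at h2
  rw [← Complex.ofReal_pow, Complex.im_ofReal_mul, abs_mul, abs_of_pos (pow_pos ht k)]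
  have h3 : 0 ≤ imW ε (q.2.1, q.2.2.2) := imW_nonneg (S₁.mu_pos hq)
  have h4 : q.x ^ k ≤ q.x ^ 2 := pow_le_pow_of_le_one hx.le (S₁.x_le hq) (mem_Icc.1 hk).1
  calc q.2.2.1 ^ k * |(coeff k (phase M mj q.2.1) y q.2.2.2).im|
      ≤ q.2.2.1 ^ k * (C k * (imW ε (q.2.1, q.2.2.2) * q.r ^ (3 - 2 * (k : ℤ)))) := by
        gcongr; exact h1
    _ = C k * (imW ε (q.2.1, q.2.2.2) * (q.r ^ (3 : ℤ) * q.x ^ k)) := by rw [← h2]; ring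
    _ ≤ C k * (imW ε (q.2.1, q.2.2.2) * (q.r ^ (3 : ℤ) * q.x ^ 2)) := by
        have := hC k
        gcongr
    _ = _ := by
        have h5 : imW ε (q.2.1, q.2.2.2) = q.im / q.r * (1 + |q.2.1| ^ (-ε) * q.r ^ 2) := rfl
        rw [h5, S₁.t_eq hq]
        norm_cast
        field_simp

/-- For small `δ` and `h` the phase has a large imaginary part. -/
theorem exists_abs_im_phaseTail_le_half (hε : 0 < ε) (M : ℕ) :
    ∃ δ₀ : ℝ, 0 < δ₀ ∧ δ₀ ≤ 1 / 2 ∧ ∃ h₂ : ℝ, 0 < h₂ ∧ ∀ q ∈ S₁ n ε h₂,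
      q.2.2.1 ≤ 2 * δ₀ * q.r ^ 2 → q.2.2.1 ≤ 2 * q.1 ^ ε → ∀ y,
      |(slices (phaseTail M mj) q y).im| ≤ q.2.2.1 * q.im / 2 := by
  obtain ⟨C, hC, hb⟩ := H.exists_abs_im_phaseTail_le (M := M) hε
  have hκ : 0 < ε * (1 / 3 + ε) := by positivity
  set A : ℝ := 1 / (8 * (C + 1)) with hA
  have hA0 : 0 < A := by positivity
  have hCA : C * A ≤ 1 / 8 := by
    rw [hA, mul_one_div, div_le_div_iff₀ (by positivity) (by norm_num)]; linarith
  refine ⟨A, hA0, ?_, A ^ (1 / (ε * (1 / 3 + ε))), rpow_pos_of_pos hA0 _,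
    fun q hq h1 h2 y => (hb _ q hq y).trans ?_⟩
  · rw [hA, div_le_div_iff₀ (by positivity) (by norm_num)]; linarith
  have ht := hq.2.2.2.2.1.1
  have hr := S₁.r_pos hq
  have hi := S₁.im_pos hq
  have hx : q.x ≤ 2 * A := by
    rw [Par.x, div_le_iff₀ (pow_pos hr 2)]; exact h1
  have h3 : q.2.2.1 * |q.2.1| ^ (-ε) ≤ 2 * A := by
    have h4 : |q.2.1| ^ (-ε) ≤ (q.1 ^ (2 / 3 - ε)) ^ (-ε) :=
      Real.rpow_le_rpow_of_nonpos (rpow_pos_of_pos hq.1 _) hq.2.2.1 (by linarith)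
    have h5 : q.1 ^ ε * (q.1 ^ (2 / 3 - ε)) ^ (-ε) = q.1 ^ (ε * (1 / 3 + ε)) := by
      rw [← rpow_mul hq.1.le, ← rpow_add hq.1]; ring_nf
    have h6 : q.1 ^ (ε * (1 / 3 + ε)) ≤ A := by
      calc q.1 ^ (ε * (1 / 3 + ε)) ≤ (A ^ (1 / (ε * (1 / 3 + ε)))) ^ (ε * (1 / 3 + ε)) :=
            Real.rpow_le_rpow hq.1.le hq.2.1 hκ.le
        _ = A := by rw [← rpow_mul hA0.le, one_div_mul_cancel hκ.ne', rpow_one]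
    have h8 : 0 < q.1 ^ ε := rpow_pos_of_pos hq.1 _
    calc q.2.2.1 * |q.2.1| ^ (-ε) ≤ (2 * q.1 ^ ε) * (q.1 ^ (2 / 3 - ε)) ^ (-ε) := by gcongr
      _ = 2 * q.1 ^ (ε * (1 / 3 + ε)) := by rw [mul_assoc, h5]
      _ ≤ _ := by gcongr
  have h7 : 0 < q.2.2.1 * q.im := mul_pos ht hi
  calc C * (q.2.2.1 * q.im * (q.x + q.2.2.1 * |q.2.1| ^ (-ε)))
      ≤ C * (q.2.2.1 * q.im * (2 * A + 2 * A)) := by gcongr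
    _ = q.2.2.1 * q.im * (4 * (C * A)) := by ring
    _ ≤ q.2.2.1 * q.im * (4 * (1 / 8)) := by gcongr
    _ = _ := by ring

end IsModelPerturbation

/-- The parameters at which the cutoffs do not vanish. -/
def S₂ (n : ℕ) [NeZero n] (ε δ h₁ : ℝ) : Set (Par n) :=
  {q | q ∈ S₁ n ε h₁ ∧ q.2.2.1 ≤ 2 * δ * q.r ^ 2 ∧ q.2.2.1 ≤ 2 * q.1 ^ ε}

/-- The oscillating factor. -/
def expPhase (M : ℕ) (mj : ℕ → ℝ → ℝ → Sym n) (h μ t : ℝ) : Sym n := fun y η =>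
  Complex.exp (I * phaseFun M mj μ t y η / h)

/-- `σ = h^{ε-1}`. -/
def Par.σ (ε : ℝ) (q : Par n) : ℝ := q.1 ^ (ε - 1)

theorem Par.one_le_σ {ε : ℝ} (hε : ε ≤ 1) (h0 : 0 < q.1) (h1 : q.1 ≤ 1) : 1 ≤ q.σ ε :=
  Real.one_le_rpow_of_pos_of_le_one_of_nonpos h0 h1 (by linarith)

theorem IsModelPerturbation.bd_expPhase (H : IsModelPerturbation Y ε m mj) (hε1 : ε ≤ 1)
    (hM : 1 ≤ M) {δ : ℝ} (hh : h₁ ≤ 1)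
    (him : ∀ q ∈ S₂ n ε δ h₁, ∀ y, |(slices (phaseTail M mj) q y).im| ≤ q.2.2.1 * q.im / 2) :
    Bd (S₂ n ε δ h₁) (Par.σ ε) (fun q => Real.exp (-(q.s / 2))) (slices (expPhase M mj)) := by
  have hσ : ∀ q ∈ S₂ n ε δ h₁, 1 ≤ q.σ ε := fun q hq =>
    Par.one_le_σ hε1 hq.1.1 (hq.1.2.1.trans hh)
  have hσ0 : ∀ q ∈ S₂ n ε δ h₁, 0 ≤ q.σ ε := fun q hq => zero_le_one.trans (hσ q hq)
  have ht : Bd (S₂ n ε δ h₁) (fun _ => 1) (fun q => q.σ ε) (fun q y =>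
      I * slices (phaseTail M mj) q y / q.1) := by
    have h1 := ((H.bd_phaseTail (M := M) (h₁ := h₁)).mono_set (T := S₂ n ε δ h₁)
      fun q hq => hq.1).const_mul one_nonneg (fun q => I / q.1) 1
      (w' := fun q => 1 / q.1) (fun q hq => (one_div_pos.2 hq.1.1).le) fun q hq => by
        rw [norm_div, norm_I, norm_real, norm_eq_abs, abs_of_pos hq.1.1,
          one_mul]
    refine (h1.mono one_nonneg 2 (fun q hq => ?_) hσ0).congr fun q _ => ?_
    · have := hq.1.1
      rw [Par.σ, Real.rpow_sub_one this.ne', one_div_mul_eq_div, ← mul_div_assoc]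
      have := hq.2.2
      gcongr
    · funext y; ring
  have h2 : Bd (S₂ n ε δ h₁) (Par.σ ε) (fun q => Real.exp (q.s / 2)) (fun q y =>
      Complex.exp (I * slices (phaseTail M mj) q y / q.1)) := by
    refine Bd.exp ht.1 hσ0 (fun k hk => ?_) fun q hq y => ?_
    · obtain ⟨C, hC, hb⟩ := ht.2 k
      refine ⟨C, hC, fun q hq y => (hb q hq y).trans ?_⟩
      rw [one_pow, mul_one]
      have := le_self_pow₀ (hσ q hq) (n := k) (by omega)
      gcongr
    · have h3 : (I * slices (phaseTail M mj) q y / q.1).re =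
          -(slices (phaseTail M mj) q y).im / q.1 := by
        rw [Complex.div_ofReal_re]; simp
      rw [h3, Real.exp_le_exp, Par.s, div_right_comm]
      have := hq.1.1
      gcongr
      exact (neg_le_abs _).trans (him q hq y)
  have h4 := h2.const_mul hσ0 (fun q => Complex.exp (I * (q.2.2.1 *
    rho n q.2.1 0 q.2.2.2) / q.1)) 1 (w' := fun q => Real.exp (-q.s)) (fun q _ => (Real.exp_pos _).le)
    fun q _ => by
      rw [one_mul, Complex.norm_exp, Complex.div_ofReal_re]
      simp [Par.s, Par.im, neg_div]
  refine (h4.congr_weight fun q _ => ?_).congr fun q _ => ?_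
  · rw [← Real.exp_add]; ring_nf
  · funext y
    rw [← Complex.exp_add]
    simp only [slices, expPhase, phaseFun_eq hM q.1]
    ring_nf

end

/-! ### The cutoffs -/

section cutoff
variable {χ : ℝ → ℂ} (hχ : ContDiff ℝ ∞ χ) (h1 : ∀ σ, |σ| ≤ 1 → χ σ = 1)
  (h2 : ∀ σ, 2 ≤ |σ| → χ σ = 0)

/-- `∂_t^i χ(tA)`. -/
def scaledD (χ : ℝ → ℂ) (i : ℕ) (A t : ℝ) : ℂ := (A : ℂ) ^ i * iteratedDeriv i χ (t * A)

include hχ in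
theorem hasDerivAt_scaledD (i : ℕ) (A t : ℝ) :
    HasDerivAt (scaledD χ i A) (scaledD χ (i + 1) A t) t := by
  have h3 : HasDerivAt (iteratedDeriv i χ) (iteratedDeriv (i + 1) χ (t * A)) (t * A) := by
    rw [iteratedDeriv_succ]
    exact ((hχ.differentiable_iteratedDeriv i (mod_cast WithTop.coe_lt_top _)) _).hasDerivAt
  have h4 : HasDerivAt (fun t : ℝ => t * A) A t := by simpa using (hasDerivAt_id t).mul_const A
  refine ((h3.scomp t h4).const_mul ((A : ℂ) ^ i)).congr_deriv ?_
  rw [scaledD, real_smul]; ring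

include h2 in
theorem iteratedDeriv_cutoff_eq_zero (i : ℕ) {σ : ℝ} (h : 2 < |σ|) : iteratedDeriv i χ σ = 0 := by
  have h3 : χ =ᶠ[nhds σ] fun _ => 0 := by
    filter_upwards [(isOpen_lt continuous_const continuous_abs).mem_nhds h] with x hx
    exact h2 x (le_of_lt hx)
  rw [h3.iteratedDeriv_eq i]
  simp

include h1 in
theorem iteratedDeriv_cutoff_eq_zero' (i : ℕ) (hi : 1 ≤ i) {σ : ℝ} (h : |σ| < 1) :
    iteratedDeriv i χ σ = 0 := by
  have h3 : χ =ᶠ[nhds σ] fun _ => 1 := by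
    filter_upwards [(isOpen_lt continuous_abs continuous_const).mem_nhds h] with x hx
    exact h1 x (le_of_lt hx)
  rw [h3.iteratedDeriv_eq i]
  simp [iteratedDeriv_const, Nat.one_le_iff_ne_zero.1 hi]

include hχ h2 in
theorem exists_norm_iteratedDeriv_cutoff_le : ∃ K, 0 ≤ K ∧ ∀ i ≤ 2, ∀ σ,
    ‖iteratedDeriv i χ σ‖ ≤ K := by
  have h : ∀ i, ∃ K, 0 ≤ K ∧ ∀ σ, ‖iteratedDeriv i χ σ‖ ≤ K := fun i => by
    obtain ⟨K, hK⟩ := (isCompact_Icc (a := (-2 : ℝ)) (b := 2)).exists_bound_of_continuousOn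
      (hχ.continuous_iteratedDeriv i (mod_cast le_top)).continuousOn
    refine ⟨max K 0, le_max_right _ _, fun σ => ?_⟩
    by_cases h : |σ| ≤ 2
    · exact (hK σ (abs_le.1 h)).trans (le_max_left _ _)
    · rw [iteratedDeriv_cutoff_eq_zero h2 i (not_le.1 h), norm_zero]; exact le_max_right _ _
  choose K hK hb using h
  refine ⟨K 0 + K 1 + K 2, by have := hK 0; have := hK 1; have := hK 2; positivity,
    fun i hi σ => (hb i σ).trans ?_⟩
  have := hK 0; have := hK 1; have := hK 2
  interval_cases i <;> linarith

/-- `∂_t^i (χ(tA) χ(tB))`. -/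
def cutD (χ : ℝ → ℂ) (A B : ℝ) (i : ℕ) (t : ℝ) : ℂ :=
  ∑ j ∈ range (i + 1), (i.choose j : ℂ) * (scaledD χ j A t * scaledD χ (i - j) B t)

theorem cutD_zero (A B t : ℝ) : cutD χ A B 0 t = χ (t * A) * χ (t * B) := by
  simp [cutD, scaledD]

include hχ in
theorem hasDerivAt_cutD_zero (A B t : ℝ) : HasDerivAt (cutD χ A B 0) (cutD χ A B 1 t) t := by
  have h := (hasDerivAt_scaledD hχ 0 A t).mul (hasDerivAt_scaledD hχ 0 B t)
  have e : cutD χ A B 0 = fun t => scaledD χ 0 A t * scaledD χ 0 B t := by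
    funext t; simp [cutD]
  rw [e]
  refine h.congr_deriv ?_
  simp [cutD, sum_range_succ]; ring

include hχ in
theorem hasDerivAt_cutD_one (A B t : ℝ) : HasDerivAt (cutD χ A B 1) (cutD χ A B 2 t) t := by
  have h := ((hasDerivAt_scaledD hχ 0 A t).mul (hasDerivAt_scaledD hχ 1 B t)).add
    ((hasDerivAt_scaledD hχ 1 A t).mul (hasDerivAt_scaledD hχ 0 B t))
  have e : cutD χ A B 1 = fun t => scaledD χ 0 A t * scaledD χ 1 B t +
      scaledD χ 1 A t * scaledD χ 0 B t := by
    funext t; simp [cutD, sum_range_succ]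
  rw [e]
  refine h.congr_deriv ?_
  simp [cutD, sum_range_succ]; ring

include h2 in
theorem cutD_eq_zero {A B t : ℝ} (i : ℕ) (h : 2 < |t * A| ∨ 2 < |t * B|) : cutD χ A B i t = 0 := by
  refine sum_eq_zero fun j _ => ?_
  rcases h with h | h <;> simp [scaledD, iteratedDeriv_cutoff_eq_zero h2 _ h]

include h1 in
theorem cutD_eq_zero' {A B t : ℝ} (i : ℕ) (hi : 1 ≤ i) (h : |t * A| < 1) (h' : |t * B| < 1) :
    cutD χ A B i t = 0 := by
  refine sum_eq_zero fun j _ => ?_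
  rcases Nat.eq_zero_or_pos j with rfl | hj
  · simp [scaledD, iteratedDeriv_cutoff_eq_zero' h1 i (by omega) h']
  · simp [scaledD, iteratedDeriv_cutoff_eq_zero' h1 j hj h]

include hχ h2 in
theorem exists_norm_cutD_le : ∃ K, 0 ≤ K ∧ ∀ i ≤ 2, ∀ A B t : ℝ, 0 ≤ A → 0 ≤ B →
    ‖cutD χ A B i t‖ ≤ K * (A + B) ^ i := by
  obtain ⟨K, hK, hb⟩ := exists_norm_iteratedDeriv_cutoff_le hχ h2
  refine ⟨K ^ 2, by positivity, fun i hi A B t hA hB => ?_⟩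
  have h3 : ∀ j ≤ 2, ∀ A, 0 ≤ A → ‖scaledD χ j A t‖ ≤ A ^ j * K := fun j hj A hA => by
    rw [scaledD, norm_mul, norm_pow, norm_real, norm_eq_abs, abs_of_nonneg hA]
    exact mul_le_mul_of_nonneg_left (hb j hj _) (by positivity)
  rw [cutD, add_pow, mul_sum]
  refine (norm_sum_le _ _).trans (sum_le_sum fun j hj => ?_)
  have hj' := mem_range.1 hj
  rw [norm_mul, norm_mul, Complex.norm_natCast]
  have e1 := h3 j (by omega) A hA
  have e2 := h3 (i - j) (by omega) B hB
  calc (i.choose j : ℝ) * (‖scaledD χ j A t‖ * ‖scaledD χ (i - j) B t‖)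
      ≤ (i.choose j : ℝ) * ((A ^ j * K) * (B ^ (i - j) * K)) := by gcongr
    _ = _ := by ring

end cutoff

section
variable [NeZero n] {Y : Set (E n)} {ε h₁ δ : ℝ} {m : ℝ → ℝ → ℝ → Sym n} {mj : ℕ → ℝ → ℝ → Sym n}
  {M : ℕ} {q : Par n} {χ : ℝ → ℂ}

/-- `∂_t^i Φ`. -/
def cutS (χ : ℝ → ℂ) (ε δ : ℝ) (i : ℕ) (h μ t : ℝ) : Sym n := fun _ η =>
  cutD χ (h ^ ε)⁻¹ (rhoN (μ, η) ^ 2 * δ)⁻¹ i t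

theorem parametrixSymbol_eq (h μ t : ℝ) : parametrixSymbol χ M mj ε δ h μ t =
    expPhase M mj h μ t * cutS χ ε δ 0 h μ t * ampD χ M mj 0 h μ t := by
  funext y η
  simp only [Pi.mul_apply, cutS, cutD_zero, ← div_eq_mul_inv]
  rfl

/-! ### The size of the factors -/

/-- All parameters. -/
def T₂ (n : ℕ) (ε h₁ : ℝ) : Set (Par n) := {q | (q.1, q.2.1, q.2.2.1) ∈ T₁ ε h₁}

theorem S₁.rpow_le_r_sq (hq : q ∈ S₁ n ε h₁) (hε : 0 < ε) (hh : h₁ ≤ 1) :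
    q.1 ^ (2 / 3 : ℝ) ≤ q.r ^ 2 := by
  refine le_trans ?_ (hq.2.2.1.trans (abs_le_rhoN_sq (q.2.1, q.2.2.2)))
  exact rpow_le_rpow_of_exponent_ge hq.1 (hq.2.1.trans hh) (by linarith)

theorem S₁.h_le_r_sq (hq : q ∈ S₁ n ε h₁) (hε : 0 < ε) (hh : h₁ ≤ 1) : q.1 ≤ q.r ^ 2 := by
  refine le_trans ?_ (S₁.rpow_le_r_sq hq hε hh)
  conv_lhs => rw [← rpow_one q.1]
  exact rpow_le_rpow_of_exponent_ge hq.1 (hq.2.1.trans hh) (by norm_num)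

theorem exists_norm_cutS_le (hχ : ContDiff ℝ ∞ χ) (h2 : ∀ σ, 2 ≤ |σ| → χ σ = 0) (hε : 0 < ε)
    (hε1 : ε ≤ 1) (hδ : 0 < δ) (hh : h₁ ≤ 1) : ∃ K, 0 ≤ K ∧ ∀ i ≤ 2, ∀ q ∈ S₁ n ε h₁,
    q.1 ^ i * ‖cutS χ ε δ i q.1 q.2.1 q.2.2.1 0 q.2.2.2‖ ≤ K := by
  obtain ⟨K, hK, hb⟩ := exists_norm_cutD_le hχ h2
  refine ⟨K * (1 + (1 + δ⁻¹) ^ 2), by positivity, fun i hi q hq => ?_⟩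
  have h3 := hq.1
  have hr := S₁.r_pos hq
  have h4 : 0 < q.1 ^ ε := rpow_pos_of_pos h3 _
  have h5 := hb i hi (q.1 ^ ε)⁻¹ (q.r ^ 2 * δ)⁻¹ q.2.2.1 (by positivity) (by positivity)
  have h6 : q.1 ≤ q.1 ^ ε := by
    conv_lhs => rw [← rpow_one q.1]
    exact rpow_le_rpow_of_exponent_ge hq.1 (hq.2.1.trans hh) hε1
  have h7 : q.1 * ((q.1 ^ ε)⁻¹ + (q.r ^ 2 * δ)⁻¹) ≤ 1 + δ⁻¹ := by
    rw [mul_add, mul_inv]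
    have e1 : q.1 * (q.1 ^ ε)⁻¹ ≤ 1 := by rw [← div_eq_mul_inv]; exact (div_le_one h4).2 h6
    have e2 : q.1 * (q.r ^ 2)⁻¹ ≤ 1 := by
      rw [← div_eq_mul_inv]; exact (div_le_one (pow_pos hr 2)).2 (S₁.h_le_r_sq hq hε hh)
    have e3 : 0 < δ⁻¹ := by positivity
    nlinarith
  have h8 : 0 ≤ q.1 * ((q.1 ^ ε)⁻¹ + (q.r ^ 2 * δ)⁻¹) := by positivity
  calc q.1 ^ i * ‖cutS χ ε δ i q.1 q.2.1 q.2.2.1 0 q.2.2.2‖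
      ≤ q.1 ^ i * (K * ((q.1 ^ ε)⁻¹ + (q.r ^ 2 * δ)⁻¹) ^ i) := by gcongr; exact h5
    _ = K * (q.1 * ((q.1 ^ ε)⁻¹ + (q.r ^ 2 * δ)⁻¹)) ^ i := by rw [mul_pow]; ring
    _ ≤ K * (1 + δ⁻¹) ^ i := by gcongr
    _ ≤ _ := by
        gcongr
        have e3 : 0 < δ⁻¹ := by positivity
        interval_cases i
        · simp; positivity
        · nlinarith
        · linarith

/-- On the support of the derivatives of the cutoffs the exponential is small. -/
theorem exists_exp_le (hδ : 0 < δ) (hh : h₁ ≤ 1) (hε : 0 < ε) (N : ℕ) :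
    ∃ K, 0 ≤ K ∧ ∀ q ∈ S₁ n ε h₁, (q.1 ^ ε ≤ q.2.2.1 ∨ δ * q.r ^ 2 ≤ q.2.2.1) →
      Real.exp (-(q.s / 2)) ≤ K * q.1 ^ (ε * N / 2) := by
  set c : ℝ := min δ (1 / 4) with hc
  have hc0 : 0 < c := lt_min hδ (by norm_num)
  refine ⟨(c⁻¹) ^ N * (N.factorial * 4 ^ N), by positivity, fun q hq h => ?_⟩
  have h3 := hq.1
  have hr := S₁.r_pos hq
  have h4 : 0 < q.1 ^ ε := rpow_pos_of_pos h3 _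
  have h5 : q.1 ^ ε ≤ 1 := rpow_le_one h3.le (hq.2.1.trans hh) hε.le
  have h6 : c * q.1 ^ ε ≤ q.x := by
    rw [Par.x, le_div_iff₀ (pow_pos hr 2)]
    rcases h with h | h
    · have h7 : q.r ^ 2 ≤ 4 := by have := S₁.r_le hq; nlinarith
      calc c * q.1 ^ ε * q.r ^ 2 ≤ (1 / 4) * q.1 ^ ε * 4 := by
            gcongr; exact min_le_right _ _
        _ ≤ _ := by linarith
    · calc c * q.1 ^ ε * q.r ^ 2 ≤ δ * 1 * q.r ^ 2 := by
            gcongr; exact min_le_left _ _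
        _ ≤ _ := by linarith
  have h7 := S₁.x_pow_mul_exp_le hq N
  have h8 : (c * q.1 ^ ε) ^ N * Real.exp (-(q.s / 2)) ≤
      (N.factorial * 4 ^ N) * q.1 ^ (3 * ε * N / 2) := by
    refine le_trans ?_ h7
    gcongr
  have h9 : q.1 ^ (3 * ε * N / 2) = (q.1 ^ ε) ^ N * q.1 ^ (ε * N / 2) := by
    rw [← rpow_natCast, ← rpow_mul h3.le, ← rpow_add h3]; ring_nf
  rw [h9, mul_pow] at h8
  have h10 : 0 < (q.1 ^ ε) ^ N := by positivity
  have h11 : c ^ N * Real.exp (-(q.s / 2)) ≤ N.factorial * 4 ^ N * q.1 ^ (ε * N / 2) := by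
    nlinarith
  rw [inv_pow, mul_assoc, inv_mul_eq_div, le_div_iff₀ (by positivity)]
  linarith

end

/-! ### Symbols depending smoothly on `t` -/

/-- Joint smoothness in `(t, y, η)`. -/
def SmoothT (F : ℝ → Sym n) : Prop := ContDiff ℝ ∞ (fun p : ℝ × E n × E n => F p.1 p.2.1 p.2.2)

/-- `∂_t F`. -/
def dT (F : ℝ → Sym n) : ℝ → Sym n := fun t y η => deriv (fun s => F s y η) t

namespace SmoothT
variable {F G : ℝ → Sym n}

theorem smoothSym (h : SmoothT F) (t : ℝ) : SmoothSym (F t) :=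
  ContDiff.comp h (contDiff_const.prodMk contDiff_id)

theorem of_smoothSym {a : Sym n} (h : SmoothSym a) : SmoothT (fun _ => a) :=
  ContDiff.comp h contDiff_snd

theorem mul (h : SmoothT F) (h' : SmoothT G) : SmoothT (fun t => F t * G t) := ContDiff.mul h h'

theorem sub (h : SmoothT F) (h' : SmoothT G) : SmoothT (fun t => F t - G t) := ContDiff.sub h h'

theorem smul (c : ℂ) (h : SmoothT F) : SmoothT (fun t => c • F t) := ContDiff.const_smul c h

theorem fderiv_apply (h : SmoothT F) (v : ℝ × E n × E n) : ContDiff ℝ ∞ (fun p =>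
    _root_.fderiv ℝ (fun p : ℝ × E n × E n => F p.1 p.2.1 p.2.2) p v) :=
  (ContDiff.fderiv_right h (by simp)).clm_apply contDiff_const

protected theorem dT (h : SmoothT F) : SmoothT (dT F) := by
  have e : (fun p : ℝ × E n × E n => dT F p.1 p.2.1 p.2.2) = fun p =>
      _root_.fderiv ℝ (fun p : ℝ × E n × E n => F p.1 p.2.1 p.2.2) p (1, 0) := by
    funext ⟨t, y, η⟩
    have h1 := ((ContDiff.differentiable h (by simp)) (t, y, η)).hasFDerivAt
    have h2 : HasFDerivAt (fun s : ℝ => (s, (y, η))) (inl ℝ ℝ (E n × E n)) t :=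
      hasFDerivAt_prodMk_left t (y, η)
    have h3 := (h1.comp t h2).hasDerivAt.deriv
    simpa using! h3
  rw [SmoothT, e]; exact h.fderiv_apply _

protected theorem dy (h : SmoothT F) (i : Fin n) : SmoothT (fun t => dy i (F t)) := by
  have e : (fun p : ℝ × E n × E n => dy i (F p.1) p.2.1 p.2.2) = fun p =>
      _root_.fderiv ℝ (fun p : ℝ × E n × E n => F p.1 p.2.1 p.2.2) p (0, bas i, 0) := by
    funext ⟨t, y, η⟩
    have h1 := ((ContDiff.differentiable h (by simp)) (t, y, η)).hasFDerivAt
    have h2 : HasFDerivAt (fun y' : E n => (t, (y', η)))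
        ((inr ℝ ℝ (E n × E n)).comp (inl ℝ (E n) (E n))) y :=
      (hasFDerivAt_prodMk_right t (y, η)).comp y (hasFDerivAt_prodMk_left y η)
    have h3 := congrArg (fun L => L (bas i)) (h1.comp y h2).fderiv
    simpa using! h3
  rw [SmoothT, e]; exact h.fderiv_apply _

end SmoothT

/-! ### The composition of symbols -/

/-- `-ih ∂_{y_i}`. -/
def hdy (h : ℝ) (i : Fin n) (b : Sym n) : Sym n := -(I • ((h : ℂ) • dy i b))

/-- `∑_{|α| ≤ M} ((-ih)^{|α|}/α!) ∂_η^α m ∂_y^α b`. -/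
def compSym (M : ℕ) (h : ℝ) (m b : Sym n) : Sym n :=
  multiSum M fun α => invFact α • (mpow deta α m * mpow (hdy h) α b)

theorem mpow_intertwine {A B : Type*} {D : Fin n → A → A} {D' : Fin n → B → B} (Q : A → B → Prop)
    (hD : ∀ j a b, Q a b → Q (D j a) (D' j b)) (α : Fin n → ℕ) {a : A} {b : B} (h : Q a b) :
    Q (mpow D α a) (mpow D' α b) := by
  unfold mpow
  induction finRange n with
  | nil => exact h
  | cons j l ih =>
    simp
    induction α j with
    | zero => exact ih
    | succ k ihk =>
      simp only [iterate_succ_apply']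
      exact hD j _ _ ihk

theorem SmoothSym.conjS {φ b : Sym n} (hφ : SmoothSym φ) (hb : SmoothSym b) (h : ℝ) (i : Fin n) :
    SmoothSym (conjS φ h i b) := by
  have h1 := ((hφ.dy i).mul hb).add ((((hb.dy i).smul (h : ℂ)).smul I).smul (-1))
  rwa [neg_one_smul, ← sub_eq_add_neg] at h1

theorem hdy_mul {φ b : Sym n} (hφ : SmoothSym φ) (hb : SmoothSym b) {h : ℝ} (hh : h ≠ 0)
    (i : Fin n) (d : E n → ℂ) :
    hdy h i (fun y η => Complex.exp (I * φ y η / h) * (d η * b y η)) =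
      fun y η => Complex.exp (I * φ y η / h) * (d η * conjS φ h i b y η) := by
  funext y η
  have h1 := (((hφ.left η).differentiable (by simp)) y).hasFDerivAt
  have h2 := (((hb.left η).differentiable (by simp)) y).hasFDerivAt
  have h3 := (((h1.const_mul I).mul_const ((h : ℂ)⁻¹)).cexp).mul (h2.const_mul (d η))
  have h4 := congrArg (fun L => L (bas i)) h3.fderiv
  have h5 : dy i (fun y η => Complex.exp (I * φ y η / h) * (d η * b y η)) y η =
      Complex.exp (I * φ y η / h) * (d η * dy i b y η) +
      d η * b y η * (Complex.exp (I * φ y η / h) * ((h : ℂ)⁻¹ *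
        (I * dy i φ y η))) := by
    exact h4
  simp only [hdy, conjS, Pi.neg_apply, Pi.smul_apply, Pi.sub_apply, Pi.mul_apply, smul_eq_mul, h5]
  have hh' : (h : ℂ) ≠ 0 := mod_cast hh
  field_simp
  ring_nf
  simp only [I_sq]
  ring

theorem compSym_exp {φ a m : Sym n} (hφ : SmoothSym φ) (ha : SmoothSym a) {h : ℝ} (hh : h ≠ 0)
    (M : ℕ) (d : E n → ℂ) :
    compSym M h m (fun y η => Complex.exp (I * φ y η / h) * (d η * a y η)) =
      fun y η => Complex.exp (I * φ y η / h) * (d η *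
        (multiSum M fun α => invFact α • (mpow deta α m * mpow (conjS φ h) α a)) y η) := by
  have h1 : ∀ α, mpow (hdy h) α (fun y η => Complex.exp (I * φ y η / h) * (d η * a y η)) =
      fun y η => Complex.exp (I * φ y η / h) * (d η * mpow (conjS φ h) α a y η) := fun α =>
    (mpow_intertwine (fun b c => (b = fun y η => Complex.exp (I * φ y η / h) *
      (d η * c y η)) ∧ SmoothSym c) (fun j b c hbc => ⟨by rw [hbc.1, hdy_mul hφ hbc.2 hh],
        hφ.conjS hbc.2 h j⟩) α ⟨rfl, ha⟩).1
  funext y η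
  simp only [compSym, multiSum, h1, Finset.sum_apply, mul_sum, Pi.smul_apply, Pi.mul_apply]
  exact sum_congr rfl fun _ _ => sum_congr rfl fun _ _ => by ring

section
variable [NeZero n] {Y : Set (E n)} {ε h₁ δ : ℝ} {m : ℝ → ℝ → ℝ → Sym n} {mj : ℕ → ℝ → ℝ → Sym n}
  {M : ℕ} {q : Par n} {χ : ℝ → ℂ} {h μ : ℝ}

/-! ### Smoothness of the parametrix -/

protected theorem SmoothT.evS {s : ℝ → FS₂ n} (N : ℕ)
    (hs : ∀ j k, SmoothSym (coeff k (coeff j (s μ)))) :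
    SmoothT (evS N s h μ) := by
  refine ContDiff.sum fun j _ => ContDiff.sum fun k _ => ContDiff.mul ?_
    (SmoothT.of_smoothSym (hs j k))
  exact contDiff_const.mul ((Complex.ofRealCLM.contDiff.comp contDiff_fst).pow k)

theorem smooth_iterate_dt {s : FS₂ n}
    (hs : ∀ j k, SmoothSym (coeff k (coeff j s))) (i : ℕ) :
    ∀ j k, SmoothSym (coeff k (coeff j ((mapCoeff dt)^[i] s))) := by
  induction i with
  | zero => exact hs
  | succ i ih =>
    intro j k
    rw [iterate_succ_apply']
    simp only [mapCoeff, dt, coeff_mk]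
    exact (ih j (k + 1)).smul _

theorem smoothT_cutS (hχ : ContDiff ℝ ∞ χ) (hμ : 0 < |μ|) (hδ : 0 < δ) :
    SmoothT (cutS (n := n) χ ε δ 0 h μ) := by
  have h1 : ContDiff ℝ ∞ (fun p : ℝ × E n × E n => (rhoN (μ, p.2.2) ^ 2 * δ)⁻¹) := by
    refine ContDiff.inv (ContDiff.mul ?_ contDiff_const) fun p => ?_
    · exact ContDiff.norm_sq ℝ (ContDiff.comp
        (f := fun p : ℝ × E n × E n => ((0 : E n), p.2.2))
        (smoothSym_rho (abs_pos.1 hμ)) (contDiff_const.prodMk (contDiff_snd.comp contDiff_snd)))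
    · have := rhoN_pos (q := (μ, p.2.2)) hμ
      positivity
  have e : (fun p : ℝ × E n × E n => cutS χ ε δ 0 h μ p.1 p.2.1 p.2.2) = fun p =>
      χ (p.1 * (h ^ ε)⁻¹) * χ (p.1 * (rhoN (μ, p.2.2) ^ 2 * δ)⁻¹) := by
    funext p; simp only [cutS, cutD_zero]
  rw [SmoothT, e]
  exact (hχ.comp (contDiff_fst.mul contDiff_const)).mul (hχ.comp (contDiff_fst.mul h1))

/-- The symbol of `D_t² + D_{y₁} - iμ` applied to the parametrix. -/
def paraSym (χ : ℝ → ℂ) (M : ℕ) (mj : ℕ → ℝ → ℝ → Sym n) (ε δ h μ t : ℝ) : Sym n := fun y η =>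
  -(h : ℂ) ^ 2 * dT (dT (parametrixSymbol χ M mj ε δ h μ)) t y η -
    I * h * dy 0 (parametrixSymbol χ M mj ε δ h μ t) y η -
    rho n μ y η ^ 2 * parametrixSymbol χ M mj ε δ h μ t y η

/-- The contribution of the derivatives of the cutoffs. -/
def cutErr (χ : ℝ → ℂ) (M : ℕ) (mj : ℕ → ℝ → ℝ → Sym n) (ε δ h μ t : ℝ) : Sym n := fun y η =>
  (h * cutS χ ε δ 1 h μ t y η) * (-2 * (I * phaseD M mj 1 h μ t y η *
    ampD χ M mj 0 h μ t y η + h * ampD χ M mj 1 h μ t y η)) -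
  (h ^ 2 * cutS χ ε δ 2 h μ t y η) * ampD χ M mj 0 h μ t y η

namespace IsModelPerturbation
variable (H : IsModelPerturbation Y ε m mj) (hμ : 0 < |μ|) (hμ1 : |μ| ≤ 1)
  (hχ : ContDiff ℝ ∞ χ)
include H hμ hμ1

theorem smoothT_phaseD (i : ℕ) : SmoothT (phaseD M mj i h μ) := by
  refine SmoothT.evS (s := fun μ => (mapCoeff dt)^[i] (phase₂ M mj μ)) _
    (smooth_iterate_dt (fun j k => ?_) i)
  rw [phase₂, coeff_C]
  split_ifs
  · exact H.ser_phase_smoothCls M k μ hμ hμ1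
  · simpa using SmoothSym.zero

theorem smoothT_expPhase : SmoothT (expPhase M mj h μ) := by
  have h1 := H.smoothT_phaseD (M := M) (h := h) hμ hμ1 0
  have e : expPhase M mj h μ = fun t y η =>
      Complex.exp (I * phaseD M mj 0 h μ t y η / h) := by
    funext t y η
    rw [expPhase, phaseFun_eq_evS h]; rfl
  rw [SmoothT, e]
  exact ContDiff.cexp ((contDiff_const.mul h1).div_const _)

include hχ

theorem smoothT_ampD (i : ℕ) : SmoothT (ampD χ M mj i h μ) :=
  SmoothT.evS (s := fun μ => (mapCoeff dt)^[i] (amp χ M mj μ)) _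
    (smooth_iterate_dt (fun j k => H.ser₂_ampAux_smoothCls hχ M (M + 1) j k μ hμ hμ1) i)

theorem smoothT_parametrixSymbol (hδ : 0 < δ) : SmoothT (parametrixSymbol χ M mj ε δ h μ) := by
  have h1 := ((H.smoothT_expPhase (M := M) (h := h) hμ hμ1).mul (smoothT_cutS (ε := ε) (h := h)
    hχ hμ hδ)).mul (H.smoothT_ampD (M := M) (h := h) hμ hμ1 hχ 0)
  have e : parametrixSymbol χ M mj ε δ h μ = fun t =>
      expPhase M mj h μ t * cutS χ ε δ 0 h μ t * ampD χ M mj 0 h μ t :=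
    funext fun t => parametrixSymbol_eq h μ t
  rw [e]; exact h1

theorem smoothT_paraSym (hδ : 0 < δ) : SmoothT (paraSym χ M mj ε δ h μ) := by
  have hb := H.smoothT_parametrixSymbol (M := M) (h := h) hμ hμ1 hχ hδ
  have h1 := ((hb.dT.dT.smul (-(h : ℂ) ^ 2)).sub ((hb.dy 0).smul (I * h))).sub
    ((SmoothT.of_smoothSym ((smoothSym_rho (abs_pos.1 hμ)).mul
      (smoothSym_rho (abs_pos.1 hμ)))).mul hb)
  rw [SmoothT] at h1 ⊢
  convert h1 using 2 with p
  simp only [paraSym, Pi.sub_apply, Pi.smul_apply, Pi.mul_apply, smul_eq_mul, sq]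

theorem paraSym_add_compSym (hh : h ≠ 0) (hM : 1 ≤ M) (t : ℝ) :
    paraSym χ M mj ε δ h μ t + compSym M h (m h μ t) (parametrixSymbol χ M mj ε δ h μ t) =
      expPhase M mj h μ t * (cutS χ ε δ 0 h μ t * transportFun χ M m mj h μ t +
        cutErr χ M mj ε δ h μ t) := by
  have hh' : (h : ℂ) ≠ 0 := mod_cast hh
  have hφ := (H.smoothT_phaseD (M := M) (h := h) hμ hμ1 0).smoothSym t
  have ha := (H.smoothT_ampD (M := M) (h := h) hμ hμ1 hχ 0).smoothSym t
  have hE : ∀ t, expPhase M mj h μ t =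
      fun y η => Complex.exp (I * phaseD M mj 0 h μ t y η / h) := fun t => by
    funext y η
    rw [expPhase, phaseFun_eq_evS h]; rfl
  have hb : parametrixSymbol χ M mj ε δ h μ t = fun y η =>
      Complex.exp (I * phaseD M mj 0 h μ t y η / h) *
        (cutS χ ε δ 0 h μ t 0 η * ampD χ M mj 0 h μ t y η) := by
    rw [parametrixSymbol_eq, hE]
    funext y η
    simp only [Pi.mul_apply, cutS, mul_assoc]
  have e1 := compSym_exp (m := m h μ t) hφ ha hh M (cutS χ ε δ 0 h μ t 0)
  have e2 := hdy_mul hφ ha hh 0 (cutS χ ε δ 0 h μ t 0)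
  rw [← hb] at e1 e2
  funext y η
  have e3 := congrArg Neg.neg (congrFun (congrFun e2 y) η)
  simp only [hdy, Pi.neg_apply, Pi.smul_apply, smul_eq_mul, neg_neg, ← mul_assoc I] at e3
  have dE : ∀ t, HasDerivAt (fun t => Complex.exp (I * phaseD M mj 0 h μ t y η / h))
      (Complex.exp (I * phaseD M mj 0 h μ t y η / h) *
        (I * phaseD M mj 1 h μ t y η / h)) t := fun t =>
    (((hasDerivAt_phaseD hM 0 h μ t y η).const_mul I).div_const _).cexp
  have dD0 : ∀ t, HasDerivAt (fun t => cutS χ ε δ 0 h μ t 0 η) (cutS χ ε δ 1 h μ t 0 η) t :=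
    fun t => hasDerivAt_cutD_zero hχ _ _ t
  have dD1 : ∀ t, HasDerivAt (fun t => cutS χ ε δ 1 h μ t 0 η) (cutS χ ε δ 2 h μ t 0 η) t :=
    fun t => hasDerivAt_cutD_one hχ _ _ t
  have da := fun i t => hasDerivAt_ampD (M := M) (mj := mj) χ i h μ t y η
  have dφ := fun i t => hasDerivAt_phaseD (mj := mj) hM i h μ t y η
  have hb' : (fun t => parametrixSymbol χ M mj ε δ h μ t y η) = fun t =>
      Complex.exp (I * phaseD M mj 0 h μ t y η / h) *
        (cutS χ ε δ 0 h μ t 0 η * ampD χ M mj 0 h μ t y η) := by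
    funext t
    rw [parametrixSymbol_eq, hE]
    simp only [Pi.mul_apply, cutS, mul_assoc]
  have d1 : (fun t => dT (parametrixSymbol χ M mj ε δ h μ) t y η) = fun t =>
      Complex.exp (I * phaseD M mj 0 h μ t y η / h) *
          (I * phaseD M mj 1 h μ t y η / h) *
          (cutS χ ε δ 0 h μ t 0 η * ampD χ M mj 0 h μ t y η) +
        Complex.exp (I * phaseD M mj 0 h μ t y η / h) *
          (cutS χ ε δ 1 h μ t 0 η * ampD χ M mj 0 h μ t y η +
            cutS χ ε δ 0 h μ t 0 η * ampD χ M mj 1 h μ t y η) := by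
    funext t
    rw [dT, hb']
    exact ((dE t).mul ((dD0 t).mul (da 0 t))).deriv
  have d2 := ((((dE t).mul (((dφ 1 t).const_mul I).div_const (h : ℂ))).mul
      ((dD0 t).mul (da 0 t))).add ((dE t).mul (((dD1 t).mul (da 0 t)).add
        ((dD0 t).mul (da 1 t))))).deriv
  have d3 := Eq.trans (congrArg (fun f => deriv f t) d1) d2
  change dT (dT (parametrixSymbol χ M mj ε δ h μ)) t y η = _ at d3
  simp only [Pi.add_apply, paraSym]
  rw [e1, d3, e3, hb, hE]
  have c0 : ∀ i, cutS χ ε δ i h μ t y η = cutS χ ε δ i h μ t 0 η := fun _ => rfl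
  simp only [transportFun, cutErr, conjS, Pi.add_apply, Pi.sub_apply, Pi.mul_apply, Pi.smul_apply,
    Pi.pow_apply, c0]
  field_simp
  ring_nf
  simp only [I_sq]
  ring

end IsModelPerturbation
end

theorem Bd.extend {ι V F : Type*} [NormedAddCommGroup V] [NormedSpace ℝ V] [NormedAddCommGroup F]
    [NormedSpace ℝ F] {S T : Set ι} {σ w : ι → ℝ} {f : ι → V → F} (h : Bd S σ w f)
    (hST : S ⊆ T) (h0 : ∀ i ∈ T, i ∉ S → f i = fun _ => 0) (hσ : ∀ i ∈ T, 0 ≤ σ i)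
    (hw : ∀ i ∈ T, 0 ≤ w i) : Bd T σ w f := by
  have h1 : Bd (T \ S) σ w f :=
    (Bd.zero (fun i hi => hσ i hi.1) (fun i hi => hw i hi.1)).congr fun i hi => (h0 i hi.1 hi.2).symm
  have e := Set.union_sdiff_cancel hST
  have h2 := h.union h1 (by rwa [e]) (by rwa [e])
  rwa [e] at h2

/-- `D_y^k b = O(w σ^k)`, uniformly in `η`. -/
def SymBd {ι : Type*} (S : Set ι) (σ w : ι → ℝ) (b : ι → Sym n) : Prop :=
  Bd (S ×ˢ (Set.univ : Set (E n))) (fun q => σ q.1) (fun q => w q.1) (fun q y => b q.1 y q.2)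

section
variable {ι : Type*} {S : Set ι} {σ w : ι → ℝ} {b m : ι → Sym n}

theorem JointBd.symBd (h : JointBd S m) (hσ : ∀ i ∈ S, 1 ≤ σ i) : SymBd S σ (fun _ => 1) m :=
  ((Bd.slice h).mono_set fun _ hq => hq.1).scale one_nonneg (fun _ hq => hσ _ hq.1)
    one_nonneg

protected theorem SymBd.hdy (hb : SymBd S σ w b) {h : ι → ℝ} (h0 : ∀ i ∈ S, 0 ≤ h i)
    (hσ0 : ∀ i ∈ S, 0 ≤ σ i) (hw : ∀ i ∈ S, 0 ≤ w i) (hσ : ∀ i ∈ S, h i * σ i ≤ 1) (j : Fin n) :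
    SymBd S σ w (fun i => hdy (h i) j (b i)) := by
  have h1 := (Bd.fderiv_apply hb (bas j)).const_mul (fun q hq => hσ0 _ hq.1)
    (fun q => -(I * h q.1)) 1 (w' := fun q => h q.1) (fun q hq => h0 _ hq.1) fun q hq => by
      rw [norm_neg, norm_mul, norm_I, norm_real, norm_eq_abs,
        abs_of_nonneg (h0 _ hq.1)]
  refine (h1.mono (fun q hq => hσ0 _ hq.1) 1 (fun q hq => ?_) fun q hq => hw _ hq.1).congr
    fun q _ => ?_
  · have := hσ _ hq.1
    have := hw _ hq.1
    nlinarith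
  · funext y
    simp only [hdy, dy, Pi.neg_apply, Pi.smul_apply, smul_eq_mul]
    ring

theorem SymBd.mpow_hdy (hb : SymBd S σ w b) {h : ι → ℝ} (h0 : ∀ i ∈ S, 0 ≤ h i)
    (hσ1 : ∀ i ∈ S, 1 ≤ σ i) (hw : ∀ i ∈ S, 0 ≤ w i) (hσ : ∀ i ∈ S, h i * σ i ≤ 1)
    (α : Fin n → ℕ) : SymBd S σ w (fun i => mpow (hdy (h i)) α (b i)) := by
  have hσ0 := fun i hi => zero_le_one.trans (hσ1 i hi)
  have := mpow_intertwine
    (D' := fun j (c : ι → Sym n) i => hdy (h i) j (c i))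
    (fun c c' => SymBd S σ w c) (fun j c _ hc => hc.hdy h0 hσ0 hw hσ j) α (b := b) hb
  have e : ∀ i, mpow (fun j (c : ι → Sym n) i => hdy (h i) j (c i)) α b i =
      mpow (hdy (h i)) α (b i) := fun i =>
    mpow_intertwine (D := fun j (c : ι → Sym n) i => hdy (h i) j (c i))
      (fun c c' => c i = c')
      (fun j c c' hc => by beta_reduce; rw [hc]) α rfl
  exact Bd.congr this fun q _ => by beta_reduce; rw [← e]

theorem SymBd.compSym_of_forall (M : ℕ) {h : ι → ℝ} (hσ : ∀ i ∈ S, 0 ≤ σ i)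
    (hw : ∀ i ∈ S, 0 ≤ w i)
    (H : ∀ α, SymBd S σ w fun i => mpow deta α (m i) * mpow (hdy (h i)) α (b i)) :
    SymBd S σ w (fun i => compSym M (h i) (m i) (b i)) := by
  refine (Bd.sum (range (M + 1)) (f := fun k (q : ι × E n) y =>
    ∑ α ∈ piAntidiag Finset.univ k, invFact α * (mpow deta α (m q.1) y q.2 *
      mpow (hdy (h q.1)) α (b q.1) y q.2))
    (fun q hq => hσ _ hq.1) (fun q hq => hw _ hq.1) fun k _ =>
    Bd.sum _ (fun q hq => hσ _ hq.1) (fun q hq => hw _ hq.1) fun α _ =>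
      Bd.smul_const (H α) _).congr fun q _ => ?_
  simp only [compSym, multiSum, Finset.sum_apply, Pi.smul_apply, Pi.mul_apply,
    smul_eq_mul]

protected theorem SymBd.compSym (M : ℕ) (hm : JointBd S m) (hb : SymBd S σ w b) {h : ι → ℝ}
    (h0 : ∀ i ∈ S, 0 ≤ h i) (hσ1 : ∀ i ∈ S, 1 ≤ σ i) (hw : ∀ i ∈ S, 0 ≤ w i)
    (hσ : ∀ i ∈ S, h i * σ i ≤ 1) :
    SymBd S σ w (fun i => compSym M (h i) (m i) (b i)) :=
  .compSym_of_forall M (fun i hi => zero_le_one.trans (hσ1 i hi)) hw fun α =>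
    Bd.congr_weight (Bd.mul ((hm.mpow_deta α).symBd hσ1) (hb.mpow_hdy h0 hσ1 hw hσ α))
      fun _ _ => one_mul _

end

section
variable [NeZero n] {Y : Set (E n)} {ε h₁ δ : ℝ} {m : ℝ → ℝ → ℝ → Sym n} {mj : ℕ → ℝ → ℝ → Sym n}
  {M : ℕ} {q : Par n} {χ : ℝ → ℂ} {h μ : ℝ}

theorem S₂_subset_T₂ : S₂ n ε δ h₁ ⊆ T₂ n ε h₁ := fun _ hq =>
  ⟨hq.1.1, hq.1.2.1, hq.1.2.2.1, hq.1.2.2.2.1, hq.1.2.2.2.2.1⟩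

theorem paraSym_eq_zero {t : ℝ} {η : E n}
    (h0 : ∀ᶠ s in nhds t, ∀ y, parametrixSymbol χ M mj ε δ h μ s y η = 0) (y : E n) :
    paraSym χ M mj ε δ h μ t y η = 0 := by
  have h1 := h0.self_of_nhds
  have h2 : dy 0 (parametrixSymbol χ M mj ε δ h μ t) y η = 0 := by
    simp only [dy, h1, fderiv_fun_const, Pi.zero_apply, zero_apply]
  have h3 : ∀ᶠ s in nhds t, dT (parametrixSymbol χ M mj ε δ h μ) s y η = 0 := by
    filter_upwards [h0.eventually_nhds] with s hs
    have : (fun s => parametrixSymbol χ M mj ε δ h μ s y η) =ᶠ[nhds s] fun _ => 0 :=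
      hs.mono fun s hs => hs y
    rw [dT, this.deriv_eq, deriv_const]
  have h4 : dT (dT (parametrixSymbol χ M mj ε δ h μ)) t y η = 0 := by
    rw [dT, Filter.EventuallyEq.deriv_eq h3, deriv_const]
  rw [paraSym, h2, h4, h1]
  ring

theorem compSym_eq_zero {h : ℝ} {a b : Sym n} {η : E n} (h0 : ∀ y, b y η = 0) (y : E n) :
    compSym M h a b y η = 0 := by
  have h1 : ∀ α, ∀ y, mpow (hdy h) α b y η = 0 := fun α =>
    mpow_induction (fun b : Sym n => ∀ y, b y η = 0) (fun j b hb y => by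
      simp only [hdy, dy, Pi.neg_apply, Pi.smul_apply, hb, fderiv_fun_const, Pi.zero_apply,
        zero_apply, smul_zero, neg_zero]) α h0
  simp only [compSym, multiSum, Finset.sum_apply, Pi.smul_apply, Pi.mul_apply, h1, mul_zero,
    smul_zero, Finset.sum_const_zero]

namespace IsModelPerturbation
variable (H : IsModelPerturbation Y ε m mj) (hχ : ContDiff ℝ ∞ χ)
  (h1 : ∀ σ, |σ| ≤ 1 → χ σ = 1) (h2 : ∀ σ, 2 ≤ |σ| → χ σ = 0) (hε : 0 < ε) (hε1 : ε ≤ 1)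
  (hδ : 0 < δ) (hδ1 : δ ≤ 1 / 2) (hh : h₁ ≤ 1) (hM : 1 ≤ M)
  (him : ∀ q ∈ S₂ n ε δ h₁, ∀ y, |(slices (phaseTail M mj) q y).im| ≤ q.2.2.1 * q.im / 2)
include H h2 hδ hδ1

theorem parametrixSymbol_eventually_eq_zero (hq : q ∈ T₂ n ε h₁) (hq' : q ∉ S₂ n ε δ h₁) :
    ∀ᶠ s in nhds q.2.2.1, ∀ y, parametrixSymbol χ M mj ε δ q.1 q.2.1 s y q.2.2.2 = 0 := by
  obtain ⟨hq1, hq2, hq3, hq4, hq5⟩ := hq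
  have hμ := (rpow_pos_of_pos hq1 _).trans_le hq3
  have hr : 0 < q.r := rhoN_pos hμ
  have hp : 0 < q.1 ^ ε := rpow_pos_of_pos hq1 _
  have key : ∀ s, (2 < |s * (q.1 ^ ε)⁻¹| ∨ 2 < |s * (rhoN (q.2.1, q.2.2.2) ^ 2 * δ)⁻¹|) →
      ∀ y, parametrixSymbol χ M mj ε δ q.1 q.2.1 s y q.2.2.2 = 0 := fun s hs y => by
    rw [parametrixSymbol_eq]
    simp only [Pi.mul_apply, cutS, cutD_eq_zero h2 0 hs, mul_zero, zero_mul]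
  by_cases hη : 2 ≤ |q.2.2.2 0|
  · refine .of_forall fun s y => ?_
    refine mul_eq_zero_of_right _ ?_
    change evS (M + 1) (amp χ M mj) q.1 q.2.1 s y q.2.2.2 = 0
    exact sum_eq_zero fun j _ => sum_eq_zero fun k _ => by
      exact mul_eq_zero_of_right _ (ser₂_amp_vanCls h2 M j k q.2.1 y q.2.2.2 hη)
  · have h3 : 2 * δ * q.r ^ 2 < q.2.2.1 ∨ 2 * q.1 ^ ε < q.2.2.1 := by
      by_contra! h4
      refine hq' ⟨⟨hq1, hq2, hq3, hq4, hq5, (not_le.1 hη).le, h4.1.trans ?_⟩, h4⟩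
      nlinarith
    have h4 : ∀ {c : ℝ}, 0 < c → ∀ {s}, 2 * c < s → 2 < |s * c⁻¹| := fun {c} hc {s} hs => by
      rw [← div_eq_mul_inv, abs_div, abs_of_pos hc, lt_div_iff₀ hc]
      exact hs.trans_le (le_abs_self _)
    rcases h3 with h3 | h3
    · filter_upwards [lt_mem_nhds h3] with s hs
      refine key s (Or.inr (h4 (by positivity) ?_))
      calc 2 * (rhoN (q.2.1, q.2.2.2) ^ 2 * δ) = 2 * δ * q.r ^ 2 := by rw [Par.r]; ring
        _ < s := hs
    · filter_upwards [lt_mem_nhds h3] with s hs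
      exact key s (Or.inl (h4 hp hs))

include hχ hε hε1 hh hM him

theorem bd_parametrixSymbol : Bd (T₂ n ε h₁) (Par.σ ε) (fun _ => 1)
    (slices (parametrixSymbol χ M mj ε δ)) := by
  have hσ : ∀ q ∈ T₂ n ε h₁, 0 ≤ q.σ ε := fun q hq => (rpow_pos_of_pos hq.1 _).le
  have hσ' : ∀ q ∈ S₂ n ε δ h₁, 0 ≤ q.σ ε := fun q hq => hσ q (S₂_subset_T₂ hq)
  obtain ⟨K, hK, hb⟩ := exists_norm_cutS_le (n := n) hχ h2 hε hε1 hδ hh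
  refine Bd.extend (S := S₂ n ε δ h₁) ?_ S₂_subset_T₂ (fun q hq hq' => ?_) hσ
    one_nonneg
  · have hE := H.bd_expPhase hε1 hM hh him
    have ha := ((H.expn_ampD (M := M) subset_rfl hε hh hχ h2 0).2.1.mono_set
      (T := S₂ n ε δ h₁) fun q hq => hq.1).scale one_nonneg
      (fun q hq => Par.one_le_σ hε1 hq.1.1 (hq.1.2.1.trans hh))
      (fun q hq => (zpow_pos (S₁.r_pos hq.1) _).le)
    have h3 := (hE.const_mul hσ' (fun q => cutS χ ε δ 0 q.1 q.2.1 q.2.2.1 0 q.2.2.2) K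
      one_nonneg fun q hq => by
        simpa using hb 0 (by norm_num) q hq.1).mul ha
    refine (h3.mono hσ' 1 (fun q hq => ?_) fun _ _ => zero_le_one).congr fun q _ => ?_
    · have := S₁.s_pos hq.1
      have : Real.exp (-(q.s / 2)) ≤ 1 := Real.exp_le_one_iff.2 (by linarith)
      simpa using this
    · funext y
      simp only [slices, parametrixSymbol_eq]
      rw [mul_comm (cutS _ _ _ _ _ _ _ _ _)]
      rfl
  · funext y
    exact (H.parametrixSymbol_eventually_eq_zero h2 hδ hδ1 hq hq').self_of_nhds y

include h1

theorem bd_paraSym_add_compSym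
    (hb : JointBd (T₁ ε h₁) (fun p => m p.1 p.2.1 p.2.2))
    (hrem : RemBd m mj M ε h₁) :
    Bd (T₂ n ε h₁) (Par.σ ε) (fun q => q.1 ^ (3 * ε * M / 2))
      (slices fun h μ t => paraSym χ M mj ε δ h μ t +
        compSym M h (m h μ t) (parametrixSymbol χ M mj ε δ h μ t)) := by
  have hσ : ∀ q ∈ T₂ n ε h₁, 0 ≤ q.σ ε := fun q hq => (rpow_pos_of_pos hq.1 _).le
  have hσ' : ∀ q ∈ S₂ n ε δ h₁, 0 ≤ q.σ ε := fun q hq => hσ q (S₂_subset_T₂ hq)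
  have hσ1 : ∀ q ∈ S₂ n ε δ h₁, 1 ≤ q.σ ε := fun q hq =>
    Par.one_le_σ hε1 hq.1.1 (hq.1.2.1.trans hh)
  have hw : ∀ q ∈ T₂ n ε h₁, 0 ≤ q.1 ^ (3 * ε * M / 2) := fun q hq =>
    (rpow_pos_of_pos hq.1 _).le
  obtain ⟨K, hK, hcut⟩ := exists_norm_cutS_le (n := n) hχ h2 hε hε1 hδ hh
  obtain ⟨K', hK', hexp⟩ := exists_exp_le (n := n) hδ hh hε (3 * M)
  refine Bd.extend (S := S₂ n ε δ h₁) ?_ S₂_subset_T₂ (fun q hq hq' => ?_) hσ hw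
  · have up : ∀ {w : Par n → ℝ} {f : Par n → E n → ℂ}, Bd (S₁ n ε h₁) (fun _ => 1) w f →
        (∀ q ∈ S₁ n ε h₁, 0 ≤ w q) → Bd (S₂ n ε δ h₁) (Par.σ ε) w f := fun hf hw =>
      (hf.mono_set fun q hq => hq.1).scale one_nonneg hσ1 (fun q hq => hw q hq.1)
    have hE := H.bd_expPhase hε1 hM hh him
    have hT := up (H.bd_transportFun hε hh hM hb hrem hχ h2) fun q hq =>
      add_nonneg (pow_pos (S₁.x_pos hq) _).le (pow_pos (S₁.z_pos hq) _).le
    have ha := fun i => up (H.expn_ampD (M := M) subset_rfl hε hh hχ h2 i).2.1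
      fun q hq => (zpow_pos (S₁.r_pos hq) _).le
    have hφ := fun i => up (H.expn_phaseD (M := M) subset_rfl hε hh i).2.1
      fun q hq => (zpow_pos (S₁.r_pos hq) _).le
    have hsmall : ∀ i, 1 ≤ i → i ≤ 2 → ∀ q ∈ S₂ n ε δ h₁, Real.exp (-(q.s / 2)) *
        ‖(q.1 : ℂ) ^ i * cutS χ ε δ i q.1 q.2.1 q.2.2.1 0 q.2.2.2‖ ≤
        K' * K * q.1 ^ (3 * ε * M / 2) := fun i hi1 hi2 q hq => by
      have h3 : ‖(q.1 : ℂ) ^ i * cutS χ ε δ i q.1 q.2.1 q.2.2.1 0 q.2.2.2‖ ≤ K := by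
        rw [norm_mul, norm_pow, norm_real, norm_eq_abs, abs_of_pos hq.1.1]
        exact hcut i hi2 q hq.1
      have h4 : 0 < q.1 ^ (3 * ε * M / 2) := rpow_pos_of_pos hq.1.1 _
      have hr := S₁.r_pos hq.1
      have hp : 0 < q.1 ^ ε := rpow_pos_of_pos hq.1.1 _
      have ht := hq.1.2.2.2.2.1.1
      by_cases hA : q.1 ^ ε ≤ q.2.2.1 ∨ δ * q.r ^ 2 ≤ q.2.2.1
      · have h5 := hexp q hq.1 hA
        have e : ε * ((3 * M : ℕ) : ℝ) / 2 = 3 * ε * M / 2 := by push_cast; ring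
        rw [e] at h5
        calc _ ≤ K' * q.1 ^ (3 * ε * M / 2) * K := by gcongr
          _ = _ := by ring
      · push Not at hA
        have h5 : cutS χ ε δ i q.1 q.2.1 q.2.2.1 0 q.2.2.2 = 0 := by
          refine cutD_eq_zero' h1 i hi1 ?_ ?_
          · rw [← div_eq_mul_inv, abs_of_pos (by positivity), div_lt_one hp]; exact hA.1
          · have h6 := hr
            rw [← div_eq_mul_inv, abs_of_pos (by positivity), div_lt_one (by positivity), mul_comm]
            exact hA.2
        rw [h5]
        simp
        positivity
    have b0 : Bd (S₂ n ε δ h₁) (Par.σ ε) (fun q => q.1 ^ (3 * ε * M / 2)) (fun q y =>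
        slices (expPhase M mj) q y * (cutS χ ε δ 0 q.1 q.2.1 q.2.2.1 0 q.2.2.2 *
          slices (transportFun χ M m mj) q y)) := by
      refine (hE.mul (hT.const_mul hσ' (fun q => cutS χ ε δ 0 q.1 q.2.1 q.2.2.1 0 q.2.2.2) K
        one_nonneg fun q hq => by
          simpa using hcut 0 (by norm_num) q hq.1)).mono hσ' (M.factorial * 4 ^ M + 1)
          (fun q hq => ?_) (fun q hq => hw q (S₂_subset_T₂ hq))
      have h3 := S₁.x_pow_mul_exp_le hq.1 M
      have h4 := S₁.z_pow_le hq.1 M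
      have h5 := S₁.s_pos hq.1
      have h6 : Real.exp (-(q.s / 2)) ≤ 1 := Real.exp_le_one_iff.2 (by linarith)
      have h8 : 0 ≤ q.z ^ M := (pow_pos (S₁.z_pos hq.1) _).le
      nlinarith
    have hin : Bd (S₂ n ε δ h₁) (Par.σ ε) (fun _ => 1) (fun q y =>
        -2 * (I * slices (phaseD M mj 1) q y * slices (ampD χ M mj 0) q y +
          q.1 * slices (ampD χ M mj 1) q y)) := by
      refine Bd.smul_const (Bd.add ?_ ?_) _
      · refine (((hφ 1).smul_const I).mul (ha 0)).mono hσ' 2 (fun q hq => ?_)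
          fun _ _ => zero_le_one
        have := S₁.r_le hq.1
        norm_num
        exact this
      · refine ((ha 1).const_mul hσ' (fun q => (q.1 : ℂ)) 1
          (fun q hq => hq.1.1.le) fun q hq => by
            rw [norm_real, norm_eq_abs, abs_of_pos hq.1.1, one_mul]).mono hσ' 1
          (fun q hq => ?_) fun _ _ => zero_le_one
        have h3 := S₁.h_le_r_sq hq.1 hε hh
        have h4 := pow_pos (S₁.r_pos hq.1) 2
        have e : q.r ^ ((0 : ℤ) - 2 * ((1 : ℕ) : ℤ)) = (q.r ^ 2)⁻¹ := by simp
        rw [e, ← div_eq_mul_inv, one_mul]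
        exact (div_le_one h4).2 h3
    have b1 : Bd (S₂ n ε δ h₁) (Par.σ ε) (fun q => q.1 ^ (3 * ε * M / 2)) (fun q y =>
        slices (expPhase M mj) q y *
          (((q.1 : ℂ) ^ 1 * cutS χ ε δ 1 q.1 q.2.1 q.2.2.1 0 q.2.2.2) *
          (-2 * (I * slices (phaseD M mj 1) q y * slices (ampD χ M mj 0) q y +
          q.1 * slices (ampD χ M mj 1) q y)))) := by
      refine (hE.mul (hin.const_mul hσ' (fun q => (q.1 : ℂ) ^ 1 *
        cutS χ ε δ 1 q.1 q.2.1 q.2.2.1 0 q.2.2.2) 1 (fun _ _ => norm_nonneg _)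
          fun q hq => by rw [one_mul])).mono hσ' (K' * K)
          (fun q hq => ?_) (fun q hq => hw q (S₂_subset_T₂ hq))
      have := hsmall 1 le_rfl (by norm_num) q hq
      rwa [mul_one]
    have b2 : Bd (S₂ n ε δ h₁) (Par.σ ε) (fun q => q.1 ^ (3 * ε * M / 2)) (fun q y =>
        slices (expPhase M mj) q y *
          (((q.1 : ℂ) ^ 2 * cutS χ ε δ 2 q.1 q.2.1 q.2.2.1 0 q.2.2.2) *
          slices (ampD χ M mj 0) q y)) := by
      refine (hE.mul ((ha 0).const_mul hσ' (fun q => (q.1 : ℂ) ^ 2 *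
        cutS χ ε δ 2 q.1 q.2.1 q.2.2.1 0 q.2.2.2) 1 (fun _ _ => norm_nonneg _)
          fun q hq => by rw [one_mul])).mono hσ' (K' * K)
          (fun q hq => ?_) (fun q hq => hw q (S₂_subset_T₂ hq))
      have := hsmall 2 (by norm_num) le_rfl q hq
      simpa using this
    refine ((b0.add b1).sub b2).congr fun q hq => ?_
    funext y
    have e := congrFun (congrFun (H.paraSym_add_compSym (δ := δ)
      (S₁.mu_pos hq.1) hq.1.2.2.2.1 hχ hq.1.1.ne' hM q.2.2.1) y) q.2.2.2
    simp only [slices]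
    rw [e]
    have c0 : ∀ i, cutS χ ε δ i q.1 q.2.1 q.2.2.1 y q.2.2.2 =
      cutS χ ε δ i q.1 q.2.1 q.2.2.1 0 q.2.2.2 := fun _ => rfl
    simp only [Pi.mul_apply, Pi.add_apply, cutErr, c0]
    ring
  · funext y
    have h3 := H.parametrixSymbol_eventually_eq_zero (M := M) h2 hδ hδ1 hq hq'
    simp only [slices, Pi.add_apply]
    rw [paraSym_eq_zero h3, compSym_eq_zero h3.self_of_nhds, add_zero]

/-- The symbols of the parametrix and of its image, as families over `(h, μ, t)`. -/
theorem symBd_parametrix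
    (hb : JointBd (T₁ ε h₁) (fun p => m p.1 p.2.1 p.2.2))
    (hrem : RemBd m mj M ε h₁) :
    SymBd (T₁ ε h₁) (fun p => p.1 ^ (ε - 1)) (fun _ => 1)
      (fun p => parametrixSymbol χ M mj ε δ p.1 p.2.1 p.2.2) ∧
    SymBd (T₁ ε h₁) (fun p => p.1 ^ (ε - 1)) (fun _ => 1)
      (fun p => paraSym χ M mj ε δ p.1 p.2.1 p.2.2) ∧
    SymBd (T₁ ε h₁) (fun p => p.1 ^ (ε - 1)) (fun p => p.1 ^ (3 * ε * M / 2))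
      (fun p => paraSym χ M mj ε δ p.1 p.2.1 p.2.2 +
        compSym M p.1 (m p.1 p.2.1 p.2.2) (parametrixSymbol χ M mj ε δ p.1 p.2.1 p.2.2)) := by
  have e1 : SymBd (T₁ ε h₁) (fun p => p.1 ^ (ε - 1)) (fun _ => 1)
      (fun p => parametrixSymbol χ M mj ε δ p.1 p.2.1 p.2.2) :=
    (H.bd_parametrixSymbol hχ h2 hε hε1 hδ hδ1 hh hM him).comp_index
      (fun q : (ℝ × ℝ × ℝ) × E n => (q.1.1, q.1.2.1, q.1.2.2, q.2)) fun q hq => hq.1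
  have e2 : SymBd (T₁ ε h₁) (fun p => p.1 ^ (ε - 1)) (fun p => p.1 ^ (3 * ε * M / 2))
      (fun p => paraSym χ M mj ε δ p.1 p.2.1 p.2.2 +
        compSym M p.1 (m p.1 p.2.1 p.2.2) (parametrixSymbol χ M mj ε δ p.1 p.2.1 p.2.2)) :=
    (H.bd_paraSym_add_compSym hχ h1 h2 hε hε1 hδ hδ1 hh hM him hb hrem).comp_index
      (fun q : (ℝ × ℝ × ℝ) × E n => (q.1.1, q.1.2.1, q.1.2.2, q.2)) fun q hq => hq.1
  have h3 := SymBd.compSym M hb e1 (fun p hp => hp.1.le)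
    (fun p hp => Real.one_le_rpow_of_pos_of_le_one_of_nonpos hp.1 (hp.2.1.trans hh) (by linarith))
    one_nonneg fun p hp => by
      rw [← Real.rpow_one_add' hp.1.le (by linarith), add_sub_cancel]
      exact rpow_le_one hp.1.le (hp.2.1.trans hh) hε.le
  refine ⟨e1, ?_, e2⟩
  have e3 := Bd.sub (Bd.mono e2 (fun q hq => (rpow_pos_of_pos hq.1.1 _).le) 1
    (fun q hq => ?_) one_nonneg) h3
  · refine e3.congr fun q _ => ?_
    simp
  · rw [mul_one]
    exact rpow_le_one hq.1.1.le (hq.1.2.1.trans hh) (by positivity)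

end IsModelPerturbation
end

open MeasureTheory FourierTransform

/-! ### Mollified indicator functions -/

section moll
variable {V : Type u} [NormedAddCommGroup V] [NormedSpace ℝ V]

/-- `1_A * g`. -/
def moll (A : Set (E n)) (g : E n → V) (y : E n) : V := ∫ s in A, g (y - s)

theorem moll_eq_convolution {A : Set (E n)} (hA : MeasurableSet A) (g : E n → V) :
    moll A g = convolution (A.indicator fun _ => (1 : ℝ)) g (lsmul ℝ ℝ)
      volume := by
  funext y
  rw [moll, convolution_def, ← integral_indicator hA]
  congr 1
  funext s
  by_cases hs : s ∈ A <;> simp [hs]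

theorem locallyIntegrable_indicator_one {A : Set (E n)} (hA : MeasurableSet A) :
    LocallyIntegrable (A.indicator fun _ => (1 : ℝ)) (volume : Measure (E n)) :=
  (locallyIntegrable_const (1 : ℝ)).indicator hA

theorem contDiff_moll [CompleteSpace V] {A : Set (E n)} (hA : MeasurableSet A) {g : E n → V} (hg : ContDiff ℝ ∞ g)
    (hc : HasCompactSupport g) : ContDiff ℝ ∞ (moll A g) := by
  rw [moll_eq_convolution hA]
  exact hc.contDiff_convolution_right _ (locallyIntegrable_indicator_one hA) hg

theorem fderiv_moll [CompleteSpace V] {A : Set (E n)} (hA : MeasurableSet A) {g : E n → V}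
    (hg : ContDiff ℝ ∞ g) (hc : HasCompactSupport g) :
    fderiv ℝ (moll A g) = moll A (fderiv ℝ g) := by
  funext y
  have h1 := (hc.hasFDerivAt_convolution_right (lsmul ℝ ℝ)
    (locallyIntegrable_indicator_one hA) (hg.of_le (by simp)) y).fderiv
  rw [← moll_eq_convolution hA] at h1
  rw [h1, moll_eq_convolution hA, convolution_def, convolution_def]
  rfl

theorem norm_moll_le {A : Set (E n)} {g : E n → V} (hg : Continuous g)
    (hc : HasCompactSupport g) (y : E n) : ‖moll A g y‖ ≤ ∫ s, ‖g s‖ := by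
  have h1 : Integrable (fun s => ‖g (y - s)‖) volume :=
    ((hg.integrable_of_hasCompactSupport hc).comp_sub_left y).norm
  refine (norm_integral_le_integral_norm _).trans ?_
  rw [← integral_sub_left_eq_self (fun s => ‖g s‖) volume y]
  exact setIntegral_le_integral h1 (.of_forall fun _ => norm_nonneg _)

end moll

theorem exists_norm_iteratedFDeriv_moll_le (k : ℕ) : ∀ {V : Type} [NormedAddCommGroup V]
    [NormedSpace ℝ V] [CompleteSpace V] {g : E n → V}, ContDiff ℝ ∞ g → HasCompactSupport g →
    ∃ C : ℝ, 0 ≤ C ∧ ∀ A : Set (E n), MeasurableSet A → ∀ y,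
      ‖iteratedFDeriv ℝ k (moll A g) y‖ ≤ C := by
  induction k with
  | zero =>
    intro V _ _ _ g hg hc
    refine ⟨∫ s, ‖g s‖, integral_nonneg fun _ => norm_nonneg _, fun A _ y => ?_⟩
    rw [norm_iteratedFDeriv_zero]
    exact norm_moll_le hg.continuous hc y
  | succ k ih =>
    intro V _ _ _ g hg hc
    obtain ⟨C, hC, h⟩ := ih
      (hg.fderiv_right (by simp)) (hc.fderiv ℝ)
    refine ⟨C, hC, fun A hA y => ?_⟩
    rw [← norm_iteratedFDeriv_fderiv, fderiv_moll hA hg hc]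
    exact h A hA y

theorem norm_iteratedFDeriv_comp_smul_le {F : Type*} [NormedAddCommGroup F] [NormedSpace ℝ F]
    {f : E n → F} (hf : ContDiff ℝ ∞ f) (c : ℝ) (k : ℕ) (y : E n) :
    ‖iteratedFDeriv ℝ k (fun y => f (c • y)) y‖ ≤ ‖iteratedFDeriv ℝ k f (c • y)‖ * |c| ^ k := by
  have h := (c • ContinuousLinearMap.id ℝ (E n)).iteratedFDeriv_comp_right hf y (i := k)
    (mod_cast le_top)
  change ‖iteratedFDeriv ℝ k (f ∘ (c • ContinuousLinearMap.id ℝ (E n))) y‖ ≤ _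
  rw [h]
  refine (norm_compContinuousLinearMap_le _ _).trans ?_
  simp only [Finset.prod_const, Finset.card_univ, Fintype.card_fin]
  have h2 : ‖c • ContinuousLinearMap.id ℝ (E n)‖ ≤ |c| := by
    refine (norm_smul_le c (ContinuousLinearMap.id ℝ (E n))).trans ?_
    have := ContinuousLinearMap.norm_id_le (𝕜 := ℝ) (E := E n)
    rw [norm_eq_abs]
    nlinarith [abs_nonneg c]
  simp
  gcongr

/-- Cutoff functions of the set `Y` at the scale `r`. -/
theorem exists_cutoff (Y : Set (E n)) : ∃ χ : ℝ → E n → ℂ,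
    Bd (Set.Ioi 0) (fun r => r⁻¹) (fun _ => 1) χ ∧
    (∀ r, 0 < r → ∀ y, y ∉ Y → χ r y = 0) ∧
    ∀ r, 0 < r → ∀ y, 3 * r < infDist y Yᶜ → χ r y = 1 := by
  set φ : ContDiffBump (0 : E n) := ⟨1 / 2, 1, by norm_num, by norm_num⟩ with hφ
  set g : E n → ℝ := φ.normed volume with hg
  have hgs : ContDiff ℝ ∞ g := φ.contDiff_normed
  have hgc : HasCompactSupport g := φ.hasCompactSupport_normed
  have hgsupp := fun s hs => by
    by_contra h
    have h1 : s ∈ Function.support g := h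
    rw [hg, φ.support_normed_eq, mem_ball_zero_iff] at h1
    exact absurd h1 (not_lt.2 hs)
  set A : ℝ → Set (E n) := fun r => {s | 2 * r ≤ infDist (r • s) Yᶜ} with hA
  have hAm : ∀ r, MeasurableSet (A r) := fun r =>
    (isClosed_le continuous_const ((Metric.continuous_infDist_pt _).comp
      (continuous_const_smul r))).measurableSet
  have hd : ∀ r, 0 < r → ∀ y s : E n, ‖r⁻¹ • y - s‖ < 1 → dist y (r • s) < r := fun r hr y s h => by
    have e : y - r • s = r • (r⁻¹ • y - s) := by
      rw [smul_sub, smul_smul, mul_inv_cancel₀ hr.ne', one_smul]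
    rw [dist_eq_norm, e, norm_smul, norm_eq_abs, abs_of_pos hr]
    nlinarith
  refine ⟨fun r y => ((moll (A r) g (r⁻¹ • y) : ℝ) : ℂ), Bd.clm Complex.ofRealCLM ⟨fun r _ => ?_,
    fun k => ?_⟩, fun r hr y hy => ?_, fun r hr y hy => ?_⟩
  · exact (contDiff_moll (hAm r) hgs hgc).comp (contDiff_const_smul _)
  · obtain ⟨C, hC, h⟩ := exists_norm_iteratedFDeriv_moll_le k hgs hgc
    refine ⟨C, hC, fun r hr y => (norm_iteratedFDeriv_comp_smul_le
      (contDiff_moll (hAm r) hgs hgc) _ k y).trans ?_⟩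
    rw [abs_of_pos (inv_pos.2 hr), mul_one]
    have := h (A r) (hAm r) (r⁻¹ • y)
    have : 0 < r⁻¹ := inv_pos.2 hr
    gcongr
  · rw [Complex.ofReal_eq_zero]
    refine setIntegral_eq_zero_of_forall_eq_zero fun s hs => hgsupp _ ?_
    by_contra! h
    have h1 := hd r hr y s h
    have h2 : infDist (r • s) Yᶜ ≤ dist (r • s) y := Metric.infDist_le_dist_of_mem hy
    rw [dist_comm] at h2
    have h3 : 2 * r ≤ infDist (r • s) Yᶜ := hs
    linarith
  · have h1 : moll (A r) g (r⁻¹ • y) = ∫ s, g (r⁻¹ • y - s) := by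
      refine setIntegral_eq_integral_of_forall_compl_eq_zero fun s hs => hgsupp _ ?_
      by_contra! h
      refine hs ?_
      have h1 := hd r hr y s h
      have h2 := Metric.infDist_le_infDist_add_dist (x := y) (y := r • s) (s := Yᶜ)
      change 2 * r ≤ infDist (r • s) Yᶜ
      linarith
    beta_reduce
    rw [h1, integral_sub_left_eq_self g volume, hg, φ.integral_normed, Complex.ofReal_one]

/-! ### Symbols supported in `Y` -/

/-- A function all of whose derivatives vanish at `z` is `O(|y - z|^N)`. -/
theorem norm_iteratedFDeriv_le_of_flat {F : Type*} [NormedAddCommGroup F] [NormedSpace ℝ F]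
    {f : E n → F} (hf : ContDiff ℝ ∞ f) {z : E n} (hz : ∀ k, iteratedFDeriv ℝ k f z = 0)
    {C : ℕ → ℝ} (hC : ∀ k y, ‖iteratedFDeriv ℝ k f y‖ ≤ C k) (N : ℕ) :
    ∀ k y, ‖iteratedFDeriv ℝ k f y‖ ≤ C (k + N) * dist y z ^ N := by
  induction N with
  | zero => intro k y; simpa using hC k y
  | succ N ih =>
    intro k y
    have h1 : ∀ x ∈ closedBall z (dist y z), ‖fderiv ℝ (iteratedFDeriv ℝ k f) x‖ ≤
        C (k + (N + 1)) * dist y z ^ N := fun x hx => by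
      rw [norm_fderiv_iteratedFDeriv]
      refine (ih (k + 1) x).trans ?_
      have h0 := (norm_nonneg _).trans (hC (k + 1 + N) x)
      rw [show k + (N + 1) = k + 1 + N by ring]
      gcongr
      exact Metric.mem_closedBall.1 hx
    have h2 := Convex.norm_image_sub_le_of_norm_fderiv_le
      (fun x _ => (hf.differentiable_iteratedFDeriv (mod_cast WithTop.coe_lt_top _)) x) h1
      (convex_closedBall z (dist y z)) (Metric.mem_closedBall_self dist_nonneg)
      (Metric.mem_closedBall.2 le_rfl)
    rw [hz k, sub_zero, ← dist_eq_norm] at h2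
    rw [pow_succ, ← mul_assoc]
    exact h2

/-- `supp_y a ⊂ Y`. -/
def SuppIn (Y : Set (E n)) (a : Sym n) : Prop := ∀ y ∉ Y, ∀ᶠ y' in nhds y, ∀ η, a y' η = 0

theorem suppIn_of_closure_subset {Y : Set (E n)} {a : Sym n}
    (h : closure {y | ∃ η, a y η ≠ 0} ⊆ Y) : SuppIn Y a := fun y hy => by
  have h1 :=
    isClosed_closure.isOpen_compl.mem_nhds fun h2 => hy (h h2)
  filter_upwards [h1] with y' hy' η
  by_contra h2
  exact hy' (subset_closure ⟨η, h2⟩)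

namespace SuppIn
variable {Y : Set (E n)} {a b : Sym n}

theorem eq_zero (h : SuppIn Y a) {y : E n} (hy : y ∉ Y) (η : E n) : a y η = 0 :=
  (h y hy).self_of_nhds η

theorem add (ha : SuppIn Y a) (hb : SuppIn Y b) : SuppIn Y (a + b) := fun y hy => by
  filter_upwards [ha y hy, hb y hy] with y' h1 h2 η
  rw [Pi.add_apply, Pi.add_apply, h1, h2, add_zero]

theorem mul_left (c : Sym n) (ha : SuppIn Y a) : SuppIn Y (c * a) := fun y hy => by
  filter_upwards [ha y hy] with y' h1 η
  rw [Pi.mul_apply, Pi.mul_apply, h1, mul_zero]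

protected theorem deta (ha : SuppIn Y a) (j : Fin n) : SuppIn Y (deta j a) := fun y hy => by
  filter_upwards [ha y hy] with y' h1 η
  simp only [deta, h1, fderiv_fun_const, Pi.zero_apply, zero_apply]

theorem mpow_deta (ha : SuppIn Y a) (α : Fin n → ℕ) :
    SuppIn Y (mpow deta α a) :=
  mpow_induction (SuppIn Y) (fun j _ hb => hb.deta j) α ha

theorem iteratedFDeriv_eq_zero (ha : SuppIn Y a) {y : E n} (hy : y ∉ Y) (η : E n) (k : ℕ) :
    iteratedFDeriv ℝ k (fun y => a y η) y = 0 := by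
  have h1 : (fun y => a y η) =ᶠ[nhds y] fun _ => 0 := (ha y hy).mono fun y' h => h η
  rw [(h1.iteratedFDeriv ℝ k).self_of_nhds, iteratedFDeriv_fun_zero, Pi.zero_apply]

end SuppIn

section
variable {ι : Type*} {S : Set ι} {σ w : ι → ℝ} {a b : ι → Sym n} {Y : Set (E n)}

/-- The product of a symbol with support in `Y` and a symbol concentrated near the complement of
`Y`. -/
theorem SymBd.mul_of_suppIn (hY : IsOpen Y) (hY' : Yᶜ.Nonempty) (ha : JointBd S a)
    (has : ∀ i ∈ S, SuppIn Y (a i)) (hb : SymBd S σ w b) (hσ : ∀ i ∈ S, 1 ≤ σ i)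
    (hw : ∀ i ∈ S, 0 ≤ w i) {K : ℝ} (hK : 0 ≤ K)
    (hb0 : ∀ i ∈ S, ∀ y η, K * (σ i)⁻¹ < infDist y Yᶜ → b i y η = 0) (N : ℕ) :
    SymBd S σ (fun i => w i * (σ i)⁻¹ ^ N) (fun i => a i * b i) := by
  have ha' : SymBd S (fun _ => 1) (fun _ => 1) a := (Bd.slice ha).mono_set fun _ hq => hq.1
  refine ⟨fun q hq => (ha'.1 q hq).mul (hb.1 q hq), fun k => ?_⟩
  obtain ⟨C', hC', hbb⟩ := hb.le_upTo (fun q hq => zero_le_one.trans (hσ _ hq.1))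
    (fun q hq => hw _ hq.1) k
  choose C hC hab using ha'.2
  have hC0 : ∀ i ∈ range (k + 1), 0 ≤ (k.choose i : ℝ) * C (i + N) * K ^ N * C' :=
    fun i _ => by have := hC (i + N); positivity
  refine ⟨∑ i ∈ range (k + 1), (k.choose i : ℝ) * C (i + N) * K ^ N * C',
    sum_nonneg hC0, fun q hq y => ?_⟩
  have h1 := hσ _ hq.1
  have h2 := hw _ hq.1
  refine (norm_iteratedFDeriv_mul_le (ha'.1 q hq) (hb.1 q hq) y
    (mod_cast le_top)).trans ?_
  rw [sum_mul, sum_mul]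
  refine sum_le_sum fun i hi => ?_
  by_cases hy : K * (σ q.1)⁻¹ < infDist y Yᶜ
  · have h3 : (fun y => b q.1 y q.2) =ᶠ[nhds y] fun _ => 0 := by
      filter_upwards [(isOpen_lt continuous_const (Metric.continuous_infDist_pt _)).mem_nhds hy]
        with y' hy'
      exact hb0 _ hq.1 y' q.2 hy'
    rw [(h3.iteratedFDeriv ℝ (k - i)).self_of_nhds, iteratedFDeriv_fun_zero, Pi.zero_apply, norm_zero, mul_zero]
    have := hC0 i hi
    positivity
  · obtain ⟨z, hz, hd⟩ := hY.isClosed_compl.exists_infDist_eq_dist hY' y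
    rw [hd, not_lt] at hy
    have h3 := norm_iteratedFDeriv_le_of_flat (ha'.1 q hq)
      (fun k => (has _ hq.1).iteratedFDeriv_eq_zero hz q.2 k)
      (fun k y => by simpa using hab k q hq y) N i y
    have h4 := hbb (k - i) (by omega) q hq y
    have h5 : σ q.1 ^ (k - i) ≤ σ q.1 ^ k := pow_le_pow_right₀ h1 (by omega)
    have h6 := hC (i + N)
    calc (k.choose i : ℝ) * ‖iteratedFDeriv ℝ i (fun y => a q.1 y q.2) y‖ *
          ‖iteratedFDeriv ℝ (k - i) (fun y => b q.1 y q.2) y‖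
        ≤ (k.choose i : ℝ) * (C (i + N) * (K * (σ q.1)⁻¹) ^ N) *
          (C' * w q.1 * σ q.1 ^ k) := by
            gcongr
            · exact h3.trans (by gcongr)
            · exact h4.trans (by gcongr)
      _ = _ := by rw [mul_pow]; ring

theorem mpow_hdy_eq_zero {b : Sym n} {U : Set (E n)} (hU : IsOpen U)
    (hb : ∀ y ∈ U, ∀ η, b y η = 0) (h : ℝ) (α : Fin n → ℕ) :
    ∀ y ∈ U, ∀ η, mpow (hdy h) α b y η = 0 :=
  mpow_induction (fun b : Sym n => ∀ y ∈ U, ∀ η, b y η = 0) (fun j b hb y hy η => by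
    have h1 : (fun y => b y η) =ᶠ[nhds y] fun _ => 0 := by
      filter_upwards [hU.mem_nhds hy] with y' hy'
      exact hb y' hy' η
    simp only [hdy, dy, Pi.neg_apply, Pi.smul_apply, h1.fderiv_eq, fderiv_fun_const, Pi.zero_apply,
      zero_apply, smul_zero, neg_zero]) α hb

theorem SymBd.compSym_of_suppIn (M : ℕ) (hY : IsOpen Y) (hY' : Yᶜ.Nonempty) (ha : JointBd S a)
    (has : ∀ i ∈ S, SuppIn Y (a i)) (hb : SymBd S σ w b) (hσ : ∀ i ∈ S, 1 ≤ σ i)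
    (hw : ∀ i ∈ S, 0 ≤ w i) {K : ℝ} (hK : 0 ≤ K)
    (hb0 : ∀ i ∈ S, ∀ y η, K * (σ i)⁻¹ < infDist y Yᶜ → b i y η = 0) {h : ι → ℝ}
    (h0 : ∀ i ∈ S, 0 ≤ h i) (hσh : ∀ i ∈ S, h i * σ i ≤ 1) (N : ℕ) :
    SymBd S σ (fun i => w i * (σ i)⁻¹ ^ N) (fun i => compSym M (h i) (a i) (b i)) :=
  have hσ0 := fun _ hi => zero_le_one.trans (hσ _ hi)
  .compSym_of_forall M hσ0
    (fun _ hi => mul_nonneg (hw _ hi) (pow_nonneg (inv_nonneg.2 (hσ0 _ hi)) _)) fun α =>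
    SymBd.mul_of_suppIn hY hY' (ha.mpow_deta α)
      (fun i hi => (has i hi).mpow_deta α) (hb.mpow_hdy h0 hσ hw hσh α) hσ hw hK
      (fun i hi y η hy => mpow_hdy_eq_zero (isOpen_lt continuous_const
        (Metric.continuous_infDist_pt _)) (fun y hy η => hb0 i hi y η hy) (h i) α y hy η) N

end

/-! ### The Fourier transform on `L¹ ∩ L²` -/

theorem Lp.ae_eq_of_forall_schwartz {u : Lp ℂ 2 (volume : Measure (E n))} {v : E n → ℂ}
    (hv : Continuous v) (h : ∀ G : SchwartzMap (E n) ℂ, ∫ x, G x • u x = ∫ x, G x • v x) :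
    u =ᵐ[volume] v :=
  ae_eq_of_integral_contDiff_smul_eq ((Lp.memLp _).locallyIntegrable (by norm_num))
    hv.locallyIntegrable fun g hg hgc =>
      h ((hgc.comp_left rfl).toSchwartzMap
        (Complex.ofRealCLM.contDiff.comp hg))

theorem integral_smul_toLp {f : E n → ℂ} (h2 : MemLp f 2) (G : SchwartzMap (E n) ℂ) :
    ∫ x, G x • (h2.toLp f) x = ∫ x, G x • f x :=
  integral_congr_ae (by filter_upwards [h2.coeFn_toLp] with x hx; rw [hx])

theorem continuous_fourier {f : E n → ℂ} (h1 : Integrable f) : Continuous (𝓕 f) :=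
  VectorFourier.fourierIntegral_continuous Real.continuous_fourierChar (by exact continuous_inner) h1

theorem fourier_toLp {f : E n → ℂ} (h1 : Integrable f) (h2 : MemLp f 2) :
    ⇑(𝓕 (h2.toLp f) : Lp ℂ 2 (volume : Measure (E n))) =ᵐ[volume] 𝓕 f := by
  refine Lp.ae_eq_of_forall_schwartz (continuous_fourier h1) fun G => ?_
  have e1 := congrArg (fun T => T G) (Lp.fourier_toTemperedDistribution_eq (h2.toLp f))
  simp only [TemperedDistribution.fourier_apply, Lp.toTemperedDistribution_apply] at e1
  have e4 := VectorFourier.integral_fourierIntegral_smul_eq_flip (L := innerₗ (E n))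
    (μ := volume) Real.continuous_fourierChar
    continuous_inner G.integrable h1
  rw [flip_innerₗ] at e4
  rw [← e1, integral_smul_toLp]
  exact e4

theorem memLp_fourier {f : E n → ℂ} (h1 : Integrable f) (h2 : MemLp f 2) : MemLp (𝓕 f) 2 :=
  (memLp_congr_ae (fourier_toLp h1 h2)).1 (Lp.memLp _)

theorem eLpNorm_fourier {f : E n → ℂ} (h1 : Integrable f) (h2 : MemLp f 2) :
    eLpNorm (𝓕 f) 2 volume = eLpNorm f 2 volume := by
  rw [← eLpNorm_congr_ae (fourier_toLp h1 h2), ← eLpNorm_congr_ae h2.coeFn_toLp,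
    ← Lp.enorm_def, ← Lp.enorm_def, ← ofReal_norm, ← ofReal_norm, Lp.norm_fourier_eq]

theorem fourierInv_eq_fourier_neg' (f : E n → ℂ) : 𝓕⁻ f = fun x => 𝓕 f (-x) :=
  funext fun x => Real.fourierInv_eq_fourier_neg f x

theorem eLpNorm_fourierInv {f : E n → ℂ} (h1 : Integrable f) (h2 : MemLp f 2) :
    eLpNorm (𝓕⁻ f) 2 volume = eLpNorm f 2 volume := by
  rw [fourierInv_eq_fourier_neg', ← eLpNorm_fourier h1 h2]
  exact eLpNorm_comp_measurePreserving
    (memLp_fourier h1 h2).1 (Measure.measurePreserving_neg volume)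

theorem fourierInv_toLp {f : E n → ℂ} (h1 : Integrable f) (h2 : MemLp f 2) :
    ⇑(𝓕⁻ (h2.toLp f) : Lp ℂ 2 (volume : Measure (E n))) =ᵐ[volume] 𝓕⁻ f := by
  refine Lp.ae_eq_of_forall_schwartz ?_ fun G => ?_
  · rw [fourierInv_eq_fourier_neg']
    exact (continuous_fourier h1).comp continuous_neg
  have e1 := congrArg (fun T => T G) (Lp.fourierInv_toTemperedDistribution_eq (h2.toLp f))
  simp only [TemperedDistribution.fourierInv_apply, Lp.toTemperedDistribution_apply] at e1
  have e4 := VectorFourier.integral_fourierIntegral_smul_eq_flip (L := -innerₗ (E n))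
    (μ := volume) Real.continuous_fourierChar
    (by exact continuous_inner.neg) G.integrable h1
  have e5 : (-innerₗ (E n)).flip = -innerₗ (E n) := by
    ext x y
    simp [real_inner_comm]
  rw [e5] at e4
  rw [← e1, integral_smul_toLp, SchwartzMap.fourierInv_coe]
  exact e4

/-! ### Minkowski's inequality -/

theorem eLpNorm_two_sq {α : Type*} [MeasurableSpace α] {μ : Measure α} (f : α → ℂ) :
    eLpNorm f 2 μ ^ 2 = ∫⁻ x, ‖f x‖ₑ ^ 2 ∂μ := by
  rw [eLpNorm_eq_lintegral_rpow_enorm_toReal (by norm_num) (by norm_num), ← ENNReal.rpow_natCast,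
    ← ENNReal.rpow_mul]
  simp

theorem lintegral_sq_le {α : Type*} [MeasurableSpace α] {μ : Measure α} {f : α → ENNReal}
    {W : α → ENNReal} (hf : AEMeasurable f μ) (hW : Measurable W) (h0 : ∀ x, W x ≠ 0)
    (h1 : ∀ x, W x ≠ ⊤) : (∫⁻ x, f x ∂μ) ^ 2 ≤ (∫⁻ x, W x ∂μ) * ∫⁻ x, f x ^ 2 * (W x)⁻¹ ∂μ := by
  have h2 := ENNReal.lintegral_mul_le_Lp_mul_Lq μ (p := 2) (q := 2) (by constructor <;> norm_num)
    (f := fun x => W x ^ (1 / 2 : ℝ)) (g := fun x => f x * (W x)⁻¹ ^ (1 / 2 : ℝ))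
    (hW.pow_const _).aemeasurable (hf.mul (hW.inv.pow_const _).aemeasurable)
  have e1 : ∀ x, W x ^ (1 / 2 : ℝ) * (f x * (W x)⁻¹ ^ (1 / 2 : ℝ)) = f x := fun x => by
    rw [mul_left_comm, ← ENNReal.mul_rpow_of_nonneg _ _ (by simp),
      ENNReal.mul_inv_cancel (h0 x) (h1 x), ENNReal.one_rpow, mul_one]
  have e2 : ∀ x, (W x ^ (1 / 2 : ℝ)) ^ (2 : ℝ) = W x := fun x => by
    rw [← ENNReal.rpow_mul]; norm_num
  have e3 : ∀ x, (f x * (W x)⁻¹ ^ (1 / 2 : ℝ)) ^ (2 : ℝ) = f x ^ 2 * (W x)⁻¹ := fun x => by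
    rw [ENNReal.mul_rpow_of_nonneg _ _ (by norm_num), ← ENNReal.rpow_mul]
    norm_num
  simp only [Pi.mul_apply, e1, e2, e3] at h2
  calc (∫⁻ x, f x ∂μ) ^ 2 ≤ ((∫⁻ x, W x ∂μ) ^ (1 / 2 : ℝ) *
      (∫⁻ x, f x ^ 2 * (W x)⁻¹ ∂μ) ^ (1 / 2 : ℝ)) ^ 2 := by gcongr
    _ = _ := by
      rw [mul_pow, ← ENNReal.rpow_natCast, ← ENNReal.rpow_natCast, ← ENNReal.rpow_mul,
        ← ENNReal.rpow_mul]
      norm_num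

/-- Minkowski's inequality for an integral with values in `L²`. -/
theorem eLpNorm_integral_le {α β : Type*} [MeasurableSpace α] [MeasurableSpace β] {μ : Measure α}
    {ν : Measure β} [SFinite μ] [SFinite ν] {G : α → β → ℂ}
    (hG : StronglyMeasurable (uncurry G)) {W : α → ℝ} (hW : Measurable W)
    (hW0 : ∀ x, 0 < W x) (hWi : Integrable W μ) {A : ENNReal}
    (hb : ∀ x, eLpNorm (G x) 2 ν ≤ A * ofReal (W x)) :
    eLpNorm (fun y => ∫ x, G x y ∂μ) 2 ν ≤ A * ofReal (∫ x, W x ∂μ) := by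
  have hm := hG.measurable.enorm
  have hWm := hW.ennreal_ofReal
  have h0 := fun x => (ENNReal.ofReal_pos.2 (hW0 x)).ne'
  rw [← ENNReal.pow_le_pow_left_iff (n := 2) (by norm_num), eLpNorm_two_sq]
  calc ∫⁻ y, ‖∫ x, G x y ∂μ‖ₑ ^ 2 ∂ν
      ≤ ∫⁻ y, (∫⁻ x, ofReal (W x) ∂μ) *
          ∫⁻ x, ‖G x y‖ₑ ^ 2 * (ofReal (W x))⁻¹ ∂μ ∂ν := by
        refine lintegral_mono fun y => ?_
        refine le_trans ?_ (lintegral_sq_le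
          (hm.comp measurable_prodMk_right).aemeasurable hWm h0 fun x => ofReal_ne_top)
        gcongr
        exact enorm_integral_le_lintegral_enorm _
    _ = (∫⁻ x, ofReal (W x) ∂μ) *
          ∫⁻ x, (∫⁻ y, ‖G x y‖ₑ ^ 2 ∂ν) * (ofReal (W x))⁻¹ ∂μ := by
        have hm2 : Measurable fun p : β × α => ‖G p.2 p.1‖ₑ ^ 2 * (ofReal (W p.2))⁻¹ :=
          ((hm.comp measurable_swap).pow_const 2).mul (hWm.comp measurable_snd).inv
        rw [lintegral_const_mul _ hm2.lintegral_prod_right', lintegral_lintegral_swap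
          (hm2.aemeasurable)]
        congr 1
        refine lintegral_congr fun x => ?_
        dsimp only
        rw [lintegral_mul_const]
        exact (hm.comp measurable_prodMk_left).pow_const 2
    _ ≤ (∫⁻ x, ofReal (W x) ∂μ) * ∫⁻ x, A ^ 2 * ofReal (W x) ∂μ := by
        refine mul_le_mul' le_rfl (lintegral_mono fun x => ?_)
        rw [← eLpNorm_two_sq]
        calc eLpNorm (G x) 2 ν ^ 2 * (ofReal (W x))⁻¹
            ≤ (A * ofReal (W x)) ^ 2 * (ofReal (W x))⁻¹ := by
              gcongr; exact hb x
          _ = A ^ 2 * ofReal (W x) * (ofReal (W x) * (ofReal (W x))⁻¹) := by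
              ring
          _ = _ := by rw [ENNReal.mul_inv_cancel (h0 x) ofReal_ne_top, mul_one]
    _ = _ := by
        rw [lintegral_const_mul _ hWm, ← ofReal_integral_eq_lintegral_ofReal hWi
          (.of_forall fun x => (hW0 x).le)]
        ring

/-! ### Quantization -/

/-- `(1 + |σ|)^{-N}`. -/
def jw (N : ℕ) (σ : E n) : ℝ := ((1 + ‖σ‖) ^ N)⁻¹

theorem jw_pos (N : ℕ) (σ : E n) : 0 < jw N σ := by unfold jw; positivity

theorem continuous_jw (N : ℕ) : Continuous (jw (n := n) N) := by
  unfold jw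
  exact Continuous.inv₀ (by fun_prop) fun σ => by positivity

theorem integrable_jw {N : ℕ} (hN : n < N) : Integrable (jw (n := n) N) := by
  have h := integrable_one_add_norm (E := E n) (μ := volume) (r := N) (by simpa using hN)
  refine h.congr (of_forall fun σ => ?_)
  simp only [jw]
  rw [Real.rpow_neg (by positivity), rpow_natCast]

theorem jw_integral_nonneg (N : ℕ) : 0 ≤ ∫ σ, jw (n := n) N σ :=
  integral_nonneg fun σ => (jw_pos N σ).le

/-- The decay of the Fourier transform of a smooth function supported in a ball. -/
theorem exists_norm_fourier_le (n : ℕ) (ρ : ℝ) (N : ℕ) : ∃ K : ℝ, 0 ≤ K ∧ ∀ (f : E n → ℂ) (A : ℝ),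
    ContDiff ℝ ∞ f → (∀ y, ρ < ‖y‖ → f y = 0) → (∀ k ≤ N, ∀ y, ‖iteratedFDeriv ℝ k f y‖ ≤ A) →
    ∀ σ, ‖𝓕 f σ‖ ≤ K * A * jw N σ := by
  set v : ℝ := volume.real (closedBall (0 : E n) ρ) with hv
  have hv0 : 0 ≤ v := measureReal_nonneg
  refine ⟨2 ^ N * (v + 2 ^ N * ((N + 1) * v)), by positivity, fun f A hf hs hb σ => ?_⟩
  have hts : tsupport f ⊆ closedBall 0 ρ := by
    refine closure_minimal (fun y hy => ?_) Metric.isClosed_closedBall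
    rw [mem_closedBall_zero_iff]
    by_contra! h
    exact hy (hs y h)
  have hc : HasCompactSupport f := HasCompactSupport.of_support_subset_isCompact
    (isCompact_closedBall 0 ρ) ((subset_tsupport f).trans hts)
  have hz : ∀ k y, y ∉ closedBall (0 : E n) ρ → ‖iteratedFDeriv ℝ k f y‖ = 0 :=
    fun k y hy => by
      rw [norm_eq_zero]
      by_contra h
      exact hy (hts (support_iteratedFDeriv_subset k h))
  have hcont : ∀ k, Continuous (fun y => ‖iteratedFDeriv ℝ k f y‖) := fun k =>
    (hf.continuous_iteratedFDeriv (mod_cast le_top)).norm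
  have hint : ∀ k, Integrable (fun y => ‖iteratedFDeriv ℝ k f y‖) := fun k =>
    (hcont k).integrable_of_hasCompactSupport
      (HasCompactSupport.intro (isCompact_closedBall 0 ρ) fun y hy => hz k y hy)
  have hle : ∀ k ≤ N, ∫ y, ‖iteratedFDeriv ℝ k f y‖ ≤ A * v := fun k hk => by
    rw [← setIntegral_eq_integral_of_forall_compl_eq_zero (fun y hy => hz k y hy)]
    have h1 := norm_setIntegral_le_of_norm_le_const (μ := volume)
      (s := closedBall (0 : E n) ρ) (f := fun y => ‖iteratedFDeriv ℝ k f y‖) (C := A)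
      measure_closedBall_lt_top fun y _ => by rw [norm_norm]; exact hb k hk y
    exact (le_abs_self _).trans h1
  have h0 : ‖𝓕 f σ‖ ≤ A * v := by
    refine le_trans ?_ (hle 0 (Nat.zero_le _))
    refine (VectorFourier.norm_fourierIntegral_le_integral_norm _ _ _ _ _).trans (le_of_eq ?_)
    simp
  have hN : ‖σ‖ ^ N * ‖𝓕 f σ‖ ≤ 2 ^ N * ((N + 1) * (A * v)) := by
    have h1 := Real.pow_mul_norm_iteratedFDeriv_fourier_le (f := f) (K := 0) (N := (N : ℕ∞))
      (hf.of_le (mod_cast le_top)) (fun k m hk _ => by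
        have : k = 0 := by simpa using hk
        subst this
        simpa using hint m) (k := 0) (n := N) le_rfl le_rfl σ
    simp only [norm_iteratedFDeriv_zero, pow_zero, one_mul, CharP.cast_eq_zero, mul_zero,
      zero_add, Finset.range_one, Finset.singleton_product, Finset.sum_map] at h1
    refine h1.trans ?_
    gcongr
    refine (Finset.sum_le_card_nsmul _ _ (A * v) fun k hk => ?_).trans (le_of_eq ?_)
    · simp only [Function.Embedding.coeFn_mk, pow_zero, one_mul]
      exact hle k (by have := mem_range.1 hk; omega)
    · simp
  have hA : 0 ≤ A := (norm_nonneg _).trans (hb 0 (Nat.zero_le _) 0)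
  rw [jw, ← div_eq_mul_inv, le_div_iff₀ (by positivity)]
  have h2 : (1 + ‖σ‖) ^ N ≤ 2 ^ N * (1 + ‖σ‖ ^ N) := by
    rcases le_total ‖σ‖ 1 with h | h
    · calc (1 + ‖σ‖) ^ N ≤ 2 ^ N := by gcongr; linarith
        _ ≤ _ := le_mul_of_one_le_right (by positivity) (by simp)
    · calc (1 + ‖σ‖) ^ N ≤ (2 * ‖σ‖) ^ N := by gcongr; linarith
        _ = 2 ^ N * ‖σ‖ ^ N := mul_pow _ _ _
        _ ≤ _ := by gcongr; linarith
  calc ‖𝓕 f σ‖ * (1 + ‖σ‖) ^ N ≤ ‖𝓕 f σ‖ * (2 ^ N * (1 + ‖σ‖ ^ N)) := by gcongr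
    _ = 2 ^ N * (‖𝓕 f σ‖ + ‖σ‖ ^ N * ‖𝓕 f σ‖) := by ring
    _ ≤ 2 ^ N * (A * v + 2 ^ N * ((N + 1) * (A * v))) := by gcongr
    _ = _ := by ring

/-- The character `y ↦ e^{2πi⟨ξ,y⟩}`. -/
def ech (ξ y : E n) : ℂ := 𝐞 (inner ℝ ξ y)

theorem norm_ech (ξ y : E n) : ‖ech ξ y‖ = 1 := Circle.norm_coe _

theorem ech_add (ξ σ y : E n) : ech (ξ + σ) y = ech ξ y * ech σ y := by
  rw [ech, inner_add_left, AddChar.map_add_eq_mul]; rfl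

@[fun_prop]
theorem continuous_ech {X : Type*} [TopologicalSpace X] {f g : X → E n} (hf : Continuous f)
    (hg : Continuous g) : Continuous fun x => ech (f x) (g x) :=
  continuous_subtype_val.comp (Real.continuous_fourierChar.comp (hf.inner hg))

theorem fourier_eq_ech (f : E n → ℂ) (ξ : E n) : 𝓕 f ξ = ∫ y, ech (-ξ) y * f y := by
  simp only [fourier_eq, ech, inner_neg_left, real_inner_comm, Circle.smul_def, smul_eq_mul]

theorem fourierInv_eq_ech (f : E n → ℂ) (y : E n) : 𝓕⁻ f y = ∫ ξ, ech ξ y * f ξ :=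
  Real.fourierInv_eq _ _

/-- The Fourier transform in `y`. -/
def yhat (a : Sym n) (σ ξ : E n) : ℂ := 𝓕 (fun y => a y ξ) σ

theorem measurable_yhat {a : Sym n} (ha : Continuous (unc a)) :
    StronglyMeasurable (uncurry (yhat a)) := by
  have e : uncurry (yhat a) = fun p : E n × E n => ∫ v, ech (-p.1) v * a v p.2 :=
    funext fun p => fourier_eq_ech _ _
  rw [e]
  have h1 : Continuous fun q : (E n × E n) × E n => a q.2 q.1.2 :=
    ha.comp (continuous_snd.prodMk (continuous_snd.comp continuous_fst))
  exact StronglyMeasurable.integral_prod_right (f := fun (p : E n × E n) (v : E n) =>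
    ech (-p.1) v * a v p.2) (Continuous.stronglyMeasurable
    (.mul (by fun_prop : Continuous fun q : (E n × E n) × E n => ech (-q.1.1) q.2) h1))

/-- `∫ e^{2πi⟨y,ξ⟩} a(y,ξ) F(ξ) dξ`. -/
def opT (a : Sym n) (F : E n → ℂ) (y : E n) : ℂ := 𝓕⁻ (fun ξ => a y ξ * F ξ) y

theorem opT_eq (a : Sym n) (F : E n → ℂ) (y : E n) :
    opT a F y = ∫ ξ, ech ξ y * (a y ξ * F ξ) := fourierInv_eq_ech _ _

theorem opT_congr_ae (a : Sym n) {F G : E n → ℂ} (h : F =ᵐ[volume] G) : opT a F = opT a G := by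
  funext y
  rw [opT_eq, opT_eq]
  refine integral_congr_ae ?_
  filter_upwards [h] with ξ hξ
  rw [hξ]

theorem stronglyMeasurable_opT_family {X : Type*} [MeasurableSpace X] {b : X → Sym n}
    (hb : StronglyMeasurable fun q : X × E n × E n => b q.1 q.2.1 q.2.2) {G : X × E n → ℂ}
    (hG : StronglyMeasurable G) :
    StronglyMeasurable fun p : X × E n => opT (b p.1) (fun ξ => G (p.1, ξ)) p.2 := by
  simp only [opT_eq]
  have h2 : Continuous fun q : E n × E n => ech q.1 q.2 := by fun_prop
  exact StronglyMeasurable.integral_prod_right (f := fun (p : X × E n) (ξ : E n) =>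
    ech ξ p.2 * (b p.1 p.2 ξ * G (p.1, ξ)))
    ((h2.stronglyMeasurable.comp_measurable (g := fun q : (X × E n) × E n => (q.2, q.1.2))
      (by fun_prop)).mul ((hb.comp_measurable (g := fun q : (X × E n) × E n =>
      (q.1.1, q.1.2, q.2)) (by fun_prop)).mul (hG.comp_measurable (g := fun q : (X × E n) × E n =>
      (q.1.1, q.2)) (by fun_prop))))

theorem stronglyMeasurable_opT {a : Sym n} (ha : Continuous (unc a)) {F : E n → ℂ}
    (hF : AEStronglyMeasurable F volume) : StronglyMeasurable (opT a F) := by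
  rw [opT_congr_ae a hF.ae_eq_mk]
  simp only [funext (opT_eq a _)]
  have h2 : Continuous fun q : E n × E n => ech q.2 q.1 := by fun_prop
  exact StronglyMeasurable.integral_prod_right (f := fun y ξ => ech ξ y * (a y ξ * hF.mk F ξ))
    (h2.stronglyMeasurable.mul (ha.stronglyMeasurable.mul
      (hF.stronglyMeasurable_mk.comp_measurable measurable_snd)))

variable {g : E n → E n → ℂ} {F : E n → ℂ} {D : ℝ}

theorem integrable_ech_mul (hg : StronglyMeasurable (uncurry g))
    (hFs : StronglyMeasurable F) (hF1 : Integrable F) {c : E n → E n → ℂ}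
    (hc : Continuous fun q : E n × E n => c q.1 q.2)
    (hD : ∀ σ ξ, ‖c σ ξ * g σ ξ‖ ≤ D * jw (n + 1) σ) (y : E n) :
    Integrable (uncurry fun ξ σ : E n =>
      ech ξ y * (ech σ y * (c σ ξ * g σ ξ * F ξ))) (volume.prod volume) := by
  refine (hF1.norm.mul_prod ((integrable_jw (Nat.lt_succ_self n)).const_mul D)).mono' ?_
    (of_forall fun q => ?_)
  · have hc1 : Continuous fun q : E n × E n => ech q.1 y := by fun_prop
    have hc2 : Continuous fun q : E n × E n => ech q.2 y := by fun_prop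
    exact (hc1.stronglyMeasurable.mul (hc2.stronglyMeasurable.mul
      (((hc.stronglyMeasurable.mul hg).comp_measurable measurable_swap).mul
        (hFs.comp_measurable measurable_fst)))).aestronglyMeasurable
  · simp only [uncurry_def]
    rw [norm_mul, norm_ech, one_mul, norm_mul, norm_ech, one_mul, norm_mul, mul_comm]
    have := hD q.2 q.1
    gcongr

theorem eLpNorm_superposition_le (hg : StronglyMeasurable (uncurry g))
    (hFs : StronglyMeasurable F) (hF1 : Integrable F) {c : E n → Sym n}
    (hc : Continuous fun p : E n × E n × E n => c p.1 p.2.1 p.2.2)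
    (hD : ∀ σ y ξ, ‖c σ y ξ * g σ ξ‖ ≤ D * jw (n + 1) σ) {A : ENNReal}
    (hA : ∀ σ, eLpNorm (opT (c σ) fun ξ => g σ ξ * F ξ) 2 volume ≤
      A * ofReal (jw (n + 1) σ)) :
    eLpNorm (fun y => ∫ ξ, ∫ σ, ech ξ y * (ech σ y * (c σ y ξ * g σ ξ * F ξ))) 2 volume ≤
      A * ofReal (∫ σ, jw (n := n) (n + 1) σ) := by
  set G : E n → E n → ℂ := fun σ y => ech σ y * opT (c σ) (fun ξ => g σ ξ * F ξ) y with hG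
  have e : (fun y => ∫ ξ, ∫ σ, ech ξ y * (ech σ y * (c σ y ξ * g σ ξ * F ξ))) =
      fun y => ∫ σ, G σ y := by
    funext y
    rw [integral_integral_swap (integrable_ech_mul hg hFs hF1 (c := fun σ ξ => c σ y ξ)
      (hc.comp (by fun_prop : Continuous fun q : E n × E n => (q.1, y, q.2))) (fun σ => hD σ y) y)]
    congr 1
    funext σ
    simp only [hG, opT_eq]
    rw [← integral_const_mul]
    congr 1
    funext ξ
    ring
  rw [e]
  have hc3 : Continuous fun q : E n × E n => ech q.1 q.2 := by fun_prop
  refine eLpNorm_integral_le (hc3.stronglyMeasurable.mul (stronglyMeasurable_opT_family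
    hc.stronglyMeasurable (hg.mul (hFs.comp_measurable measurable_snd))))
    (continuous_jw (n + 1)).measurable (jw_pos (n + 1))
    (integrable_jw (Nat.lt_succ_self n)) fun σ => le_trans (le_of_eq ?_) (hA σ)
  exact eLpNorm_congr_norm_ae (of_forall fun y => by
    simp only [hG, norm_mul, norm_ech, one_mul])

/-- `a(y,ξ)` vanishes for `‖y‖ > ρ`. -/
def YSupp (ρ : ℝ) (a : Sym n) : Prop := ∀ y η, ρ < ‖y‖ → a y η = 0

theorem YSupp.hasCompactSupport {ρ : ℝ} {a : Sym n} (h : YSupp ρ a) (η : E n) :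
    HasCompactSupport fun y => a y η :=
  HasCompactSupport.intro (isCompact_closedBall 0 ρ) fun y hy => h y η (by simpa using hy)

/-- Bounds for the derivatives in `y` up to the order `N`. -/
abbrev YBd (N : ℕ) (a : Sym n) (A : ℝ) : Prop :=
  ∀ k ≤ N, ∀ y ξ, ‖iteratedFDeriv ℝ k (fun y => a y ξ) y‖ ≤ A

/-- The basic bound for quantized symbols, with the constant `K`. -/
def OpBound (n : ℕ) (ρ K : ℝ) : Prop := ∀ (a : Sym n) (A : ℝ), SmoothSym a → YSupp ρ a →
  YBd (n + 1) a A → ∀ F : E n → ℂ, Integrable F → MemLp F 2 →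
    eLpNorm (opT a F) 2 volume ≤ ofReal (K * A) * eLpNorm F 2 volume

theorem exists_opBound (n : ℕ) (ρ : ℝ) : ∃ K : ℝ, 0 ≤ K ∧ OpBound n ρ K := by
  obtain ⟨K, hK, hdec⟩ := exists_norm_fourier_le n ρ (n + 1)
  set J : ℝ := ∫ σ, jw (n := n) (n + 1) σ with hI
  have hJ0 : 0 ≤ J := jw_integral_nonneg _
  refine ⟨K * J, by positivity, fun a A ha hs hb F₀ hF1₀ hF2₀ => ?_⟩
  have hA : 0 ≤ A := (norm_nonneg _).trans (hb 0 (Nat.zero_le _) 0 0)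
  have hFm := hF1₀.1
  set F := hFm.mk F₀ with hFdef
  have hFF : F₀ =ᵐ[volume] F := hFm.ae_eq_mk
  rw [opT_congr_ae a hFF, eLpNorm_congr_ae hFF]
  have hF1 : Integrable F := hF1₀.congr hFF
  have hF2 : MemLp F 2 := (memLp_congr_ae hFF).1 hF2₀
  have hFs : StronglyMeasurable F := hFm.stronglyMeasurable_mk
  have hhat : ∀ σ ξ, ‖yhat a σ ξ‖ ≤ K * A * jw (n + 1) σ := fun σ ξ =>
    hdec _ A (ha.left ξ) (fun y hy => hs y ξ hy) (fun k hk y => hb k hk y ξ) σ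
  have hhm := measurable_yhat (ContDiff.continuous ha)
  have hinv : ∀ y ξ, a y ξ = ∫ σ, ech σ y * yhat a σ ξ := fun y ξ => by
    have h1 := Continuous.fourierInv_fourier_eq (f := fun y => a y ξ) (ha.left ξ).continuous
      ((ha.left ξ).continuous.integrable_of_hasCompactSupport (hs.hasCompactSupport ξ))
      (((integrable_jw (Nat.lt_succ_self n)).const_mul (K * A)).mono'
        (hhm.comp_measurable measurable_prodMk_right).aestronglyMeasurable
        (of_forall fun σ => hhat σ ξ))
    exact (congrFun h1 y).symm.trans (fourierInv_eq_ech _ _)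
  have hop : opT a F = fun y => ∫ ξ, ∫ σ, ech ξ y *
      (ech σ y * ((1 : Sym n) y ξ * yhat a σ ξ * F ξ)) := by
    funext y
    rw [opT_eq]
    congr 1
    funext ξ
    rw [hinv y ξ, ← integral_mul_const, ← integral_const_mul]
    congr 1
    funext σ
    simp only [Pi.one_apply]
    ring
  have hn : ∀ σ, ∀ᵐ ξ, ‖yhat a σ ξ * F ξ‖ ≤ K * A * jw (n + 1) σ * ‖F ξ‖ := fun σ =>
    of_forall fun ξ => by rw [norm_mul]; gcongr; exact hhat σ ξ
  have hm : ∀ σ, AEStronglyMeasurable (fun ξ => yhat a σ ξ * F ξ) volume := fun σ =>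
    ((hhm.comp_measurable measurable_prodMk_left).mul hFs).aestronglyMeasurable
  rw [hop]
  refine (eLpNorm_superposition_le hhm hFs hF1 (c := fun _ => 1) (D := K * A) continuous_const
    (fun σ y ξ => by simpa using hhat σ ξ) (A := ofReal (K * A) * eLpNorm F 2 volume)
    fun σ => ?_).trans (le_of_eq ?_)
  · have e1 : opT 1 (fun ξ => yhat a σ ξ * F ξ) = 𝓕⁻ fun ξ => yhat a σ ξ * F ξ := by
      funext y
      simp [opT]
    rw [e1, eLpNorm_fourierInv ((hF1.norm.const_mul _).mono' (hm σ) (hn σ))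
      (hF2.of_le_mul (hm σ) (hn σ))]
    refine (eLpNorm_le_mul_eLpNorm_of_ae_le_mul (hn σ) 2).trans (le_of_eq ?_)
    rw [ofReal_mul (by positivity)]
    ring
  · rw [← hI, mul_right_comm, ← ofReal_mul (by positivity)]
    ring_nf

/-! ### Composition of quantized symbols -/

protected theorem SmoothSym.hdy {a : Sym n} (ha : SmoothSym a) (h : ℝ) (i : Fin n) :
    SmoothSym (hdy h i a) := by
  have h1 := ((ha.dy i).smul (h : ℂ)).smul (-I)
  rwa [neg_smul] at h1

protected theorem YSupp.hdy {ρ : ℝ} {a : Sym n} (hs : YSupp ρ a) (h : ℝ) (i : Fin n) :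
    YSupp ρ (hdy h i a) := fun y η hy => by
  have h1 : (fun y => a y η) =ᶠ[nhds y] fun _ => 0 := by
    filter_upwards [(isOpen_lt continuous_const continuous_norm).mem_nhds hy] with z hz
    exact hs z η hz
  simp [hdy, dy, h1.fderiv_eq]

theorem integrable_fourier_of_smooth {g : E n → ℂ} (hg : ContDiff ℝ ∞ g) (hc : HasCompactSupport g) :
    Integrable (𝓕 g) := by
  have h1 := (𝓕 (hc.toSchwartzMap hg)).integrable (μ := volume)
  rwa [SchwartzMap.fourier_coe] at h1

theorem eq_integral_fourier {g : E n → ℂ} (hg : ContDiff ℝ ∞ g) (hc : HasCompactSupport g)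
    (y : E n) : g y = ∫ σ, ech σ y * 𝓕 g σ := by
  rw [← fourierInv_eq_ech, Continuous.fourierInv_fourier_eq hg.continuous
    (hg.continuous.integrable_of_hasCompactSupport hc) (integrable_fourier_of_smooth hg hc)]

theorem yhat_hdy {ρ : ℝ} {a : Sym n} (ha : SmoothSym a) (hs : YSupp ρ a) (h : ℝ) (i : Fin n)
    (σ η : E n) : yhat (hdy h i a) σ η = (((2 * π * h) • σ) i : ℝ) * yhat a σ η := by
  have hg := ha.left η
  have hc := hs.hasCompactSupport η
  set g : E n → ℂ := fun y => a y η with hgd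
  have hgd' : Continuous (fderiv ℝ g) := hg.continuous_fderiv (by simp)
  have h1 := Real.fourier_fderiv (hg.continuous.integrable_of_hasCompactSupport hc)
    (hg.differentiable (by simp)) (hgd'.integrable_of_hasCompactSupport (hc.fderiv ℝ))
  have h2 : 𝓕 (fun y => fderiv ℝ g y (single i 1)) σ =
      (𝓕 (fderiv ℝ g) σ) (single i 1) := by
    rw [fourier_eq, fourier_eq]
    have h3 := ContinuousLinearMap.integral_apply (φ := fun y : E n =>
      𝐞 (-inner ℝ y σ) • fderiv ℝ g y) (μ := volume) (by
        refine (Real.fourierIntegral_convergent_iff σ).2 ?_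
        exact hgd'.integrable_of_hasCompactSupport (hc.fderiv ℝ)) (single i 1)
    rw [h3]
    rfl
  have h4 : yhat (hdy h i a) σ η = -(I * (h * 𝓕 (fun y =>
      fderiv ℝ g y (single i 1)) σ)) := by
    unfold yhat
    rw [fourier_eq, fourier_eq, ← integral_const_mul, ← integral_const_mul, ← integral_neg]
    congr 1
    funext y
    simp only [hdy, Pi.neg_apply, Pi.smul_apply, smul_eq_mul, dy, Circle.smul_def, hgd]
    ring
  rw [h4, h2, h1]
  have hI := I_sq
  have e1 : innerSL ℝ σ (single i (1 : ℝ)) = σ i := by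
    rw [innerSL_apply_apply, EuclideanSpace.inner_single_right]
    simp
  simp only [VectorFourier.fourierSMulRight_apply, neg_apply, e1, yhat, PiLp.smul_apply,
    smul_eq_mul, neg_smul, real_smul]
  push_cast
  linear_combination (-(2 * π * h * σ i * 𝓕 g σ)) * hI

theorem yhat_mpow_hdy {ρ : ℝ} {a : Sym n} (ha : SmoothSym a) (hs : YSupp ρ a) (h : ℝ)
    (α : Fin n → ℕ) : SmoothSym (mpow (hdy h) α a) ∧ YSupp ρ (mpow (hdy h) α a) ∧
    ∀ σ η, yhat (mpow (hdy h) α a) σ η = monom ((2 * π * h) • σ) α * yhat a σ η := by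
  have h1 := mpow_intertwine (D := hdy h) (D' := fun i (b : Sym n) =>
    (fun σ _ => ((((2 * π * h) • σ) i : ℝ) : ℂ)) * b)
    (fun a b => SmoothSym a ∧ YSupp ρ a ∧ ∀ σ η, yhat a σ η = b σ η)
    (fun j a b hab => ⟨hab.1.hdy h j, hab.2.1.hdy h j, fun σ η => by
      rw [yhat_hdy hab.1 hab.2.1, hab.2.2]; rfl⟩) α (a := a) (b := yhat a) ⟨ha, hs, fun _ _ => rfl⟩
  refine ⟨h1.1, h1.2.1, fun σ η => ?_⟩
  rw [h1.2.2, mpow_mul_left]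
  simp only [Pi.mul_apply, Finset.prod_apply, Pi.pow_apply, monom]

/-- `a(y, 2πhξ)`. -/
def sc (h : ℝ) (a : Sym n) : Sym n := fun y ξ => a y ((2 * π * h) • ξ)

protected theorem SmoothSym.sc {a : Sym n} (ha : SmoothSym a) (h : ℝ) : SmoothSym (sc h a) := by
  have : unc (sc h a) = unc a ∘ fun p : E n × E n => (p.1, (2 * π * h) • p.2) := rfl
  rw [SmoothSym, this]
  exact ContDiff.comp ha (by fun_prop)

protected theorem YSupp.sc {ρ : ℝ} {a : Sym n} (hs : YSupp ρ a) (h : ℝ) : YSupp ρ (sc h a) :=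
  fun y _ hy => hs y _ hy

protected theorem OpBound.sc {ρ K h : ℝ} (hK : OpBound n ρ K) {a : Sym n} {D : ℝ} (ha : SmoothSym a)
    (hs : YSupp ρ a) (hD : YBd (n + 1) a D) {F : E n → ℂ} (hF1 : Integrable F) (hF2 : MemLp F 2) :
    eLpNorm (opT (sc h a) F) 2 volume ≤ ofReal (K * D) * eLpNorm F 2 volume :=
  hK _ _ (ha.sc h) (hs.sc h) (fun k hk y _ => hD k hk y _) F hF1 hF2

section

variable {ρ B Q A₀ : ℝ} {a : Sym n} {F : E n → ℂ}

theorem memLp_opT_one_two (ha : SmoothSym a) (hs : YSupp ρ a) (hB : ∀ y η, ‖a y η‖ ≤ B)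
    (hF : Integrable F) : Integrable (opT a F) ∧ MemLp (opT a F) 2 := by
  have hac : Continuous (unc a) := ContDiff.continuous ha
  have hm := (stronglyMeasurable_opT hac hF.1).aestronglyMeasurable (μ := volume)
  have h0 : ∀ y, y ∉ closedBall (0 : E n) ρ → opT a F y = 0 := fun y hy => by
    rw [opT_eq]
    have : ∀ ξ, a y ξ = 0 := fun ξ => hs y ξ (by simpa using hy)
    simp [this]
  have hb : ∀ y, ‖opT a F y‖ ≤ B * ∫ ξ, ‖F ξ‖ := fun y => by
    rw [opT_eq, ← integral_const_mul]
    refine norm_integral_le_of_norm_le (hF.norm.const_mul B) (of_forall fun ξ => ?_)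
    rw [norm_mul, norm_ech, one_mul, norm_mul]
    gcongr
    exact hB y ξ
  have hind : opT a F = (closedBall (0 : E n) ρ).indicator (opT a F) := by
    funext y
    by_cases hy : y ∈ closedBall (0 : E n) ρ
    · rw [indicator_of_mem hy]
    · rw [indicator_of_notMem hy, h0 y hy]
  have key : ∀ p : ENNReal, MemLp (opT a F) p := fun p => by
    rw [hind]
    rw [memLp_indicator_iff_restrict Metric.isClosed_closedBall.measurableSet]
    have : IsFiniteMeasure (volume.restrict (closedBall (0 : E n) ρ)) :=
      ⟨by simpa using measure_closedBall_lt_top⟩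
    exact MemLp.of_bound hm.restrict _ (of_forall hb)
  exact ⟨memLp_one_iff_integrable.1 (key 1), key 2⟩

theorem fourier_opT (ha : SmoothSym a) (hs : YSupp ρ a) (hB : ∀ y η, ‖a y η‖ ≤ B)
    (hF : Integrable F) (η : E n) : 𝓕 (opT a F) η = ∫ ξ, yhat a (η - ξ) ξ * F ξ := by
  have hac : Continuous fun q : E n × E n => a q.1 q.2 := ContDiff.continuous ha
  have hint : Integrable (uncurry fun y ξ : E n => ech (-η) y *
      (ech ξ y * (a y ξ * F ξ))) (volume.prod volume) := by
    have h1 : Integrable ((closedBall (0 : E n) ρ).indicator fun _ => B) :=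
      (integrable_indicator_iff Metric.isClosed_closedBall.measurableSet).2
        (integrableOn_const measure_closedBall_lt_top.ne)
    refine (h1.mul_prod hF.norm).mono' ?_ (of_forall fun q => ?_)
    · have hc1 : Continuous fun q : E n × E n => ech (-η) q.1 := by fun_prop
      have hc2 : Continuous fun q : E n × E n => ech q.2 q.1 := by fun_prop
      exact hc1.aestronglyMeasurable.mul (hc2.aestronglyMeasurable.mul
        (hac.aestronglyMeasurable.mul hF.1.comp_snd))
    · simp only [uncurry_def, norm_mul, norm_ech, one_mul]
      gcongr
      by_cases hy : q.1 ∈ closedBall (0 : E n) ρ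
      · rw [indicator_of_mem hy]; exact hB _ _
      · rw [indicator_of_notMem hy, hs _ _ (by simpa using hy), norm_zero]
  rw [fourier_eq_ech]
  simp only [opT_eq, ← integral_const_mul]
  rw [integral_integral_swap hint]
  congr 1
  funext ξ
  rw [yhat, fourier_eq_ech, ← integral_mul_const]
  congr 1
  funext y
  rw [neg_sub, sub_eq_neg_add, ech_add]
  ring

theorem integrable_yhat_mul (ha : SmoothSym a)
    (hdec : ∀ σ ξ, ‖yhat a σ ξ‖ ≤ Q * jw (n + 1) σ) (hF : Integrable F) :
    Integrable (fun q : E n × E n => yhat a (q.1 - q.2) q.2 * F q.2) (volume.prod volume) := by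
  have h1 := Integrable.convolution_integrand (ContinuousLinearMap.mul ℝ ℝ) (μ := volume)
    (ν := volume) (hF.norm) ((integrable_jw (Nat.lt_succ_self n)).const_mul Q)
  refine h1.mono' ?_ (of_forall fun q => ?_)
  · exact ((measurable_yhat (ContDiff.continuous ha)).comp_measurable
      ((measurable_fst.sub measurable_snd).prodMk measurable_snd)).aestronglyMeasurable.mul
        hF.1.comp_snd
  · simp only [ContinuousLinearMap.mul_apply', norm_mul]
    rw [mul_comm]
    gcongr
    exact hdec _ _

theorem integrable_fourier_opT (ha : SmoothSym a) (hs : YSupp ρ a) (hB : ∀ y η, ‖a y η‖ ≤ B)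
    (hdec : ∀ σ ξ, ‖yhat a σ ξ‖ ≤ Q * jw (n + 1) σ) (hF : Integrable F) :
    Integrable (𝓕 (opT a F)) :=
  (integrable_yhat_mul ha hdec hF).integral_prod_left.congr (of_forall fun η =>
    (fourier_opT ha hs hB hF η).symm)

theorem opT_fourier_opT {m : Sym n} (hm : SmoothSym m) (hA₀ : ∀ y η, ‖m y η‖ ≤ A₀)
    (ha : SmoothSym a) (hs : YSupp ρ a) (hB : ∀ y η, ‖a y η‖ ≤ B)
    (hdec : ∀ σ ξ, ‖yhat a σ ξ‖ ≤ Q * jw (n + 1) σ) (hF : Integrable F) (y : E n) :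
    opT m (𝓕 (opT a F)) y = ∫ ξ, ∫ σ, ech ξ y *
      (ech σ y * (m y (ξ + σ) * yhat a σ ξ * F ξ)) := by
  have hint : Integrable (uncurry fun η ξ : E n => ech η y *
      (m y η * (yhat a (η - ξ) ξ * F ξ))) (volume.prod volume) := by
    refine ((integrable_yhat_mul ha hdec hF).norm.const_mul A₀).mono' ?_
      (of_forall fun q => ?_)
    · have hc1 : Continuous fun q : E n × E n => ech q.1 y := by fun_prop
      have hc2 : Continuous fun q : E n × E n => m y q.1 :=
        (hm.right y).continuous.comp continuous_fst
      exact hc1.aestronglyMeasurable.mul (hc2.aestronglyMeasurable.mul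
        (integrable_yhat_mul ha hdec hF).1)
    · simp only [uncurry_def]
      rw [norm_mul, norm_ech, one_mul, norm_mul]
      gcongr
      exact hA₀ _ _
  rw [opT_eq]
  simp only [fourier_opT ha hs hB hF, ← integral_const_mul]
  rw [integral_integral_swap hint]
  congr 1
  funext ξ
  rw [← integral_add_left_eq_self _ ξ]
  congr 1
  funext σ
  rw [ech_add, add_sub_cancel_left]
  ring

end

protected theorem SmoothSym.etaRem {m : Sym n} (hm : SmoothSym m) (M : ℕ) (ζ : E n) :
    SmoothSym (etaRem M m ζ) := by
  have h1 : ContDiff ℝ ∞ fun p : E n × E n => m p.1 (p.2 + ζ) := by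
    have : (fun p : E n × E n => m p.1 (p.2 + ζ)) =
      unc m ∘ fun p : E n × E n => (p.1, p.2 + ζ) := rfl
    rw [this]
    exact ContDiff.comp hm (by fun_prop)
  have h2 : ContDiff ℝ ∞ fun p : E n × E n => ∑ k ∈ range (M + 1),
      ∑ α ∈ piAntidiag Finset.univ k,
        invFact α * monom ζ α * mpow deta α m p.1 p.2 :=
    ContDiff.sum fun k _ => ContDiff.sum fun α _ => contDiff_const.mul (hm.mpow_deta α)
  exact h1.sub h2

theorem YSupp.mpow_deta {ρ : ℝ} {m : Sym n} (hs : YSupp ρ m) (α : Fin n → ℕ) :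
    YSupp ρ (mpow deta α m) :=
  mpow_induction (fun m => YSupp ρ m) (fun j b hb y η hy => by
    have : (b y) = 0 := funext fun η' => hb y η' hy
    simp [deta, this]) α hs

protected theorem YSupp.etaRem {ρ : ℝ} {m : Sym n} (hs : YSupp ρ m) (M : ℕ) (ζ : E n) :
    YSupp ρ (etaRem M m ζ) := fun y η hy => by
  simp [etaRem, hs _ _ hy, hs.mpow_deta _ _ _ hy, multiSum]

theorem continuous_etaRem {m : Sym n} (hm : SmoothSym m) (M : ℕ) :
    Continuous fun p : E n × E n × E n => etaRem M m p.1 p.2.1 p.2.2 := by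
  have hc : ∀ b : Sym n, SmoothSym b → Continuous fun q : E n × E n => b q.1 q.2 :=
    fun b hb => ContDiff.continuous hb
  refine Continuous.sub ((hc m hm).comp (by fun_prop : Continuous fun p : E n × E n × E n =>
    (p.2.1, p.2.2 + p.1))) ?_
  refine continuous_finsetSum _ fun k _ => continuous_finsetSum _ fun α _ =>
    (continuous_const.mul ?_).mul ((hc _ (hm.mpow_deta α)).comp continuous_snd)
  unfold monom
  exact continuous_finsetProd _ fun i _ => (Complex.continuous_ofReal.comp (by fun_prop)).pow _

theorem smoothSym_compSym {m a : Sym n} (hm : SmoothSym m) (ha : SmoothSym a) (M : ℕ)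
    (h : ℝ) : SmoothSym (compSym M h m a) := by
  have h1 : unc (compSym M h m a) = fun p => ∑ k ∈ range (M + 1),
      ∑ α ∈ piAntidiag Finset.univ k,
      unc (invFact α • (mpow deta α m * mpow (hdy h) α a)) p := by
    funext p
    simp only [unc, compSym, multiSum, Finset.sum_apply]
  rw [SmoothSym, h1]
  exact ContDiff.sum fun k _ => ContDiff.sum fun α _ =>
    ((hm.mpow_deta α).mul (mpow_induction SmoothSym (fun j _ hb => hb.hdy h j) α ha)).smul _

theorem integral_monom_yhat {a : Sym n} {ρ : ℝ} (ha : SmoothSym a) (hs : YSupp ρ a) (h : ℝ)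
    (α : Fin n → ℕ) (y η : E n) :
    Integrable (fun σ => ech σ y * (monom ((2 * π * h) • σ) α * yhat a σ η)) ∧
    ∫ σ, ech σ y * (monom ((2 * π * h) • σ) α * yhat a σ η) = mpow (hdy h) α a y η := by
  obtain ⟨h1, h2, h3⟩ := yhat_mpow_hdy ha hs h α
  have hi := integrable_fourier_of_smooth (h1.left η) (h2.hasCompactSupport η)
  have h4 : ∀ σ, monom ((2 * π * h) • σ) α * yhat a σ η =
      𝓕 (fun y => mpow (hdy h) α a y η) σ := fun σ => (h3 σ η).symm
  simp only [h4]
  refine ⟨hi.norm.mono' ?_ (of_forall fun σ => ?_),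
    (eq_integral_fourier (h1.left η) (h2.hasCompactSupport η) y).symm⟩
  · have hc : Continuous fun σ : E n => ech σ y := by fun_prop
    exact hc.aestronglyMeasurable.mul hi.1
  · rw [norm_mul, norm_ech, one_mul]

/-- The composition formula before integration in `ξ`. -/
theorem integral_shift_yhat {m a : Sym n} {ρ : ℝ} (ha : SmoothSym a)
    (hs : YSupp ρ a) (M : ℕ) (h : ℝ) (y η : E n)
    (hR : Integrable fun σ => ech σ y * (etaRem M m ((2 * π * h) • σ) y η * yhat a σ η)) :
    ∫ σ, ech σ y * (m y (η + (2 * π * h) • σ) * yhat a σ η) = compSym M h m a y η +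
      ∫ σ, ech σ y * (etaRem M m ((2 * π * h) • σ) y η * yhat a σ η) := by
  have h1 : ∀ σ : E n, ech σ y * (m y (η + (2 * π * h) • σ) * yhat a σ η) =
      (∑ k ∈ range (M + 1), ∑ α ∈ piAntidiag Finset.univ k,
        invFact α * mpow deta α m y η * (ech σ y *
          (monom ((2 * π * h) • σ) α * yhat a σ η))) +
      ech σ y * (etaRem M m ((2 * π * h) • σ) y η * yhat a σ η) := fun σ => by
    rw [etaRem, sub_mul, mul_sub, ← sub_eq_iff_eq_add']
    simp only [multiSum, sum_mul, mul_sum]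
    congr 1
    exact sum_congr rfl fun k _ => sum_congr rfl fun α _ => by ring
  have hI := fun α => integral_monom_yhat ha hs h α y η
  simp only [h1]
  rw [integral_add (integrable_finsetSum _ fun k _ => integrable_finsetSum _ fun α _ =>
    (hI α).1.const_mul _) hR, integral_finsetSum _ fun k _ => integrable_finsetSum _ fun α _ =>
    (hI α).1.const_mul _]
  congr 1
  simp only [compSym, multiSum, Finset.sum_apply]
  refine sum_congr rfl fun k _ => ?_
  rw [integral_finsetSum _ fun α _ => (hI α).1.const_mul _]
  refine sum_congr rfl fun α _ => ?_
  rw [integral_const_mul, (hI α).2]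
  simp only [Pi.smul_apply, Pi.mul_apply, smul_eq_mul]
  ring

/-- The bound for the remainder in the composition of `Op(m)` with `Op(a)`, with the constant
`K`. -/
def CompBound (n : ℕ) (ρ : ℝ) (M : ℕ) (K : ℝ) : Prop :=
  ∀ (m a : Sym n) (h A₀ A B : ℝ), 0 < h → SmoothSym m → YSupp ρ m → (∀ y η, ‖m y η‖ ≤ A₀) →
    0 ≤ A → (∀ ζ, YBd (n + 1) (etaRem M m ζ) (A * ‖ζ‖ ^ (M + 1))) →
    SmoothSym a → YSupp ρ a → YBd (M + n + 2) a B →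
    ∀ F : E n → ℂ, Integrable F → MemLp F 2 →
      Integrable (𝓕 (opT (sc h a) F)) ∧
      eLpNorm (fun y => opT (sc h m) (𝓕 (opT (sc h a) F)) y - opT (sc h (compSym M h m a)) F y)
        2 volume ≤ ofReal (K * A * B * h ^ (M + 1)) * eLpNorm F 2 volume

theorem exists_compBound (n : ℕ) (ρ : ℝ) (M : ℕ) : ∃ K : ℝ, 0 ≤ K ∧ CompBound n ρ M K := by
  obtain ⟨K₁, hK₁, hdec₁⟩ := exists_norm_fourier_le n ρ (M + n + 2)
  obtain ⟨K₂, hK₂, hop⟩ := exists_opBound n ρ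
  set J : ℝ := ∫ σ, jw (n := n) (n + 1) σ with hI
  have hJ0 : 0 ≤ J := jw_integral_nonneg _
  refine ⟨K₂ * (2 * π) ^ (M + 1) * K₁ * J, by positivity,
    fun m a h A₀ A B hh hm hms hA₀ hA hE ha hs hb F₀ hF1₀ hF2₀ => ?_⟩
  have hB : 0 ≤ B := (norm_nonneg _).trans (hb 0 (Nat.zero_le _) 0 0)
  have hFm := hF1₀.1
  set F := hFm.mk F₀ with hFdef
  have hFF : F₀ =ᵐ[volume] F := hFm.ae_eq_mk
  simp only [opT_congr_ae _ hFF, eLpNorm_congr_ae hFF]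
  have hF1 : Integrable F := hF1₀.congr hFF
  have hF2 : MemLp F 2 := (memLp_congr_ae hFF).1 hF2₀
  have hFs : StronglyMeasurable F := hFm.stronglyMeasurable_mk
  have hha : SmoothSym (sc h a) := ha.sc h
  have hhs : YSupp ρ (sc h a) := hs.sc h
  have hhB : ∀ y η, ‖sc h a y η‖ ≤ B := fun y η => by
    simpa [sc] using hb 0 (Nat.zero_le _) y ((2 * π * h) • η)
  have hdecN : ∀ σ ξ, ‖yhat (sc h a) σ ξ‖ ≤ K₁ * B * jw (M + n + 2) σ := fun σ ξ =>
    hdec₁ _ B (hha.left ξ) (fun y hy => hhs y ξ hy) (fun k hk y => hb k hk y _) σ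
  have hjw : ∀ σ : E n, ‖σ‖ ^ (M + 1) * jw (M + n + 2) σ ≤ jw (n + 1) σ := fun σ => by
    unfold jw
    rw [show M + n + 2 = (M + 1) + (n + 1) by ring, pow_add (1 + ‖σ‖), mul_inv, ← mul_assoc,
      ← div_eq_mul_inv (‖σ‖ ^ (M + 1)), ← div_pow]
    refine mul_le_of_le_one_left (by positivity) (pow_le_one₀ (by positivity) ?_)
    rw [div_le_one (by positivity)]
    linarith
  have hjw' : ∀ σ : E n, jw (M + n + 2) σ ≤ jw (n + 1) σ := fun σ => by
    unfold jw
    gcongr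
    · linarith [norm_nonneg σ]
    · linarith
    · norm_num
  have hdec : ∀ σ ξ, ‖yhat (sc h a) σ ξ‖ ≤ K₁ * B * jw (n + 1) σ := fun σ ξ =>
    (hdecN σ ξ).trans (by have := hjw' σ; gcongr)
  refine ⟨integrable_fourier_opT hha hhs hhB hdec hF1, ?_⟩
  set Er : E n → Sym n := fun σ => sc h (etaRem M m ((2 * π * h) • σ)) with hEr
  have hErn : ∀ σ, YBd (n + 1) (Er σ) (A * (2 * π * h) ^ (M + 1) * ‖σ‖ ^ (M + 1)) :=
    fun σ k hk y η => by
      refine (hE ((2 * π * h) • σ) k hk y _).trans (le_of_eq ?_)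
      rw [norm_smul, mul_pow, Real.norm_of_nonneg (by positivity)]
      ring
  set D : ℝ := A * (2 * π * h) ^ (M + 1) * (K₁ * B) with hD
  have hD0 : 0 ≤ D := by positivity
  have hprod : ∀ σ y ξ, ‖Er σ y ξ * yhat (sc h a) σ ξ‖ ≤ D * jw (n + 1) σ := fun σ y ξ => by
    have h1 := hErn σ 0 (Nat.zero_le _) y ξ
    rw [norm_iteratedFDeriv_zero] at h1
    have h2 := hdecN σ ξ
    rw [norm_mul]
    calc _ ≤ (A * (2 * π * h) ^ (M + 1) * ‖σ‖ ^ (M + 1)) *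
          (K₁ * B * jw (M + n + 2) σ) := by gcongr
      _ = D * (‖σ‖ ^ (M + 1) * jw (M + n + 2) σ) := by rw [hD]; ring
      _ ≤ _ := by have := hjw σ; gcongr
  have hErc : Continuous fun p : E n × E n × E n => Er p.1 p.2.1 p.2.2 :=
    (continuous_etaRem hm M).comp (by fun_prop : Continuous fun p : E n × E n × E n =>
      ((2 * π * h) • p.1, p.2.1, (2 * π * h) • p.2.2))
  have hhm := measurable_yhat (ContDiff.continuous hha)
  have hmain : (fun y => opT (sc h m) (𝓕 (opT (sc h a) F)) y -
      opT (sc h (compSym M h m a)) F y) = fun y => ∫ ξ, ∫ σ, ech ξ y *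
      (ech σ y * (Er σ y ξ * yhat (sc h a) σ ξ * F ξ)) := by
    funext y
    have hErcy : Continuous fun q : E n × E n => Er q.1 y q.2 :=
      hErc.comp (by fun_prop : Continuous fun q : E n × E n => (q.1, y, q.2))
    have hIrem : Integrable fun ξ => ∫ σ, ech ξ y * (ech σ y *
        (Er σ y ξ * yhat (sc h a) σ ξ * F ξ)) := (integrable_ech_mul hhm hFs hF1 (c := fun σ ξ => Er σ y ξ) hErcy
      (fun σ ξ => hprod σ y ξ) y).integral_prod_left
    have hItot := (integrable_ech_mul hhm hFs hF1 (c := fun σ ξ => sc h m y (ξ + σ))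
      (D := A₀ * (K₁ * B)) (((hm.sc h).right y).continuous.comp
        (by fun_prop : Continuous fun q : E n × E n => q.2 + q.1)) (fun σ ξ => by
      rw [norm_mul, mul_assoc]
      have h1 : ‖sc h m y (ξ + σ)‖ ≤ A₀ := hA₀ _ _
      have h2 := hdec σ ξ
      have h3 := (norm_nonneg _).trans h1
      gcongr) y).integral_prod_left
    have hRσ : ∀ ξ, Integrable fun σ => ech σ y * (Er σ y ξ * yhat (sc h a) σ ξ) := fun ξ => by
      refine ((integrable_jw (Nat.lt_succ_self n)).const_mul D).mono' ?_
        (of_forall fun σ => ?_)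
      · have hc2 : Continuous fun σ : E n => ech σ y := by fun_prop
        exact (hc2.stronglyMeasurable.mul ((hErcy.comp (.prodMk_left ξ)).stronglyMeasurable.mul
          (hhm.comp_measurable measurable_prodMk_right))).aestronglyMeasurable
      · rw [norm_mul, norm_ech, one_mul]
        exact hprod σ y ξ
    have e2 : ∀ ξ, ∫ σ, ech ξ y * (ech σ y * (sc h m y (ξ + σ) * yhat (sc h a) σ ξ * F ξ)) =
        ech ξ y * (sc h (compSym M h m a) y ξ * F ξ) +
        ∫ σ, ech ξ y * (ech σ y * (Er σ y ξ * yhat (sc h a) σ ξ * F ξ)) := fun ξ => by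
      have e3 := integral_shift_yhat (m := m) ha hs M h y ((2 * π * h) • ξ) (hRσ ξ)
      have e4 : ∀ c : E n → ℂ, ∫ σ, ech ξ y * (ech σ y * (c σ * yhat (sc h a) σ ξ * F ξ)) =
          ech ξ y * F ξ * ∫ σ, ech σ y * (c σ * yhat a σ ((2 * π * h) • ξ)) := fun c => by
        rw [← integral_const_mul]
        congr 1
        funext σ
        rw [show yhat (sc h a) σ ξ = yhat a σ ((2 * π * h) • ξ) from rfl]
        ring
      rw [e4, e4]
      simp only [sc, smul_add, hEr]
      rw [e3]
      ring
    rw [opT_fourier_opT (hm.sc h) (fun y η => hA₀ y _) hha hhs hhB hdec hF1 y]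
    simp only [e2]
    rw [integral_add ((hItot.sub hIrem).congr (of_forall fun ξ =>
      sub_eq_iff_eq_add.2 (e2 ξ))) hIrem, opT_eq, add_sub_cancel_left]
  rw [hmain]
  refine (eLpNorm_superposition_le hhm hFs hF1 hErc hprod
    (A := ofReal (K₂ * D) * eLpNorm F 2 volume) fun σ => ?_).trans (le_of_eq ?_)
  · have hg : ∀ᵐ ξ, ‖yhat (sc h a) σ ξ * F ξ‖ ≤ (K₁ * B * jw (M + n + 2) σ) * ‖F ξ‖ :=
      of_forall fun ξ => by rw [norm_mul]; have := hdecN σ ξ; gcongr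
    have hgm : AEStronglyMeasurable (fun ξ => yhat (sc h a) σ ξ * F ξ) volume :=
      ((hhm.comp_measurable measurable_prodMk_left).mul hFs).aestronglyMeasurable
    refine (hop (Er σ) _ ((hm.etaRem M _).sc h) ((hms.etaRem M _).sc h) (hErn σ) _
      ((hF1.norm.const_mul (K₁ * B * jw (M + n + 2) σ)).mono' hgm hg)
      (hF2.of_le_mul hgm hg)).trans ?_
    refine (mul_le_mul' le_rfl (eLpNorm_le_mul_eLpNorm_of_ae_le_mul hg 2)).trans ?_
    rw [← mul_assoc, ← ofReal_mul (by positivity),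
      mul_right_comm (ofReal (K₂ * D)), ← ofReal_mul (by positivity)]
    refine mul_le_mul' (ENNReal.ofReal_le_ofReal ?_) le_rfl
    calc K₂ * (A * (2 * π * h) ^ (M + 1) * ‖σ‖ ^ (M + 1)) * (K₁ * B * jw (M + n + 2) σ)
        = K₂ * D * (‖σ‖ ^ (M + 1) * jw (M + n + 2) σ) := by rw [hD]; ring
      _ ≤ _ := by have := hjw σ; gcongr
  · rw [← hI, mul_right_comm, ← ofReal_mul (by positivity)]
    congr 2
    rw [hD]
    ring

theorem eLpNorm_fourierInv_sub {G w : E n → ℂ} (hG1 : Integrable G) (hG2 : MemLp G 2)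
    (hw1 : Integrable w) (hw2 : MemLp w 2) :
    eLpNorm (fun y => 𝓕⁻ G y - w y) 2 volume = eLpNorm (fun ξ => G ξ - 𝓕 w ξ) 2 volume := by
  have h1 : eLpNorm (fun y => 𝓕⁻ G y - w y) 2 volume =
      ‖(𝓕⁻ (hG2.toLp G) - hw2.toLp w : Lp ℂ 2 (volume : Measure (E n)))‖ₑ := by
    rw [Lp.enorm_def]
    refine eLpNorm_congr_ae ?_
    filter_upwards [Lp.coeFn_sub (𝓕⁻ (hG2.toLp G)) (hw2.toLp w), fourierInv_toLp hG1 hG2,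
      hw2.coeFn_toLp] with y h1 h2 h3
    rw [h1, Pi.sub_apply, h2, h3]
  have h2 : eLpNorm (fun ξ => G ξ - 𝓕 w ξ) 2 volume =
      ‖(hG2.toLp G - 𝓕 (hw2.toLp w) : Lp ℂ 2 (volume : Measure (E n)))‖ₑ := by
    rw [Lp.enorm_def]
    refine eLpNorm_congr_ae ?_
    filter_upwards [Lp.coeFn_sub (hG2.toLp G) (𝓕 (hw2.toLp w)), fourier_toLp hw1 hw2,
      hG2.coeFn_toLp] with y h1 h2 h3
    rw [h1, Pi.sub_apply, h2, h3]
  rw [h1, h2, ← ofReal_norm, ← ofReal_norm, ← Lp.norm_fourier_eq (𝓕⁻ (hG2.toLp G) - hw2.toLp w)]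
  congr 2
  have h3 : 𝓕 (𝓕⁻ (hG2.toLp G)) = hG2.toLp G := FourierTransform.fourier_fourierInv_eq _
  rw [sub_eq_add_neg, FourierTransform.fourier_add, FourierTransform.fourier_neg, h3, sub_eq_add_neg]

theorem fourier_sub_fun {U V : E n → ℂ} (hU : Integrable U) (hV : Integrable V) :
    𝓕 (U - V) = 𝓕 U - 𝓕 V := by
  have := VectorFourier.fourierIntegral_add (L := innerₗ (E n)) (μ := volume) Real.continuous_fourierChar
    (by exact continuous_inner) (hU.sub hV) hV
  rw [sub_add_cancel] at this
  exact eq_sub_of_add_eq this.symm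

theorem SmoothSym.integrable_ech_mul {c : Sym n} (hc : SmoothSym c) {y : E n} {C : ℝ}
    (hC : ∀ ξ, ‖c y ξ‖ ≤ C) {F : E n → ℂ} (hF : Integrable F) :
    Integrable fun ξ => ech ξ y * (c y ξ * F ξ) := by
  have hc1 : Continuous fun ξ : E n => ech ξ y := by fun_prop
  refine (hF.norm.const_mul C).mono' (hc1.aestronglyMeasurable.mul
    ((hc.right y).continuous.aestronglyMeasurable.mul hF.1)) (of_forall fun ξ => ?_)
  rw [norm_mul, norm_ech, one_mul, norm_mul]
  gcongr
  exact hC ξ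

theorem opT_sub_symbol {a b : Sym n} {F : E n → ℂ} {y : E n} {A B : ℝ} (ha : SmoothSym a)
    (hb : SmoothSym b) (hA : ∀ ξ, ‖a y ξ‖ ≤ A) (hB : ∀ ξ, ‖b y ξ‖ ≤ B) (hF : Integrable F) :
    opT (a - b) F y = opT a F y - opT b F y := by
  simp only [opT_eq]
  rw [← integral_sub (ha.integrable_ech_mul hA hF) (hb.integrable_ech_mul hB hF)]
  simp only [Pi.sub_apply, sub_mul, mul_sub]

theorem opT_sub {a : Sym n} {F G : E n → ℂ} {y : E n} {A : ℝ} (ha : SmoothSym a)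
    (hA : ∀ ξ, ‖a y ξ‖ ≤ A) (hF : Integrable F) (hG : Integrable G) :
    opT a (F - G) y = opT a F y - opT a G y := by
  simp only [opT_eq]
  rw [← integral_sub (ha.integrable_ech_mul hA hF) (ha.integrable_ech_mul hA hG)]
  simp only [Pi.sub_apply, mul_sub]

theorem opT_mul_left (c : E n → ℂ) (a : Sym n) (F : E n → ℂ) (y : E n) :
    opT ((fun y _ => c y) * a) F y = c y * opT a F y := by
  simp only [opT_eq, Pi.mul_apply]
  rw [← integral_const_mul]
  congr 1
  funext ξ
  ring

theorem MemLp.ball_indicator {F : E n → ℂ} (hF : MemLp F 2) (r : ℝ) :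
    Integrable ((Metric.ball (0 : E n) r).indicator F) ∧
      MemLp ((Metric.ball (0 : E n) r).indicator F) 2 := by
  have : IsFiniteMeasure (volume.restrict (Metric.ball (0 : E n) r)) :=
    ⟨by simpa using measure_ball_lt_top⟩
  exact ⟨(integrable_indicator_iff measurableSet_ball).2 ((hF.restrict _).integrable one_le_two),
    hF.indicator measurableSet_ball⟩

/-- The composition with a cutoff to `Y` in between, for one value of the parameters. -/
theorem eLpNorm_indicator_add_le {ρ K₁ K₂ : ℝ} {M : ℕ} (hK₁0 : 0 ≤ K₁) (hK₁ : OpBound n ρ K₁)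
    (hK₂0 : 0 ≤ K₂) (hK₂ : CompBound n ρ M K₂) {Y : Set (E n)} {m b c e : Sym n} {θ : E n → ℂ}
    {h A B e₂ e₃ B' : ℝ} (hh : 0 < h) (hm : SmoothSym m) (hms : YSupp ρ m) (hA : 0 ≤ A)
    (hmA : YBd (n + 1) m A) (hmE : ∀ ζ, YBd (n + 1) (etaRem M m ζ) (A * ‖ζ‖ ^ (M + 1)))
    (hθ : ContDiff ℝ ∞ θ) (hθY : ∀ y ∉ Y, θ y = 0) (hYρ : ∀ y ∈ Y, ‖y‖ ≤ ρ)
    (hθB : ∀ k ≤ M + n + 2, ∀ y, ‖iteratedFDeriv ℝ k θ y‖ ≤ B)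
    (hb : SmoothSym b) (hθb : YBd (M + n + 2) ((fun y _ => θ y) * b) B)
    (hE₂ : YBd (n + 1) (m - compSym M h m fun y _ => θ y) e₂)
    (hcB : ∀ y η, ‖c y η‖ ≤ B') (he : SmoothSym e) (hes : YSupp ρ e)
    (heY : ∀ y ∈ Y, ∀ η, e y η = c y η + compSym M h m ((fun y _ => θ y) * b) y η)
    (hE₃ : YBd (n + 1) e e₃)
    {F : E n → ℂ} (hF1 : Integrable F) (hF2 : MemLp F 2)
    (hw1 : Integrable (Y.indicator (opT (sc h b) F))) (hw2 : MemLp (Y.indicator (opT (sc h b) F)) 2)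
    {R : ℝ} {G : E n → ℂ}
    (hG : G = (Metric.ball (0 : E n) R).indicator (𝓕 (Y.indicator (opT (sc h b) F)))) :
    eLpNorm (Y.indicator fun y => opT (sc h c) F y + opT (sc h m) G y) 2 volume ≤
      ofReal (K₁ * e₃ + K₂ * A * B * h ^ (M + 1)) * eLpNorm F 2 volume +
      ofReal (K₁ * e₂ + K₂ * A * B * h ^ (M + 1)) * eLpNorm G 2 volume +
      ofReal (K₁ * A * B) * eLpNorm (fun ξ => G ξ -
        𝓕 (Y.indicator (opT (sc h b) F)) ξ) 2 volume := by
  set χ : Sym n := fun y _ => θ y with hχ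
  set w := Y.indicator (opT (sc h b) F) with hw
  have hB : 0 ≤ B := (norm_nonneg _).trans (hθB 0 (Nat.zero_le _) 0)
  have he₂ : 0 ≤ e₂ := (norm_nonneg _).trans (hE₂ 0 (Nat.zero_le _) 0 0)
  have he₃ : 0 ≤ e₃ := (norm_nonneg _).trans (hE₃ 0 (Nat.zero_le _) 0 0)
  have hχm : SmoothSym χ := ContDiff.comp hθ contDiff_fst
  have hχs : YSupp ρ χ := fun y _ hy => hθY y fun hy' => absurd (hYρ y hy') (not_le.2 hy)
  have hVm : SmoothSym (χ * b) := hχm.mul hb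
  have hVs : YSupp ρ (χ * b) := fun y η hy => by simp [hχs y η hy]
  have h0 : ∀ {N : ℕ} {a : Sym n} {D : ℝ}, YBd N a D → ∀ y η, ‖a y η‖ ≤ D :=
    fun h y η => by simpa using h 0 (Nat.zero_le _) y η
  have hm0 := h0 hmA
  have hχ0 : ∀ y η, ‖χ y η‖ ≤ B := h0 fun k hk y _ => hθB k hk y
  have hV0 : ∀ y η, ‖(χ * b) y η‖ ≤ B := h0 hθb
  obtain ⟨hG1, hG2⟩ := MemLp.ball_indicator (memLp_fourier hw1 hw2) R
  rw [← hG] at hG1 hG2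
  obtain ⟨hV1, hV2⟩ := memLp_opT_one_two (hVm.sc h) (hVs.sc h) (fun y η => hV0 y _) hF1
  obtain ⟨hU1, hU2⟩ := memLp_opT_one_two (hχm.sc h) (hχs.sc h) (fun y η => hχ0 y η) hG1
  set V := opT (sc h (χ * b)) F with hV
  set U := opT (sc h χ) G with hU
  obtain ⟨hVi, hVe⟩ := hK₂ m (χ * b) h A A B hh hm hms hm0 hA hmE hVm hVs hθb F hF1 hF2
  obtain ⟨hUi, hUe⟩ := hK₂ m χ h A A B hh hm hms hm0 hA hmE hχm hχs (fun k hk y _ => hθB k hk y)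
    G hG1 hG2
  have hmeas : ∀ {a : Sym n} {F : E n → ℂ}, SmoothSym a → Integrable F →
      AEStronglyMeasurable (opT (sc h a) F) volume := fun ha hF =>
    (stronglyMeasurable_opT (ContDiff.continuous (ha.sc h)) hF.1).aestronglyMeasurable
  have hC₂ := smoothSym_compSym hm hχm M h
  have hC₃ := smoothSym_compSym hm hVm M h
  have hdiff : SmoothSym (m - compSym M h m χ) := ContDiff.sub hm hC₂
  have hcs : YSupp ρ (m - compSym M h m χ) := fun y η hy => by
    simp [compSym, multiSum, Finset.sum_apply, hms y η hy, hms.mpow_deta _ y η hy]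
  have hX₂ := hK₁.sc (h := h) hdiff hcs hE₂ hG1 hG2
  have hX₅ := hK₁.sc (h := h) he hes hE₃ hF1 hF2
  have hUV : U - V = fun y => θ y * (𝓕⁻ G y - w y) := by
    funext y
    have e1 : U y = θ y * 𝓕⁻ G y := by
      have : sc h χ = (fun y _ => θ y) * (1 : Sym n) := by
        funext y ξ; simp [sc, hχ]
      rw [hU, this, opT_mul_left]
      simp [opT]
    have e2 : V y = θ y * opT (sc h b) F y := opT_mul_left θ (sc h b) F y
    have e3 : θ y * opT (sc h b) F y = θ y * w y := by
      by_cases hy : y ∈ Y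
      · rw [hw, indicator_of_mem hy]
      · rw [hθY y hy, zero_mul, zero_mul]
    rw [Pi.sub_apply, e1, e2, e3]
    ring
  have hX₃ : eLpNorm (opT (sc h m) (𝓕 (U - V))) 2 volume ≤
      ofReal (K₁ * A * B) * eLpNorm (fun ξ => G ξ - 𝓕 w ξ) 2 volume := by
    have h1 := hK₁.sc (h := h) hm hms hmA (F := 𝓕 (U - V)) (by rw [fourier_sub_fun hU1 hV1]; exact hUi.sub hVi)
      (memLp_fourier (hU1.sub hV1) (hU2.sub hV2))
    refine h1.trans ?_
    rw [eLpNorm_fourier (hU1.sub hV1) (hU2.sub hV2), hUV, ← eLpNorm_fourierInv_sub hG1 hG2 hw1 hw2,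
      ofReal_mul (p := K₁ * A) (q := B) (by positivity), mul_assoc (ofReal (K₁ * A))]
    refine mul_le_mul' le_rfl (eLpNorm_le_mul_eLpNorm_of_ae_le_mul
      (of_forall fun y => ?_) 2)
    rw [norm_mul]
    have := hχ0 y 0
    gcongr
  set f₁ : E n → ℂ := fun y => opT (sc h m) (𝓕 U) y - opT (sc h (compSym M h m χ)) G y with hf₁
  set f₄ : E n → ℂ := fun y => opT (sc h m) (𝓕 V) y - opT (sc h (compSym M h m (χ * b))) F y with hf₄
  have hm₁ : AEStronglyMeasurable f₁ volume := (hmeas hm hUi).sub (hmeas hC₂ hG1)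
  have hm₄ : AEStronglyMeasurable f₄ volume := (hmeas hm hVi).sub (hmeas hC₃ hF1)
  have hm₂ := hmeas hdiff hG1
  have hm₃ := hmeas hm (F := 𝓕 (U - V)) (by rw [fourier_sub_fun hU1 hV1]; exact hUi.sub hVi)
  have hm₅ := hmeas he hF1
  have hdecomp : (Y.indicator fun y => opT (sc h c) F y + opT (sc h m) G y) =
      Y.indicator ((opT (sc h e) F + f₄) + ((opT (sc h (m - compSym M h m χ)) G - f₁) +
        opT (sc h m) (𝓕 (U - V)))) := by
    refine Set.indicator_congr fun y hy => ?_
    have e5 : opT (sc h e) F y = opT (sc h c) F y + opT (sc h (compSym M h m (χ * b))) F y := by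
      have h1 := opT_sub_symbol (y := y) (F := F) (he.sc h) (hC₃.sc h) (A := e₃) (B := e₃ + B')
        (fun ξ => h0 hE₃ y _) (fun ξ => by
          have h2 : sc h (compSym M h m (χ * b)) y ξ = sc h e y ξ - sc h c y ξ := by
            simp only [sc]; rw [heY y hy]; ring
          rw [h2]
          exact (norm_sub_le _ _).trans (add_le_add (h0 hE₃ y _) (hcB y _))) hF1
      have h2 : opT (sc h c) F y = opT (sc h e - sc h (compSym M h m (χ * b))) F y := by
        rw [opT_eq, opT_eq]
        congr 1
        funext ξ
        simp only [sc, Pi.sub_apply]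
        rw [heY y hy]
        ring_nf
      rw [h2, h1]
      ring
    have e2 : opT (sc h (m - compSym M h m χ)) G y = opT (sc h m) G y -
        opT (sc h (compSym M h m χ)) G y :=
      opT_sub_symbol (A := A) (B := A + e₂) (hm.sc h) (hC₂.sc h) (fun ξ => hm0 y _) (fun ξ => by
        have h1 := h0 hE₂ y ((2 * π * h) • ξ)
        have h2 : sc h (compSym M h m χ) y ξ = sc h m y ξ -
          (m - compSym M h m χ) y ((2 * π * h) • ξ) := by
            simp only [sc, Pi.sub_apply]; ring
        refine (congrArg norm h2).le.trans ?_
        exact (norm_sub_le _ _).trans (add_le_add (hm0 y _) h1)) hG1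
    have e3 : opT (sc h m) (𝓕 (U - V)) y = opT (sc h m) (𝓕 U) y - opT (sc h m) (𝓕 V) y := by
      rw [fourier_sub_fun hU1 hV1]
      exact opT_sub (hm.sc h) (fun ξ => hm0 y _) hUi hVi
    simp only [Pi.add_apply, Pi.sub_apply, hf₁, hf₄, e5, e2, e3]
    ring
  rw [hdecomp]
  refine (eLpNorm_indicator_le _).trans ?_
  refine (eLpNorm_add_le (hm₅.add hm₄) ((hm₂.sub hm₁).add hm₃) (by norm_num)).trans ?_
  have hp : ∀ {a : ENNReal} {s t : ℝ}, 0 ≤ s → 0 ≤ t → ofReal s * a + ofReal t * a =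
      ofReal (s + t) * a := fun hs ht => by rw [← add_mul, ENNReal.ofReal_add hs ht]
  have hn1 : 0 ≤ K₂ * A * B * h ^ (M + 1) := by positivity
  rw [← hp (by positivity) hn1, ← hp (by positivity) hn1, add_assoc (_ + _)]
  refine add_le_add ((eLpNorm_add_le hm₅ hm₄ (by norm_num)).trans (add_le_add hX₅ hVe)) ?_
  refine (eLpNorm_add_le (hm₂.sub hm₁) hm₃ (by norm_num)).trans (add_le_add ?_ hX₃)
  exact (eLpNorm_sub_le hm₂ hm₁ (by norm_num)).trans (add_le_add hX₂ hUe)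

theorem compSym_add {a b : Sym n} (ha : SmoothSym a) (hb : SmoothSym b) (M : ℕ) (h : ℝ) (m : Sym n) :
    compSym M h m (a + b) = compSym M h m a + compSym M h m b := by
  have h1 : ∀ α, mpow (hdy h) α (a + b) = mpow (hdy h) α a + mpow (hdy h) α b := fun α =>
    (mpow_family_induction (ι := Fin 3) (D := hdy h) (fun f => SmoothSym (f 0) ∧ SmoothSym (f 1) ∧
      f 2 = f 0 + f 1) (fun j f hf => ⟨hf.1.hdy h j, hf.2.1.hdy h j, by
        beta_reduce; rw [hf.2.2, hdy, hdy, hdy, dy_add hf.1 hf.2.1, smul_add, smul_add, neg_add]⟩) α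
      (a := ![a, b, a + b]) ⟨ha, hb, rfl⟩).2.2
  simp only [compSym, multiSum, h1, mul_add, smul_add, sum_add_distrib]

theorem compSym_one (M : ℕ) (h : ℝ) (m : Sym n) : compSym M h m 1 = m := by
  have h1 : ∀ α : Fin n → ℕ, mpow (hdy h) α (1 : Sym n) = (∏ i, (0 : Sym n) ^ α i) * 1 := fun α => by
    rw [← mpow_mul_left]
    exact (mpow_intertwine (D := hdy h) (D' := fun _ (b : Sym n) => 0 * b)
      (fun a b => (∃ c : ℂ, a = fun _ _ => c) ∧ a = b) (fun j a b hab => by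
        obtain ⟨⟨c, rfl⟩, rfl⟩ := hab
        have : hdy h j (fun _ _ => c : Sym n) = 0 := by
          funext y η; simp [hdy, dy]
        rw [this, zero_mul]
        exact ⟨⟨0, rfl⟩, rfl⟩) α (a := 1) ⟨⟨1, rfl⟩, rfl⟩).2
  have h2 : ∀ k ∈ range M, ∑ α ∈ piAntidiag (Finset.univ : Finset (Fin n)) (k + 1),
      invFact α • (mpow deta α m * mpow (hdy h) α 1) = 0 := fun k _ => by
    refine sum_eq_zero fun α hα => ?_
    have h3 : ∃ i, α i ≠ 0 := by
      by_contra! h4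
      have := len_of_mem hα
      simp [len, h4] at this
    obtain ⟨i, hi⟩ := h3
    rw [h1, Finset.prod_eq_zero (Finset.mem_univ i) (zero_pow hi), zero_mul, mul_zero, smul_zero]
  rw [compSym, multiSum, sum_range_succ', sum_eq_zero h2, zero_add,
    Finset.piAntidiag_zero, Finset.sum_singleton, h1]
  have h4 : mpow deta (0 : Fin n → ℕ) m = m := by
    unfold mpow
    induction finRange n with
    | nil => rfl
    | cons j l ih => simp
  simp [h4, invFact]

theorem SymBd.exists_le {ι : Type*} {S : Set ι} {σ w : ι → ℝ} {b : ι → Sym n} (hb : SymBd S σ w b)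
    (hσ : ∀ i ∈ S, 1 ≤ σ i) (hw : ∀ i ∈ S, 0 ≤ w i) (N : ℕ) : ∃ C : ℝ, 0 ≤ C ∧
    ∀ i ∈ S, YBd N (b i) (C * (w i * σ i ^ N)) := by
  obtain ⟨C, hC, h⟩ := hb.le_upTo (fun q hq => zero_le_one.trans (hσ _ hq.1))
    (fun q hq => hw _ hq.1) N
  refine ⟨C, hC, fun i hi k hk y η => (h k hk (i, η) ⟨hi, Set.mem_univ _⟩ y).trans ?_⟩
  have h1 := pow_le_pow_right₀ (hσ i hi) hk
  have h2 := hw i hi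
  rw [mul_assoc]
  gcongr

/-- A smooth function equal to `1` on a bounded set. -/
theorem exists_bump {Y : Set (E n)} (hY : IsBounded Y) : ∃ (ρ : ℝ) (θ : E n → ℂ),
    (∀ y ∈ Y, ‖y‖ ≤ ρ) ∧ (∀ y ∈ Y, θ y = 1) ∧ (∀ y, ρ < ‖y‖ → θ y = 0) ∧ ContDiff ℝ ∞ θ ∧
    HasCompactSupport θ := by
  obtain ⟨r, hr⟩ := hY.subset_closedBall 0
  set f : ContDiffBump (0 : E n) := ⟨|r| + 1, |r| + 2, by positivity, by linarith⟩ with hf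
  have hle : ∀ y ∈ Y, ‖y‖ ≤ |r| := fun y hy =>
    (mem_closedBall_zero_iff.1 (hr hy)).trans (le_abs_self r)
  refine ⟨|r| + 2, fun y => (f y : ℂ), fun y hy => (hle y hy).trans (by linarith), fun y hy => ?_,
    fun y hy => ?_, Complex.ofRealCLM.contDiff.comp f.contDiff,
    f.hasCompactSupport.comp_left (g := fun x : ℝ => (x : ℂ)) rfl⟩
  · beta_reduce; rw [f.one_of_mem_closedBall (by
      rw [mem_closedBall_zero_iff]; exact (hle y hy).trans (by simp [hf])), Complex.ofReal_one]
  · beta_reduce; rw [f.zero_of_le_dist (by rw [dist_zero_right]; exact hy.le), Complex.ofReal_zero]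

theorem Bd.of_hasCompactSupport {ι : Type*} {S : Set ι} {θ : E n → ℂ} (h : ContDiff ℝ ∞ θ)
    (hc : HasCompactSupport θ) {σ : ι → ℝ} (hσ : ∀ i ∈ S, 1 ≤ σ i) :
    Bd S σ (fun _ => 1) (fun _ => θ) := by
  refine ⟨fun _ _ => h, fun k => ?_⟩
  obtain ⟨C, hC⟩ := (hc.iteratedFDeriv (𝕜 := ℝ) k).exists_bound_of_continuous
    (h.continuous_iteratedFDeriv (mod_cast le_top))
  refine ⟨C, (norm_nonneg _).trans (hC 0), fun i hi y => (hC y).trans ?_⟩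
  rw [mul_one]
  exact le_mul_of_one_le_right ((norm_nonneg _).trans (hC 0)) (one_le_pow₀ (hσ i hi))

section
variable [NeZero n] {Y : Set (E n)} {ε h₁ δ : ℝ} {m : ℝ → ℝ → ℝ → Sym n} {mj : ℕ → ℝ → ℝ → Sym n}
  {M : ℕ} {χ : ℝ → ℂ}

theorem compl_nonempty (hY : IsBounded Y) : Yᶜ.Nonempty := by
  obtain ⟨ρ, θ, h1, -⟩ := exists_bump hY
  refine ⟨single 0 (|ρ| + 1), fun h => ?_⟩
  have := h1 _ h
  rw [PiLp.norm_single, Real.norm_of_nonneg (by positivity)] at this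
  linarith [le_abs_self ρ]

theorem IsModelPerturbation.exists_suppIn (H : IsModelPerturbation Y ε m mj) :
    ∃ h₃ : ℝ, 0 < h₃ ∧ ∀ p ∈ T₁ ε h₃, SuppIn Y (m p.1 p.2.1 p.2.2) := by
  obtain ⟨h₃, h0, hexp⟩ := H.expansion
  refine ⟨h₃, h0, fun p hp => ?_⟩
  have h1 := suppIn_of_closure_subset (((hexp 0).1 p hp).2)
  have hμ : 0 < |p.2.1| := (rpow_pos_of_pos hp.1 _).trans_le hp.2.2.1
  have h2 := suppIn_of_closure_subset (((H.symbol 0 0).1 (p.2.1, p.2.2)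
    ⟨hμ, hp.2.2.2.1, Set.Ioo_subset_Icc_self hp.2.2.2.2⟩).2)
  have h3 := (h1.mul_left (fun _ _ => (p.1 : ℂ))).add h2
  have hh : (p.1 : ℂ) ≠ 0 := by exact_mod_cast hp.1.ne'
  convert h3 using 1
  funext y η
  simp [dtWithin, hh]

set_option maxHeartbeats 1600000 in
/-- The bounds at a fixed time. -/
theorem IsModelPerturbation.exists_fixed_time (H : IsModelPerturbation Y ε m mj)
    (hY : IsOpen Y) (hYb : IsBounded Y)
    (hχ : ContDiff ℝ ∞ χ)
    (h1 : ∀ σ, |σ| ≤ 1 → χ σ = 1) (h2 : ∀ σ, 2 ≤ |σ| → χ σ = 0) (hε : 0 < ε) (hε1 : ε ≤ 2 / 3)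
    (hδ : 0 < δ) (hδ1 : δ ≤ 1 / 2) (hh : h₁ ≤ 1) (hM : 1 ≤ M) (hMn : 4 * ((n : ℝ) + 1) ≤ ε * M)
    (him : ∀ q ∈ S₂ n ε δ h₁, ∀ y, |(slices (phaseTail M mj) q y).im| ≤ q.2.2.1 * q.im / 2)
    (hb : JointBd (T₁ ε h₁) (fun p => m p.1 p.2.1 p.2.2))
    (hrem : RemBd m mj M ε h₁)
    (hsupp : ∀ p ∈ T₁ ε h₁, SuppIn Y (m p.1 p.2.1 p.2.2)) :
    ∃ K : ℝ, 0 ≤ K ∧ ∀ p ∈ T₁ ε h₁,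
      (∀ F : E n → ℂ, Integrable F → MemLp F 2 →
        Integrable (Y.indicator (opT (sc p.1 (parametrixSymbol χ M mj ε δ p.1 p.2.1 p.2.2)) F)) ∧
        MemLp (Y.indicator (opT (sc p.1 (parametrixSymbol χ M mj ε δ p.1 p.2.1 p.2.2)) F)) 2 ∧
        eLpNorm (Y.indicator (opT (sc p.1 (parametrixSymbol χ M mj ε δ p.1 p.2.1 p.2.2)) F)) 2 volume ≤
          ofReal (K * (p.1 ^ (ε - 1)) ^ (n + 1)) * eLpNorm F 2 volume ∧
        eLpNorm (Y.indicator (opT (sc p.1 (paraSym χ M mj ε δ p.1 p.2.1 p.2.2)) F)) 2 volume ≤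
          ofReal (K * (p.1 ^ (ε - 1)) ^ (n + 1)) * eLpNorm F 2 volume ∧
        eLpNorm (opT (sc p.1 (m p.1 p.2.1 p.2.2)) F) 2 volume ≤ ofReal K * eLpNorm F 2 volume) ∧
      ∀ F : E n → ℂ, Integrable F → MemLp F 2 → ∀ (R : ℝ) (w G : E n → ℂ),
        w = Y.indicator (opT (sc p.1 (parametrixSymbol χ M mj ε δ p.1 p.2.1 p.2.2)) F) →
        G = (Metric.ball (0 : E n) R).indicator (𝓕 w) →
        eLpNorm (Y.indicator fun y => opT (sc p.1 (paraSym χ M mj ε δ p.1 p.2.1 p.2.2)) F y +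
          opT (sc p.1 (m p.1 p.2.1 p.2.2)) G y) 2 volume ≤
        ofReal (K * p.1 ^ (ε * M / 2)) * eLpNorm F 2 volume +
          ofReal (K * (p.1 ^ (ε - 1)) ^ (M + n + 2)) *
            eLpNorm (fun ξ => G ξ - 𝓕 w ξ) 2 volume := by
  set T := T₁ ε h₁ with hT
  set σ : ℝ × ℝ × ℝ → ℝ := fun p => p.1 ^ (ε - 1) with hσd
  have h0 : ∀ p ∈ T, 0 < p.1 := fun p hp => hp.1
  have hp1 : ∀ p ∈ T, p.1 ≤ 1 := fun p hp => hp.2.1.trans hh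
  have hσ : ∀ p ∈ T, 1 ≤ σ p := fun p hp =>
    Real.one_le_rpow_of_pos_of_le_one_of_nonpos hp.1 (hp1 p hp) (by linarith)
  have hσ0 : ∀ q ∈ T ×ˢ (Set.univ : Set (E n)), 0 ≤ σ q.1 := fun q hq => zero_le_one.trans (hσ _ hq.1)
  have hσh : ∀ p ∈ T, p.1 * σ p ≤ 1 := fun p hp => by
    rw [hσd, ← Real.rpow_one_add' hp.1.le (by linarith), add_sub_cancel]
    exact rpow_le_one hp.1.le (hp1 p hp) hε.le
  have hσi : ∀ p ∈ T, (σ p)⁻¹ = p.1 ^ (1 - ε) := fun p hp => by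
    rw [hσd, ← Real.rpow_neg hp.1.le, neg_sub]
  have one0 : ∀ p ∈ T, (0 : ℝ) ≤ 1 := fun _ _ => zero_le_one
  set b : ℝ × ℝ × ℝ → Sym n := fun p => parametrixSymbol χ M mj ε δ p.1 p.2.1 p.2.2 with hbd
  set c : ℝ × ℝ × ℝ → Sym n := fun p => paraSym χ M mj ε δ p.1 p.2.1 p.2.2 with hcd
  set m' : ℝ × ℝ × ℝ → Sym n := fun p => m p.1 p.2.1 p.2.2 with hmd
  obtain ⟨hbB, hcB, hcb⟩ := H.symBd_parametrix hχ h1 h2 hε (by linarith) hδ hδ1 hh hM him hb hrem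
  have hμ : ∀ p ∈ T, 0 < |p.2.1| := fun p hp => (rpow_pos_of_pos hp.1 _).trans_le hp.2.2.1
  have hbm : ∀ p ∈ T, SmoothSym (b p) := fun p hp =>
    (H.smoothT_parametrixSymbol (hμ p hp) hp.2.2.2.1 hχ hδ).smoothSym _
  have hcm : ∀ p ∈ T, SmoothSym (c p) := fun p hp =>
    (H.smoothT_paraSym (hμ p hp) hp.2.2.2.1 hχ hδ).smoothSym _
  have hmm : ∀ p ∈ T, SmoothSym (m' p) := hb.1
  obtain ⟨ρ, Θ, hYρ, hΘ1, hΘs, hΘ, hΘc⟩ := exists_bump hYb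
  obtain ⟨κ, hκ, hκ0, hκ1⟩ := exists_cutoff Y
  have hY' := compl_nonempty hYb
  have hms : ∀ p ∈ T, YSupp ρ (m' p) := fun p hp y η hy =>
    (hsupp p hp).eq_zero (fun hy' => absurd (hYρ y hy') (not_le.2 hy)) η
  set θ : ℝ × ℝ × ℝ → E n → ℂ := fun p => κ (p.1 ^ (1 - ε)) with hθd
  have hr : ∀ p ∈ T, 0 < p.1 ^ (1 - ε) := fun p hp => rpow_pos_of_pos hp.1 _
  have hθB : SymBd T σ (fun _ => 1) (fun p y _ => θ p y) :=
    Bd.scale (hκ.comp_index (fun q : (ℝ × ℝ × ℝ) × E n => q.1.1 ^ (1 - ε)) fun q hq => hr _ hq.1)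
      (fun q hq => inv_nonneg.2 (hr _ hq.1).le) (fun q hq => by rw [← hσi _ hq.1, inv_inv])
      one_nonneg
  have hθm : ∀ p ∈ T, ContDiff ℝ ∞ (θ p) := fun p hp => hκ.1 _ (hr p hp)
  have hΘB : SymBd T σ (fun _ => 1) (fun _ y _ => Θ y) :=
    Bd.of_hasCompactSupport hΘ hΘc fun q hq => hσ _ hq.1
  have hΘm : SmoothSym (fun y _ => Θ y : Sym n) := ContDiff.comp hΘ contDiff_fst
  have hΘS : YSupp ρ (fun y _ => Θ y : Sym n) := fun y _ hy => hΘs y hy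
  set θ' : ℝ × ℝ × ℝ → Sym n := fun p => 1 - (fun y _ => θ p y) with hθ'd
  have hθ'B : SymBd T σ (fun _ => 1) θ' := Bd.sub (Bd.const hσ0 one_nonneg
    (fun _ => (1 : ℂ)) 1 (fun _ _ => by simp)) hθB
  have hmul : ∀ {a a' : ℝ × ℝ × ℝ → Sym n} {w : ℝ × ℝ × ℝ → ℝ}, SymBd T σ (fun _ => 1) a →
      SymBd T σ w a' → SymBd T σ w (fun p => a p * a' p) := fun ha ha' =>
    Bd.congr_weight (Bd.mul ha ha') fun q _ => one_mul _
  set N : ℕ := 2 * M + 2 * (n + 1) with hN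
  have hflat : ∀ a : ℝ × ℝ × ℝ → Sym n, SymBd T σ (fun _ => 1) a →
      (∀ p ∈ T, ∀ y η, 3 * (σ p)⁻¹ < infDist y Yᶜ → a p y η = 0) →
      SymBd T σ (fun p => (σ p)⁻¹ ^ N) (fun p => compSym M p.1 (m' p) (a p)) := fun a ha ha0 =>
    Bd.congr_weight (SymBd.compSym_of_suppIn M hY hY' hb hsupp ha hσ one0 (K := 3) (by norm_num) ha0
      (fun p hp => hp.1.le) hσh N) fun q _ => one_mul _
  have hθ'0 : ∀ p ∈ T, ∀ y η, 3 * (σ p)⁻¹ < infDist y Yᶜ → θ' p y η = 0 := fun p hp y η hy => by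
    have := hκ1 _ (hr p hp) y (by rwa [← hσi p hp])
    simp [hθ'd, hθd, this]
  set W : ℝ × ℝ × ℝ → ℝ := fun p => p.1 ^ (ε * M / 2) * (σ p)⁻¹ ^ (2 * (n + 1)) with hWd
  have hσi0 : ∀ p ∈ T, 0 < (σ p)⁻¹ := fun p hp => inv_pos.2 (zero_lt_one.trans_le (hσ p hp))
  have hσi1 : ∀ p ∈ T, (σ p)⁻¹ ≤ 1 := fun p hp => inv_le_one_of_one_le₀ (hσ p hp)
  have hW0 : ∀ p ∈ T, 0 ≤ W p := fun p hp => by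
    have := hσi0 p hp
    have := rpow_pos_of_pos hp.1 (ε * M / 2)
    positivity
  have hWN : ∀ p ∈ T, (σ p)⁻¹ ^ N ≤ 1 * W p := fun p hp => by
    rw [hN, pow_add, one_mul, hWd]
    refine mul_le_mul_of_nonneg_right ?_ (pow_nonneg (hσi0 p hp).le _)
    rw [hσi p hp, ← rpow_natCast, ← rpow_mul hp.1.le]
    refine rpow_le_rpow_of_exponent_ge hp.1 (hp1 p hp) ?_
    push_cast
    nlinarith [show (0 : ℝ) ≤ M from Nat.cast_nonneg M]
  have hW3 : ∀ p ∈ T, p.1 ^ (3 * ε * M / 2) ≤ 1 * W p := fun p hp => by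
    rw [one_mul, hWd]
    simp only
    rw [hσi p hp, ← rpow_natCast, ← rpow_mul hp.1.le, ← rpow_add hp.1]
    refine rpow_le_rpow_of_exponent_ge hp.1 (hp1 p hp) ?_
    push_cast
    nlinarith [show (0 : ℝ) ≤ n from Nat.cast_nonneg n]
  have hWs : ∀ p ∈ T, W p * σ p ^ (n + 1) * σ p ^ (n + 1) = p.1 ^ (ε * M / 2) := fun p hp => by
    have := (zero_lt_one.trans_le (hσ p hp)).ne'
    rw [hWd, mul_assoc, ← pow_add, ← two_mul, mul_assoc, ← mul_pow, inv_mul_cancel₀ this, one_pow,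
      mul_one]
  have hWs1 : ∀ p ∈ T, W p * σ p ^ (n + 1) ≤ p.1 ^ (ε * M / 2) := fun p hp => by
    rw [← hWs p hp]
    exact le_mul_of_one_le_right (mul_nonneg (hW0 p hp) (pow_nonneg (zero_le_one.trans (hσ p hp)) _))
      (one_le_pow₀ (hσ p hp))
  have hhs : ∀ p ∈ T, σ p ^ (M + n + 2) * p.1 ^ (M + 1) * σ p ^ (n + 1) ≤ p.1 ^ (ε * M / 2) :=
    fun p hp => by
      rw [mul_right_comm, ← pow_add, hσd, ← rpow_natCast, ← rpow_natCast,
        ← rpow_mul hp.1.le, ← rpow_add hp.1]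
      refine rpow_le_rpow_of_exponent_ge hp.1 (hp1 p hp) ?_
      push_cast
      nlinarith [show (0 : ℝ) ≤ n from Nat.cast_nonneg n]
  have hhs1 : ∀ p ∈ T, σ p ^ (M + n + 2) * p.1 ^ (M + 1) ≤ p.1 ^ (ε * M / 2) := fun p hp => by
    refine le_trans ?_ (hhs p hp)
    have := zero_le_one.trans (hσ p hp)
    have := hp.1.le
    exact le_mul_of_one_le_right (by positivity) (one_le_pow₀ (hσ p hp))
  set e : ℝ × ℝ × ℝ → Sym n := fun p => (fun y _ => Θ y) * (c p + compSym M p.1 (m' p) (b p)) -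
    compSym M p.1 (m' p) (θ' p * b p) with hed
  have he₁ : SymBd T σ W (fun p => (fun y _ => Θ y) * (c p + compSym M p.1 (m' p) (b p))) :=
    Bd.mono (hmul hΘB hcb) hσ0 1 (fun q hq => hW3 _ hq.1) fun q hq => hW0 _ hq.1
  have he₂ : SymBd T σ W (fun p => compSym M p.1 (m' p) (θ' p * b p)) :=
    Bd.mono (hflat (fun p => θ' p * b p) (hmul hθ'B hbB) fun p hp y η hy => by
      rw [Pi.mul_apply, Pi.mul_apply, hθ'0 p hp y η hy, zero_mul]) hσ0 1
      (fun q hq => hWN _ hq.1) fun q hq => hW0 _ hq.1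
  have he' : SymBd T σ W e := Bd.sub he₁ he₂
  have hdB : SymBd T σ W (fun p => m' p - compSym M p.1 (m' p) (fun y _ => θ p y)) := by
    refine Bd.congr (Bd.mono (hflat _ hθ'B hθ'0) hσ0 1 (fun q hq => hWN _ hq.1) fun q hq => hW0 _ hq.1)
      fun q hq => ?_
    have h3 : SmoothSym (fun y _ => θ q.1 y : Sym n) := ContDiff.comp (hθm _ hq.1) contDiff_fst
    have h4 : SmoothSym (θ' q.1) := ContDiff.sub (contDiff_const (c := (1 : ℂ))) h3
    have h5 := compSym_add h3 h4 M q.1.1 (m' q.1)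
    rw [hθ'd, add_sub_cancel, compSym_one] at h5
    have h6 : m' q.1 - compSym M q.1.1 (m' q.1) (fun y _ => θ q.1 y) =
        compSym M q.1.1 (m' q.1) (θ' q.1) := sub_eq_of_eq_add' h5
    funext y
    exact (congrFun (congrFun h6 y) q.2).symm
  obtain ⟨Cm, hCm, hCm'⟩ := (SymBd.exists_le (JointBd.symBd hb (σ := fun _ => 1) fun _ _ => le_rfl)
    (fun _ _ => le_rfl) one0 (n + 1))
  obtain ⟨Ce, hCe, hCe'⟩ := (Bd.slice (JointBd.etaRem hb M)).le_upTo one_nonneg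
    (fun q _ => by positivity) (n + 1)
  obtain ⟨Cθ, hCθ, hCθ'⟩ := SymBd.exists_le hθB hσ one0 (M + n + 2)
  obtain ⟨Cb, hCb, hCb'⟩ := SymBd.exists_le (hmul hθB hbB) hσ one0 (M + n + 2)
  obtain ⟨C₂, hC₂, hC₂'⟩ := SymBd.exists_le hdB hσ hW0 (n + 1)
  obtain ⟨C₃, hC₃, hC₃'⟩ := SymBd.exists_le he' hσ hW0 (n + 1)
  obtain ⟨C₄, hC₄, hC₄'⟩ := SymBd.exists_le (hmul hΘB hbB) hσ one0 (n + 1)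
  obtain ⟨C₅, hC₅, hC₅'⟩ := SymBd.exists_le (hmul hΘB hcB) hσ one0 (n + 1)
  obtain ⟨C₆, hC₆, hC₆'⟩ := SymBd.exists_le hcB hσ one0 0
  obtain ⟨K₁, hK₁0, hK₁⟩ := exists_opBound n ρ
  obtain ⟨K₂, hK₂0, hK₂⟩ := exists_compBound n ρ M
  set A := Cm + Ce with hA
  set CB := Cθ + Cb with hCB
  set Kt := K₁ * C₃ + K₂ * A * CB + (K₁ * C₂ + K₂ * A * CB) * (K₁ * C₄) with hKt
  have hKt0 : 0 ≤ Kt := by positivity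
  refine ⟨K₁ * C₄ + K₁ * C₅ + K₁ * Cm + Kt + K₁ * A * CB, by positivity, fun p hp => ?_⟩
  have hh0 := hp.1
  set h := p.1 with hhd
  have hs1 := hσ p hp
  set s := σ p with hsd
  have hs0 : 0 < s := zero_lt_one.trans_le hs1
  have hind : ∀ (a : Sym n) (F : E n → ℂ), Y.indicator (opT (sc h a) F) =
      Y.indicator (opT (sc h ((fun y _ => Θ y) * a)) F) := fun a F =>
    Set.indicator_congr fun y hy => by
      have h3 : opT (sc h ((fun y _ => Θ y) * a)) F y = Θ y * opT (sc h a) F y :=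
        opT_mul_left Θ (sc h a) F y
      rw [h3, hΘ1 y hy, one_mul]
  have hsupΘ : ∀ a : Sym n, YSupp ρ ((fun y _ => Θ y) * a) := fun a y η hy => by
    simp [hΘs y hy]
  have hsp : 0 < s ^ (n + 1) := by positivity
  have hle : ∀ {x y : ℝ} {a : ENNReal}, x ≤ y → ofReal x * a ≤ ofReal y * a :=
    fun hxy => mul_le_mul' (ENNReal.ofReal_le_ofReal hxy) le_rfl
  have hw : ∀ F : E n → ℂ, Integrable F → MemLp F 2 →
      Integrable (Y.indicator (opT (sc h (b p)) F)) ∧ MemLp (Y.indicator (opT (sc h (b p)) F)) 2 ∧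
      eLpNorm (Y.indicator (opT (sc h (b p)) F)) 2 volume ≤
        ofReal (K₁ * (C₄ * (1 * s ^ (n + 1)))) * eLpNorm F 2 volume := fun F hF1 hF2 => by
    rw [hind]
    obtain ⟨h3, h4⟩ := memLp_opT_one_two ((hΘm.mul (hbm p hp)).sc h) ((hsupΘ (b p)).sc h)
      (B := C₄ * (1 * s ^ (n + 1))) (fun y η =>
        (norm_iteratedFDeriv_zero (𝕜 := ℝ)).symm.le.trans
          (hC₄' p hp 0 (Nat.zero_le _) y ((2 * π * h) • η))) hF1
    exact ⟨h3.indicator hY.measurableSet, h4.indicator hY.measurableSet,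
      (eLpNorm_indicator_le _).trans (hK₁.sc (hΘm.mul (hbm p hp)) (hsupΘ _) (hC₄' p hp) hF1 hF2)⟩
  have hA0 : 0 ≤ A := by positivity
  have hCB0 : 0 ≤ CB := by positivity
  have hpos : 0 ≤ K₁ * C₄ ∧ 0 ≤ K₁ * C₅ ∧ 0 ≤ K₁ * Cm ∧ 0 ≤ K₁ * A * CB :=
    ⟨by positivity, by positivity, by positivity, by positivity⟩
  obtain ⟨hpos1, hpos2, hpos3, hpos4⟩ := hpos
  refine ⟨fun F hF1 hF2 => ⟨(hw F hF1 hF2).1, (hw F hF1 hF2).2.1, (hw F hF1 hF2).2.2.trans (hle ?_),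
    ?_, ?_⟩, fun F hF1 hF2 R w G hwd hG => ?_⟩
  · rw [one_mul, ← mul_assoc]
    exact mul_le_mul_of_nonneg_right (by linarith) hsp.le
  · rw [show paraSym χ M mj ε δ h p.2.1 p.2.2 = c p from rfl, hind]
    refine (eLpNorm_indicator_le _).trans ((hK₁.sc (hΘm.mul (hcm p hp)) (hsupΘ _) (hC₅' p hp) hF1
      hF2).trans (hle ?_))
    rw [one_mul, ← mul_assoc]
    exact mul_le_mul_of_nonneg_right (by linarith) hsp.le
  · refine (hK₁.sc (hmm p hp) (hms p hp) (hCm' p hp) hF1 hF2).trans (hle ?_)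
    rw [one_pow, mul_one, mul_one]
    linarith
  · obtain ⟨hw1, hw2, hw3⟩ := hw F hF1 hF2
    set S := s ^ (M + n + 2) with hS
    have hS0 : 0 ≤ S := by positivity
    have hθ1 : SmoothSym (fun y _ => θ p y : Sym n) := ContDiff.comp (hθm p hp) contDiff_fst
    have hθ2 : SmoothSym (θ' p) := ContDiff.sub (contDiff_const (c := (1 : ℂ))) hθ1
    have hem : SmoothSym (e p) := ContDiff.sub
      (hΘm.mul ((hcm p hp).add (smoothSym_compSym (hmm p hp) (hbm p hp) M h)))
      (smoothSym_compSym (hmm p hp) (hθ2.mul (hbm p hp)) M h)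
    have main := eLpNorm_indicator_add_le hK₁0 hK₁ hK₂0 hK₂ (Y := Y) (m := m' p) (b := b p) (c := c p)
      (e := e p) (θ := θ p) (h := h) (A := A) (B := CB * S) (e₂ := C₂ * (W p * s ^ (n + 1)))
      (e₃ := C₃ * (W p * s ^ (n + 1))) (B' := C₆ * (1 * s ^ 0)) hh0 (hmm p hp) (hms p hp) hA0
      (fun k hk y ξ => (hCm' p hp k hk y ξ).trans (by rw [one_pow, mul_one, mul_one, hA]; linarith))
      (fun ζ k hk y η => (hCe' k hk ((p, ζ), η) ⟨hp, Set.mem_univ _⟩ y).trans (by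
        rw [one_pow, mul_one]
        exact mul_le_mul_of_nonneg_right (by linarith) (by positivity)))
      (hθm p hp) (hκ0 _ (hr p hp)) hYρ
      (fun k hk y => (hCθ' p hp k hk y 0).trans (by
        rw [one_mul]; exact mul_le_mul_of_nonneg_right (by linarith) hS0))
      (hbm p hp)
      (fun k hk y η => (hCb' p hp k hk y η).trans (by
        rw [one_mul]; exact mul_le_mul_of_nonneg_right (by linarith) hS0))
      (hC₂' p hp) (fun y η => by simpa using! hC₆' p hp 0 le_rfl y η) hem
      (fun y η hy => by
        simp [hed, hΘs y hy, compSym, multiSum, Finset.sum_apply, (hms p hp).mpow_deta _ y η hy])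
      (fun y hy η => by
        have h5 := compSym_add (hθ1.mul (hbm p hp)) (hθ2.mul (hbm p hp)) M h (m' p)
        rw [← add_mul, hθ'd, add_sub_cancel, one_mul] at h5
        simp only [hed, Pi.sub_apply, Pi.mul_apply, Pi.add_apply, hΘ1 y hy, one_mul]
        rw [← hhd, h5]
        simp only [Pi.add_apply, hθ'd]
        ring)
      (hC₃' p hp) hF1 hF2 hw1 hw2 (R := R) (G := G) (by rw [hG, hwd])
    rw [hwd]
    refine main.trans ?_
    have hGn : eLpNorm G 2 volume ≤
        ofReal (K₁ * (C₄ * (1 * s ^ (n + 1)))) * eLpNorm F 2 volume := by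
      rw [hG, hwd]
      exact (eLpNorm_indicator_le _).trans ((eLpNorm_fourier hw1 hw2).le.trans hw3)
    have hH := rpow_pos_of_pos hh0 (ε * M / 2)
    set Hh := h ^ (ε * M / 2) with hHd
    have n1 := hWs p hp
    have n2 := hWs1 p hp
    have n3 := hhs p hp
    have n4 := hhs1 p hp
    have n0 := hW0 p hp
    rw [← hsd] at n1 n2 n3 n4
    rw [← hS] at n3 n4
    have hKA : 0 ≤ K₂ * A * CB := by positivity
    have hh0' := hh0.le
    refine add_le_add ((add_le_add le_rfl (mul_le_mul' le_rfl hGn)).trans ?_) (hle ?_)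
    · rw [← mul_assoc (ofReal _), ← ofReal_mul (by positivity), ← add_mul, ← ENNReal.ofReal_add
        (by positivity) (by positivity)]
      refine hle ?_
      calc K₁ * (C₃ * (W p * s ^ (n + 1))) + K₂ * A * (CB * S) * h ^ (M + 1) +
            (K₁ * (C₂ * (W p * s ^ (n + 1))) + K₂ * A * (CB * S) * h ^ (M + 1)) *
              (K₁ * (C₄ * (1 * s ^ (n + 1))))
          = K₁ * C₃ * (W p * s ^ (n + 1)) + K₂ * A * CB * (S * h ^ (M + 1)) +
            (K₁ * C₂ * (W p * s ^ (n + 1) * s ^ (n + 1)) +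
              K₂ * A * CB * (S * h ^ (M + 1) * s ^ (n + 1))) * (K₁ * C₄) := by ring
        _ ≤ K₁ * C₃ * Hh + K₂ * A * CB * Hh + (K₁ * C₂ * Hh + K₂ * A * CB * Hh) * (K₁ * C₄) := by
            rw [n1]
            gcongr
        _ = Kt * Hh := by rw [hKt]; ring
        _ ≤ _ := mul_le_mul_of_nonneg_right (by linarith) hH.le
    · rw [← mul_assoc]
      exact mul_le_mul_of_nonneg_right (by linarith) hS0

end

/-! ### Functions on the slab -/

/-- Lebesgue measure on `(0,1) × ℝⁿ`. -/
def nu (n : ℕ) : Measure (ℝ × E n) := (volume.restrict (Ioo (0 : ℝ) 1)).prod volume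

theorem eLpNorm_nu_le {w z : ℝ × E n → ℂ} (hw : AEStronglyMeasurable w (nu n))
    (hz : AEStronglyMeasurable z (nu n)) {A B : ENNReal}
    (h : ∀ᵐ t ∂volume.restrict (Ioo (0 : ℝ) 1), eLpNorm (fun y => w (t, y)) 2 volume ≤
      A + B * eLpNorm (fun y => z (t, y)) 2 volume) :
    eLpNorm w 2 (nu n) ≤ A + B * eLpNorm z 2 (nu n) := by
  have hsq : ∀ {w : ℝ × E n → ℂ}, AEStronglyMeasurable w (nu n) → eLpNorm w 2 (nu n) ^ 2 =
      ∫⁻ t in Ioo (0 : ℝ) 1, eLpNorm (fun y => w (t, y)) 2 volume ^ 2 := fun hw => by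
    rw [eLpNorm_two_sq, nu, lintegral_prod _ (hw.enorm.pow_const 2)]
    refine lintegral_congr fun t => ?_
    rw [eLpNorm_two_sq]
  have hm : AEMeasurable (fun t => eLpNorm (fun y => z (t, y)) 2 volume)
      (volume.restrict (Ioo (0 : ℝ) 1)) := by
    have h1 := (AEMeasurable.lintegral_prod_right' (hz.enorm.pow_const 2)).pow_const (1 / 2 : ℝ)
    refine h1.congr (of_forall fun t => ?_)
    simp only
    rw [← eLpNorm_two_sq, ← ENNReal.rpow_natCast, ← ENNReal.rpow_mul]
    norm_num
  have h2 : ∀ x : ENNReal, x ^ (2 : ℝ) = x ^ 2 := fun x => by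
    rw [← ENNReal.rpow_natCast]; norm_num
  have h3 := ENNReal.lintegral_Lp_add_le (p := 2) (μ := volume.restrict (Ioo (0 : ℝ) 1))
    (f := fun _ => A) (g := fun t => B * eLpNorm (fun y => z (t, y)) 2 volume) aemeasurable_const
    (hm.const_mul B) (by norm_num)
  have h4 : ∀ x : ENNReal, (x ^ 2) ^ (1 / 2 : ℝ) = x := fun x => by
    rw [← h2, ← ENNReal.rpow_mul]; norm_num
  simp only [Pi.add_apply, h2, mul_pow, lintegral_const, Measure.restrict_apply_univ, Real.volume_Ioo,
    sub_zero, ENNReal.ofReal_one, mul_one, h4] at h3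
  rw [lintegral_const_mul'' _ (hm.pow_const 2), ← hsq hz, ← mul_pow, h4] at h3
  refine le_trans ?_ h3
  rw [← h4 (eLpNorm w 2 (nu n)), hsq hw]
  refine ENNReal.rpow_le_rpow (lintegral_mono_ae ?_) (by norm_num)
  filter_upwards [h] with t ht
  gcongr

theorem slab_eq (Y : Set (E n)) : slab Y = (nu n).restrict (Set.univ ×ˢ Y) := by
  rw [slab, nu, Measure.volume_eq_prod, ← Measure.prod_restrict, ← Measure.prod_restrict,
    Measure.restrict_univ]

/-- Extension by zero to `(0,1) × ℝⁿ`. -/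
def ext0 (Y : Set (E n)) (w : ℝ × E n → ℂ) : ℝ × E n → ℂ := (Set.univ ×ˢ Y).indicator w

theorem ext0_apply (Y : Set (E n)) (w : ℝ × E n → ℂ) (t : ℝ) :
    (fun y => ext0 Y w (t, y)) = Y.indicator fun y => w (t, y) := by
  funext y
  by_cases hy : y ∈ Y <;> simp [ext0, hy]

theorem eLpNorm_slab {Y : Set (E n)} (hY : MeasurableSet Y) (w : ℝ × E n → ℂ) :
    eLpNorm w 2 (slab Y) = eLpNorm (ext0 Y w) 2 (nu n) := by
  rw [slab_eq, ext0, eLpNorm_indicator_eq_eLpNorm_restrict (MeasurableSet.univ.prod hY)]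

theorem aestronglyMeasurable_ext0 {Y : Set (E n)} (hY : MeasurableSet Y) {w : ℝ × E n → ℂ} :
    AEStronglyMeasurable (ext0 Y w) (nu n) ↔ AEStronglyMeasurable w (slab Y) := by
  rw [slab_eq, ext0, aestronglyMeasurable_indicator_iff (MeasurableSet.univ.prod hY)]

theorem tendsto_eLpNorm_indicator {α : Type*} [MeasurableSpace α] {μ : Measure α} {f : α → ℂ}
    (hf : MemLp f 2 μ) {S : ℝ → Set α} (hS : ∀ R, MeasurableSet (S R))
    (h : ∀ x, ∀ᶠ R in Filter.atTop, x ∉ S R) :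
    Filter.Tendsto (fun R => eLpNorm ((S R).indicator f) 2 μ) Filter.atTop (nhds 0) := by
  have h1 : Filter.Tendsto (fun R => ∫⁻ x, ‖(S R).indicator f x‖ₑ ^ 2 ∂μ) Filter.atTop
      (nhds (∫⁻ _, 0 ∂μ)) := by
    refine tendsto_lintegral_filter_of_dominated_convergence' (fun x => ‖f x‖ₑ ^ 2)
      (of_forall fun R => (hf.1.indicator (hS R)).enorm.pow_const 2)
      (of_forall fun R => of_forall fun x => ?_) ?_
      (of_forall fun x => ?_)
    · gcongr
      by_cases hx : x ∈ S R
      · rw [indicator_of_mem hx]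
      · rw [indicator_of_notMem hx]; simp
    · rw [← eLpNorm_two_sq]
      exact ENNReal.pow_ne_top hf.2.ne
    · refine tendsto_const_nhds.congr' ?_
      filter_upwards [h x] with R hR
      rw [indicator_of_notMem hR]
      simp
  have h2 := h1.ennrpow_const (1 / 2 : ℝ)
  simp only [← eLpNorm_two_sq, lintegral_zero] at h2
  rw [ENNReal.zero_rpow_of_pos (by norm_num)] at h2
  refine h2.congr fun R => ?_
  rw [← ENNReal.rpow_natCast, ← ENNReal.rpow_mul]
  norm_num

theorem exists_eLpNorm_limit {α : Type*} [MeasurableSpace α] {μ : Measure α} {w : ℝ → α → ℂ}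
    (hw : ∀ R, MemLp (w R) 2 μ) {D : ℝ → ENNReal} (hD : Filter.Tendsto D Filter.atTop (nhds 0))
    (h : ∀ R R', R ≤ R' → eLpNorm (w R' - w R) 2 μ ≤ D R) :
    ∃ u : α → ℂ, StronglyMeasurable u ∧ MemLp u 2 μ ∧
      Filter.Tendsto (fun R => eLpNorm (w R - u) 2 μ) Filter.atTop (nhds 0) := by
  have hc : CauchySeq fun R => (hw R).toLp (w R) := by
    rw [EMetric.cauchySeq_iff']
    intro e he
    obtain ⟨N, hN⟩ := (hD.eventually (gt_mem_nhds he)).exists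
    refine ⟨N, fun R hR => ?_⟩
    rw [Lp.edist_toLp_toLp]
    exact (h N R hR).trans_lt hN
  obtain ⟨u, hu⟩ := cauchySeq_tendsto_of_complete hc
  refine ⟨u, Lp.stronglyMeasurable u, Lp.memLp u, ?_⟩
  have h1 := (tendsto_iff_edist_tendsto_0.1 hu)
  refine h1.congr fun R => ?_
  rw [Lp.edist_def]
  refine eLpNorm_congr_ae ?_
  filter_upwards [(hw R).coeFn_toLp] with x hx
  simp [hx]

theorem opTrunc_eq (Y : Set (E n)) (hY : MeasurableSet Y) {h : ℝ} (hh : 0 < h) (R : ℝ) (a : Sym n)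
    (g : E n → ℂ) (y : E n) : opTrunc Y h R a g y =
      opT (sc h a) ((Metric.ball 0 (R / (2 * π * h))).indicator (𝓕 (Y.indicator g))) y := by
  have hp : 0 < 2 * π * h := by positivity
  set q : ℝ := 2 * π * h with hq
  have hball : q • Metric.ball (0 : E n) (R / q) = Metric.ball 0 R := by
    rw [smul_ball hp.ne', smul_zero, Real.norm_of_nonneg hp.le, mul_div_cancel₀ _ hp.ne']
  have h1 := Measure.setIntegral_comp_smul_of_pos (volume : Measure (E n)) (fun η => ∫ w in Y,
    Complex.exp (I * (inner ℝ (y - w) η : ℝ) / h) * a y η * g w) (Metric.ball 0 (R / q)) hp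
  rw [hball, finrank_euclideanSpace_fin] at h1
  have h2 : opTrunc Y h R a g y = ∫ ξ in Metric.ball (0 : E n) (R / q), ∫ w in Y,
      Complex.exp (I * (inner ℝ (y - w) (q • ξ) : ℝ) / h) * a y (q • ξ) * g w := by
    rw [h1, opTrunc, ← hq, real_smul]
    push_cast
    rw [inv_pow]
  rw [h2, opT_eq, ← integral_indicator Metric.isOpen_ball.measurableSet]
  congr 1
  funext ξ
  by_cases hξ : ξ ∈ Metric.ball (0 : E n) (R / q)
  · rw [indicator_of_mem hξ, indicator_of_mem hξ, fourier_eq_ech,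
      ← integral_const_mul, ← integral_const_mul, ← integral_indicator hY]
    congr 1
    funext w
    by_cases hw : w ∈ Y
    · rw [indicator_of_mem hw, indicator_of_mem hw]
      have e : Complex.exp (I * (inner ℝ (y - w) (q • ξ) : ℝ) / h) =
          ech ξ y * ech (-ξ) w := by
        rw [ech, ech, Real.fourierChar_apply, Real.fourierChar_apply, ← Complex.exp_add,
          inner_smul_right, inner_sub_left, inner_neg_left, real_inner_comm ξ y,
          real_inner_comm ξ w, hq]
        congr 1
        have : (h : ℂ) ≠ 0 := by exact_mod_cast hh.ne'
        push_cast
        field_simp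
        ring
      rw [e, sc, ← hq]
      ring
    · rw [indicator_of_notMem hw, indicator_of_notMem hw]
      simp
  · rw [indicator_of_notMem hξ, indicator_of_notMem hξ]
    simp

theorem stronglyMeasurable_fourier_family {w : ℝ × E n → ℂ} (hw : StronglyMeasurable w) :
    StronglyMeasurable fun p : ℝ × E n => 𝓕 (fun y => w (p.1, y)) p.2 := by
  simp only [fourier_eq_ech]
  have h2 : Continuous fun q : (ℝ × E n) × E n => ech (-q.1.2) q.2 := by fun_prop
  exact StronglyMeasurable.integral_prod_right (f := fun (p : ℝ × E n) (y : E n) =>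
    ech (-p.2) y * w (p.1, y)) (h2.stronglyMeasurable.mul (hw.comp_measurable
      (g := fun q : (ℝ × E n) × E n => (q.1.1, q.2)) (by fun_prop)))

/-- Functions measurable in `t` and continuous in the other variables. -/
theorem exists_measurable_symbol {m : ℝ → Sym n} {μ : Measure ℝ}
    (hc : ∀ᵐ t ∂μ, Continuous (unc (m t))) (hm : ∀ y η, AEMeasurable (fun t => m t y η) μ) :
    ∃ m' : ℝ → Sym n, (StronglyMeasurable fun q : ℝ × E n × E n => m' q.1 q.2.1 q.2.2) ∧
      ∀ᵐ t ∂μ, m' t = m t := by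
  obtain ⟨D, hDc, hDd⟩ := TopologicalSpace.exists_countable_dense (E n × E n)
  have h1 : ∀ᵐ t ∂μ, Continuous (unc (m t)) ∧ ∀ d ∈ D, (hm d.1 d.2).mk _ t = m t d.1 d.2 := by
    filter_upwards [hc, (ae_ball_iff hDc).2 fun d _ => (hm d.1 d.2).ae_eq_mk] with t ht1 ht2
    exact ⟨ht1, fun d hd => (ht2 d hd).symm⟩
  obtain ⟨N, hN, hNm, hN0⟩ := exists_measurable_superset_of_null (ae_iff.1 h1)
  have hgood : ∀ t ∉ N, Continuous (unc (m t)) ∧ ∀ d ∈ D, (hm d.1 d.2).mk _ t = m t d.1 d.2 :=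
    fun t ht => by
      by_contra h
      exact ht (hN h)
  classical
  refine ⟨fun t => if t ∈ N then 0 else m t, ?_, ?_⟩
  · have hcont : ∀ t, Continuous fun d : E n × E n => (if t ∈ N then (0 : Sym n) else m t) d.1 d.2 :=
      fun t => by
        by_cases ht : t ∈ N
        · simp only [ht, if_true, Pi.zero_apply]; exact continuous_const
        · simp only [ht, if_false]; exact (hgood t ht).1
    have hmeas : ∀ d : E n × E n, StronglyMeasurable fun t =>
        (if t ∈ N then (0 : Sym n) else m t) d.1 d.2 := fun d => by
      have hd : ∀ d ∈ D, Measurable fun t => (if t ∈ N then (0 : Sym n) else m t) d.1 d.2 := fun d hd => by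
        have : (fun t => (if t ∈ N then (0 : Sym n) else m t) d.1 d.2) =
            fun t => if t ∈ N then 0 else (hm d.1 d.2).mk _ t := by
          funext t
          by_cases ht : t ∈ N
          · simp [ht]
          · simp only [ht, if_false]; exact ((hgood t ht).2 d hd).symm
        rw [this]
        exact Measurable.ite hNm measurable_const (hm d.1 d.2).measurable_mk
      obtain ⟨s, hs, hsl⟩ := mem_closure_iff_seq_limit.1 (hDd d)
      refine (measurable_of_tendsto_metrizable (fun k => hd (s k) (hs k)) ?_).stronglyMeasurable
      rw [tendsto_pi_nhds]
      exact fun t => ((hcont t).tendsto d).comp hsl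
    exact (stronglyMeasurable_uncurry_of_continuous_of_stronglyMeasurable (u := fun (d : E n × E n) t =>
      (if t ∈ N then (0 : Sym n) else m t) d.1 d.2) hcont hmeas).comp_measurable measurable_swap
  · filter_upwards [compl_mem_ae_iff.2 hN0] with t ht
    exact if_neg ht

open Filter Metric

/-! ### Families of operators -/

theorem integrable_opT_ball {a : Sym n} (ha : Continuous (unc a)) {F : E n → ℂ} (hF : MemLp F 2)
    (r : ℝ) (y : E n) : Integrable fun ξ =>
      ech ξ y * (a y ξ * (ball (0 : E n) r).indicator F ξ) := by
  have hc : Continuous fun ξ : E n => ech ξ y * a y ξ :=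
    .mul (by fun_prop : Continuous fun ξ : E n => ech ξ y)
      (ha.comp (by fun_prop : Continuous fun ξ => (y, ξ)))
  obtain ⟨A, hA⟩ := (isCompact_closedBall (0 : E n) r).exists_bound_of_continuousOn hc.continuousOn
  have h1 := (MemLp.ball_indicator hF r).1
  refine (h1.norm.const_mul A).mono' ?_ (Eventually.of_forall fun ξ => ?_)
  · simp only [← mul_assoc]
    exact hc.aestronglyMeasurable.mul h1.1
  · rw [← mul_assoc, norm_mul]
    by_cases hξ : ξ ∈ ball (0 : E n) r
    · exact mul_le_mul_of_nonneg_right (hA ξ (ball_subset_closedBall hξ)) (norm_nonneg _)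
    · simp [indicator_of_notMem hξ]

theorem opT_ball_sub {a : Sym n} (ha : Continuous (unc a)) {F G : E n → ℂ} (hF : MemLp F 2)
    (hG : MemLp G 2) (r r' : ℝ) (y : E n) :
    opT a ((ball (0 : E n) r).indicator F - (ball (0 : E n) r').indicator G) y =
      opT a ((ball (0 : E n) r).indicator F) y - opT a ((ball (0 : E n) r').indicator G) y := by
  simp only [opT_eq]
  rw [← integral_sub (integrable_opT_ball ha hF r y) (integrable_opT_ball ha hG r' y)]
  simp only [Pi.sub_apply, mul_sub]

/-- The operators with symbols `a t`, applied to the functions `G (t, ·)` restricted to a ball. -/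
def famT (a : ℝ → Sym n) (G : ℝ × E n → ℂ) (r : ℝ) (p : ℝ × E n) : ℂ :=
  opT (a p.1) ((ball (0 : E n) r).indicator fun ξ => G (p.1, ξ)) p.2

/-- A measurable family of symbols whose operators have norm at most `κ`. -/
structure FamBound (Y : Set (E n)) (a : ℝ → Sym n) (κ : ENNReal) : Prop where
  meas : ∃ a' : ℝ → Sym n, (StronglyMeasurable fun q : ℝ × E n × E n => a' q.1 q.2.1 q.2.2) ∧
    ∀ᵐ t ∂volume.restrict (Ioo (0 : ℝ) 1), a' t = a t
  cont : ∀ᵐ t ∂volume.restrict (Ioo (0 : ℝ) 1), Continuous (unc (a t))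
  ne_top : κ ≠ ⊤
  bound : ∀ᵐ t ∂volume.restrict (Ioo (0 : ℝ) 1), ∀ F : E n → ℂ, Integrable F → MemLp F 2 →
    eLpNorm (Y.indicator (opT (a t) F)) 2 volume ≤ κ * eLpNorm F 2 volume

theorem ae_nu_of_ae {P : ℝ × E n → Prop} {Q : ℝ → Prop}
    (h : ∀ᵐ t ∂volume.restrict (Ioo (0 : ℝ) 1), Q t) (hP : ∀ t, Q t → ∀ y, P (t, y)) :
    ∀ᵐ p ∂nu n, P p := by
  have := Measure.quasiMeasurePreserving_fst (μ := volume.restrict (Ioo (0 : ℝ) 1))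
    (ν := (volume : Measure (E n)))
  filter_upwards [this.ae h] with p hp
  exact hP p.1 hp p.2

theorem ae_memLp_slice {G : ℝ × E n → ℂ} (hG : StronglyMeasurable G) (h2 : MemLp G 2 (nu n)) :
    ∀ᵐ t ∂volume.restrict (Ioo (0 : ℝ) 1), MemLp (fun ξ => G (t, ξ)) 2 := by
  have h1 : ∫⁻ t in Ioo (0 : ℝ) 1, ∫⁻ ξ, ‖G (t, ξ)‖ₑ ^ 2 ≠ ⊤ := by
    rw [← lintegral_prod (f := fun p => ‖G p‖ₑ ^ 2) (hG.enorm.pow_const 2).aemeasurable, ← nu,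
      ← eLpNorm_two_sq]
    exact ENNReal.pow_ne_top h2.2.ne
  filter_upwards [ae_lt_top' (AEMeasurable.lintegral_prod_right'
    (hG.enorm.pow_const 2).aemeasurable) h1] with t ht
  refine ⟨(hG.comp_measurable measurable_prodMk_left).aestronglyMeasurable, ?_⟩
  rw [← eLpNorm_two_sq] at ht
  by_contra! h
  simp [top_le_iff.1 h] at ht

theorem stronglyMeasurable_ext0 {Y : Set (E n)} (hY : MeasurableSet Y) {G : ℝ × E n → ℂ}
    (hG : StronglyMeasurable G) : StronglyMeasurable (ext0 Y G) :=
  hG.indicator (MeasurableSet.univ.prod hY)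

section
variable {Y : Set (E n)} {a : ℝ → Sym n} {κ : ENNReal} {G G' : ℝ × E n → ℂ}

theorem FamBound.aestronglyMeasurable (H : FamBound Y a κ)
    (hG : StronglyMeasurable G) (r : ℝ) : AEStronglyMeasurable (famT a G r) (nu n) := by
  obtain ⟨a', h1, h2⟩ := H.meas
  refine ⟨famT a' G r, ?_, (ae_nu_of_ae h2 fun t ht y => ?_)⟩
  · have := stronglyMeasurable_opT_family h1 (stronglyMeasurable_ext0 (measurableSet_ball
      (x := (0 : E n)) (ε := r)) hG)
    simp only [ext0_apply] at this
    exact this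
  · simp only [famT, ht]

theorem FamBound.eLpNorm_sub_le (H : FamBound Y a κ) (hY : MeasurableSet Y)
    (hG : StronglyMeasurable G) (hG' : StronglyMeasurable G') (h2 : MemLp G 2 (nu n))
    (h2' : MemLp G' 2 (nu n)) (r r' : ℝ) :
    eLpNorm (famT a G r - famT a G' r') 2 (slab Y) ≤
      κ * eLpNorm (ext0 (ball 0 r) G - ext0 (ball 0 r') G') 2 (nu n) := by
  rw [eLpNorm_slab hY, ← zero_add (κ * _)]
  refine eLpNorm_nu_le ((aestronglyMeasurable_ext0 hY).2 ?_)
    ((stronglyMeasurable_ext0 measurableSet_ball hG).sub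
      (stronglyMeasurable_ext0 measurableSet_ball hG')).aestronglyMeasurable ?_
  · rw [slab_eq]
    exact ((H.aestronglyMeasurable hG r).sub (H.aestronglyMeasurable hG' r')).restrict
  · filter_upwards [H.cont, H.bound, ae_memLp_slice hG h2, ae_memLp_slice hG' h2']
      with t ht1 ht2 ht3 ht4
    have h3 := ht2 _ ((MemLp.ball_indicator ht3 r).1.sub (MemLp.ball_indicator ht4 r').1)
      ((MemLp.ball_indicator ht3 r).2.sub (MemLp.ball_indicator ht4 r').2)
    rw [zero_add, ext0_apply]
    have e : (fun ξ => (ext0 (ball 0 r) G - ext0 (ball 0 r') G') (t, ξ)) =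
        (ball 0 r).indicator (fun ξ => G (t, ξ)) - (ball 0 r').indicator fun ξ => G' (t, ξ) := by
      rw [← ext0_apply, ← ext0_apply]; rfl
    rw [e]
    refine le_trans (le_of_eq ?_) h3
    congr 2
    funext y
    rw [opT_ball_sub ht1 ht3 ht4]
    rfl

theorem FamBound.eLpNorm_sub_le' (H : FamBound Y a κ) (hY : MeasurableSet Y)
    (hG : StronglyMeasurable G) (hG' : StronglyMeasurable G') (h2 : MemLp G 2 (nu n))
    (h2' : MemLp G' 2 (nu n)) (r : ℝ) :
    eLpNorm (famT a G r - famT a G' r) 2 (slab Y) ≤ κ * eLpNorm (G - G') 2 (nu n) := by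
  refine (H.eLpNorm_sub_le hY hG hG' h2 h2' r r).trans (mul_le_mul' le_rfl ?_)
  rw [ext0, ext0, ← Set.indicator_sub']
  exact eLpNorm_indicator_le _

theorem FamBound.eLpNorm_le (H : FamBound Y a κ) (hY : MeasurableSet Y)
    (hG : StronglyMeasurable G) (h2 : MemLp G 2 (nu n)) (r : ℝ) :
    eLpNorm (famT a G r) 2 (slab Y) ≤ κ * eLpNorm G 2 (nu n) := by
  have h := H.eLpNorm_sub_le' hY hG stronglyMeasurable_zero h2 MemLp.zero r
  have e : famT a 0 r = 0 := by
    funext p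
    simp [famT, opT_eq]
  rwa [e, sub_zero, sub_zero] at h

theorem FamBound.memLp (H : FamBound Y a κ) (hY : MeasurableSet Y)
    (hG : StronglyMeasurable G) (h2 : MemLp G 2 (nu n)) (r : ℝ) :
    MemLp (famT a G r) 2 (slab Y) := by
  refine ⟨?_, (H.eLpNorm_le hY hG h2 r).trans_lt (ENNReal.mul_lt_top H.ne_top.lt_top h2.2)⟩
  rw [slab_eq]
  exact (H.aestronglyMeasurable hG r).restrict

theorem tendsto_eLpNorm_ext0_ball_sub (h2 : MemLp G 2 (nu n)) :
    Tendsto (fun r => eLpNorm (ext0 (ball 0 r) G - G) 2 (nu n)) atTop (nhds 0) := by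
  refine (tendsto_eLpNorm_indicator h2 (S := fun r => Set.univ ×ˢ (ball (0 : E n) r)ᶜ)
    (fun r => MeasurableSet.univ.prod measurableSet_ball.compl) fun p => ?_).congr fun r => ?_
  · filter_upwards [eventually_gt_atTop ‖p.2‖] with r hr
    simpa using hr
  · rw [← eLpNorm_neg]
    congr 1
    funext p
    by_cases hp : p.2 ∈ ball (0 : E n) r <;> simp [ext0, Set.indicator, hp]

theorem FamBound.exists_limit (H : FamBound Y a κ) (hY : MeasurableSet Y)
    (hG : StronglyMeasurable G) (h2 : MemLp G 2 (nu n)) :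
    ∃ u : ℝ × E n → ℂ, StronglyMeasurable u ∧ MemLp u 2 (slab Y) ∧
      Tendsto (fun r => eLpNorm (famT a G r - u) 2 (slab Y)) atTop (nhds 0) := by
  refine exists_eLpNorm_limit (H.memLp hY hG h2) (D := fun r => κ * eLpNorm (ext0 (ball 0 r) G - G) 2
    (nu n)) ?_ fun r r' hr => (H.eLpNorm_sub_le hY hG hG h2 h2 r' r).trans (mul_le_mul' le_rfl ?_)
  · simpa using ENNReal.Tendsto.const_mul (tendsto_eLpNorm_ext0_ball_sub h2) (Or.inr H.ne_top)
  · refine eLpNorm_mono fun p => ?_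
    by_cases hp : p.2 ∈ ball (0 : E n) r
    · have hp' : p.2 ∈ ball (0 : E n) r' := ball_subset_ball hr hp
      simp_all [ext0, Set.indicator]
    · rw [mem_ball_zero_iff] at hp
      by_cases hp' : ‖p.2‖ < r' <;> simp [ext0, Set.indicator, hp, hp']

/-- The Fourier transforms of the functions `w (t, ·)` on `Y`. -/
def famF (Y : Set (E n)) (w : ℝ × E n → ℂ) (p : ℝ × E n) : ℂ :=
  𝓕 (Y.indicator fun y => w (p.1, y)) p.2

theorem stronglyMeasurable_famF (hY : MeasurableSet Y) {w : ℝ × E n → ℂ} (hw : StronglyMeasurable w) :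
    StronglyMeasurable (famF Y w) := by
  have := stronglyMeasurable_fourier_family (stronglyMeasurable_ext0 hY hw)
  simp only [ext0_apply] at this
  exact this

theorem MemLp.integrable_of_indicator {Y : Set (E n)} (hY : MeasurableSet Y)
    (hb : IsBounded Y) {g : E n → ℂ} (h : MemLp (Y.indicator g) 2) :
    Integrable (Y.indicator g) := by
  have : IsFiniteMeasure (volume.restrict Y) := ⟨by simpa using hb.measure_lt_top⟩
  rw [memLp_indicator_iff_restrict hY] at h
  exact (integrable_indicator_iff hY).2 (h.integrable one_le_two)

theorem ae_memLp_indicator_slice (hY : MeasurableSet Y) {w : ℝ × E n → ℂ} (hw : StronglyMeasurable w)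
    (h2 : MemLp w 2 (slab Y)) : ∀ᵐ t ∂volume.restrict (Ioo (0 : ℝ) 1),
      MemLp (Y.indicator fun y => w (t, y)) 2 := by
  have := ae_memLp_slice (stronglyMeasurable_ext0 hY hw)
    ⟨(aestronglyMeasurable_ext0 hY).2 h2.1, by rw [← eLpNorm_slab hY]; exact h2.2⟩
  simpa only [ext0_apply] using this

theorem eLpNorm_famF_sub_le (hY : MeasurableSet Y) (hb : IsBounded Y) {w w' : ℝ × E n → ℂ}
    (hw : StronglyMeasurable w) (hw' : StronglyMeasurable w') (h2 : MemLp w 2 (slab Y))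
    (h2' : MemLp w' 2 (slab Y)) :
    eLpNorm (famF Y w - famF Y w') 2 (nu n) ≤ eLpNorm (w - w') 2 (slab Y) := by
  rw [eLpNorm_slab hY, ← zero_add (eLpNorm (ext0 _ _) _ _), ← one_mul (eLpNorm (ext0 _ _) _ _)]
  refine eLpNorm_nu_le ((stronglyMeasurable_famF hY hw).sub
    (stronglyMeasurable_famF hY hw')).aestronglyMeasurable
    (stronglyMeasurable_ext0 hY (hw.sub hw')).aestronglyMeasurable ?_
  filter_upwards [ae_memLp_indicator_slice hY hw h2, ae_memLp_indicator_slice hY hw' h2']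
    with t ht ht'
  have h1 := MemLp.integrable_of_indicator hY hb ht
  have h1' := MemLp.integrable_of_indicator hY hb ht'
  rw [zero_add, one_mul, ext0_apply]
  have e : (Y.indicator fun y => (w - w') (t, y)) =
      (Y.indicator fun y => w (t, y)) - Y.indicator fun y => w' (t, y) := Set.indicator_sub _ _ _
  rw [e, ← eLpNorm_fourier (h1.sub h1') (ht.sub ht'), fourier_sub_fun h1 h1']
  rfl

theorem memLp_famF (hY : MeasurableSet Y) (hb : IsBounded Y) {w : ℝ × E n → ℂ}
    (hw : StronglyMeasurable w) (h2 : MemLp w 2 (slab Y)) : MemLp (famF Y w) 2 (nu n) := by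
  refine ⟨(stronglyMeasurable_famF hY hw).aestronglyMeasurable, ?_⟩
  have h := eLpNorm_famF_sub_le hY hb hw stronglyMeasurable_zero h2 MemLp.zero
  have e : famF Y (0 : ℝ × E n → ℂ) = 0 := by
    funext p
    simp [famF, fourier_eq]
  rw [e, sub_zero, sub_zero] at h
  exact h.trans_lt h2.2

theorem isOp_of_tendsto (hY : MeasurableSet Y) {h : ℝ} (hh : 0 < h) {a : ℝ → Sym n}
    {g : ℝ → E n → ℂ} {v : ℝ × E n → ℂ} (hv : MemLp v 2 (slab Y))
    (hl : Tendsto (fun r => eLpNorm (famT (fun t => sc h (a t)) (fun p => 𝓕 (Y.indicator (g p.1)) p.2) r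
      - v) 2 (slab Y)) atTop (nhds 0)) : IsOp Y h a g v := by
  refine ⟨hv, (hl.comp (tendsto_id.atTop_div_const (by positivity : 0 < 2 * π * h))).congr
    fun R => ?_⟩
  simp only [opTrunc_eq Y hY hh]
  rfl
end

theorem le_of_tendsto_eLpNorm_sub {α : Type*} [MeasurableSpace α] {μ : Measure α} {w : ℝ → α → ℂ}
    {u : α → ℂ} {C : ENNReal} (hw : ∀ r, AEStronglyMeasurable (w r) μ)
    (hu : AEStronglyMeasurable u μ) (hC : ∀ r, eLpNorm (w r) 2 μ ≤ C)
    (h : Tendsto (fun r => eLpNorm (w r - u) 2 μ) atTop (nhds 0)) : eLpNorm u 2 μ ≤ C := by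
  have h1 := h.const_add C
  rw [add_zero] at h1
  refine ge_of_tendsto' h1 fun r => ?_
  have h2 := eLpNorm_sub_le (p := 2) (hw r) ((hw r).sub hu) one_le_two
  rw [sub_sub_cancel] at h2
  exact h2.trans (add_le_add (hC r) le_rfl)

theorem exists_solution {Y : Set (E n)} (hY : MeasurableSet Y) (hb : IsBounded Y)
    {b c m : ℝ → Sym n} {κ κ' A B : ENNReal} (hbm : StronglyMeasurable fun q : ℝ × E n × E n =>
      b q.1 q.2.1 q.2.2) (hbb : FamBound Y b κ) (hcb : FamBound Y c κ) (hmb : FamBound Y m κ')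
    (hB : B ≠ ⊤)
    (hcomp : ∀ᵐ t ∂volume.restrict (Ioo (0 : ℝ) 1), ∀ F : E n → ℂ, Integrable F → MemLp F 2 →
      ∀ (R : ℝ) (w G : E n → ℂ), w = Y.indicator (opT (b t) F) →
        G = (ball (0 : E n) R).indicator (𝓕 w) →
        eLpNorm (Y.indicator fun y => opT (c t) F y + opT (m t) G y) 2 volume ≤
          A * eLpNorm F 2 volume + B * eLpNorm (fun ξ => G ξ - 𝓕 w ξ) 2 volume)
    {F : E n → ℂ} (hF : StronglyMeasurable F) (hF2 : MemLp F 2) :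
    ∃ u v z : ℝ × E n → ℂ, MemLp u 2 (slab Y) ∧ MemLp v 2 (slab Y) ∧ MemLp z 2 (slab Y) ∧
      Tendsto (fun r => eLpNorm (famT b (fun p => F p.2) r - u) 2 (slab Y)) atTop (nhds 0) ∧
      Tendsto (fun r => eLpNorm (famT m (famF Y u) r - v) 2 (slab Y)) atTop (nhds 0) ∧
      Tendsto (fun r => eLpNorm (famT c (fun p => F p.2) r - z) 2 (slab Y)) atTop (nhds 0) ∧
      eLpNorm u 2 (slab Y) ≤ κ * eLpNorm F 2 volume ∧
      eLpNorm (z + v) 2 (slab Y) ≤ A * eLpNorm F 2 volume := by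
  set Φ : ℝ × E n → ℂ := fun p => F p.2 with hΦ
  have hΦm : StronglyMeasurable Φ := hF.comp_measurable measurable_snd
  have hΦn : eLpNorm Φ 2 (nu n) ≤ eLpNorm F 2 volume := by
    have := eLpNorm_nu_le (A := eLpNorm F 2 volume) (B := 0) hΦm.aestronglyMeasurable
      (stronglyMeasurable_zero (α := ℝ × E n) (β := ℂ)).aestronglyMeasurable
      (Eventually.of_forall fun t => by simp [hΦ])
    simpa using this
  have hΦ2 : MemLp Φ 2 (nu n) := ⟨hΦm.aestronglyMeasurable, hΦn.trans_lt hF2.2⟩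
  obtain ⟨u, hum, hu2, hul⟩ := hbb.exists_limit hY hΦm hΦ2
  obtain ⟨z, hzm, hz2, hzl⟩ := hcb.exists_limit hY hΦm hΦ2
  have hUm := stronglyMeasurable_famF hY hum
  have hU2 := memLp_famF hY hb hum hu2
  obtain ⟨v, hvm, hv2, hvl⟩ := hmb.exists_limit hY hUm hU2
  refine ⟨u, v, z, hu2, hv2, hz2, hul, hvl, hzl, ?_, ?_⟩
  · exact le_of_tendsto_eLpNorm_sub (fun r => (hbb.memLp hY hΦm hΦ2 r).1) hu2.1
      (fun r => (hbb.eLpNorm_le hY hΦm hΦ2 r).trans (mul_le_mul' le_rfl hΦn)) hul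
  have hwm : ∀ r, StronglyMeasurable (famT b Φ r) := fun r => by
    have := stronglyMeasurable_opT_family hbm (stronglyMeasurable_ext0 (measurableSet_ball
      (x := (0 : E n)) (ε := r)) hΦm)
    simp only [ext0_apply] at this
    exact this
  have hw2 : ∀ r, MemLp (famT b Φ r) 2 (slab Y) := hbb.memLp hY hΦm hΦ2
  have hW2 : ∀ r, MemLp (famF Y (famT b Φ r)) 2 (nu n) := fun r => memLp_famF hY hb (hwm r) (hw2 r)
  have hWm : ∀ r, StronglyMeasurable (famF Y (famT b Φ r)) := fun r =>
    stronglyMeasurable_famF hY (hwm r)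
  have hcomp' : ∀ r r', eLpNorm (famT c Φ r + famT m (famF Y (famT b Φ r)) r') 2 (slab Y) ≤
      A * eLpNorm F 2 volume + B * eLpNorm (ext0 (ball 0 r') (famF Y (famT b Φ r)) -
        famF Y (famT b Φ r)) 2 (nu n) := fun r r' => by
    rw [eLpNorm_slab hY]
    refine eLpNorm_nu_le ((aestronglyMeasurable_ext0 hY).2
      ((hcb.memLp hY hΦm hΦ2 r).1.add (hmb.memLp hY (hWm r) (hW2 r) r').1))
      ((stronglyMeasurable_ext0 measurableSet_ball (hWm r)).sub (hWm r)).aestronglyMeasurable ?_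
    filter_upwards [hcomp] with t ht
    have h3 := MemLp.ball_indicator hF2 r
    have h4 := ht _ h3.1 h3.2 r' _ _ rfl rfl
    rw [ext0_apply]
    refine le_trans h4 (add_le_add (mul_le_mul' le_rfl (eLpNorm_indicator_le _)) (le_of_eq ?_))
    congr 2
    funext ξ
    rw [Pi.sub_apply]
    congr 1
    exact (congrFun (ext0_apply (ball (0 : E n) r') (famF Y (famT b Φ r)) t) ξ).symm
  have hmain : ∀ r r', eLpNorm (z + v) 2 (slab Y) ≤
      (A * eLpNorm F 2 volume + B * eLpNorm (ext0 (ball 0 r') (famF Y (famT b Φ r)) -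
        famF Y (famT b Φ r)) 2 (nu n)) + (eLpNorm (famT c Φ r - z) 2 (slab Y) +
        (eLpNorm (famT m (famF Y u) r' - v) 2 (slab Y) +
          κ' * eLpNorm (famT b Φ r - u) 2 (slab Y))) := fun r r' => by
    have m1 := (hcb.memLp hY hΦm hΦ2 r).1
    have m2 := (hmb.memLp hY (hWm r) (hW2 r) r').1
    have m3 := (hmb.memLp hY hUm hU2 r').1
    have e : z + v = (famT c Φ r + famT m (famF Y (famT b Φ r)) r') - ((famT c Φ r - z) +
        ((famT m (famF Y u) r' - v) + (famT m (famF Y (famT b Φ r)) r' - famT m (famF Y u) r'))) := by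
      ring
    rw [e]
    refine (eLpNorm_sub_le (m1.add m2) ((m1.sub hz2.1).add ((m3.sub hv2.1).add (m2.sub m3)))
      one_le_two).trans (add_le_add (hcomp' r r') ?_)
    refine (eLpNorm_add_le (m1.sub hz2.1) ((m3.sub hv2.1).add (m2.sub m3)) one_le_two).trans
      (add_le_add le_rfl ?_)
    refine (eLpNorm_add_le (m3.sub hv2.1) (m2.sub m3) one_le_two).trans (add_le_add le_rfl ?_)
    exact (hmb.eLpNorm_sub_le' hY (hWm r) hUm (hW2 r) hU2 r').trans
      (mul_le_mul' le_rfl (eLpNorm_famF_sub_le hY hb (hwm r) hum (hw2 r) hu2))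
  have h1 : ∀ r, eLpNorm (z + v) 2 (slab Y) ≤ A * eLpNorm F 2 volume +
      (eLpNorm (famT c Φ r - z) 2 (slab Y) + κ' * eLpNorm (famT b Φ r - u) 2 (slab Y)) := fun r => by
    refine ge_of_tendsto' (x := atTop) ?_ (hmain r)
    have t1 := (ENNReal.Tendsto.const_mul (tendsto_eLpNorm_ext0_ball_sub (hW2 r))
      (Or.inr hB)).const_add (A * eLpNorm F 2 volume)
    have t2 := (hvl.add_const (κ' * eLpNorm (famT b Φ r - u) 2 (slab Y))).const_add
      (eLpNorm (famT c Φ r - z) 2 (slab Y))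
    rw [mul_zero, add_zero] at t1
    rw [zero_add] at t2
    exact t1.add t2
  refine ge_of_tendsto' (x := atTop) ?_ h1
  have t := (hzl.add (ENNReal.Tendsto.const_mul hul (Or.inr hmb.ne_top))).const_add
    (A * eLpNorm F 2 volume)
  simpa using t

/-- Passage to the limit in an integral against a fixed function. -/
theorem tendsto_integral_mul {α : Type*} [MeasurableSpace α] {μ : Measure α} {w : ℝ → α → ℂ}
    {u ψ : α → ℂ} (hw : ∀ r, MemLp (w r) 2 μ) (hu : MemLp u 2 μ) (hψ : MemLp ψ 2 μ)
    (h : Tendsto (fun r => eLpNorm (w r - u) 2 μ) atTop (nhds 0)) :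
    Tendsto (fun r => ∫ x, w r x * ψ x ∂μ) atTop (nhds (∫ x, u x * ψ x ∂μ)) := by
  refine tendsto_integral_of_L1' (fun x => u x * ψ x) (hu.integrable_mul hψ).1
    (Eventually.of_forall fun r => (hw r).integrable_mul hψ) ?_
  have h1 : ∀ r, eLpNorm ((fun x => w r x * ψ x) - fun x => u x * ψ x) 1 μ ≤
      eLpNorm (w r - u) 2 μ * eLpNorm ψ 2 μ := fun r => by
    have := eLpNorm_smul_le_mul_eLpNorm (p := 2) (q := 2) (r := 1) hψ.1 ((hw r).1.sub hu.1)
    refine le_trans (le_of_eq ?_) this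
    congr 1
    funext x
    simp only [Pi.sub_apply, Pi.smul_apply', smul_eq_mul]
    ring
  refine tendsto_of_tendsto_of_tendsto_of_le_of_le tendsto_const_nhds ?_ (fun _ => zero_le) h1
  simpa using ENNReal.Tendsto.mul_const h (Or.inr hψ.2.ne)

/-- Integration by parts. -/
theorem integral_mul_fderiv_eq {V : Type*} [NormedAddCommGroup V] [NormedSpace ℝ V]
    [FiniteDimensional ℝ V] [MeasurableSpace V] [BorelSpace V] {μ : Measure V} [μ.IsAddHaarMeasure]
    {f g : V → ℂ} (hf : ContDiff ℝ ∞ f) (hg : ContDiff ℝ ∞ g) (hc : HasCompactSupport g) (v : V) :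
    ∫ x, f x * fderiv ℝ g x v ∂μ = -∫ x, fderiv ℝ f x v * g x ∂μ := by
  have cf' : Continuous fun x => fderiv ℝ f x v :=
    (hf.continuous_fderiv (by simp)).clm_apply continuous_const
  have cg' : Continuous fun x => fderiv ℝ g x v :=
    (hg.continuous_fderiv (by simp)).clm_apply continuous_const
  refine integral_mul_fderiv_eq_neg_fderiv_mul_of_integrable ?_ ?_ ?_
    (fun x _ => hf.differentiable (by simp) x) (fun x _ => hg.differentiable (by simp) x)
  · exact (cf'.mul hg.continuous).integrable_of_hasCompactSupport hc.mul_left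
  · exact (hf.continuous.mul cg').integrable_of_hasCompactSupport
      (HasCompactSupport.mul_left (hc.fderiv_apply ℝ v))
  · exact (hf.continuous.mul hg.continuous).integrable_of_hasCompactSupport hc.mul_left

/-! ### The equation in the sense of distributions -/

/-- The transpose of `D_t² + D_{y₁} - iμ`. -/
def transp [NeZero n] (h μ : ℝ) (ψ : ℝ × E n → ℂ) (p : ℝ × E n) : ℂ :=
  -(h : ℂ) ^ 2 * fderiv ℝ (fun q => fderiv ℝ ψ q (1, 0)) p (1, 0) +
    I * h * fderiv ℝ ψ p (0, single 0 1) - I * μ * ψ p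

theorem contDiff_fderiv_apply {V : Type*} [NormedAddCommGroup V] [NormedSpace ℝ V] {f : V → ℂ}
    (hf : ContDiff ℝ ∞ f) (v : V) : ContDiff ℝ ∞ fun x => fderiv ℝ f x v :=
  (hf.fderiv_right (by simp)).clm_apply contDiff_const

theorem contDiff_transp [NeZero n] {h μ : ℝ} {ψ : ℝ × E n → ℂ} (hψ : ContDiff ℝ ∞ ψ) :
    ContDiff ℝ ∞ (transp h μ ψ) :=
  ((contDiff_const.mul (contDiff_fderiv_apply (contDiff_fderiv_apply hψ _) _)).add
    (contDiff_const.mul (contDiff_fderiv_apply hψ _))).sub (contDiff_const.mul hψ)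

theorem transp_eq_zero [NeZero n] {h μ : ℝ} {ψ : ℝ × E n → ℂ} {p : ℝ × E n} (hp : p ∉ tsupport ψ) :
    transp h μ ψ p = 0 := by
  have h1 : ∀ q ∉ tsupport ψ, fderiv ℝ ψ q = 0 := fun q hq => by
    by_contra h
    exact hq (support_fderiv_subset ℝ h)
  have h2 : fderiv ℝ (fun q => fderiv ℝ ψ q (1, 0)) p = 0 := by
    by_contra h
    have := support_fderiv_subset ℝ (f := fun q => fderiv ℝ ψ q (1, 0)) h
    refine hp (closure_minimal (fun q hq => ?_) (isClosed_tsupport ψ) this)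
    by_contra h'
    exact hq (by simp only [h1 q h', zero_apply])
  rw [transp, h2, h1 p hp, image_eq_zero_of_notMem_tsupport hp]
  simp

theorem integral_mul_transp [NeZero n] {h μ : ℝ} {f ψ : ℝ × E n → ℂ} (hf : ContDiff ℝ ∞ f)
    (hψ : ContDiff ℝ ∞ ψ) (hc : HasCompactSupport ψ) :
    ∫ p, f p * transp h μ ψ p = ∫ p, (-(h : ℂ) ^ 2 * fderiv ℝ (fun q => fderiv ℝ f q (1, 0)) p (1, 0) -
      I * h * fderiv ℝ f p (0, single 0 1) - I * μ * f p) * ψ p := by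
  have hψ' := contDiff_fderiv_apply hψ (1, 0)
  have hc' := hc.fderiv_apply ℝ ((1, 0) : ℝ × E n)
  have : (volume : Measure (ℝ × E n)).IsAddHaarMeasure := Measure.prod.instIsAddHaarMeasure _ _
  have int : ∀ {f g : ℝ × E n → ℂ}, ContDiff ℝ ∞ f → ContDiff ℝ ∞ g → HasCompactSupport g →
      ∀ c : ℂ, Integrable fun p => c * (f p * g p) := fun hf hg hc c =>
    ((hf.continuous.mul hg.continuous).integrable_of_hasCompactSupport hc.mul_left).const_mul c
  have e1 := integral_mul_fderiv_eq (μ := volume) hf hψ' hc' (1, 0)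
  have e2 := integral_mul_fderiv_eq (μ := volume) (contDiff_fderiv_apply hf (1, 0)) hψ hc (1, 0)
  have e3 := integral_mul_fderiv_eq (μ := volume) hf hψ hc (0, single 0 1)
  have l : ∫ p, f p * transp h μ ψ p =
      (∫ p, -(h : ℂ) ^ 2 * (f p * fderiv ℝ (fun q => fderiv ℝ ψ q (1, 0)) p (1, 0))) +
      (∫ p, I * h * (f p * fderiv ℝ ψ p (0, single 0 1))) +
      ∫ p, -(I * μ) * (f p * ψ p) := by
    rw [← integral_add, ← integral_add]
    · refine integral_congr_ae (Eventually.of_forall fun p => ?_)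
      simp only [transp]
      ring
    · exact (int hf (contDiff_fderiv_apply hψ' _) (hc'.fderiv_apply ℝ _) _).add
        (int hf (contDiff_fderiv_apply hψ _) (hc.fderiv_apply ℝ _) _)
    · exact int hf hψ hc _
    · exact int hf (contDiff_fderiv_apply hψ' _) (hc'.fderiv_apply ℝ _) _
    · exact int hf (contDiff_fderiv_apply hψ _) (hc.fderiv_apply ℝ _) _
  have r : ∫ p, (-(h : ℂ) ^ 2 * fderiv ℝ (fun q => fderiv ℝ f q (1, 0)) p (1, 0) -
      I * h * fderiv ℝ f p (0, single 0 1) - I * μ * f p) * ψ p =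
      (∫ p, -(h : ℂ) ^ 2 * (fderiv ℝ (fun q => fderiv ℝ f q (1, 0)) p (1, 0) * ψ p)) +
      (∫ p, -(I * h) * (fderiv ℝ f p (0, single 0 1) * ψ p)) +
      ∫ p, -(I * μ) * (f p * ψ p) := by
    rw [← integral_add, ← integral_add]
    · refine integral_congr_ae (Eventually.of_forall fun p => ?_)
      simp only
      ring
    · exact (int (contDiff_fderiv_apply (contDiff_fderiv_apply hf _) _) hψ hc _).add
        (int (contDiff_fderiv_apply hf _) hψ hc _)
    · exact int hf hψ hc _
    · exact int (contDiff_fderiv_apply (contDiff_fderiv_apply hf _) _) hψ hc _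
    · exact int (contDiff_fderiv_apply hf _) hψ hc _
  rw [l, r]
  simp only [integral_const_mul, e1, e2, e3]
  ring

/-- A symbol times the oscillating factor, as a function of `(t, y)`. -/
def wave (q : ℝ) (b : ℝ → Sym n) (ξ : E n) (p : ℝ × E n) : ℂ :=
  ech ξ p.2 * b p.1 p.2 (q • ξ)

theorem contDiff_ech (ξ : E n) : ContDiff ℝ ∞ (ech ξ) := by
  unfold ech
  simp only [Real.fourierChar_apply]
  refine ContDiff.cexp (ContDiff.mul (Complex.ofRealCLM.contDiff.comp ?_) contDiff_const)
  exact contDiff_const.mul (contDiff_const.inner ℝ contDiff_id)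

theorem SmoothT.contDiff_wave {b : ℝ → Sym n} (hb : SmoothT b) (q : ℝ) (ξ : E n) :
    ContDiff ℝ ∞ (wave q b ξ) :=
  ((contDiff_ech ξ).comp contDiff_snd).mul
    (ContDiff.comp (g := fun p : ℝ × E n × E n => b p.1 p.2.1 p.2.2) hb
      (contDiff_fst.prodMk (contDiff_snd.prodMk contDiff_const)))

theorem fderiv_wave_fst {b : ℝ → Sym n} (hb : SmoothT b) (q : ℝ) (ξ : E n) (p : ℝ × E n) :
    fderiv ℝ (wave q b ξ) p (1, 0) = wave q (dT b) ξ p := by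
  have h1 := ((hb.contDiff_wave q ξ).differentiable (by simp) p).hasFDerivAt.comp_hasDerivAt p.1
    ((hasDerivAt_id p.1).prodMk (hasDerivAt_const p.1 p.2))
  rw [← h1.deriv]
  simp only [wave, dT, Function.comp_def, id]
  rw [deriv_const_mul_field]

theorem fderiv_ech (ξ y e : E n) :
    fderiv ℝ (ech ξ) y e = 2 * π * I * (inner ℝ ξ e : ℝ) * ech ξ y := by
  have h1 : HasFDerivAt (fun y : E n => ((2 * π * inner ℝ ξ y : ℝ) : ℂ) * I)
      ((Complex.ofRealCLM.comp ((2 * π) • innerSL ℝ ξ)).smulRight I) y := by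
    have := (((2 * π) • innerSL ℝ ξ).hasFDerivAt (x := y))
    have h2 := (Complex.ofRealCLM.hasFDerivAt.comp y this).smul_const I
    exact h2
  unfold ech
  simp only [Real.fourierChar_apply]
  rw [h1.cexp.fderiv]
  simp only [smul_apply, ContinuousLinearMap.smulRight_apply,
    ContinuousLinearMap.comp_apply, innerSL_apply_apply, Complex.ofRealCLM_apply, smul_eq_mul]
  push_cast
  ring

theorem fderiv_wave_snd [NeZero n] {b : ℝ → Sym n} (hb : SmoothT b) (q : ℝ) (ξ : E n)
    (p : ℝ × E n) : fderiv ℝ (wave q b ξ) p (0, single 0 1) =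
      2 * π * I * ξ 0 * wave q b ξ p + wave q (fun t => dy 0 (b t)) ξ p := by
  have h1 := HasFDerivAt.comp (g := wave q b ξ) (f := fun y => (p.1, y)) p.2
    ((hb.contDiff_wave q ξ).differentiable (by simp) p).hasFDerivAt
    ((hasFDerivAt_const p.1 p.2).prodMk (hasFDerivAt_id p.2))
  have h2 : fderiv ℝ (wave q b ξ) p (0, single 0 1) =
      fderiv ℝ (fun y => wave q b ξ (p.1, y)) p.2 (single 0 1) := by
    have := h1.fderiv
    simp only [Function.comp_def] at this
    rw [this]
    rfl
  have h3 : DifferentiableAt ℝ (fun y => b p.1 y (q • ξ)) p.2 :=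
    (ContDiff.comp (g := fun p : ℝ × E n × E n => b p.1 p.2.1 p.2.2) hb
      (contDiff_const.prodMk (contDiff_id.prodMk contDiff_const))).differentiable (by simp) p.2
  rw [h2]
  simp only [wave]
  rw [fderiv_fun_mul ((contDiff_ech ξ).differentiable (by simp) p.2) h3]
  simp only [add_apply, smul_apply, smul_eq_mul,
    fderiv_ech, dy]
  have h4 : inner ℝ ξ (single (0 : Fin n) (1 : ℝ)) = ξ 0 := by
    simp [EuclideanSpace.inner_single_right]
  rw [h4]
  ring

theorem integral_famT_mul {a : ℝ → Sym n} (ha : SmoothT a) (q : ℝ) {F : E n → ℂ} (hF : MemLp F 2)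
    (r : ℝ) {P : ℝ × E n → ℂ} (hP : Continuous P) (hc : HasCompactSupport P) :
    ∫ p, famT (fun t y ξ => a t y (q • ξ)) (fun p => F p.2) r p * P p =
      ∫ ξ, (ball (0 : E n) r).indicator F ξ * ∫ p, wave q a ξ p * P p := by
  set Fr := (ball (0 : E n) r).indicator F with hFr
  have hFi : Integrable Fr := (MemLp.ball_indicator hF r).1
  have hk : Continuous fun x : (ℝ × E n) × E n => wave q a x.2 x.1 :=
    .mul (by fun_prop : Continuous fun x : (ℝ × E n) × E n => ech x.2 x.1.2)
      (Continuous.comp (g := fun p : ℝ × E n × E n => a p.1 p.2.1 p.2.2) (ContDiff.continuous ha)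
        (f := fun x : (ℝ × E n) × E n => (x.1.1, x.1.2, q • x.2)) (by fun_prop))
  obtain ⟨A, hA⟩ := (hc.isCompact.prod (isCompact_closedBall (0 : E n) r)).exists_bound_of_continuousOn
    hk.continuousOn
  have hint : Integrable (uncurry fun (p : ℝ × E n) (ξ : E n) => wave q a ξ p * (P p * Fr ξ))
      ((volume : Measure (ℝ × E n)).prod volume) := by
    have h1 := (hP.integrable_of_hasCompactSupport (μ := volume) hc).mul_prod hFi
    refine (h1.norm.const_mul A).mono' (hk.aestronglyMeasurable.mul h1.1)
      (Eventually.of_forall fun x => ?_)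
    simp only [uncurry]
    rw [norm_mul]
    by_cases hx : x.1 ∈ tsupport P ∧ x.2 ∈ ball (0 : E n) r
    · exact mul_le_mul_of_nonneg_right (hA x ⟨hx.1, ball_subset_closedBall hx.2⟩) (norm_nonneg _)
    · have : P x.1 * Fr x.2 = 0 := by
        rcases not_and_or.1 hx with h | h
        · rw [image_eq_zero_of_notMem_tsupport h, zero_mul]
        · rw [hFr, indicator_of_notMem h, mul_zero]
      simp [this]
  have := integral_integral_swap hint
  calc _ = ∫ p, ∫ ξ, wave q a ξ p * (P p * Fr ξ) := by
        congr 1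
        funext p
        rw [famT, opT_eq, ← integral_mul_const]
        congr 1
        funext ξ
        simp only [wave, ← hFr]
        ring
    _ = _ := by
        rw [this]
        congr 1
        funext ξ
        rw [← integral_const_mul]
        congr 1
        funext p
        ring

theorem weak_famT [NeZero n] {h μ : ℝ} {b c : ℝ → Sym n} (hb : SmoothT b) (hc : SmoothT c)
    (hbc : ∀ t y η, c t y η = -(h : ℂ) ^ 2 * dT (dT b) t y η - I * h * dy 0 (b t) y η +
      ((η 0 : ℂ) - I * μ) * b t y η) {Y : Set (E n)} {F : E n → ℂ} (hF : MemLp F 2)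
    (r : ℝ) {ψ : ℝ × E n → ℂ} (hψ : ContDiff ℝ ∞ ψ) (hψc : HasCompactSupport ψ)
    (hs : tsupport ψ ⊆ Ioo (0 : ℝ) 1 ×ˢ Y) :
    ∫ p, famT (fun t => sc h (b t)) (fun p => F p.2) r p * transp h μ ψ p ∂(slab Y) =
      ∫ p, famT (fun t => sc h (c t)) (fun p => F p.2) r p * ψ p ∂(slab Y) := by
  have hPc : HasCompactSupport (transp h μ ψ) := HasCompactSupport.intro hψc fun p hp =>
    transp_eq_zero hp
  rw [slab, setIntegral_eq_integral_of_forall_compl_eq_zero fun p hp => by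
      rw [transp_eq_zero fun h => hp (hs h), mul_zero],
    setIntegral_eq_integral_of_forall_compl_eq_zero fun p hp => by
      rw [image_eq_zero_of_notMem_tsupport fun h => hp (hs h), mul_zero]]
  rw [show (fun t => sc h (b t)) = fun t y ξ => b t y ((2 * π * h) • ξ) from rfl,
    show (fun t => sc h (c t)) = fun t y ξ => c t y ((2 * π * h) • ξ) from rfl,
    integral_famT_mul hb _ hF r (contDiff_transp hψ).continuous hPc,
    integral_famT_mul hc _ hF r hψ.continuous hψc]
  congr 1
  funext ξ
  rw [integral_mul_transp (hb.contDiff_wave _ ξ) hψ hψc]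
  congr 2
  funext p
  have e : (fun q => fderiv ℝ (wave (2 * π * h) b ξ) q (1, 0)) =
      wave (2 * π * h) (dT b) ξ := funext fun q => fderiv_wave_fst hb _ ξ q
  rw [e, fderiv_wave_fst hb.dT, fderiv_wave_snd hb]
  simp only [wave, hbc, PiLp.smul_apply, smul_eq_mul]
  push_cast
  linear_combination (-(h : ℂ) * 2 * π * ξ 0 * ech ξ p.2 *
    b p.1 p.2 ((2 * π * h) • ξ) * ψ p) * I_sq

section
variable [NeZero n] {Y : Set (E n)} {ε h₁ δ : ℝ} {m : ℝ → ℝ → ℝ → Sym n} {mj : ℕ → ℝ → ℝ → Sym n}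
  {M : ℕ} {χ : ℝ → ℂ}

theorem SmoothT.famBound {a : ℝ → Sym n} (ha : SmoothT a) {h : ℝ} {κ : ENNReal} (hκ : κ ≠ ⊤)
    (hb : ∀ᵐ t ∂volume.restrict (Ioo (0 : ℝ) 1), ∀ F : E n → ℂ, Integrable F → MemLp F 2 →
      eLpNorm (Y.indicator (opT (sc h (a t)) F)) 2 volume ≤ κ * eLpNorm F 2 volume) :
    FamBound Y (fun t => sc h (a t)) κ := by
  have hc : Continuous fun q : ℝ × E n × E n => sc h (a q.1) q.2.1 q.2.2 :=
    Continuous.comp (g := fun p : ℝ × E n × E n => a p.1 p.2.1 p.2.2) (ContDiff.continuous ha)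
      (f := fun x : ℝ × E n × E n => (x.1, x.2.1, (2 * π * h) • x.2.2)) (by fun_prop)
  exact ⟨⟨_, hc.stronglyMeasurable, Eventually.of_forall fun _ => rfl⟩, Eventually.of_forall fun t =>
    hc.comp (by fun_prop : Continuous fun p : E n × E n => (t, p)), hκ, hb⟩

theorem IsModelPerturbation.exists_parametrix (H : IsModelPerturbation Y ε m mj)
    (hY : IsOpen Y) (hYb : IsBounded Y) (hχ : ContDiff ℝ ∞ χ)
    (h1 : ∀ σ, |σ| ≤ 1 → χ σ = 1) (h2 : ∀ σ, 2 ≤ |σ| → χ σ = 0) (hε : 0 < ε) (hε1 : ε ≤ 2 / 3)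
    (hδ : 0 < δ) (hδ1 : δ ≤ 1 / 2) (hh : h₁ ≤ 1) (hM : 1 ≤ M) (hMn : 4 * ((n : ℝ) + 1) ≤ ε * M)
    (him : ∀ q ∈ S₂ n ε δ h₁, ∀ y, |(slices (phaseTail M mj) q y).im| ≤ q.2.2.1 * q.im / 2)
    (hb : JointBd (T₁ ε h₁) (fun p => m p.1 p.2.1 p.2.2))
    (hrem : RemBd m mj M ε h₁)
    (hsupp : ∀ p ∈ T₁ ε h₁, SuppIn Y (m p.1 p.2.1 p.2.2)) :
    ∃ C : ℝ, ∀ h μ : ℝ, 0 < h → h ≤ h₁ → h ^ (2 / 3 - ε) ≤ |μ| → |μ| ≤ 1 →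
      ∀ f : E n → ℂ, MemLp f 2 (volume.restrict Y) →
      ∃ u g : ℝ × E n → ℂ,
        IsOp Y h (parametrixSymbol χ M mj ε δ h μ) (fun _ => f) u ∧
        MemLp g 2 (slab Y) ∧
        IsP0 Y h μ (m h μ) u g ∧
        eLpNorm u 2 (slab Y) ≤ ofReal (C * h ^ (-((n : ℝ) + 1))) *
          eLpNorm f 2 (volume.restrict Y) ∧
        eLpNorm g 2 (slab Y) ≤ ofReal (C * h ^ (ε * M / 2)) *
          eLpNorm f 2 (volume.restrict Y) := by
  obtain ⟨K, hK, hmain⟩ := H.exists_fixed_time hY hYb hχ h1 h2 hε hε1 hδ hδ1 hh hM hMn him hb hrem hsupp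
  refine ⟨K, fun h μ hh0 hh1 hhμ hμ1 f hf => ?_⟩
  have hYm := hY.measurableSet
  have hμ0 : 0 < |μ| := (rpow_pos_of_pos hh0 _).trans_le hhμ
  have hT : ∀ t ∈ Ioo (0 : ℝ) 1, (h, μ, t) ∈ T₁ ε h₁ := fun t ht => ⟨hh0, hh1, hhμ, hμ1, ht⟩
  have hae := ae_restrict_mem (μ := volume) (measurableSet_Ioo (a := (0 : ℝ)) (b := 1))
  have hbT : SmoothT (parametrixSymbol χ M mj ε δ h μ) := H.smoothT_parametrixSymbol hμ0 hμ1 hχ hδ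
  have hcT : SmoothT (paraSym χ M mj ε δ h μ) := H.smoothT_paraSym hμ0 hμ1 hχ hδ
  have hms : ∀ t ∈ Ioo (0 : ℝ) 1, Continuous (unc (sc h (m h μ t))) := fun t ht =>
    ContDiff.continuous (SmoothSym.sc (hb.1 _ (hT t ht)) h)
  have hbb := hbT.famBound (Y := Y) (h := h) (ofReal_ne_top
    (r := K * (h ^ (ε - 1)) ^ (n + 1))) (hae.mono fun t ht F hF1 hF2 =>
      ((hmain _ (hT t ht)).1 F hF1 hF2).2.2.1)
  have hcb := hcT.famBound (Y := Y) (h := h) (ofReal_ne_top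
    (r := K * (h ^ (ε - 1)) ^ (n + 1))) (hae.mono fun t ht F hF1 hF2 =>
      ((hmain _ (hT t ht)).1 F hF1 hF2).2.2.2.1)
  have hmb : FamBound Y (fun t => sc h (m h μ t)) (ofReal K) :=
    ⟨exists_measurable_symbol (hae.mono hms) fun y η => H.measurable h μ hh0 hhμ hμ1 y _,
      hae.mono hms, ofReal_ne_top, hae.mono fun t ht F hF1 hF2 =>
      (eLpNorm_indicator_le _).trans ((hmain _ (hT t ht)).1 F hF1 hF2).2.2.2.2⟩
  have hbm : StronglyMeasurable fun q : ℝ × E n × E n =>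
      sc h (parametrixSymbol χ M mj ε δ h μ q.1) q.2.1 q.2.2 :=
    (Continuous.comp (g := fun p : ℝ × E n × E n => parametrixSymbol χ M mj ε δ h μ p.1 p.2.1 p.2.2)
      (ContDiff.continuous hbT) (f := fun x : ℝ × E n × E n =>
        (x.1, x.2.1, (2 * π * h) • x.2.2)) (by fun_prop)).stronglyMeasurable
  have hf2 : MemLp (Y.indicator f) 2 := (memLp_indicator_iff_restrict hYm).2 hf
  have hf1 := MemLp.integrable_of_indicator hYm hYb hf2
  have hFc : Continuous (𝓕 (Y.indicator f)) := continuous_fourier hf1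
  have hF2 := memLp_fourier hf1 hf2
  obtain ⟨u, v, z, hu, hv, hz, hul, hvl, hzl, hun, hgn⟩ := exists_solution hYm hYb
    (A := ofReal (K * h ^ (ε * M / 2))) hbm hbb hcb hmb
    (ofReal_ne_top (r := K * (h ^ (ε - 1)) ^ (M + n + 2)))
    (hae.mono fun t ht => (hmain _ (hT t ht)).2) hFc.stronglyMeasurable hF2
  rw [eLpNorm_fourier hf1 hf2, eLpNorm_indicator_eq_eLpNorm_restrict hYm] at hun hgn
  refine ⟨u, z + v, isOp_of_tendsto hYm hh0 hu hul, hz.add hv,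
    ⟨v, isOp_of_tendsto hYm hh0 hv hvl, fun ψ hψ hψc hs => ?_⟩, hun.trans ?_, hgn⟩
  · have hP := contDiff_transp (h := h) (μ := μ) hψ
    have hP2 : MemLp (transp h μ ψ) 2 (slab Y) := (hP.continuous.memLp_of_hasCompactSupport
      (HasCompactSupport.intro hψc fun p hp => transp_eq_zero hp)).restrict _
    have hψ2 : MemLp ψ 2 (slab Y) := (hψ.continuous.memLp_of_hasCompactSupport hψc).restrict _
    have hΦm : StronglyMeasurable fun p : ℝ × E n => 𝓕 (Y.indicator f) p.2 :=
      hFc.stronglyMeasurable.comp_measurable measurable_snd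
    have hΦ2 : MemLp (fun p : ℝ × E n => 𝓕 (Y.indicator f) p.2) 2 (nu n) := hF2.comp_snd _
    have l1 := tendsto_integral_mul (hbb.memLp hYm hΦm hΦ2) hu hP2 hul
    have l2 := tendsto_integral_mul (hcb.memLp hYm hΦm hΦ2) hz hψ2 hzl
    have e := tendsto_nhds_unique (l1.congr fun r => weak_famT hbT hcT (fun t y η => by
      rw [paraSym, rho_sq]; ring) hF2 r hψ hψc hs) l2
    have i1 : Integrable (fun p => v p * ψ p) (slab Y) := hv.integrable_mul hψ2
    have i2 : Integrable (fun p => u p * transp h μ ψ p) (slab Y) := hu.integrable_mul hP2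
    have i3 : Integrable (fun p => z p * ψ p) (slab Y) := hz.integrable_mul hψ2
    calc _ = ∫ p, (u p * transp h μ ψ p + v p * ψ p) ∂(slab Y) := rfl
      _ = _ := by
        rw [integral_add i2 i1, e, ← integral_add i3 i1]
        congr 1
        funext p
        simp only [Pi.add_apply]
        ring
  · refine mul_le_mul' (ENNReal.ofReal_le_ofReal (mul_le_mul_of_nonneg_left ?_ hK)) le_rfl
    rw [← rpow_natCast, ← rpow_mul hh0.le]
    refine rpow_le_rpow_of_exponent_ge hh0 (hh1.trans hh) ?_
    push_cast
    nlinarith [mul_nonneg hε.le (by positivity : 0 ≤ (n : ℝ) + 1)]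

end

end ModelParametrix

end

open ModelParametrix in
theorem proposition2p8 (n : ℕ) [NeZero n] (ε : ℝ) (hε : 0 < ε) :
    ∃ M₀ : ℕ, ∀ (Y : Set (E n)), IsOpen Y → Bornology.IsBounded Y →
      ∀ χ : ℝ → ℂ, ContDiff ℝ ∞ χ → (∀ σ, |σ| ≤ 1 → χ σ = 1) → (∀ σ, 2 ≤ |σ| → χ σ = 0) →
      ∀ (m : ℝ → ℝ → ℝ → Sym n) (mj : ℕ → ℝ → ℝ → Sym n), IsModelPerturbation Y ε m mj →
      ∀ M : ℕ, M₀ ≤ M → ∃ δ₀ : ℝ, 0 < δ₀ ∧ ∀ δ : ℝ, 0 < δ → δ ≤ δ₀ →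
      ∃ C h₀ : ℝ, 0 < h₀ ∧ ∀ h μ : ℝ, 0 < h → h ≤ h₀ → h ^ (2 / 3 - ε) ≤ |μ| → |μ| ≤ 1 →
      ∀ f : E n → ℂ, MeasureTheory.MemLp f 2 (MeasureTheory.volume.restrict Y) →
      ∃ u g : ℝ × E n → ℂ,
        IsOp Y h (parametrixSymbol χ M mj ε δ h μ) (fun _ => f) u ∧
        MeasureTheory.MemLp g 2 (slab Y) ∧
        IsP0 Y h μ (m h μ) u g ∧
        MeasureTheory.eLpNorm u 2 (slab Y) ≤ ENNReal.ofReal (C * h ^ (-((n : ℝ) + 1))) *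
          MeasureTheory.eLpNorm f 2 (MeasureTheory.volume.restrict Y) ∧
        MeasureTheory.eLpNorm g 2 (slab Y) ≤ ENNReal.ofReal (C * h ^ (ε * M / 2)) *
          MeasureTheory.eLpNorm f 2 (MeasureTheory.volume.restrict Y) := by
  refine ⟨max 1 ⌈4 * ((n : ℝ) + 1) / ε⌉₊, fun Y hY hYb χ hχ h1 h2 m mj H M hM => ?_⟩
  obtain ⟨hM1, hM2⟩ := max_le_iff.1 hM
  have hMn : 4 * ((n : ℝ) + 1) ≤ ε * M := by
    have := (Nat.le_ceil _).trans (Nat.cast_le (α := ℝ).2 hM2)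
    rwa [div_le_iff₀ hε, mul_comm (M : ℝ)] at this
  obtain ⟨δ₀, hδ₀, hδ₁, h₂, hh₂, him⟩ := H.exists_abs_im_phaseTail_le_half hε M
  refine ⟨δ₀, hδ₀, fun δ hδ hδδ => ?_⟩
  rcases le_or_gt ε (2 / 3) with hε1 | hε1
  · obtain ⟨h₁, hh₁, hh₁', hb, hrem⟩ := H.exists_bd
    obtain ⟨h₃, hh₃, hsupp⟩ := H.exists_suppIn
    set h₀ := min h₁ (min h₂ h₃) with hh₀
    have e1 : h₀ ≤ h₁ := min_le_left _ _
    have e2 : h₀ ≤ h₂ := (min_le_right _ _).trans (min_le_left _ _)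
    have e3 : h₀ ≤ h₃ := (min_le_right _ _).trans (min_le_right _ _)
    have hsub : ∀ {h' : ℝ}, h₀ ≤ h' → T₁ ε h₀ ⊆ T₁ ε h' := fun hle p hp =>
      ⟨hp.1, hp.2.1.trans hle, hp.2.2⟩
    obtain ⟨C, hC⟩ := H.exists_parametrix (h₁ := h₀) hY hYb hχ h1 h2 hε hε1 hδ (hδδ.trans hδ₁)
      (e1.trans hh₁') hM1 hMn (fun q hq y => him q ⟨hq.1.1, hq.1.2.1.trans e2, hq.1.2.2⟩
        (hq.2.1.trans (by gcongr)) hq.2.2 y) (hb.mono_set (hsub e1)) ((hrem M hM1).mono_set (hsub e1))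
      fun p hp => hsupp p (hsub e3 hp)
    exact ⟨C, h₀, lt_min hh₁ (lt_min hh₂ hh₃), hC⟩
  · refine ⟨0, 1 / 2, by norm_num, fun h μ hh hh' hμ hμ1 => absurd (hμ.trans hμ1) (not_le.2 ?_)⟩
    exact Real.one_lt_rpow_of_pos_of_lt_one_of_neg hh (by linarith) (by linarith)
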